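/- **Conventions.** Let $n\ge 0$ and let $G=H_n=\mathbb R^{2n+1}$ be the Heisenberg group, with the law $(xy)_0=x_0+y_0+\frac12\sum_{j=1}^n(x_jy_{n+j}-y_jx_{n+j})$, $(xy)_i=x_i+y_i$ for $i\ge1$, the dilations $\delta_t(x_0,x_1,\dots,x_{2n})=(t^2x_0,tx_1,\dots,tx_{2n})$, the contact form $\theta=dx_0+\frac12\sum_j(x_jdx_{n+j}-x_{n+j}dx_j)$ and Lebesgue measure. For a continuous compactly supported function $\alpha$ on $T_HG\cong G\times G$ and $t>0$ let $$(T^t_\alpha f)(x)=t^{2n+2}\int_G\alpha(x,\delta_t(xy^{-1}))f(y)\,dy,\qquad f\in L^2(G).$$ Let $M$ be a smooth (Hausdorff, second countable) manifold of dimension $2n+1$ without boundary, with a contact structure $H\subset TM$ and a smooth positive measure $\mu$ (a smooth positive $1$-density). Let $T_HM=H\oplus N$, $N=TM/H$, be the bundle of osculating groups, with the law $(h,\nu)(h',\nu')=(h+h',\nu+\nu'+\frac12L(h,h'))$ on the fibres, where $L(h,h')\in N$ is determined by $\theta'(L(h,h'))=d\theta'(h,h')$ for local $1$-forms $\theta'$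 with kernel $H$. Its fibres carry the Haar measures $\lambda_x$ given by the density of $\mu$ at $x$. Let $C^*(T_HM)$ be the completion of the convolution algebra $C_c(T_HM)$ in the norm $\|f\|=\sup_{x\in M}\|\pi_x(f)\|$, where $\pi_x$ is the regular representation on $L^2(T_HM_x,\lambda_x)$. A contact chart is a diffeomorphism $\Phi$ from an open set $U\subset M$ onto an open set $V\subset G$ that preserves the contact structures. Write $\Phi_*(\mu|_U)=w_\Phi(y)\,dy$. Let $U_\Phi:L^2(U,\mu)\to L^2(V,dy)$, $(U_\Phi f)(y)=w_\Phi(y)^{1/2}f(\Phi^{-1}(y))$, be the induced unitary; operators are extended by zero between $L^2(M)$ and $L^2(G)$. Let $\widetilde\Phi:T_HU\to T_HV\cong V\times G$ be the isomorphism induced by $\Phi$, where $y\in G$ is identified with the parabolic arrow at $g$ of the curve $s\mapsto\delta_s(y)g$. For $\alpha\in C_c(G\times G)$ with support in $V\times G$, let $\Phi^*\alpha\in C_c(T_HM)$ be $\alpha\circ\widetilde\Phi$ as a fibrewise density, that is, the function $w_\Phi(\Phi(x))^{-1}\,\alpha(\widetilde\Phi(x,\zeta))$ on $T_HU$, extended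 by zero. (So $\Phi^*\alpha=\alpha\circ\widetilde\Phi$ if $\Phi$ preserves the measures.) **Theorem.** There is an asymptotic morphism $T^t:C^*(T_HM)\to\mathcal K(L^2(M,\mu))$, $t>0$, with the following properties. (Asymptotic morphism: $(t,a)\mapsto T^t(a)$ is continuous; $\limsup_{t\to\infty}\|T^t(a)\|<\infty$ for each $a$; and as $t\to\infty$ the expressions $T^t(a)+cT^t(b)-T^t(a+cb)$ for each $c\in\mathbb C$, $T^t(a^*)-T^t(a)^*$ and $T^t(a)T^t(b)-T^t(ab)$ tend to $0$ in norm, uniformly for $a,b$ in compact subsets.) 1. For every contact chart $\Phi:U\to V$ and every $\alpha\in C_c(G\times G)$ with support in $V\times G$, $$\bigl\|T^t(\Phi^*\alpha)-U_\Phi^{-1}\,T^t_\alpha\,U_\Phi\bigr\|\to0\qquad(t\to\infty).$$ 2. $T^t$ is glued from the local operators: if $f=\sum_{i=1}^k\Phi_i^*\alpha_i$ with contact charts $\Phi_i$ and functions $\alpha_i$ as in 1 (for instance $\Phi_i^*\alpha_i=\rho_if$ for a partition of unity $\{\rho_i\}$), then $$\Bigl\|T^t(f)-\sum_{i=1}^kU_{\Phi_i}^{-1}\,T^t_{\alpha_i}\,U_{\Phi_i}\Bigr\|\to0\qquad(t\to\infty).$$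 -/

import Mathlib

open Set Filter Topology MeasureTheory
open scoped Manifold ContDiff ENNReal

/-! ## Compact operators and asymptotic morphisms -/

/-- The adjoint of a compact operator on a Hilbert space is compact. -/
theorem isCompactOperator_adjoint_of {H : Type*} [NormedAddCommGroup H] [InnerProductSpace ℂ H]
    [CompleteSpace H] (A : H →L[ℂ] H) (hA : IsCompactOperator A) :
    IsCompactOperator (ContinuousLinearMap.adjoint A) := by
  set B := ContinuousLinearMap.adjoint A with hB
  have hAB : IsCompactOperator (A ∘L B) := hA.comp_clm B
  suffices h : TotallyBounded (B '' Metric.ball 0 1) by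
    change IsCompactOperator (B : H →ₗ[ℂ] H)
    rw [isCompactOperator_iff_isCompact_closure_image_ball (B : H →ₗ[ℂ] H) zero_lt_one]
    exact h.closure.isCompact_of_isClosed isClosed_closure
  have htb : TotallyBounded ((A ∘L B) '' Metric.ball 0 1) := by
    have h1 : IsCompactOperator ((A ∘L B : H →L[ℂ] H) : H →ₗ[ℂ] H) := hAB
    exact (h1.isCompact_closure_image_ball 1).totallyBounded.subset subset_closure
  rw [Metric.totallyBounded_iff]
  intro ε hε
  obtain ⟨t, hts, htf, htc⟩ :=
    Metric.finite_approx_of_totallyBounded htb (ε ^ 2 / 2) (by positivity)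
  choose! g hg using fun y (hy : y ∈ t) => hts hy
  refine ⟨(fun y => B (g y)) '' t, htf.image _, ?_⟩
  rintro _ ⟨x, hx, rfl⟩
  have hmem : (A ∘L B) x ∈ ⋃ y ∈ t, Metric.ball y (ε ^ 2 / 2) := htc ⟨x, hx, rfl⟩
  simp only [mem_iUnion] at hmem
  obtain ⟨y, hy, hxy⟩ := hmem
  simp only [mem_iUnion]
  refine ⟨B (g y), ⟨y, hy, rfl⟩, ?_⟩
  rw [Metric.mem_ball, dist_eq_norm, ← (hg y hy).2, ← map_sub] at hxy
  rw [Metric.mem_ball, dist_eq_norm, ← map_sub]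
  have hgy := (hg y hy).1
  rw [Metric.mem_ball, dist_zero_right] at hx hgy
  set z := x - g y with hz
  have hz2 : ‖z‖ ≤ 2 := (norm_sub_le _ _).trans (by linarith)
  have key : ‖B z‖ ^ 2 ≤ ‖(A ∘L B) z‖ * ‖z‖ := by
    have h2 : inner ℂ (B z) (B z) = inner ℂ (A (B z)) z := by
      rw [hB, ContinuousLinearMap.adjoint_inner_right]
    calc ‖B z‖ ^ 2 = ‖inner ℂ (B z) (B z)‖ := by
          rw [inner_self_eq_norm_sq_to_K]; simp
      _ = ‖inner ℂ (A (B z)) z‖ := by rw [h2]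
      _ ≤ ‖A (B z)‖ * ‖z‖ := norm_inner_le_norm _ _
      _ = _ := rfl
  have h3 : ‖B z‖ ^ 2 < ε ^ 2 := by nlinarith [norm_nonneg z, norm_nonneg ((A ∘L B) z)]
  exact lt_of_pow_lt_pow_left₀ 2 hε.le h3

/-- The C*-algebra `𝒦(H)` of compact operators on a Hilbert space `H`. -/
def compactOperators (H : Type*) [NormedAddCommGroup H] [InnerProductSpace ℂ H]
    [CompleteSpace H] : NonUnitalStarSubalgebra ℂ (H →L[ℂ] H) where
  carrier := {A | IsCompactOperator A}
  add_mem' := fun ha hb => IsCompactOperator.add ha hb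
  zero_mem' := isCompactOperator_zero
  mul_mem' := fun {_ b} ha _ => IsCompactOperator.comp_clm ha b
  smul_mem' := fun c _ hx => IsCompactOperator.smul hx c
  star_mem' := fun {a} ha => isCompactOperator_adjoint_of a ha

noncomputable instance (H : Type*) [NormedAddCommGroup H] [InnerProductSpace ℂ H]
    [CompleteSpace H] : NonUnitalCStarAlgebra (compactOperators H) :=
  NonUnitalStarSubalgebra.nonUnitalCStarAlgebra _
    (h_closed := isClosed_setOfPred_isCompactOperator)

/-- The C*-subalgebra generated by a subset of a C*-algebra. -/
noncomputable def cstarGenerated {A : Type*} [NonUnitalCStarAlgebra A] (s : Set A) :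
    NonUnitalStarSubalgebra ℂ A :=
  (NonUnitalStarAlgebra.adjoin ℂ s).topologicalClosure

noncomputable instance {A : Type*} [NonUnitalCStarAlgebra A] (s : Set A) :
    NonUnitalCStarAlgebra (cstarGenerated s) :=
  NonUnitalStarSubalgebra.nonUnitalCStarAlgebra _
    (h_closed := NonUnitalStarSubalgebra.isClosed_topologicalClosure _)

/-- An asymptotic morphism from `A` to `B`: a family of maps `T t : A → B`, `t > 0`. -/
structure IsAsymptoticMorphism {A B : Type*} [NonUnitalCStarAlgebra A] [NonUnitalCStarAlgebra B]
    (T : ℝ → A → B) : Prop where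
  continuousOn : ContinuousOn (fun p : ℝ × A => T p.1 p.2) (Ioi 0 ×ˢ univ)
  bounded : ∀ a, IsBoundedUnder (· ≤ ·) atTop (fun t => ‖T t a‖)
  linear : ∀ (c : ℂ) (K : Set A), IsCompact K →
    TendstoUniformlyOn
      (fun t (p : A × A) => ‖T t p.1 + c • T t p.2 - T t (p.1 + c • p.2)‖) 0 atTop (K ×ˢ K)
  star : ∀ K : Set A, IsCompact K →
    TendstoUniformlyOn (fun t a => ‖T t (star a) - star (T t a)‖) 0 atTop K
  mul : ∀ K : Set A, IsCompact K →
    TendstoUniformlyOn (fun t (p : A × A) => ‖T t p.1 * T t p.2 - T t (p.1 * p.2)‖) 0 atTop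
      (K ×ˢ K)

/-! ## The Heisenberg group

The group `H_n` is `ℝ^(2n+1)` with coordinates `(x₀, x₁, …, x_{2n})`. -/

/-- The model space `ℝ^(2n+1)`, with its Lebesgue measure (which is the Haar measure of `H_n`). -/
abbrev Heis (n : ℕ) : Type := EuclideanSpace ℝ (Fin (2 * n + 1))

/-- The coordinate `x_{j+1}`, for `j < n`. -/
def Heis.p {n : ℕ} (x : Heis n) (j : Fin n) : ℝ := x ⟨j + 1, by omega⟩

/-- The coordinate `x_{n+j+1}`, for `j < n`. -/
def Heis.q {n : ℕ} (x : Heis n) (j : Fin n) : ℝ := x ⟨n + j + 1, by omega⟩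

/-- The group law: `(xy)₀ = x₀ + y₀ + ½ ∑ⱼ (xⱼ y_{n+j} - yⱼ x_{n+j})`, and
`(xy)ᵢ = xᵢ + yᵢ` for `i ≥ 1`. -/
noncomputable def Heis.mul {n : ℕ} (x y : Heis n) : Heis n :=
  WithLp.toLp 2 fun i =>
    if i = 0 then x 0 + y 0 + (1 / 2) * ∑ j, (x.p j * y.q j - y.p j * x.q j) else x i + y i

/-- The inverse in the Heisenberg group. -/
noncomputable def Heis.inv {n : ℕ} (x : Heis n) : Heis n := -x

/-- The dilation `δ_t (x₀, x') = (t² x₀, t x')`. -/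
noncomputable def Heis.dil {n : ℕ} (t : ℝ) (x : Heis n) : Heis n :=
  WithLp.toLp 2 fun i => if i = 0 then t ^ 2 * x 0 else t * x i

/-- The canonical contact form `θ = dx₀ + ½ ∑ⱼ (xⱼ dx_{n+j} - x_{n+j} dxⱼ)`, at `x`, on the
tangent vector `v`. -/
noncomputable def Heis.form {n : ℕ} (x v : Heis n) : ℝ :=
  v 0 + (1 / 2) * ∑ j, (x.p j * v.q j - x.q j * v.p j)

/-- `S` is the operator `T^t_α` on `L²(H_n)`:
`(S f)(x) = t^(2n+2) ∫ α(x, δ_t(x y⁻¹)) f(y) dy`. -/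
def IsLocalOperator {n : ℕ} (α : Heis n × Heis n → ℂ) (t : ℝ)
    (S : Lp ℂ 2 (volume : Measure (Heis n)) →L[ℂ] Lp ℂ 2 (volume : Measure (Heis n))) : Prop :=
  ∀ f : Lp ℂ 2 (volume : Measure (Heis n)), S f =ᵐ[volume] fun x =>
    (t : ℂ) ^ (2 * n + 2) * ∫ y, α (x, Heis.dil t (x.mul y.inv)) * f y

/-! ## Contact manifolds -/

section Contact

variable {n : ℕ} {M : Type*} [TopologicalSpace M] [ChartedSpace (Heis n) M]

/-- The tangent space of `M` at `x`. -/
abbrev TSp (n : ℕ) {M : Type*} [TopologicalSpace M] [ChartedSpace (Heis n) M] (x : M) : Type :=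
  TangentSpace (𝓡 (2 * n + 1)) x

/-- The expression of the 1-form `θ` in the preferred chart at `x`. -/
noncomputable def formInChart (θ : ∀ x : M, TSp n x →L[ℝ] ℝ) (x : M) (y : Heis n) :
    Heis n →L[ℝ] ℝ :=
  (θ ((extChartAt (𝓡 (2 * n + 1)) x).symm y)).comp
    (mfderiv (𝓡 (2 * n + 1)) (𝓡 (2 * n + 1)) (extChartAt (𝓡 (2 * n + 1)) x).symm y)

/-- The exterior derivative `dθ_x(v, w)` of a 1-form, computed in the preferred chart at `x`
(through which Mathlib identifies `T_x M` with the model space). -/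
noncomputable def extDerivAt (θ : ∀ x : M, TSp n x →L[ℝ] ℝ) (x : M) (v w : TSp n x) : ℝ :=
  fderiv ℝ (formInChart θ x) (extChartAt (𝓡 (2 * n + 1)) x x) v w -
    fderiv ℝ (formInChart θ x) (extChartAt (𝓡 (2 * n + 1)) x x) w v

/-- The value of the `(2n+1)`-form `θ ∧ η ∧ ⋯ ∧ η` (`n` factors `η`) on `(v₀, …, v_{2n})`. -/
noncomputable def wedgeTop {V : Type*} (n : ℕ) (θ : V → ℝ) (η : V → V → ℝ)
    (v : Fin (2 * n + 1) → V) : ℝ :=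
  (1 / 2) ^ n * ∑ σ : Equiv.Perm (Fin (2 * n + 1)), ((Equiv.Perm.sign σ : ℤ) : ℝ) *
    (θ (v (σ 0)) * ∏ j : Fin n, η (v (σ ⟨2 * j + 1, by omega⟩)) (v (σ ⟨2 * j + 2, by omega⟩)))

/-- `θ` is, on the open set `U`, a smooth nowhere vanishing 1-form whose kernel is `H`. -/
structure IsLocalDefiningForm [IsManifold (𝓡 (2 * n + 1)) ∞ M]
    (H : ∀ x : M, Submodule ℝ (TSp n x)) (U : Set M) (θ : ∀ x : M, TSp n x →L[ℝ] ℝ) :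
    Prop where
  isOpen : IsOpen U
  smooth : ContMDiffOn (𝓡 (2 * n + 1)) ((𝓡 (2 * n + 1)).prod 𝓘(ℝ, Heis n →L[ℝ] ℝ)) ∞
    (fun x => (Bundle.TotalSpace.mk' (Heis n →L[ℝ] ℝ) x (θ x) :
      Bundle.TotalSpace (Heis n →L[ℝ] ℝ)
        (fun x : M => TangentSpace (𝓡 (2 * n + 1)) x →L[ℝ] Bundle.Trivial M ℝ x))) U
  ne_zero : ∀ x ∈ U, θ x ≠ 0
  ker_eq : ∀ x ∈ U, ∀ v, θ x v = 0 ↔ v ∈ H x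

/-- A contact structure on `M`: a smooth subbundle `H ⊂ TM` of codimension 1 such that
`θ ∧ (dθ)^n` vanishes nowhere, for every local 1-form `θ` with kernel `H`. -/
structure ContactStructure (n : ℕ) (M : Type*) [TopologicalSpace M] [ChartedSpace (Heis n) M]
    [IsManifold (𝓡 (2 * n + 1)) ∞ M] where
  H : ∀ x : M, Submodule ℝ (TSp n x)
  exists_form : ∀ x : M, ∃ θ U, x ∈ U ∧ IsLocalDefiningForm H U θ
  nondegenerate : ∀ U θ, IsLocalDefiningForm H U θ → ∀ x ∈ U,
    ∃ v : Fin (2 * n + 1) → TSp n x, wedgeTop n (θ x) (extDerivAt θ x) v ≠ 0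

/-- `w` is the density of `μ` in the chart `e`: smooth and positive on the target of `e`, and the
image of `μ` under `e` is `w(y) dy`. -/
structure IsChartDensity [MeasurableSpace M] (μ : Measure M)
    (e : OpenPartialHomeomorph M (Heis n)) (w : Heis n → ℝ) : Prop where
  smooth : ContDiffOn ℝ ∞ w e.target
  pos : ∀ y ∈ e.target, 0 < w y
  map_eq : (μ.restrict e.source).map e =
    (volume.restrict e.target).withDensity (fun y => ENNReal.ofReal (w y))

/-- A measure on `M` given by a smooth positive 1-density. -/
structure SmoothMeasure (n : ℕ) (M : Type*) [TopologicalSpace M] [ChartedSpace (Heis n) M]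
    [MeasurableSpace M] where
  measure : Measure M
  exists_density : ∀ e ∈ IsManifold.maximalAtlas (𝓡 (2 * n + 1)) ∞ M,
    ∃ w, IsChartDensity measure e w

/-- The density of `μ` in the chart `e`; by continuity it is unique on the target of `e`. -/
noncomputable def SmoothMeasure.density [MeasurableSpace M] (μ : SmoothMeasure n M)
    {e : OpenPartialHomeomorph M (Heis n)}
    (he : e ∈ IsManifold.maximalAtlas (𝓡 (2 * n + 1)) ∞ M) : Heis n → ℝ :=
  (μ.exists_density e he).choose

/-- `L²(M)`. -/
abbrev SmoothMeasure.L2 [MeasurableSpace M] (μ : SmoothMeasure n M) : Type _ :=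
  Lp ℂ 2 μ.measure

variable [IsManifold (𝓡 (2 * n + 1)) ∞ M]

/-! ## The osculating groups and the Heisenberg tangent bundle -/

namespace ContactStructure

variable (C : ContactStructure n M)

/-- A local defining form of the contact structure near `x`. -/
noncomputable def formAt (x : M) : ∀ y : M, TSp n y →L[ℝ] ℝ := (C.exists_form x).choose

theorem exists_normal (x : M) : ∃ r : TSp n x, C.formAt x x r = 1 := by
  obtain ⟨U, hxU, hU⟩ := (C.exists_form x).choose_spec
  have h := hU.ne_zero x hxU
  obtain ⟨r, hr⟩ : ∃ r, C.formAt x x r ≠ 0 := by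
    by_contra! hall
    exact h (ContinuousLinearMap.ext hall)
  exact ⟨(C.formAt x x r)⁻¹ • r, by rw [map_smul, smul_eq_mul, inv_mul_cancel₀ hr]⟩

/-- The normal space `N_x = T_x M / H_x`. -/
abbrev Normal (x : M) : Type := TSp n x ⧸ C.H x

/-- The class in `N_x` on which the chosen defining form takes the value `1`. -/
noncomputable def normalGen (x : M) : C.Normal x :=
  Submodule.Quotient.mk (C.exists_normal x).choose

/-- The Levi form `H_x × H_x → N_x`: the element `ν` of `N_x` with `θ(ν) = dθ(h, h')`, for one, or
equivalently for every, local defining form `θ`. It is minus the bracket of vector fields modulo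
`H`. -/
noncomputable def levi (x : M) (h h' : C.H x) : C.Normal x :=
  extDerivAt (C.formAt x) x (h : TSp n x) (h' : TSp n x) • C.normalGen x

/-- The osculating group `T_H M_x`, in exponential coordinates: the set `H_x ⊕ N_x`. -/
def Osc (x : M) : Type := C.H x × C.Normal x

noncomputable instance (x : M) : AddCommGroup (C.Osc x) := inferInstanceAs (AddCommGroup (C.H x × C.Normal x))

noncomputable instance (x : M) : TopologicalSpace (C.Osc x) :=
  inferInstanceAs (TopologicalSpace (C.H x × C.Normal x))

noncomputable instance (x : M) : MeasurableSpace (C.Osc x) := borel _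

/-- The group law of the osculating group, the simply connected group of the graded Lie algebra
`H_x ⊕ N_x`. The sign is the one for which parabolic arrows are composed like the flows which
they generate. -/
noncomputable def oscMul (x : M) (g g' : C.Osc x) : C.Osc x :=
  (g.1 + g'.1, g.2 + g'.2 + (1 / 2 : ℝ) • C.levi x g.1 g'.1)

/-- The inverse in the osculating group. -/
noncomputable def oscInv (x : M) (g : C.Osc x) : C.Osc x := (-g.1, -g.2)

/-- The set of all `(x, h, v)` with `h ∈ H_x` and `v ∈ T_x M`. -/
def PreTangent : Type _ := Σ x : M, C.H x × TSp n x

/-- It is topologized as a subset of `TM × TM`. -/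
noncomputable instance : TopologicalSpace C.PreTangent :=
  TopologicalSpace.induced
    (fun p : C.PreTangent =>
      ((⟨p.1, (p.2.1 : TSp n p.1)⟩, ⟨p.1, p.2.2⟩) :
        TangentBundle (𝓡 (2 * n + 1)) M × TangentBundle (𝓡 (2 * n + 1)) M)) inferInstance

/-- The Heisenberg tangent bundle `T_H M = H ⊕ N`. -/
def HeisTangent : Type _ := Σ x : M, C.Osc x

/-- The topology of the vector bundle `H ⊕ N`, as a quotient of that of `H ⊕ TM`. -/
noncomputable instance : TopologicalSpace C.HeisTangent :=
  TopologicalSpace.coinduced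
    (fun p : C.PreTangent =>
      (⟨p.1, (p.2.1, Submodule.Quotient.mk p.2.2)⟩ : C.HeisTangent)) inferInstance

/-- A linear section of the projection `T_x M → N_x`. -/
noncomputable def section_ (x : M) : C.Normal x →ₗ[ℝ] TSp n x :=
  ((C.H x).mkQ.exists_rightInverse_of_surjective (C.H x).range_mkQ).choose

/-- The identification `H_x ⊕ N_x ≅ T_x M` given by the section. -/
noncomputable def oscToTangent (x : M) (g : C.Osc x) : Heis n :=
  ((g.1 : TSp n x) + C.section_ x g.2 : TSp n x)

/-! ## The C*-algebra of the Heisenberg tangent bundle -/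

variable [MeasurableSpace M] (μ : SmoothMeasure n M)

/-- The Haar measure on `T_H M_x` given by the value of the density `μ` at `x`, by means of
`|Λ|(H_x ⊕ N_x) = |Λ|(T_x M)`. It does not depend on the section. -/
noncomputable def haar (x : M) : Measure (C.Osc x) :=
  Measure.comap (C.oscToTangent x)
    (ENNReal.ofReal
      (μ.density (IsManifold.chart_mem_maximalAtlas (I := 𝓡 (2 * n + 1)) (n := ∞) x)
        (chartAt (Heis n) x x)) • (volume : Measure (Heis n)))

/-- The bounded operators on `L²(T_H M_x)`. -/
abbrev FibreOp (x : M) : Type := Lp ℂ 2 (C.haar μ x) →L[ℂ] Lp ℂ 2 (C.haar μ x)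

/-- The C*-algebra `∏_x B(L²(T_H M_x))` of bounded families of operators, with the norm
`sup_x ‖a_x‖`. -/
def FibreOps : Type _ := lp (fun x : M => C.FibreOp μ x) ∞

noncomputable instance : NonUnitalCStarAlgebra (C.FibreOps μ) :=
  inferInstanceAs (NonUnitalCStarAlgebra (lp (fun x : M => C.FibreOp μ x) ∞))

/-- The operator `a_x` of a family `a = (a_x)_x`. -/
noncomputable def FibreOps.at {C : ContactStructure n M} {μ : SmoothMeasure n M}
    (a : C.FibreOps μ) (x : M) : C.FibreOp μ x :=
  (show lp (fun x : M => C.FibreOp μ x) ∞ from a) x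

/-- The element `a = (a_x)_x` is the family of regular representations of the function `f` on
`T_H M`: for each `x`, `a_x ξ = f * ξ`, i.e.
`(a_x ξ)(g) = ∫ f(x, g g'⁻¹) ξ(g') dg'` for `ξ ∈ L²(T_H M_x)`. -/
def IsRegularRep (f : C.HeisTangent → ℂ) (a : C.FibreOps μ) : Prop :=
  ∀ (x : M) (ξ : Lp ℂ 2 (C.haar μ x)), (a.at x) ξ =ᵐ[C.haar μ x] fun g =>
    ∫ g', f ⟨x, C.oscMul x g (C.oscInv x g')⟩ * ξ g' ∂(C.haar μ x)

/-- The C*-algebra `C*(T_H M)`: the completion of `C_c(T_H M)` in the norm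
`‖f‖ = sup_x ‖π_x(f)‖`, realized as the norm closed algebra generated by the operators
`(π_x(f))_x`, where `π_x` is the regular representation on `L²(T_H M_x)`. -/
noncomputable def cstar : NonUnitalStarSubalgebra ℂ (C.FibreOps μ) :=
  cstarGenerated {a : C.FibreOps μ | ∃ f : C.HeisTangent → ℂ, Continuous f ∧
    HasCompactSupport f ∧ C.IsRegularRep μ f a}

noncomputable instance : NonUnitalCStarAlgebra (C.cstar μ) :=
  inferInstanceAs (NonUnitalCStarAlgebra (cstarGenerated _))

end ContactStructure

/-! ## Contact charts -/

/-- A diffeomorphism from an open subset of `M` onto an open subset of `H_n` which preserves the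
contact structures. -/
structure ContactChart (C : ContactStructure n M) where
  chart : OpenPartialHomeomorph M (Heis n)
  mem_atlas : chart ∈ IsManifold.maximalAtlas (𝓡 (2 * n + 1)) ∞ M
  map_contact : ∀ x ∈ chart.source, ∀ v : TSp n x, v ∈ C.H x ↔
    Heis.form (chart x) (mfderiv (𝓡 (2 * n + 1)) (𝓡 (2 * n + 1)) chart x v) = 0

namespace ContactChart

variable {C : ContactStructure n M} (Φ : ContactChart C)

/-- The fibre part `T_H M_x → T_H (H_n)_{Φ(x)} ≅ H_n` of the map `Φ̃` induced by `Φ` on the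
Heisenberg tangent bundles, for `x` in the domain of `Φ`. It is
`(h, ν) ↦ (θ(dΦ ν), (dΦ h)₁, …, (dΦ h)_{2n})`. Here `T_H (H_n)_g` is identified with `H_n` by right
translation, an element `y` of `H_n` being the arrow at `g` of the curve `s ↦ δ_s(y) g`. The choice
of the representative of `ν` does not matter. -/
noncomputable def fibreMap (x : M) (g : C.Osc x) : Heis n :=
  WithLp.toLp 2 fun i =>
    if i = 0 then
      Heis.form (Φ.chart x)
        (mfderiv (𝓡 (2 * n + 1)) (𝓡 (2 * n + 1)) Φ.chart x (Quotient.out g.2))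
    else
      (show Heis n from
        mfderiv (𝓡 (2 * n + 1)) (𝓡 (2 * n + 1)) Φ.chart x (g.1 : TSp n x)) i

/-- The functions on `T_H (H_n) = H_n × H_n` to which the chart is applied: continuous, with compact
support over the image of `Φ`. -/
structure IsSymbol (α : Heis n × Heis n → ℂ) : Prop where
  continuous : Continuous α
  compactSupport : HasCompactSupport α
  support_subset : tsupport α ⊆ Φ.chart.target ×ˢ univ

variable [MeasurableSpace M] (μ : SmoothMeasure n M)

open Classical in
/-- The function `α ∘ Φ̃` on `T_H M`, extended by zero. The function `α` stands for the fibrewise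
density `α dy`, and the result for a fibrewise density with respect to the Haar system of `μ`: hence
the factor `1/w`, where `w(y) dy` is the image of `μ` under `Φ`. The factor is `1` if `Φ` preserves
the measures. -/
noncomputable def pullback (α : Heis n × Heis n → ℂ) (p : C.HeisTangent) : ℂ :=
  if p.1 ∈ Φ.chart.source then
    (((μ.density Φ.mem_atlas (Φ.chart p.1))⁻¹ : ℝ) : ℂ) *
      α (Φ.chart p.1, Φ.fibreMap p.1 p.2)
  else 0

/-- `W` is the partial isometry `L²(M) → L²(H_n)` which is zero on the complement of the
domain `U` of `Φ` and the unitary `U_Φ : L²(U) → L²(Φ(U))` on `L²(U)`: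
`(U_Φ f)(y) = w(y)^(1/2) f(Φ⁻¹(y))`, where `w(y) dy` is the image of `μ` under `Φ`. -/
def IsUnitary (W : μ.L2 →L[ℂ] Lp ℂ 2 (volume : Measure (Heis n))) : Prop :=
  ∀ f : μ.L2, W f =ᵐ[volume] Φ.chart.target.indicator fun y =>
    ((Real.sqrt (μ.density Φ.mem_atlas y) : ℝ) : ℂ) * f (Φ.chart.symm y)

/-- `B t = U_Φ⁻¹ T^t_α U_Φ` for `t > 0`, as operators on `L²(M)`. -/
def IsTransported (α : Heis n × Heis n → ℂ) (B : ℝ → (μ.L2 →L[ℂ] μ.L2)) : Prop :=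
  ∃ (W : μ.L2 →L[ℂ] Lp ℂ 2 (volume : Measure (Heis n)))
    (S : ℝ → (Lp ℂ 2 (volume : Measure (Heis n)) →L[ℂ] Lp ℂ 2 (volume : Measure (Heis n)))),
    Φ.IsUnitary μ W ∧ ∀ t > 0, IsLocalOperator α t (S t) ∧
      B t = (ContinuousLinearMap.adjoint W) ∘L (S t) ∘L W

end ContactChart

end Contact

/-! The theorem is proved by zooming in at points. Rescale a chart at `b` parabolically, by `t`
horizontally and by `t²` vertically. As `t → ∞`, an operator with kernel `t^(2n+2) β(x, y, δ_t(x -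
y))` then tends to a convolution operator on the osculating group at `b`, and the limit is the same
in whichever chart it is computed. `IsZoomLimit` makes this precise: the family `F` enlarges
supports by `O(1/t)` at the parabolic scale, and after conjugation with the rescaling operators it
tends to the fibre operators `a_b`, uniformly for `b` in a compact set, on functions supported in a
bounded cell. Because propagation is finite, such families can be added and composed; `IsZoomRep`
carries the adjoints along. Hence "the family `F` represents `a`" respects the operations of a
*-algebra without any composition formula for kernels.

The decisive estimate is `limsup ‖F t‖ ≤ ‖a‖` (`IsZoomRep.eventually_norm_le`). For functions
supported in a single cell it is immediate, since the rescaling operators are isometric there.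
Averaging over all cells gives it up to a factor `c` that depends only on the compact set carrying
the supports. Applied to the powers `(F*F)^(2^m)`, which represent `(a*a)^(2^m)` and are carried by
the same compact set, the estimate up to `c` gives the sharp one: by the C*-identity the factor
becomes `c^(1/N)` with `N → ∞`. In particular two families representing the same element differ by a
family tending to `0`; this is why the local operators of different charts fit together.

Functions in `C_c(T_H M)` are finite sums of functions supported over charts, so the represented
elements are dense (`dense_localRel`). The representation relation is thus a densely defined
contractive *-homomorphism into bounded families modulo families vanishing at infinity. A successive
approximation in the manner of Bartle and Graves lifts it to a continuous map on the whole algebra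
(`IsAsymptoticRel.exists_lift`), and this map is the asymptotic morphism.

The local analysis uses charts in which `H` is the kernel of a 1-form `θ` with `θ(e0) = 1`. They
exist near every point by linear algebra, so no Darboux normal form is needed; contact charts are
the case of the canonical form, for which `x y⁻¹` is exactly the horizontal difference together with
`θ` at the midpoint applied to `x - y` (`Heis.mul_inv_eq_diff`). The midpoint makes this difference
antisymmetric, and it makes the error under a change of coordinates `o(‖x - y‖²)`
(`isLittleO_midpoint`, `isLittleO_form`), which survives multiplication by `t²`. Together with the
quadratic term in `zoom` this yields `tendsto_dil_diff`: rescaled differences tend to quotients in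
the osculating group, carried over by the differential of the coordinate change. -/

/-! ## Extension of asymptotically multiplicative families to asymptotic morphisms -/

/-- The relation `R a F`, "the family `F` represents `a`", is an asymptotically isometric
*-representation with dense domain. -/
structure IsAsymptoticRel {A B : Type*} [NonUnitalCStarAlgebra A] [NonUnitalCStarAlgebra B]
    (R : A → (ℝ → B) → Prop) : Prop where
  continuousOn : ∀ {a F}, R a F → ContinuousOn F (Ioi 0)
  add : ∀ {a F b G}, R a F → R b G → R (a + b) (F + G)
  smul : ∀ (c : ℂ) {a F}, R a F → R (c • a) (c • F)
  star_rel : ∀ {a F}, R a F → R (star a) (star F)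
  mul : ∀ {a F b G}, R a F → R b G → R (a * b) (F * G)
  bound : ∀ {a F}, R a F → ∀ ε > 0, ∀ᶠ t in atTop, ‖F t‖ ≤ ‖a‖ + ε
  dense : Dense {a | ∃ F, R a F}

namespace IsAsymptoticRel

open scoped BoundedContinuousFunction

variable {A B : Type*} [NonUnitalCStarAlgebra A] [NonUnitalCStarAlgebra B]
  {R : A → (ℝ → B) → Prop}

theorem sub_bound (hR : IsAsymptoticRel R) {a F b G} (ha : R a F) (hb : R b G) {ε : ℝ}
    (hε : 0 < ε) : ∀ᶠ t in atTop, ‖F t - G t‖ ≤ ‖a - b‖ + ε := by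
  have h := hR.bound (hR.add ha (hR.smul (-1) hb)) ε hε
  simpa [← sub_eq_add_neg] using h

/-- `F` is `δ`-close to a representative of an element which is `δ`-close to `a`. -/
def Close (R : A → (ℝ → B) → Prop) (F : ℝ →ᵇ B) (a : A) (δ : ℝ) : Prop :=
  ∃ b G, R b G ∧ ‖b - a‖ < δ ∧ ∀ᶠ t in atTop, ‖F t - G t‖ < δ

/-- Representatives of elements form convex combinations because `R` is linear, and balls are
convex. Convexity is what allows local choices to be glued by a partition of unity on `A`; the bound
on `h` is kept in the set so that it survives the gluing. -/
theorem convex_close (hR : IsAsymptoticRel R) (F : ℝ →ᵇ B) (a : A) (δ M : ℝ) :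
    Convex ℝ {h : ℝ →ᵇ B | ‖h‖ ≤ M ∧ Close R (F + h) a δ} := by
  rintro h ⟨hM, b, G, hb, hba, hG⟩ h' ⟨hM', b', G', hb', hba', hG'⟩ s s' hs hs' hss
  refine ⟨?_, (s : ℂ) • b + (s' : ℂ) • b', (s : ℂ) • G + (s' : ℂ) • G',
    hR.add (hR.smul _ hb) (hR.smul _ hb'), ?_, ?_⟩
  · have := convex_closedBall (0 : ℝ →ᵇ B) M (x := h) (by simpa using hM) (y := h')
      (by simpa using hM') hs hs' hss
    simpa using this
  · have := convex_ball (0 : A) δ (x := b - a) (by simpa using hba) (y := b' - a)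
      (by simpa using hba') hs hs' hss
    have e : (s : ℂ) • b + (s' : ℂ) • b' - a = s • (b - a) + s' • (b' - a) := by
      simp only [Complex.coe_smul, smul_sub]
      nth_rewrite 1 [show a = (s + s') • a by rw [hss, one_smul]]
      rw [add_smul]; abel
    rw [e]; simpa using this
  · filter_upwards [hG, hG'] with t ht ht'
    have := convex_ball (0 : B) δ (x := (F + h) t - G t) (by simpa using ht)
      (y := (F + h') t - G' t) (by simpa using ht') hs hs' hss
    have e : (F + (s • h + s' • h')) t - ((s : ℂ) • G + (s' : ℂ) • G') t =
        s • ((F + h) t - G t) + s' • ((F + h') t - G' t) := by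
      simp only [BoundedContinuousFunction.coe_add, BoundedContinuousFunction.coe_smul,
        Pi.add_apply, Pi.smul_apply, Complex.coe_smul, smul_sub, smul_add]
      nth_rewrite 1 [show F t = (s + s') • F t by rw [hss, one_smul]]
      rw [add_smul]; abel
    rw [e]; simpa using this

/-- `G - F` is multiplied by a ramp that rises from `0` to `1` on `[τ, τ + 1]`, where `τ` lies
beyond the time from which the bound `M` holds. Freezing the argument at `max t τ ≥ 1` avoids the
times at which `G` need not be continuous or bounded. -/
theorem exists_correction (hR : IsAsymptoticRel R) (F : ℝ →ᵇ B) {b G} (hb : R b G) {M : ℝ}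
    (hM : ∀ᶠ t in atTop, ‖F t - G t‖ ≤ M) :
    ∃ h : ℝ →ᵇ B, ‖h‖ ≤ M ∧ ∀ᶠ t in atTop, (F + h) t = G t := by
  obtain ⟨τ₀, hτ₀⟩ := eventually_atTop.1 hM
  set τ := max τ₀ 1 with hτ
  have hM0 : 0 ≤ M := (norm_nonneg _).trans (hτ₀ τ₀ le_rfl)
  have hc : Continuous fun t : ℝ => (max 0 (min 1 (t - τ)) : ℝ) • (G (max t τ) - F (max t τ)) := by
    refine Continuous.smul (f := fun t : ℝ => (max 0 (min 1 (t - τ)) : ℝ)) (by fun_prop)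
      (Continuous.sub ?_ (by fun_prop))
    refine (hR.continuousOn hb).comp_continuous (by fun_prop) fun t => ?_
    exact lt_of_lt_of_le zero_lt_one ((le_max_right τ₀ 1).trans (le_max_right t τ))
  have hbd : ∀ t : ℝ, ‖(max 0 (min 1 (t - τ)) : ℝ) • (G (max t τ) - F (max t τ))‖ ≤ M := by
    intro t
    rw [norm_smul, Real.norm_of_nonneg (le_max_left _ _), norm_sub_rev]
    have h1 : max 0 (min 1 (t - τ)) ≤ 1 := max_le zero_le_one (min_le_left _ _)
    have h2 := hτ₀ (max t τ) ((le_max_left _ _).trans (le_max_right _ _))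
    calc _ ≤ 1 * M := mul_le_mul h1 h2 (norm_nonneg _) zero_le_one
      _ = M := one_mul _
  refine ⟨BoundedContinuousFunction.ofNormedAddCommGroup _ hc M hbd,
    BoundedContinuousFunction.norm_ofNormedAddCommGroup_le hc hM0 hbd, ?_⟩
  filter_upwards [eventually_ge_atTop (τ + 1)] with t ht
  have h1 : min 1 (t - τ) = 1 := min_eq_left (by linarith)
  have h2 : max t τ = t := max_eq_left (by linarith)
  simp [h1, h2]

/-- The witnesses `b`, `G` and the correction `h` stay fixed while `a'` varies; the two norm
conditions are open. This is the local constancy required by the selection theorem. -/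
theorem eventually_close (T : C(A, ℝ →ᵇ B)) {δ : ℝ} (hδ : 0 < δ) (a : A)
    {b G} (hb : R b G) (hba : ‖b - a‖ < δ) {h : ℝ →ᵇ B}
    (hG : ∀ᶠ t in atTop, (T a + h) t = G t) :
    ∀ᶠ a' in 𝓝 a, Close R (T a' + h) a' δ := by
  have h1 : ∀ᶠ a' in 𝓝 a, ‖b - a'‖ < δ :=
    ((continuous_const.sub continuous_id).norm.tendsto a).eventually (gt_mem_nhds hba)
  have h2 : ∀ᶠ a' in 𝓝 a, ‖T a' - T a‖ < δ := by
    refine ((T.continuous.sub continuous_const).norm.tendsto a).eventually (gt_mem_nhds ?_)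
    simpa using hδ
  filter_upwards [h1, h2] with a' h1 h2
  refine ⟨b, G, hb, h1, ?_⟩
  filter_upwards [hG] with t ht
  rw [← ht]
  have : (T a' + h) t - (T a + h) t = (T a' - T a) t := by simp
  rw [this]
  exact (BoundedContinuousFunction.norm_coe_le_norm _ _).trans_lt h2

theorem exists_near (hR : IsAsymptoticRel R) (a : A) {δ : ℝ} (hδ : 0 < δ) :
    ∃ b G, R b G ∧ ‖b - a‖ < δ := by
  obtain ⟨b, ⟨G, hb⟩, hG⟩ := hR.dense.exists_mem_open Metric.isOpen_ball
    ⟨a, Metric.mem_ball_self hδ⟩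
  exact ⟨b, G, hb, by rwa [← dist_eq_norm]⟩

theorem exists_start (hR : IsAsymptoticRel R) {δ : ℝ} (hδ : 0 < δ) :
    ∃ T : C(A, ℝ →ᵇ B), ∀ a, Close R (T a) a δ := by
  have key := exists_continuous_forall_mem_convex_of_local_const (X := A) (E := ℝ →ᵇ B)
    (t := fun a => {F | Close R F a δ}) (fun a => ?_) (fun a => ?_)
  · exact key
  · intro F hF G hG s s' hs hs' hss
    have := hR.convex_close 0 a δ (max ‖F‖ ‖G‖) (x := F) ⟨le_max_left _ _, by simpa using hF⟩
      (y := G) ⟨le_max_right _ _, by simpa using hG⟩ hs hs' hss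
    simpa using this.2
  · obtain ⟨b, G, hb, hba⟩ := hR.exists_near a hδ
    obtain ⟨h, -, hG⟩ := hR.exists_correction 0 hb (M := ‖b‖ + 1)
      (by simpa using hR.bound hb 1 one_pos)
    refine ⟨h, ?_⟩
    have := eventually_close 0 hδ a hb hba (h := h) (by simpa using hG)
    simpa using this

theorem exists_step (hR : IsAsymptoticRel R) (T : C(A, ℝ →ᵇ B)) {δ δ' : ℝ} (hδ : 0 < δ)
    (hδ' : 0 < δ') (hT : ∀ a, Close R (T a) a δ) :
    ∃ T' : C(A, ℝ →ᵇ B), (∀ a, dist (T a) (T' a) ≤ 3 * δ + δ') ∧ ∀ a, Close R (T' a) a δ' := by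
  obtain ⟨h, hh⟩ := exists_continuous_forall_mem_convex_of_local_const (X := A) (E := ℝ →ᵇ B)
    (t := fun a => {h | ‖h‖ ≤ 3 * δ + δ' ∧ Close R (T a + h) a δ'})
    (fun a => hR.convex_close _ _ _ _) (fun a => by
      obtain ⟨b, G, hb, hba, hG⟩ := hT a
      obtain ⟨c, H, hc, hca⟩ := hR.exists_near a hδ'
      -- `T a` is within `δ` of `G`; `G` and `H` differ asymptotically by at most `‖b - c‖ + δ`, and
      -- `‖b - c‖ ≤ δ + δ'`.
      have hM : ∀ᶠ t in atTop, ‖T a t - H t‖ ≤ 3 * δ + δ' := by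
        filter_upwards [hG, hR.sub_bound hb hc hδ] with t h1 h2
        have h3 : ‖b - c‖ ≤ ‖b - a‖ + ‖c - a‖ := by
          rw [norm_sub_rev c a]; exact norm_sub_le_norm_sub_add_norm_sub b a c
        have h4 := norm_sub_le_norm_sub_add_norm_sub (T a t) (G t) (H t)
        linarith
      obtain ⟨h, hM', hh⟩ := hR.exists_correction (T a) hc hM
      refine ⟨h, ?_⟩
      filter_upwards [eventually_close T hδ' a hc hca hh] with a' ha'
      exact ⟨hM', ha'⟩)
  refine ⟨T + h, fun a => ?_, fun a => (hh a).2⟩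
  rw [dist_comm, dist_eq_norm]
  simpa using (hh a).1

/-- Successive approximation: stage `k` is a continuous selection with error `2^(-k)`, and each
correction is bounded by a multiple of the error of the preceding stage. The stages therefore
converge uniformly on `A`, and the limit is continuous and asymptotically exact. -/
theorem exists_lift (hR : IsAsymptoticRel R) :
    ∃ T : A → ℝ →ᵇ B, Continuous T ∧ ∀ a b G, R b G → ∀ ε > 0,
      ∀ᶠ t in atTop, ‖T a t - G t‖ ≤ ‖a - b‖ + ε := by
  have hpos : ∀ k : ℕ, 0 < (1 / 2 : ℝ) ^ k := fun k => by positivity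
  obtain ⟨T₀, hT₀⟩ := hR.exists_start (hpos 0)
  choose! next hd hn using fun (k : ℕ) (T : C(A, ℝ →ᵇ B)) (hT : ∀ a, Close R (T a) a ((1 / 2) ^ k)) =>
    hR.exists_step T (hpos k) (hpos (k + 1)) hT
  let S : ℕ → C(A, ℝ →ᵇ B) := fun k => Nat.rec T₀ (fun k T => next k T) k
  have hS : ∀ k a, Close R (S k a) a ((1 / 2) ^ k) := by
    intro k
    induction k with
    | zero => exact hT₀
    | succ k ih => exact hn k (S k) ih
  -- `3 · 2^(-k) + 2^(-k-1) ≤ 4 · 2^(-k)`.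
  have hdist : ∀ a k, dist (S k a) (S (k + 1) a) ≤ 8 / 2 / 2 ^ k := by
    intro a k
    refine (hd k (S k) (hS k) a).trans ?_
    have : (0 : ℝ) < 2 ^ k := by positivity
    rw [pow_succ, one_div, inv_pow]
    field_simp
    norm_num
  have hcau : ∀ a, CauchySeq fun k => S k a := fun a => cauchySeq_of_le_geometric_two (hdist a)
  choose T hT using fun a => cauchySeq_tendsto_of_complete (hcau a)
  have hdT : ∀ a k, dist (S k a) (T a) ≤ 8 / 2 ^ k := fun a k =>
    dist_le_of_le_geometric_two_of_tendsto (hdist a) (hT a) k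
  have hlim : Tendsto (fun k : ℕ => (8 : ℝ) / 2 ^ k) atTop (𝓝 0) := by
    have := (tendsto_pow_atTop_nhds_zero_of_lt_one (r := (1 / 2 : ℝ)) (by norm_num)
      (by norm_num)).const_mul 8
    simpa [div_eq_mul_inv] using this
  refine ⟨T, ?_, ?_⟩
  · refine TendstoUniformly.continuous (F := fun k a => S k a) (p := atTop) ?_
      (Frequently.of_forall fun k => (S k).continuous)
    rw [Metric.tendstoUniformly_iff]
    intro ε hε
    filter_upwards [hlim.eventually (gt_mem_nhds hε)] with k hk a
    rw [dist_comm]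
    exact (hdT a k).trans_lt hk
  · intro a b G hb ε hε
    have h0 : Tendsto (fun k : ℕ => (1 / 2 : ℝ) ^ k) atTop (𝓝 0) :=
      tendsto_pow_atTop_nhds_zero_of_lt_one (by norm_num) (by norm_num)
    -- The four quarters of `ε` pay for the distance from `T` to `S k`, from `S k a` to `H`, from
    -- `c` to `a`, and for the slack in `sub_bound`.
    obtain ⟨k, hk, hk'⟩ := ((hlim.eventually (gt_mem_nhds (show 0 < ε / 4 by positivity))).and
      (h0.eventually (gt_mem_nhds (show 0 < ε / 4 by positivity)))).exists
    obtain ⟨c, H, hc, hca, hH⟩ := hS k a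
    filter_upwards [hH, hR.sub_bound hc hb (show 0 < ε / 4 by positivity)] with t h1 h2
    have h3 : ‖T a t - S k a t‖ ≤ 8 / 2 ^ k := by
      rw [← dist_eq_norm, dist_comm]
      exact (BoundedContinuousFunction.dist_coe_le_dist t).trans (hdT a k)
    have h4 : ‖c - b‖ ≤ ‖c - a‖ + ‖a - b‖ := norm_sub_le_norm_sub_add_norm_sub c a b
    have h5 := norm_sub_le_norm_sub_add_norm_sub (T a t) (S k a t) (G t)
    have h6 := norm_sub_le_norm_sub_add_norm_sub (S k a t) (H t) (G t)
    linarith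

/-- Continuity of `D` is with respect to the supremum norm over all `t`, so a threshold for one
point `z`, with half the error, serves a whole neighbourhood of `z`; compactness does the rest. It
reduces the uniform conditions on an asymptotic morphism to pointwise ones. -/
theorem tendstoUniformlyOn_of_continuous {Z : Type*} [TopologicalSpace Z] {D : Z → ℝ →ᵇ B}
    (hD : Continuous D) (h0 : ∀ z, Tendsto (fun t => D z t) atTop (𝓝 0)) {K : Set Z}
    (hK : IsCompact K) : TendstoUniformlyOn (fun t z => ‖D z t‖) 0 atTop K := by
  rw [← tendstoLocallyUniformlyOn_iff_tendstoUniformlyOn_of_compact hK,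
    Metric.tendstoLocallyUniformlyOn_iff]
  intro ε hε z hz
  refine ⟨{z' | ‖D z' - D z‖ < ε / 2}, mem_nhdsWithin_of_mem_nhds ?_, ?_⟩
  · refine ((hD.sub continuous_const).norm.tendsto z).eventually (gt_mem_nhds ?_)
    simpa using half_pos hε
  · filter_upwards [(h0 z).norm.eventually (gt_mem_nhds
      (show ‖(0 : B)‖ < ε / 2 by simpa using half_pos hε))] with t ht z' hz'
    have h1 : ‖(D z' - D z) t‖ ≤ ‖D z' - D z‖ := BoundedContinuousFunction.norm_coe_le_norm _ _
    have h2 : D z' t = (D z' - D z) t + D z t := by simp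
    have h3 := norm_add_le ((D z' - D z) t) (D z t)
    rw [← h2] at h3
    have h4 : ‖D z' - D z‖ < ε / 2 := hz'
    simp only [Pi.zero_apply, dist_zero_left, norm_norm]
    linarith

/-- At a given element, each defect is computed with nearby represented elements, for which the
relation respects the operation exactly. What remains are distances between `T` and representatives,
controlled by `exists_lift`. -/
theorem exists_isAsymptoticMorphism (hR : IsAsymptoticRel R) :
    ∃ T : ℝ → A → B, IsAsymptoticMorphism T ∧
      ∀ a F, R a F → Tendsto (fun t => ‖T t a - F t‖) atTop (𝓝 0) := by
  obtain ⟨T, hTc, hT⟩ := hR.exists_lift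
  have hT0 : ∀ a F, R a F → Tendsto (fun t => ‖T a t - F t‖) atTop (𝓝 0) := by
    intro a F ha
    rw [Metric.tendsto_nhds]
    intro ε hε
    filter_upwards [hT a a F ha (ε / 2) (half_pos hε)] with t ht
    rw [sub_self, norm_zero, zero_add] at ht
    rw [Real.dist_0_eq_abs, abs_of_nonneg (norm_nonneg _)]
    linarith
  have approx : ∀ a, ∀ ε > 0, ∃ b G, R b G ∧ ‖b - a‖ < ε ∧
      ∀ᶠ t in atTop, ‖T a t - G t‖ ≤ ε := by
    intro a ε hε
    obtain ⟨b, G, hb, hba⟩ := hR.exists_near a (half_pos hε)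
    refine ⟨b, G, hb, hba.trans (half_lt_self hε), ?_⟩
    filter_upwards [hT a b G hb (ε / 2) (half_pos hε)] with t ht
    rw [norm_sub_rev] at hba
    linarith
  have lim0 : ∀ D : ℝ → B, (∀ ε > 0, ∀ᶠ t in atTop, ‖D t‖ ≤ ε) → Tendsto D atTop (𝓝 0) := by
    intro D hD
    rw [NormedAddGroup.tendsto_nhds_zero]
    intro ε hε
    filter_upwards [hD (ε / 2) (half_pos hε)] with t ht
    linarith
  refine ⟨fun t a => T a t, ⟨?_, ?_, ?_, ?_, ?_⟩, hT0⟩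
  · refine Continuous.continuousOn ?_
    exact (continuous_eval (F := ℝ →ᵇ B)).comp
      ((hTc.comp continuous_snd).prodMk continuous_fst) |>.congr fun p => rfl
  · exact fun a => ⟨‖T a‖, eventually_map.2 <| Eventually.of_forall fun t =>
      BoundedContinuousFunction.norm_coe_le_norm _ _⟩
  · intro c K hK
    have := tendstoUniformlyOn_of_continuous
      (D := fun p : A × A => T p.1 + c • T p.2 - T (p.1 + c • p.2)) (by fun_prop) ?_ (hK.prod hK)
    · simpa using this
    · rintro ⟨a, b⟩
      refine lim0 _ fun ε hε => ?_
      -- Contributions: `η` and `‖c‖ η` from replacing `T a` and `T b`, and `η + ‖c‖ η` plus the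
      -- slack `η` from replacing `T (a + c • b)`.
      set η := ε / (3 + 2 * ‖c‖) with hη
      have hc : 0 < 3 + 2 * ‖c‖ := by positivity
      have hη0 : 0 < η := by positivity
      obtain ⟨a', F, ha', haa, hF⟩ := approx a η hη0
      obtain ⟨b', G, hb', hbb, hG⟩ := approx b η hη0
      have hFG := hR.add ha' (hR.smul c hb')
      filter_upwards [hF, hG, hT (a + c • b) _ _ hFG η hη0] with t h1 h2 h3
      have e1 : (T a + c • T b - T (a + c • b)) t = (T a t - F t) + c • (T b t - G t) -
          (T (a + c • b) t - (F + c • G) t) := by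
        simp [smul_sub]; abel
      have e2 : a + c • b - (a' + c • b') = -((a' - a) + c • (b' - b)) := by
        simp [smul_sub]; abel
      have h4 : ‖a + c • b - (a' + c • b')‖ ≤ η + ‖c‖ * η := by
        rw [e2, norm_neg]
        refine (norm_add_le _ _).trans (add_le_add haa.le ?_)
        rw [norm_smul]; gcongr
      have h5 : ‖c • (T b t - G t)‖ ≤ ‖c‖ * η := by rw [norm_smul]; gcongr
      change ‖(T a + c • T b - T (a + c • b)) t‖ ≤ ε
      rw [e1]
      have h6 := norm_sub_le ((T a t - F t) + c • (T b t - G t)) (T (a + c • b) t - (F + c • G) t)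
      have h7 := norm_add_le (T a t - F t) (c • (T b t - G t))
      have h8 : ε = (3 + 2 * ‖c‖) * η := by rw [hη]; field_simp
      rw [h8]; linarith
  · intro K hK
    have := tendstoUniformlyOn_of_continuous
      (D := fun a : A => T (star a) - star (T a)) (by fun_prop) ?_ hK
    · simpa using this
    · intro a
      refine lim0 _ fun ε hε => ?_
      obtain ⟨a', F, ha', haa, hF⟩ := approx a (ε / 4) (by positivity)
      filter_upwards [hF, hT (star a) _ _ (hR.star_rel ha') (ε / 4) (by positivity)] with t h1 h2
      have e1 : (T (star a) - star (T a)) t =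
          (T (star a) t - (star F) t) - star (T a t - F t) := by
        simp
      have h3 : ‖star a - star a'‖ < ε / 4 := by rw [← star_sub, norm_star, norm_sub_rev]; exact haa
      change ‖(T (star a) - star (T a)) t‖ ≤ ε
      rw [e1]
      have h4 := norm_sub_le (T (star a) t - (star F) t) (star (T a t - F t))
      rw [norm_star] at h4
      linarith
  · intro K hK
    have := tendstoUniformlyOn_of_continuous
      (D := fun p : A × A => T p.1 * T p.2 - T (p.1 * p.2)) (by fun_prop) ?_ (hK.prod hK)
    · simpa using this
    · rintro ⟨a, b⟩
      refine lim0 _ fun ε hε => ?_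
      -- This is the total coefficient of `η` in `h9`; the condition `η ≤ 1` serves to bound `‖b'‖`
      -- and `‖F t‖` independently of `η`.
      set c := ‖T a‖ + ‖T b‖ + ‖a‖ + ‖b‖ + 3 with hc
      have hc0 : 0 < c := by positivity
      set η := min 1 (ε / c) with hη
      have hη0 : 0 < η := by positivity
      have hη1 : η ≤ 1 := min_le_left _ _
      have hηε : c * η ≤ ε := by
        calc c * η ≤ c * (ε / c) := by gcongr; exact min_le_right _ _
          _ = ε := by field_simp
      obtain ⟨a', F, ha', haa, hF⟩ := approx a η hη0
      obtain ⟨b', G, hb', hbb, hG⟩ := approx b η hη0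
      filter_upwards [hF, hG, hT (a * b) _ _ (hR.mul ha' hb') η hη0] with t h1 h2 h3
      have e1 : (T a * T b - T (a * b)) t = (T a t - F t) * T b t + F t * (T b t - G t) -
          (T (a * b) t - (F * G) t) := by
        simp [mul_sub, sub_mul]
      have e2 : a * b - a' * b' = -((a' - a) * b' + a * (b' - b)) := by
        simp [mul_sub, sub_mul]
      have hb'n : ‖b'‖ ≤ ‖b‖ + 1 := by
        have := norm_add_le (b' - b) b
        rw [sub_add_cancel] at this; linarith
      have hFn : ‖F t‖ ≤ ‖T a‖ + 1 := by
        have := norm_sub_le (T a t) (T a t - F t)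
        rw [sub_sub_cancel] at this
        linarith [BoundedContinuousFunction.norm_coe_le_norm (T a) t]
      have h4 : ‖a * b - a' * b'‖ ≤ η * (‖b‖ + 1) + ‖a‖ * η := by
        rw [e2, norm_neg]
        refine (norm_add_le _ _).trans (add_le_add ?_ ?_)
        · exact (norm_mul_le _ _).trans (by gcongr)
        · exact (norm_mul_le _ _).trans (by gcongr)
      change ‖(T a * T b - T (a * b)) t‖ ≤ ε
      rw [e1]
      have h5 : ‖(T a t - F t) * T b t‖ ≤ η * ‖T b‖ := (norm_mul_le _ _).trans
        (mul_le_mul h1 (BoundedContinuousFunction.norm_coe_le_norm _ _) (norm_nonneg _) hη0.le)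
      have h6 : ‖F t * (T b t - G t)‖ ≤ (‖T a‖ + 1) * η := (norm_mul_le _ _).trans
        (mul_le_mul hFn h2 (norm_nonneg _) (by positivity))
      have h7 := norm_sub_le ((T a t - F t) * T b t + F t * (T b t - G t))
        (T (a * b) t - (F * G) t)
      have h8 := norm_add_le ((T a t - F t) * T b t) (F t * (T b t - G t))
      have h9 : c * η = η * ‖T b‖ + (‖T a‖ + 1) * η + (η * (‖b‖ + 1) + ‖a‖ * η) + η := by
        rw [hc]; ring
      linarith

end IsAsymptoticRel

/-! ## Weighted composition operators and integral operators on `L²` -/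

section L2

variable {X Y : Type*} [MeasurableSpace X] [MeasurableSpace Y] {ν : Measure X} {ρ : Measure Y}

theorem enorm_sq_eq_lintegral (u : Lp ℂ 2 ν) : ‖u‖ₑ ^ 2 = ∫⁻ x, ‖u x‖ₑ ^ 2 ∂ν := by
  have h : eLpNorm u 2 ν ^ 2 = ∫⁻ x, ‖u x‖ₑ ^ 2 ∂ν := by
    rw [eLpNorm_eq_lintegral_rpow_enorm_toReal (by norm_num) (by norm_num)]
    simp only [ENNReal.toReal_ofNat, ENNReal.rpow_ofNat]
    rw [← ENNReal.rpow_natCast, ← ENNReal.rpow_mul]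
    simp
  rw [← h, Lp.enorm_def]

theorem memLp_two_of_lintegral {f : X → ℂ} (hf : AEStronglyMeasurable f ν)
    (h : ∫⁻ x, ‖f x‖ₑ ^ 2 ∂ν < ⊤) : MemLp f 2 ν := by
  refine ⟨hf, ?_⟩
  rw [eLpNorm_eq_lintegral_rpow_enorm_toReal (by norm_num) (by norm_num)]
  simp only [ENNReal.toReal_ofNat, ENNReal.rpow_ofNat]
  exact ENNReal.rpow_lt_top_of_nonneg (by norm_num) h.ne

theorem norm_le_of_lintegral_le (u : Lp ℂ 2 ν) (v : Lp ℂ 2 ρ) {c : ℝ} (hc : 0 ≤ c)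
    (h : ∫⁻ x, ‖u x‖ₑ ^ 2 ∂ν ≤ ENNReal.ofReal (c ^ 2) * ∫⁻ x, ‖v x‖ₑ ^ 2 ∂ρ) : ‖u‖ ≤ c * ‖v‖ := by
  rw [← enorm_sq_eq_lintegral, ← enorm_sq_eq_lintegral] at h
  rw [ENNReal.ofReal_pow hc, ← mul_pow, ← ofReal_norm, ← ofReal_norm,
    ← ENNReal.ofReal_mul hc, ← ENNReal.ofReal_pow (norm_nonneg _),
    ← ENNReal.ofReal_pow (by positivity), ENNReal.ofReal_le_ofReal_iff (by positivity)] at h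
  exact le_of_sq_le_sq h (by positivity)

/-- The operator `u ↦ m · (u ∘ g)`. -/
def IsWeightedComp (g : Y → X) (m : Y → ℝ) (L : Lp ℂ 2 ν →L[ℂ] Lp ℂ 2 ρ) : Prop :=
  ∀ u : Lp ℂ 2 ν, L u =ᵐ[ρ] fun y => (m y : ℂ) * u (g y)

/-- The hypothesis says that `g` pushes `m² ρ` forward to `ν` restricted to `A`, so a `ν`-null set
has a preimage that is null apart from the zeros of `m`. Measurability of `g` is asked only where `m
≠ 0`, since inverse charts carry no information off their domain. -/
theorem ae_comp_of_lintegral {g : Y → X} {m : Y → ℝ} {A : Set X}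
    (h : ∀ f : X → ℝ≥0∞, Measurable f →
      ∫⁻ y, ENNReal.ofReal (m y ^ 2) * f (g y) ∂ρ = ∫⁻ x in A, f x ∂ν)
    (hm : Measurable m) (hg : AEMeasurable g (ρ.restrict {y | m y ≠ 0}))
    {p : X → Prop} (hp : ∀ᵐ x ∂ν, p x) : ∀ᵐ y ∂ρ, m y = 0 ∨ p (g y) := by
  obtain ⟨N, hN, hNm, hN0⟩ := exists_measurable_superset_of_null hp
  have h1 := h (N.indicator 1) (measurable_one.indicator hNm)
  rw [lintegral_indicator_one hNm, le_antisymm ((Measure.restrict_apply_le _ _).trans hN0.le)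
    zero_le] at h1
  have hS : MeasurableSet {y | m y ≠ 0} := hm (measurableSet_singleton 0).compl
  have h2 : ∫⁻ y in {y | m y ≠ 0}, ENNReal.ofReal (m y ^ 2) * N.indicator 1 (g y) ∂ρ = 0 :=
    le_antisymm ((setLIntegral_le_lintegral _ _).trans h1.le) zero_le
  rw [lintegral_eq_zero_iff'] at h2
  · rw [Filter.EventuallyEq, ae_restrict_iff' hS] at h2
    filter_upwards [h2] with y hy
    by_cases hy0 : m y = 0
    · exact Or.inl hy0
    · right
      have h3 := hy hy0
      simp only [Pi.zero_apply, mul_eq_zero, ENNReal.ofReal_eq_zero] at h3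
      rcases h3 with h3 | h3
      · exact absurd h3 (not_le.2 (by positivity))
      · by_contra hcon
        have : g y ∈ N := hN hcon
        simp [this] at h3
  · exact (hm.pow_const 2).ennreal_ofReal.aemeasurable.mul
      ((measurable_one.indicator hNm).comp_aemeasurable hg)

theorem aestronglyMeasurable_weightedComp {g : Y → X} {m : Y → ℝ} (hm : Measurable m)
    (hg : AEMeasurable g (ρ.restrict {y | m y ≠ 0})) {u : X → ℂ} (hu : Measurable u) :
    AEStronglyMeasurable (fun y => (m y : ℂ) * u (g y)) ρ := by
  have hS : MeasurableSet {y | m y ≠ 0} := hm (measurableSet_singleton 0).compl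
  have h1 : AEMeasurable ({y | m y ≠ 0}.indicator fun y => (m y : ℂ) * u (g y)) ρ := by
    rw [aemeasurable_indicator_iff hS]
    exact (Complex.measurable_ofReal.comp hm).aemeasurable.mul (hu.comp_aemeasurable hg)
  have h2 : {y | m y ≠ 0}.indicator (fun y => (m y : ℂ) * u (g y)) =
      fun y => (m y : ℂ) * u (g y) := by
    ext y
    by_cases hy : m y = 0 <;> simp [hy]
  rw [h2] at h1
  exact h1.aestronglyMeasurable

theorem lintegral_weightedComp {g : Y → X} {m : Y → ℝ} {A : Set X}
    (h : ∀ f : X → ℝ≥0∞, Measurable f →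
      ∫⁻ y, ENNReal.ofReal (m y ^ 2) * f (g y) ∂ρ = ∫⁻ x in A, f x ∂ν) {u : X → ℂ}
    (hu : Measurable u) :
    ∫⁻ y, ‖(m y : ℂ) * u (g y)‖ₑ ^ 2 ∂ρ = ∫⁻ x in A, ‖u x‖ₑ ^ 2 ∂ν := by
  rw [← h _ (hu.enorm.pow_const 2)]
  refine lintegral_congr fun y => ?_
  rw [enorm_mul, mul_pow]
  congr 1
  rw [← ofReal_norm, ← ENNReal.ofReal_pow (norm_nonneg _)]
  simp

/-- The formula respects equality almost everywhere by `ae_comp_of_lintegral`, and it is contractive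
because the image of `u` has the square norm of `u` restricted to `A`. -/
theorem exists_weightedComp {g : Y → X} {m : Y → ℝ} {A : Set X}
    (h : ∀ f : X → ℝ≥0∞, Measurable f →
      ∫⁻ y, ENNReal.ofReal (m y ^ 2) * f (g y) ∂ρ = ∫⁻ x in A, f x ∂ν)
    (hm : Measurable m) (hg : AEMeasurable g (ρ.restrict {y | m y ≠ 0})) :
    ∃ L : Lp ℂ 2 ν →L[ℂ] Lp ℂ 2 ρ, IsWeightedComp g m L := by
  have hmeas : ∀ u : Lp ℂ 2 ν, Measurable u := fun u => (Lp.stronglyMeasurable u).measurable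
  have hle : ∀ u : Lp ℂ 2 ν, ∫⁻ y, ‖(m y : ℂ) * u (g y)‖ₑ ^ 2 ∂ρ ≤ ∫⁻ x, ‖u x‖ₑ ^ 2 ∂ν :=
    fun u => (lintegral_weightedComp h (hmeas u)).trans_le (setLIntegral_le_lintegral _ _)
  have hL2 : ∀ u : Lp ℂ 2 ν, MemLp (fun y => (m y : ℂ) * u (g y)) 2 ρ := fun u =>
    memLp_two_of_lintegral (aestronglyMeasurable_weightedComp hm hg (hmeas u))
      ((hle u).trans_lt (by rw [← enorm_sq_eq_lintegral]; exact ENNReal.pow_lt_top (enorm_lt_top (x := u))))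
  let L₀ : Lp ℂ 2 ν →ₗ[ℂ] Lp ℂ 2 ρ :=
    { toFun := fun u => (hL2 u).toLp _
      map_add' := fun u v => by
        rw [← MemLp.toLp_add, MemLp.toLp_eq_toLp_iff]
        filter_upwards [ae_comp_of_lintegral h hm hg (Lp.coeFn_add u v)] with y hy
        rcases hy with hy | hy
        · simp [hy]
        · rw [hy, Pi.add_apply, Pi.add_apply, mul_add]
      map_smul' := fun c u => by
        rw [RingHom.id_apply, ← MemLp.toLp_const_smul, MemLp.toLp_eq_toLp_iff]
        filter_upwards [ae_comp_of_lintegral h hm hg (Lp.coeFn_smul c u)] with y hy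
        rcases hy with hy | hy
        · simp [hy]
        · rw [hy, Pi.smul_apply, Pi.smul_apply, smul_eq_mul, smul_eq_mul, mul_left_comm] }
  have hb : ∀ u, ‖L₀ u‖ ≤ 1 * ‖u‖ := fun u => by
    refine norm_le_of_lintegral_le _ _ zero_le_one ?_
    rw [one_pow, ENNReal.ofReal_one, one_mul]
    refine le_trans (le_of_eq (lintegral_congr_ae ?_)) (hle u)
    filter_upwards [MemLp.coeFn_toLp (hL2 u)] with y hy
    change ‖((hL2 u).toLp _ : Lp ℂ 2 ρ) y‖ₑ ^ 2 = _
    rw [hy]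
  exact ⟨L₀.mkContinuous 1 hb, fun u => MemLp.coeFn_toLp (hL2 u)⟩

theorem IsWeightedComp.lintegral_sq {g : Y → X} {m : Y → ℝ} {A : Set X}
    {L : Lp ℂ 2 ν →L[ℂ] Lp ℂ 2 ρ} (hL : IsWeightedComp g m L)
    (h : ∀ f : X → ℝ≥0∞, Measurable f →
      ∫⁻ y, ENNReal.ofReal (m y ^ 2) * f (g y) ∂ρ = ∫⁻ x in A, f x ∂ν) (u : Lp ℂ 2 ν) :
    ‖L u‖ₑ ^ 2 = ∫⁻ x in A, ‖u x‖ₑ ^ 2 ∂ν := by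
  rw [enorm_sq_eq_lintegral, ← lintegral_weightedComp h (Lp.stronglyMeasurable u).measurable]
  refine lintegral_congr_ae ?_
  filter_upwards [hL u] with y hy
  rw [hy]

theorem IsWeightedComp.norm_le {g : Y → X} {m : Y → ℝ} {A : Set X}
    {L : Lp ℂ 2 ν →L[ℂ] Lp ℂ 2 ρ} (hL : IsWeightedComp g m L)
    (h : ∀ f : X → ℝ≥0∞, Measurable f →
      ∫⁻ y, ENNReal.ofReal (m y ^ 2) * f (g y) ∂ρ = ∫⁻ x in A, f x ∂ν) (u : Lp ℂ 2 ν) :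
    ‖L u‖ ≤ ‖u‖ := by
  have := norm_le_of_lintegral_le (L u) u zero_le_one (by
    rw [one_pow, ENNReal.ofReal_one, one_mul, ← enorm_sq_eq_lintegral, hL.lintegral_sq h]
    exact setLIntegral_le_lintegral _ _)
  simpa using this

/-- Weighted composition operators which are inverse to each other on the supports are adjoint. -/
theorem integral_weightedComp {G : Type*} [NormedAddCommGroup G] [NormedSpace ℝ G]
    {g : Y → X} {m : Y → ℝ} {A : Set X}
    (h : ∀ f : X → ℝ≥0∞, Measurable f →
      ∫⁻ y, ENNReal.ofReal (m y ^ 2) * f (g y) ∂ρ = ∫⁻ x in A, f x ∂ν)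
    (hm : Measurable m) (hg : AEMeasurable g (ρ.restrict {y | m y ≠ 0})) {f : X → G}
    (hf : AEStronglyMeasurable f (ν.restrict A)) :
    ∫ y, m y ^ 2 • f (g y) ∂ρ = ∫ x in A, f x ∂ν := by
  have hS : MeasurableSet {y | m y ≠ 0} := hm (measurableSet_singleton 0).compl
  have hd : Measurable fun y => Real.toNNReal (m y ^ 2) := (hm.pow_const 2).real_toNNReal
  have hac : (ρ.withDensity fun y => ((Real.toNNReal (m y ^ 2) : NNReal) : ℝ≥0∞)) ≪
      ρ.restrict {y | m y ≠ 0} := by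
    refine Measure.AbsolutelyContinuous.mk fun s hs h0 => ?_
    rw [Measure.restrict_apply hs] at h0
    rw [withDensity_apply _ hs, ← lintegral_indicator hs]
    have : (s.indicator fun y => ((Real.toNNReal (m y ^ 2) : NNReal) : ℝ≥0∞)) =
        (s ∩ {y | m y ≠ 0}).indicator fun y => ((Real.toNNReal (m y ^ 2) : NNReal) : ℝ≥0∞) := by
      ext y
      by_cases hy : m y = 0 <;> by_cases hys : y ∈ s <;> simp [hy, hys]
    rw [this, lintegral_indicator (hs.inter hS)]
    exact setLIntegral_measure_zero _ _ h0
  have hg2 : AEMeasurable g (ρ.withDensity fun y => ((Real.toNNReal (m y ^ 2) : NNReal) : ℝ≥0∞)) :=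
    hg.mono_ac hac
  -- Tested on indicator functions, the hypothesis identifies an image measure; this is what
  -- transfers it from nonnegative functions to the Bochner integral.
  have hmap : (ρ.withDensity fun y => ((Real.toNNReal (m y ^ 2) : NNReal) : ℝ≥0∞)).map g =
      ν.restrict A := by
    ext s hs
    have h1 : AEMeasurable (fun y => s.indicator (1 : X → ℝ≥0∞) (g y)) (ρ.withDensity fun y =>
        ((Real.toNNReal (m y ^ 2) : NNReal) : ℝ≥0∞)) :=
      (measurable_one.indicator hs).comp_aemeasurable hg2
    rw [← lintegral_indicator_one hs, ← lintegral_indicator_one hs, ← h _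
      (measurable_one.indicator hs), lintegral_map' (measurable_one.indicator hs).aemeasurable hg2,
      lintegral_withDensity_eq_lintegral_mul₀' hd.coe_nnreal_ennreal.aemeasurable h1]
    rfl
  rw [← hmap, integral_map hg2 (by rwa [hmap]), integral_withDensity_eq_integral_smul hd]
  refine integral_congr_ae (Eventually.of_forall fun y => ?_)
  simp only [NNReal.smul_def, Real.coe_toNNReal _ (sq_nonneg (m y))]

/-- Substituting `x = g y` in `⟨L' v, u⟩` produces the factor `m²`; one `m` cancels against `m'` and
the other turns `u ∘ g` into `L u`. -/
theorem IsWeightedComp.eq_adjoint {g : Y → X} {m : Y → ℝ} {g' : X → Y} {m' : X → ℝ}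
    {A : Set X} {L : Lp ℂ 2 ν →L[ℂ] Lp ℂ 2 ρ} {L' : Lp ℂ 2 ρ →L[ℂ] Lp ℂ 2 ν}
    (hL : IsWeightedComp g m L) (hL' : IsWeightedComp g' m' L') (hA : MeasurableSet A)
    (h : ∀ f : X → ℝ≥0∞, Measurable f →
      ∫⁻ y, ENNReal.ofReal (m y ^ 2) * f (g y) ∂ρ = ∫⁻ x in A, f x ∂ν)
    (hm : Measurable m) (hg : AEMeasurable g (ρ.restrict {y | m y ≠ 0}))
    (hm' : ∀ x ∉ A, m' x = 0) (hgg : ∀ y, m y ≠ 0 → g' (g y) = y)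
    (hmm : ∀ y, m y ≠ 0 → m y * m' (g y) = 1) :
    L' = ContinuousLinearMap.adjoint L := by
  rw [ContinuousLinearMap.eq_adjoint_iff]
  intro v u
  rw [L2.inner_def, L2.inner_def]
  have h1 : ∫ x, inner ℂ (L' v x) (u x) ∂ν =
      ∫ x in A, inner ℂ ((m' x : ℂ) * v (g' x)) (u x) ∂ν := by
    rw [← integral_indicator hA]
    refine integral_congr_ae ?_
    filter_upwards [hL' v] with x hx
    by_cases hxA : x ∈ A
    · rw [indicator_of_mem hxA, hx]
    · rw [indicator_of_notMem hxA, hx, hm' x hxA]; simp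
  have hmeas : AEStronglyMeasurable (fun x => inner ℂ ((m' x : ℂ) * v (g' x)) (u x))
      (ν.restrict A) := by
    refine AEStronglyMeasurable.restrict ?_
    refine AEStronglyMeasurable.congr (f := fun x => inner ℂ (L' v x) (u x))
      ((Lp.aestronglyMeasurable _).inner (Lp.aestronglyMeasurable _)) ?_
    filter_upwards [hL' v] with x hx
    rw [hx]
  rw [h1, ← integral_weightedComp h hm hg hmeas]
  refine integral_congr_ae ?_
  filter_upwards [hL u] with y hy
  rw [hy]
  by_cases hy0 : m y = 0
  · simp [hy0]
  · rw [hgg y hy0]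
    have h2 : (m y : ℂ) * m' (g y) = 1 := by exact_mod_cast hmm y hy0
    simp only [RCLike.inner_apply, map_mul, Complex.conj_ofReal, Complex.real_smul,
      Complex.ofReal_pow]
    linear_combination (m y : ℂ) * u (g y) * (starRingEnd ℂ) (v y) * h2

end L2

/-! ### Integral operators: Schur's test, adjoints, compactness. -/

section Kernel

variable {X : Type*} [MeasurableSpace X] {ν : Measure X}

/-- The integral operator with kernel `k`. -/
def IsKernelOp (ν : Measure X) (k : X → X → ℂ) (T : Lp ℂ 2 ν →L[ℂ] Lp ℂ 2 ν) : Prop :=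
  ∀ u : Lp ℂ 2 ν, T u =ᵐ[ν] fun x => ∫ y, k x y * u y ∂ν

/-- Cauchy–Schwarz for the functions `1` and `v` with respect to the measure `a ν`. -/
theorem sq_lintegral_mul_le {a v : X → ℝ≥0∞} (ha : Measurable a) (hv : Measurable v) :
    (∫⁻ y, a y * v y ∂ν) ^ 2 ≤ (∫⁻ y, a y ∂ν) * ∫⁻ y, a y * v y ^ 2 ∂ν := by
  have h := ENNReal.lintegral_mul_le_Lp_mul_Lq (ν.withDensity a) Real.HolderConjugate.two_two
    (f := fun _ => 1) (g := v) aemeasurable_const hv.aemeasurable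
  simp only [Pi.mul_apply, one_mul, ENNReal.rpow_ofNat] at h
  rw [lintegral_withDensity_eq_lintegral_mul _ ha hv,
    lintegral_withDensity_eq_lintegral_mul _ ha (hv.pow_const 2),
    lintegral_withDensity_eq_lintegral_mul _ ha measurable_const] at h
  simp only [Pi.mul_apply] at h
  refine (pow_le_pow_left' h 2).trans (le_of_eq ?_)
  rw [mul_pow, ← ENNReal.rpow_natCast, ← ENNReal.rpow_natCast, ← ENNReal.rpow_mul]
  rw [← ENNReal.rpow_natCast (_ ^ (1 / 2 : ℝ)), ← ENNReal.rpow_mul]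
  norm_num

/-- Schur's test. -/
theorem schur_lintegral [SFinite ν] {a : X → X → ℝ≥0∞} (ha : Measurable (Function.uncurry a))
    {v : X → ℝ≥0∞} (hv : Measurable v) {c d : ℝ≥0∞} (h1 : ∀ x, ∫⁻ y, a x y ∂ν ≤ c)
    (h2 : ∀ y, ∫⁻ x, a x y ∂ν ≤ d) :
    ∫⁻ x, (∫⁻ y, a x y * v y ∂ν) ^ 2 ∂ν ≤ c * d * ∫⁻ y, v y ^ 2 ∂ν := by
  have hax : ∀ x, Measurable (a x) := fun x => ha.of_uncurry_left
  have hay : ∀ y, Measurable fun x => a x y := fun y => ha.of_uncurry_right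
  calc ∫⁻ x, (∫⁻ y, a x y * v y ∂ν) ^ 2 ∂ν
      ≤ ∫⁻ x, c * ∫⁻ y, a x y * v y ^ 2 ∂ν ∂ν := by
        refine lintegral_mono fun x => (sq_lintegral_mul_le (hax x) hv).trans ?_
        gcongr
        exact h1 x
    _ = c * ∫⁻ y, ∫⁻ x, a x y * v y ^ 2 ∂ν ∂ν := by
        rw [lintegral_const_mul _ (by
          exact (ha.mul ((hv.comp measurable_snd).pow_const 2)).lintegral_prod_right'),
          lintegral_lintegral_swap]
        exact (ha.mul ((hv.comp measurable_snd).pow_const 2)).aemeasurable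
    _ ≤ c * ∫⁻ y, d * v y ^ 2 ∂ν := by
        gcongr with y
        rw [lintegral_mul_const _ (hay y)]
        gcongr
        exact h2 y
    _ = _ := by rw [lintegral_const_mul _ (hv.pow_const 2), mul_assoc]

theorem ae_integrable_of_schur [SFinite ν] {k : X → X → ℂ} (hk : Measurable (Function.uncurry k))
    {c : ℝ} (h1 : ∀ x, ∫⁻ y, ‖k x y‖ₑ ∂ν ≤ ENNReal.ofReal c)
    (h2 : ∀ y, ∫⁻ x, ‖k x y‖ₑ ∂ν ≤ ENNReal.ofReal c) (u : Lp ℂ 2 ν) :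
    ∀ᵐ x ∂ν, Integrable (fun y => k x y * u y) ν := by
  have hu := (Lp.stronglyMeasurable u).measurable
  have hfin : ∫⁻ x, (∫⁻ y, ‖k x y‖ₑ * ‖u y‖ₑ ∂ν) ^ 2 ∂ν ≠ ⊤ := by
    refine ne_of_lt ((schur_lintegral (a := fun x y => ‖k x y‖ₑ) hk.enorm hu.enorm h1 h2).trans_lt ?_)
    rw [← enorm_sq_eq_lintegral]
    exact ENNReal.mul_lt_top (ENNReal.mul_lt_top ENNReal.ofReal_lt_top ENNReal.ofReal_lt_top)
      (ENNReal.pow_lt_top enorm_lt_top)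
  have hm : Measurable fun x => (∫⁻ y, ‖k x y‖ₑ * ‖u y‖ₑ ∂ν) ^ 2 :=
    ((hk.enorm.mul (hu.comp measurable_snd).enorm).lintegral_prod_right').pow_const 2
  filter_upwards [ae_lt_top hm hfin] with x hx
  refine ⟨(hk.of_uncurry_left.mul hu).aestronglyMeasurable, ?_⟩
  rw [HasFiniteIntegral]
  simp only [enorm_mul]
  exact lt_top_iff_ne_top.2 fun h => by simp [h] at hx

theorem exists_isKernelOp [SFinite ν] {k : X → X → ℂ} (hk : Measurable (Function.uncurry k))
    {c : ℝ} (hc : 0 ≤ c) (h1 : ∀ x, ∫⁻ y, ‖k x y‖ₑ ∂ν ≤ ENNReal.ofReal c)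
    (h2 : ∀ y, ∫⁻ x, ‖k x y‖ₑ ∂ν ≤ ENNReal.ofReal c) :
    ∃ T : Lp ℂ 2 ν →L[ℂ] Lp ℂ 2 ν, IsKernelOp ν k T ∧ ‖T‖ ≤ c := by
  have hmeas : ∀ u : Lp ℂ 2 ν, Measurable u := fun u => (Lp.stronglyMeasurable u).measurable
  have hle : ∀ u : Lp ℂ 2 ν, ∫⁻ x, ‖∫ y, k x y * u y ∂ν‖ₑ ^ 2 ∂ν ≤
      ENNReal.ofReal (c ^ 2) * ∫⁻ x, ‖u x‖ₑ ^ 2 ∂ν := by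
    intro u
    rw [pow_two c, ENNReal.ofReal_mul hc]
    refine le_trans (lintegral_mono fun x => ?_)
      (schur_lintegral (a := fun x y => ‖k x y‖ₑ) hk.enorm (hmeas u).enorm h1 h2)
    gcongr
    refine (enorm_integral_le_lintegral_enorm _).trans (le_of_eq ?_)
    simp only [enorm_mul]
  have hsm : ∀ u : Lp ℂ 2 ν, AEStronglyMeasurable (fun x => ∫ y, k x y * u y ∂ν) ν := fun u =>
    (StronglyMeasurable.integral_prod_right'
      (f := fun p : X × X => k p.1 p.2 * u p.2)
      (hk.mul ((hmeas u).comp measurable_snd)).stronglyMeasurable).aestronglyMeasurable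
  have hL2 : ∀ u : Lp ℂ 2 ν, MemLp (fun x => ∫ y, k x y * u y ∂ν) 2 ν := fun u =>
    memLp_two_of_lintegral (hsm u) ((hle u).trans_lt (by
      rw [← enorm_sq_eq_lintegral]
      exact ENNReal.mul_lt_top ENNReal.ofReal_lt_top (ENNReal.pow_lt_top (enorm_lt_top (x := u)))))
  let L₀ : Lp ℂ 2 ν →ₗ[ℂ] Lp ℂ 2 ν :=
    { toFun := fun u => (hL2 u).toLp _
      map_add' := fun u v => by
        rw [← MemLp.toLp_add, MemLp.toLp_eq_toLp_iff]
        filter_upwards [ae_integrable_of_schur hk h1 h2 u, ae_integrable_of_schur hk h1 h2 v]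
          with x hx hx'
        rw [Pi.add_apply, ← integral_add hx hx']
        refine integral_congr_ae ?_
        filter_upwards [Lp.coeFn_add u v] with y hy
        rw [hy, Pi.add_apply, mul_add]
      map_smul' := fun s u => by
        rw [RingHom.id_apply, ← MemLp.toLp_const_smul, MemLp.toLp_eq_toLp_iff]
        refine Eventually.of_forall fun x => ?_
        rw [Pi.smul_apply, ← integral_smul]
        refine integral_congr_ae ?_
        filter_upwards [Lp.coeFn_smul s u] with y hy
        rw [hy, Pi.smul_apply, smul_eq_mul, smul_eq_mul, mul_left_comm] }
  have hb : ∀ u, ‖L₀ u‖ ≤ c * ‖u‖ := fun u => by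
    refine norm_le_of_lintegral_le _ _ hc ?_
    refine le_trans (le_of_eq (lintegral_congr_ae ?_)) (hle u)
    filter_upwards [MemLp.coeFn_toLp (hL2 u)] with y hy
    change ‖((hL2 u).toLp _ : Lp ℂ 2 ν) y‖ₑ ^ 2 = _
    rw [hy]
  exact ⟨L₀.mkContinuous c hb, fun u => MemLp.coeFn_toLp (hL2 u), L₀.mkContinuous_norm_le hc hb⟩

theorem IsKernelOp.unique {k : X → X → ℂ} {S T : Lp ℂ 2 ν →L[ℂ] Lp ℂ 2 ν}
    (hS : IsKernelOp ν k S) (hT : IsKernelOp ν k T) : S = T := by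
  ext1 u
  exact Lp.ext ((hS u).trans (hT u).symm)

/-- Fubini's theorem, with the conjugate transposed kernel first shown to define an operator by
Schur's test. The work lies in the integrability on the product. -/
theorem IsKernelOp.adjoint [SFinite ν] {k : X → X → ℂ} (hk : Measurable (Function.uncurry k))
    {c : ℝ} (hc : 0 ≤ c) (h1 : ∀ x, ∫⁻ y, ‖k x y‖ₑ ∂ν ≤ ENNReal.ofReal c)
    (h2 : ∀ y, ∫⁻ x, ‖k x y‖ₑ ∂ν ≤ ENNReal.ofReal c) {T : Lp ℂ 2 ν →L[ℂ] Lp ℂ 2 ν}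
    (hT : IsKernelOp ν k T) :
    IsKernelOp ν (fun x y => (starRingEnd ℂ) (k y x)) (ContinuousLinearMap.adjoint T) := by
  obtain ⟨T', hT', -⟩ := exists_isKernelOp (ν := ν) (k := fun x y => (starRingEnd ℂ) (k y x))
    (Complex.continuous_conj.measurable.comp (hk.comp measurable_swap)) hc
    (fun x => by simpa only [RCLike.enorm_conj] using h2 x)
    (fun y => by simpa only [RCLike.enorm_conj] using h1 y)
  suffices T' = ContinuousLinearMap.adjoint T by rwa [← this]
  rw [ContinuousLinearMap.eq_adjoint_iff]
  intro u v
  rw [L2.inner_def, L2.inner_def]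
  have hu := (Lp.stronglyMeasurable u).measurable
  have hv := (Lp.stronglyMeasurable v).measurable
  have hfin : ∀ w : Lp ℂ 2 ν, ∫⁻ x, ‖w x‖ₑ ^ 2 ∂ν < ⊤ := fun w => by
    rw [← enorm_sq_eq_lintegral]; exact ENNReal.pow_lt_top enorm_lt_top
  have hprod : Integrable (Function.uncurry fun x y => k y x * (v x * (starRingEnd ℂ) (u y)))
      (ν.prod ν) := by
    have hmeas : Measurable (Function.uncurry fun x y => k y x * (v x * (starRingEnd ℂ) (u y))) :=
      (hk.comp measurable_swap).mul ((hv.comp measurable_fst).mul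
        (Complex.continuous_conj.measurable.comp (hu.comp measurable_snd)))
    refine ⟨hmeas.aestronglyMeasurable, ?_⟩
    rw [HasFiniteIntegral, lintegral_prod _ hmeas.enorm.aemeasurable]
    calc ∫⁻ x, ∫⁻ y, ‖k y x * (v x * (starRingEnd ℂ) (u y))‖ₑ ∂ν ∂ν
        = ∫⁻ x, ‖v x‖ₑ * ∫⁻ y, ‖k y x‖ₑ * ‖u y‖ₑ ∂ν ∂ν := by
          refine lintegral_congr fun x => ?_
          rw [← lintegral_const_mul' _ _ enorm_ne_top]
          refine lintegral_congr fun y => ?_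
          rw [enorm_mul, enorm_mul, RCLike.enorm_conj]; ring
      -- A product is at most the sum of the squares; both squares are integrable, the second one by
      -- Schur's test for the transposed kernel.
      _ ≤ ∫⁻ x, (‖v x‖ₑ ^ 2 + (∫⁻ y, ‖k y x‖ₑ * ‖u y‖ₑ ∂ν) ^ 2) ∂ν := by
          refine lintegral_mono fun x => ?_
          rcases le_total ‖v x‖ₑ (∫⁻ y, ‖k y x‖ₑ * ‖u y‖ₑ ∂ν) with h | h
          · exact le_add_left (by rw [sq]; gcongr)
          · exact le_add_right (by rw [sq]; gcongr)
      _ = ∫⁻ x, ‖v x‖ₑ ^ 2 ∂ν + ∫⁻ x, (∫⁻ y, ‖k y x‖ₑ * ‖u y‖ₑ ∂ν) ^ 2 ∂ν :=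
          lintegral_add_left (hv.enorm.pow_const 2) _
      _ < ⊤ := ENNReal.add_lt_top.2 ⟨hfin v, (schur_lintegral (a := fun x y => ‖k y x‖ₑ)
          (hk.comp measurable_swap).enorm hu.enorm h2 h1).trans_lt
          (ENNReal.mul_lt_top (ENNReal.mul_lt_top ENNReal.ofReal_lt_top ENNReal.ofReal_lt_top) (hfin u))⟩
  have e1 : ∫ x, inner ℂ (T' u x) (v x) ∂ν =
      ∫ x, ∫ y, k y x * (v x * (starRingEnd ℂ) (u y)) ∂ν ∂ν := by
    refine integral_congr_ae ?_
    filter_upwards [hT' u] with x hx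
    rw [hx, RCLike.inner_apply, ← integral_conj, ← integral_const_mul]
    refine integral_congr_ae (Eventually.of_forall fun y => ?_)
    simp only [map_mul, Complex.conj_conj]
    ring
  have e2 : ∫ y, inner ℂ (u y) (T v y) ∂ν =
      ∫ y, ∫ x, k y x * (v x * (starRingEnd ℂ) (u y)) ∂ν ∂ν := by
    refine integral_congr_ae ?_
    filter_upwards [hT v] with y hy
    rw [hy, RCLike.inner_apply, ← integral_mul_const]
    refine integral_congr_ae (Eventually.of_forall fun x => ?_)
    simp only
    ring
  rw [e1, e2, integral_integral_swap hprod]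

/-- A measurable kernel which is bounded by `c` and vanishes outside `K × K`. -/
structure IsBddKernel (ν : Measure X) (k : X → X → ℂ) (c : ℝ) (K : Set X) : Prop where
  measurable : Measurable (Function.uncurry k)
  measurableSet : MeasurableSet K
  finite : ν K < ⊤
  nonneg : 0 ≤ c
  bound : ∀ x y, ‖k x y‖ ≤ c
  support : ∀ x y, k x y ≠ 0 → x ∈ K ∧ y ∈ K

namespace IsBddKernel

variable {k : X → X → ℂ} {c : ℝ} {K : Set X}

theorem enorm_le (h : IsBddKernel ν k c K) (x y : X) :
    ‖k x y‖ₑ ≤ K.indicator (fun _ => ENNReal.ofReal c) y := by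
  by_cases hy : y ∈ K
  · rw [indicator_of_mem hy, ← ofReal_norm]
    exact ENNReal.ofReal_le_ofReal (h.bound x y)
  · have : k x y = 0 := by
      by_contra h0
      exact hy (h.support x y h0).2
    simp [this]

theorem enorm_le' (h : IsBddKernel ν k c K) (x y : X) :
    ‖k x y‖ₑ ≤ K.indicator (fun _ => ENNReal.ofReal c) x := by
  by_cases hy : x ∈ K
  · rw [indicator_of_mem hy, ← ofReal_norm]
    exact ENNReal.ofReal_le_ofReal (h.bound x y)
  · have : k x y = 0 := by
      by_contra h0
      exact hy (h.support x y h0).1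
    simp [this]

theorem lintegral_le (h : IsBddKernel ν k c K) (x : X) :
    ∫⁻ y, ‖k x y‖ₑ ∂ν ≤ ENNReal.ofReal (c * ν.real K) := by
  refine (lintegral_mono fun y => h.enorm_le x y).trans ?_
  rw [lintegral_indicator_const h.measurableSet, ENNReal.ofReal_mul h.nonneg, Measure.real,
    ENNReal.ofReal_toReal h.finite.ne]

theorem lintegral_le' (h : IsBddKernel ν k c K) (y : X) :
    ∫⁻ x, ‖k x y‖ₑ ∂ν ≤ ENNReal.ofReal (c * ν.real K) := by
  refine (lintegral_mono fun x => h.enorm_le' x y).trans ?_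
  rw [lintegral_indicator_const h.measurableSet, ENNReal.ofReal_mul h.nonneg, Measure.real,
    ENNReal.ofReal_toReal h.finite.ne]

theorem mono (h : IsBddKernel ν k c K) {c' : ℝ} {K' : Set X} (hc : c ≤ c') (hK : K ⊆ K')
    (hm : MeasurableSet K') (hf : ν K' < ⊤) : IsBddKernel ν k c' K' :=
  ⟨h.measurable, hm, hf, h.nonneg.trans hc, fun x y => (h.bound x y).trans hc,
    fun x y hxy => ⟨hK (h.support x y hxy).1, hK (h.support x y hxy).2⟩⟩

theorem exists_op [SFinite ν] (h : IsBddKernel ν k c K) :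
    ∃ T : Lp ℂ 2 ν →L[ℂ] Lp ℂ 2 ν, IsKernelOp ν k T ∧ ‖T‖ ≤ c * ν.real K :=
  exists_isKernelOp h.measurable (mul_nonneg h.nonneg measureReal_nonneg)
    h.lintegral_le h.lintegral_le'

theorem norm_le [SFinite ν] (h : IsBddKernel ν k c K) {T : Lp ℂ 2 ν →L[ℂ] Lp ℂ 2 ν}
    (hT : IsKernelOp ν k T) : ‖T‖ ≤ c * ν.real K := by
  obtain ⟨T', hT', hn⟩ := h.exists_op
  rwa [hT.unique hT']

theorem integrable (h : IsBddKernel ν k c K) (u : Lp ℂ 2 ν) (x : X) :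
    Integrable (fun y => k x y * u y) ν := by
  have h1 : IntegrableOn (fun y => u y) K ν := by
    have : IsFiniteMeasure (ν.restrict K) := ⟨by simpa using h.finite⟩
    exact ((Lp.memLp u).restrict K).integrable (by norm_num)
  have h2 : Integrable (fun y => k x y * K.indicator u y) ν :=
    (h1.integrable_indicator h.measurableSet).bdd_mul (c := c)
      h.measurable.of_uncurry_left.aestronglyMeasurable (Eventually.of_forall (h.bound x))
  refine h2.congr (Eventually.of_forall fun y => ?_)
  by_cases hy : y ∈ K
  · simp [hy]
  · have : k x y = 0 := by
      by_contra h0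
      exact hy (h.support x y h0).2
    simp [this]

theorem sub {k' : X → X → ℂ} {c' : ℝ} (h : IsBddKernel ν k c K) (h' : IsBddKernel ν k' c' K)
    {T T' : Lp ℂ 2 ν →L[ℂ] Lp ℂ 2 ν} (hT : IsKernelOp ν k T) (hT' : IsKernelOp ν k' T') :
    IsKernelOp ν (fun x y => k x y - k' x y) (T - T') := by
  intro u
  rw [sub_apply]
  filter_upwards [Lp.coeFn_sub (T u) (T' u), hT u, hT' u] with x h1 h2 h3
  rw [h1, Pi.sub_apply, h2, h3, ← integral_sub (h.integrable u x) (h'.integrable u x)]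
  simp only [sub_mul]

end IsBddKernel

/-- Operators of finite rank are compact. -/
theorem isCompactOperator_sum_smulRight {ι : Type*} (s : Finset ι) {H : Type*}
    [NormedAddCommGroup H] [NormedSpace ℂ H] (ℓ : ι → H →L[ℂ] ℂ) (v : ι → H) :
    IsCompactOperator (∑ i ∈ s, (ℓ i).smulRight (v i) : H →L[ℂ] H) := by
  classical
  induction s using Finset.induction_on with
  | empty => simpa using isCompactOperator_zero
  | insert i s hi ih =>
    rw [Finset.sum_insert hi]
    refine IsCompactOperator.add ?_ ih
    have h1 : IsCompactOperator (ℓ i) :=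
      isCompactOperator_of_locallyCompactSpace_dom (ℓ i)
    exact h1.clm_comp (ContinuousLinearMap.toSpanSingleton ℂ (v i))

/-- Replacing `x` by the nearest of finitely many points makes the kernel piecewise constant in `x`,
hence the operator of finite rank. The error is a kernel that is uniformly small on `K × K`, so its
operator has small norm, and the compact operators are norm closed. -/
theorem IsBddKernel.isCompactOperator {X : Type*} [MeasurableSpace X] [PseudoMetricSpace X]
    [OpensMeasurableSpace X] [TopologicalSpace.SeparableSpace X] {ν : Measure X} [SFinite ν]
    {k : X → X → ℂ} {c : ℝ} {K : Set X} (h : IsBddKernel ν k c K) (hK : IsCompact K)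
    (huc : ∀ ε > 0, ∃ δ > 0, ∀ x x' y, dist x x' < δ → ‖k x y - k x' y‖ ≤ ε)
    {T : Lp ℂ 2 ν →L[ℂ] Lp ℂ 2 ν} (hT : IsKernelOp ν k T) : IsCompactOperator T := by
  classical
  rcases isEmpty_or_nonempty X with hX | hX
  · have : T = 0 := by
      ext1 u
      refine Lp.ext ?_
      have : ν = 0 := Measure.eq_zero_of_isEmpty ν
      subst this
      rw [Filter.EventuallyEq, ae_zero]
      exact eventually_bot
    rw [this]; exact isCompactOperator_zero
  have hcl : T ∈ closure {A : Lp ℂ 2 ν →L[ℂ] Lp ℂ 2 ν | IsCompactOperator A} := by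
    rw [Metric.mem_closure_iff]
    intro ε hε
    set V := ν.real K with hV
    have hV0 : 0 ≤ V := measureReal_nonneg
    obtain ⟨δ, hδ, hk⟩ := huc (ε / (2 * (V + 1))) (by positivity)
    let e := TopologicalSpace.denseSeq X
    have hcov : K ⊆ ⋃ i, Metric.ball (e i) δ := by
      intro x _
      obtain ⟨i, hi⟩ := (TopologicalSpace.denseRange_denseSeq X).exists_dist_lt x hδ
      exact mem_iUnion.2 ⟨i, hi⟩
    obtain ⟨t, ht⟩ := hK.elim_finite_subcover _ (fun i => Metric.isOpen_ball) hcov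
    -- The nearest point is sought among all indices up to the largest index of the finite cover, so
    -- it is at least as near as the centre of a covering ball.
    let φ := SimpleFunc.nearestPt e (t.sup id)
    have hφ : ∀ x ∈ K, dist x (φ x) < δ := by
      intro x hx
      obtain ⟨i, hi⟩ := mem_iUnion.1 (ht hx)
      obtain ⟨hit, hi⟩ := mem_iUnion.1 hi
      have h1 := SimpleFunc.edist_nearestPt_le e x (Finset.le_sup (f := id) hit)
      rw [edist_dist, edist_dist, ENNReal.ofReal_le_ofReal_iff dist_nonneg] at h1
      rw [dist_comm]
      refine h1.trans_lt ?_
      rw [dist_comm]; exact hi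
    have hmem : ∀ x, MemLp (fun y => (starRingEnd ℂ) (k x y)) 2 ν := fun x => by
      refine memLp_two_of_lintegral
        (Complex.continuous_conj.measurable.comp h.measurable.of_uncurry_left).aestronglyMeasurable
        (lt_of_le_of_lt (lintegral_mono (g := K.indicator fun _ => ENNReal.ofReal c ^ 2)
          fun y => ?_) ?_)
      · have h2 := h.enorm_le x y
        by_cases hy : y ∈ K
        · rw [indicator_of_mem hy] at h2 ⊢
          gcongr
          simpa using h2
        · rw [indicator_of_notMem hy] at h2 ⊢
          simpa using h2
      · rw [lintegral_indicator_const h.measurableSet]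
        exact ENNReal.mul_lt_top (by simp) h.finite
    have hind : ∀ z, MemLp ((φ ⁻¹' {z} ∩ K).indicator fun _ => (1 : ℂ)) 2 ν := fun z =>
      memLp_indicator_const 2 ((φ.measurableSet_fiber z).inter h.measurableSet) 1
        (Or.inr ((measure_mono inter_subset_right).trans_lt h.finite).ne)
    refine ⟨_, isCompactOperator_sum_smulRight φ.range
      (fun z => innerSL ℂ ((hmem z).toLp _)) (fun z => (hind z).toLp _), ?_⟩
    set k' : X → X → ℂ := fun x y => K.indicator (fun x => k (φ x) y) x with hk'
    have hk'm : Measurable (Function.uncurry k') := by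
      have : Function.uncurry k' = (K ×ˢ univ).indicator fun p => k (φ p.1) p.2 := by
        ext p
        by_cases hp : p.1 ∈ K <;> simp [hk', hp, Function.uncurry, indicator]
      rw [this]
      refine Measurable.indicator ?_ (h.measurableSet.prod MeasurableSet.univ)
      exact h.measurable.comp ((φ.measurable.comp measurable_fst).prodMk measurable_snd)
    have hb' : IsBddKernel ν k' c K := by
      refine ⟨hk'm, h.measurableSet, h.finite, h.nonneg, fun x y => ?_, fun x y hxy => ?_⟩
      · by_cases hx : x ∈ K
        · simpa [hk', hx] using h.bound _ _
        · simpa [hk', hx] using h.nonneg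
      · by_cases hx : x ∈ K
        · exact ⟨hx, (h.support _ _ (by simpa [hk', hx] using hxy)).2⟩
        · simp [hk', hx] at hxy
    have hT' : IsKernelOp ν k' (∑ z ∈ φ.range, (innerSL ℂ ((hmem z).toLp _)).smulRight
        ((hind z).toLp _)) := by
      intro u
      rw [sum_apply]
      have h1 : ∀ᵐ x ∂ν, ∀ z ∈ φ.range, ((hind z).toLp _ : Lp ℂ 2 ν) x =
          (φ ⁻¹' {z} ∩ K).indicator (fun _ => (1 : ℂ)) x := by
        rw [eventually_all_finset]
        exact fun z _ => MemLp.coeFn_toLp (hind z)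
      have h3 : ∀ᵐ x ∂ν, ∀ z ∈ φ.range, (((innerSL ℂ ((hmem z).toLp _)).smulRight
          ((hind z).toLp _ : Lp ℂ 2 ν)) u) x = (∫ y, k z y * u y ∂ν) *
          ((hind z).toLp _ : Lp ℂ 2 ν) x := by
        rw [eventually_all_finset]
        intro z _
        rw [ContinuousLinearMap.smulRight_apply]
        filter_upwards [Lp.coeFn_smul (innerSL ℂ ((hmem z).toLp _) u)
          ((hind z).toLp _ : Lp ℂ 2 ν)] with x hx
        rw [hx, Pi.smul_apply, smul_eq_mul, innerSL_apply_apply, L2.inner_def]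
        congr 1
        refine integral_congr_ae ?_
        filter_upwards [MemLp.coeFn_toLp (hmem z)] with y hy
        rw [hy, RCLike.inner_apply, Complex.conj_conj, mul_comm]
      filter_upwards [Lp.coeFn_fun_finsetSum φ.range (fun z => ((innerSL ℂ ((hmem z).toLp _)).smulRight
          ((hind z).toLp _ : Lp ℂ 2 ν)) u), h1, h3] with x h2 h1 h3
      rw [h2, Finset.sum_congr rfl h3,
        Finset.sum_eq_single (φ x)]
      · rw [h1 _ (φ.mem_range_self x)]
        by_cases hx : x ∈ K <;> simp [hk', hx, indicator]
      · intro z hz hzx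
        rw [h1 z hz, indicator_of_notMem, mul_zero]
        exact fun hcon => hzx hcon.1.symm
      · exact fun hcon => absurd (φ.mem_range_self x) hcon
    have hd : IsBddKernel ν (fun x y => k x y - k' x y) (ε / (2 * (V + 1))) K := by
      refine ⟨h.measurable.sub hk'm, h.measurableSet, h.finite, by positivity, fun x y => ?_,
        fun x y hxy => ?_⟩
      · by_cases hx : x ∈ K
        · simpa [hk', hx] using hk x (φ x) y (hφ x hx)
        · have : k x y = 0 := by
            by_contra h0
            exact hx (h.support x y h0).1
          simp only [hk', indicator_of_notMem hx, this, sub_zero, norm_zero]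
          positivity
      · by_cases h0 : k x y = 0
        · exact hb'.support x y (by simpa [h0] using hxy)
        · exact h.support x y h0
    rw [dist_eq_norm]
    refine (hd.norm_le (h.sub hb' hT hT')).trans_lt ?_
    rw [← hV, div_mul_eq_mul_div, div_lt_iff₀ (by positivity)]
    nlinarith
  rwa [isClosed_setOfPred_isCompactOperator.closure_eq] at hcl

end Kernel

/-! ## The model space: horizontal part, dilations, zooms -/

namespace Heis

variable {n : ℕ}

/-- The vertical unit vector. -/
noncomputable def e0 : Heis n := EuclideanSpace.single 0 1

/-- The vertical coordinate, as a continuous linear map. -/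
noncomputable def vert : Heis n →L[ℝ] ℝ := EuclideanSpace.proj 0

/-- The horizontal part, as a continuous linear map. -/
noncomputable def hor : Heis n →L[ℝ] Heis n :=
  ContinuousLinearMap.id ℝ _ - vert.smulRight e0

@[simp] theorem vert_apply (v : Heis n) : vert v = v 0 := rfl

theorem hor_apply (v : Heis n) : hor v = v - v 0 • e0 := rfl

@[simp] theorem e0_zero : (e0 : Heis n) 0 = 1 := by simp [e0]

@[simp] theorem hor_e0 : hor (e0 : Heis n) = 0 := by simp [hor_apply]

@[simp] theorem hor_zero_coord (v : Heis n) : hor v 0 = 0 := by simp [hor_apply]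

theorem hor_add_vert (v : Heis n) : hor v + v 0 • e0 = v := by simp [hor_apply]

@[simp] theorem hor_hor (v : Heis n) : hor (hor v) = hor v := by simp [hor_apply (hor v)]

theorem hor_coord (v : Heis n) {i : Fin (2 * n + 1)} (hi : i ≠ 0) : hor v i = v i := by
  simp [hor_apply, e0, hi]

theorem ext_hor {v w : Heis n} (h : hor v = hor w) (h0 : v 0 = w 0) : v = w := by
  rw [← hor_add_vert v, ← hor_add_vert w, h, h0]

theorem dil_eq (t : ℝ) (v : Heis n) : dil t v = t • hor v + (t ^ 2 * v 0) • e0 := by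
  ext i
  by_cases hi : i = 0
  · subst hi; simp [dil]
  · simp [dil, hi, hor_coord v hi, e0]

@[simp] theorem hor_dil (t : ℝ) (v : Heis n) : hor (dil t v) = t • hor v := by
  simp [dil_eq]

@[simp] theorem dil_zero_coord (t : ℝ) (v : Heis n) : dil t v 0 = t ^ 2 * v 0 := by
  simp [dil]

/-- The dilation as a continuous linear map. -/
noncomputable def dilL (t : ℝ) : Heis n →L[ℝ] Heis n := t • hor + t ^ 2 • vert.smulRight e0

theorem dilL_apply (t : ℝ) (v : Heis n) : dilL t v = dil t v := by
  simp [dilL, dil_eq, mul_smul]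

theorem dil_dil (s t : ℝ) (v : Heis n) : dil s (dil t v) = dil (s * t) v :=
  ext_hor (by simp [mul_smul]) (by simp; ring)

@[simp] theorem dil_one (v : Heis n) : dil 1 v = v := ext_hor (by simp) (by simp)

theorem continuous_dil : Continuous fun p : ℝ × Heis n => dil p.1 p.2 := by
  simp only [dil_eq]
  refine Continuous.add (continuous_fst.smul (hor.continuous.comp continuous_snd)) ?_
  exact ((continuous_fst.pow 2).mul (vert.continuous.comp continuous_snd)).smul continuous_const

theorem dil_neg (t : ℝ) (v : Heis n) : dil t (-v) = -dil t v :=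
  ext_hor (by simp) (by simp)

theorem det_dil (t : ℝ) : LinearMap.det ((dilL t : Heis n →L[ℝ] Heis n) : Heis n →ₗ[ℝ] Heis n) = t ^ (2 * n + 2) := by
  rw [← LinearMap.det_toMatrix (EuclideanSpace.basisFun (Fin (2 * n + 1)) ℝ).toBasis]
  have : LinearMap.toMatrix (EuclideanSpace.basisFun (Fin (2 * n + 1)) ℝ).toBasis
      (EuclideanSpace.basisFun (Fin (2 * n + 1)) ℝ).toBasis
      ((dilL t : Heis n →L[ℝ] Heis n) : Heis n →ₗ[ℝ] Heis n) =
      Matrix.diagonal (fun i : Fin (2 * n + 1) => if i = 0 then t ^ 2 else t) := by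
    ext i j
    rw [LinearMap.toMatrix_apply, Matrix.diagonal_apply]
    simp only [OrthonormalBasis.coe_toBasis, EuclideanSpace.basisFun_apply,
      OrthonormalBasis.coe_toBasis_repr_apply, EuclideanSpace.basisFun_repr,
      ContinuousLinearMap.coe_coe, dilL_apply, dil]
    by_cases hij : i = j
    · subst hij
      by_cases hi : i = 0
      · subst hi; simp
      · simp [hi]
    · simp only [hij, if_false]
      by_cases hi : i = 0
      · subst hi; simp [hij]
      · simp [hi, hij]
  rw [this, Matrix.det_diagonal, Fin.prod_univ_succ]
  simp [Fin.succ_ne_zero]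
  ring

theorem lintegral_dil {t : ℝ} (ht : 0 < t) (f : Heis n → ℝ≥0∞) :
    ENNReal.ofReal (t ^ (2 * n + 2)) * ∫⁻ v, f (dil t v) = ∫⁻ v, f v := by
  have hinj : Function.Injective (dil t : Heis n → Heis n) := fun v w h => by
    have := congrArg (dil t⁻¹) h
    simpa [dil_dil, inv_mul_cancel₀ ht.ne'] using this
  have hsurj : Function.Surjective (dil t : Heis n → Heis n) := fun v =>
    ⟨dil t⁻¹ v, by simp [dil_dil, mul_inv_cancel₀ ht.ne']⟩
  have h := lintegral_image_eq_lintegral_abs_det_fderiv_mul (volume : Measure (Heis n))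
    MeasurableSet.univ (f := dil t) (f' := fun _ => dilL t)
    (fun x _ => ((dilL t).hasFDerivAt.congr_of_eventuallyEq
      (Eventually.of_forall fun v => (dilL_apply t v).symm)).hasFDerivWithinAt) hinj.injOn f
  rw [image_univ, hsurj.range_eq, setLIntegral_univ, setLIntegral_univ] at h
  rw [h]
  have hd : (dilL t : Heis n →L[ℝ] Heis n).det = t ^ (2 * n + 2) := det_dil t
  simp only [hd, abs_of_pos (pow_pos ht _)]
  rw [lintegral_const_mul' _ _ ENNReal.ofReal_ne_top]

/-- Shears along the vertical direction preserve the measure. -/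
theorem lintegral_shear {c : Heis n → ℝ} (hc : Differentiable ℝ c)
    (h0 : ∀ v (s : ℝ), c (v + s • e0) = c v) (f : Heis n → ℝ≥0∞) :
    ∫⁻ v, f (v + c v • e0) = ∫⁻ v, f v := by
  have hinj : Function.Injective fun v : Heis n => v + c v • e0 := fun v w h => by
    have h1 := congrArg c h
    simp only [h0] at h1
    simp only [h1] at h
    exact add_right_cancel h
  have hsurj : Function.Surjective fun v : Heis n => v + c v • e0 := fun v =>
    ⟨v + (-c v) • e0, by
      change v + (-c v) • e0 + c (v + (-c v) • e0) • e0 = v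
      rw [h0, neg_smul, neg_add_cancel_right]⟩
  have h := lintegral_image_eq_lintegral_abs_det_fderiv_mul (volume : Measure (Heis n))
    MeasurableSet.univ (f := fun v : Heis n => v + c v • e0)
    (f' := fun v => ContinuousLinearMap.id ℝ _ + (fderiv ℝ c v).smulRight e0)
    (fun x _ => ((hasFDerivAt_id x).add
      ((hc x).hasFDerivAt.smul_const e0)).hasFDerivWithinAt) hinj.injOn f
  rw [image_univ, hsurj.range_eq, setLIntegral_univ, setLIntegral_univ] at h
  rw [h]
  refine lintegral_congr fun v => ?_
  have h1 : fderiv ℝ c v e0 = 0 := by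
    have h2 : HasDerivAt (fun s : ℝ => c (v + s • e0)) (fderiv ℝ c v e0) 0 := by
      have h3 : HasDerivAt (fun s : ℝ => v + s • (e0 : Heis n)) e0 0 := by
        simpa using ((hasDerivAt_id (0 : ℝ)).smul_const (e0 : Heis n)).const_add v
      have h4 : HasFDerivAt c (fderiv ℝ c v) (v + (0 : ℝ) • e0) := by
        simpa using (hc v).hasFDerivAt
      exact h4.comp_hasDerivAt (0 : ℝ) h3
    simp only [h0] at h2
    exact h2.unique (hasDerivAt_const _ _)
  -- The derivative of a shear is a transvection along `e0`, because `c` does not change in the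
  -- direction `e0`.
  have hd : (ContinuousLinearMap.id ℝ (Heis n) + (fderiv ℝ c v).smulRight e0).det = 1 := by
    have := LinearMap.transvection.det (fderiv ℝ c v : Heis n →ₗ[ℝ] ℝ) (e0 : Heis n)
    have h5 : ((ContinuousLinearMap.id ℝ (Heis n) + (fderiv ℝ c v).smulRight e0 :
        Heis n →L[ℝ] Heis n) : Heis n →ₗ[ℝ] Heis n) =
        LinearMap.transvection (fderiv ℝ c v : Heis n →ₗ[ℝ] ℝ) (e0 : Heis n) := by
      ext1 w; rfl
    rw [ContinuousLinearMap.det, h5, this]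
    simp [h1]
  rw [hd]; simp

/-- The parabolic box of size `R`. -/
def box (n : ℕ) (R : ℝ) : Set (Heis n) := {v | ‖hor v‖ < R ∧ |v 0| < R ^ 2}

theorem isOpen_box (R : ℝ) : IsOpen (box n R) :=
  (isOpen_lt hor.continuous.norm continuous_const).inter
    (isOpen_lt vert.continuous.abs continuous_const)

theorem norm_le_hor_add (v : Heis n) : ‖v‖ ≤ ‖hor v‖ + |v 0| := by
  nth_rewrite 1 [← hor_add_vert v]
  refine (norm_add_le _ _).trans (add_le_add le_rfl ?_)
  rw [norm_smul, e0]
  simp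

theorem abs_coord_le (v : Heis n) : |v 0| ≤ ‖v‖ := PiLp.norm_apply_le v 0

theorem norm_hor_le (v : Heis n) : ‖hor v‖ ≤ 2 * ‖v‖ := by
  rw [hor_apply]
  refine (norm_sub_le _ _).trans ?_
  rw [norm_smul, e0]
  simp only [PiLp.norm_single, norm_one, mul_one, Real.norm_eq_abs]
  linarith [abs_coord_le v]

theorem box_subset_ball (R : ℝ) : box n R ⊆ Metric.ball 0 (R + R ^ 2) := fun v hv => by
  rw [Metric.mem_ball, dist_zero_right]
  exact (norm_le_hor_add v).trans_lt (add_lt_add hv.1 hv.2)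

theorem volume_box_lt_top (R : ℝ) : volume (box n R) < ⊤ :=
  (measure_mono (box_subset_ball R)).trans_lt measure_ball_lt_top

theorem dil_mem_box {t R : ℝ} (ht : 0 < t) (v : Heis n) : dil t v ∈ box n (t * R) ↔ v ∈ box n R := by
  change ‖hor (dil t v)‖ < t * R ∧ |dil t v 0| < (t * R) ^ 2 ↔ ‖hor v‖ < R ∧ |v 0| < R ^ 2
  simp only [hor_dil, norm_smul, Real.norm_of_nonneg ht.le, dil_zero_coord,
    abs_mul, abs_pow, abs_of_pos ht, mul_pow]
  rw [mul_lt_mul_iff_right₀ ht, mul_lt_mul_iff_right₀ (pow_pos ht 2)]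

theorem volume_box {R : ℝ} (hR : 0 < R) :
    volume (box n R) = ENNReal.ofReal (R ^ (2 * n + 2)) * volume (box n 1) := by
  rw [← lintegral_indicator_one (isOpen_box R).measurableSet, ← lintegral_dil hR,
    ← lintegral_indicator_one (isOpen_box 1).measurableSet]
  congr 1
  refine lintegral_congr fun v => ?_
  have := dil_mem_box (R := 1) hR v
  rw [mul_one] at this
  by_cases hv : v ∈ box n 1
  · rw [indicator_of_mem hv, indicator_of_mem (this.2 hv)]; rfl
  · rw [indicator_of_notMem hv, indicator_of_notMem (fun h => hv (this.1 h))]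

theorem volume_box_pos {R : ℝ} (hR : 0 < R) : 0 < volume (box n R) :=
  (isOpen_box R).measure_pos _ ⟨0, by simp [box, hR]⟩

end Heis

/-- A continuously differentiable 1-form on the model space which is `1` on the vertical vector, with a growth
condition. -/
structure TransverseForm (n : ℕ) where
  form : Heis n → Heis n →L[ℝ] ℝ
  contDiff : ContDiff ℝ 1 form
  apply_e0 : ∀ x, form x Heis.e0 = 1
  growth : ∃ C, ∀ x, ‖form x‖ ≤ C * (1 + ‖Heis.hor x‖)

/-! ### Transverse forms: horizontal lifts, rescaled coordinates, osculating group laws. -/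

namespace TransverseForm

open Heis

variable {n : ℕ} (θ : TransverseForm n)

theorem apply_eq (b v : Heis n) : θ.form b v = v 0 + θ.form b (hor v) := by
  nth_rewrite 1 [← hor_add_vert v]
  rw [map_add, map_smul, θ.apply_e0]; simp [add_comm]

theorem differentiable : Differentiable ℝ θ.form := θ.contDiff.differentiable (by simp)

/-- The horizontal lift. -/
noncomputable def lift (b : Heis n) : Heis n →L[ℝ] Heis n :=
  hor - ((θ.form b).comp hor).smulRight e0

theorem lift_apply (b v : Heis n) : θ.lift b v = hor v - θ.form b (hor v) • e0 := rfl

@[simp] theorem hor_lift (b v : Heis n) : hor (θ.lift b v) = hor v := by simp [lift_apply]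

@[simp] theorem form_lift (b v : Heis n) : θ.form b (θ.lift b v) = 0 := by
  simp [lift_apply, θ.apply_e0]

@[simp] theorem lift_hor (b v : Heis n) : θ.lift b (hor v) = θ.lift b v := by simp [lift_apply]

@[simp] theorem lift_e0 (b : Heis n) : θ.lift b e0 = 0 := by simp [lift_apply]

theorem lift_of_form_eq_zero {b v : Heis n} (h : θ.form b v = 0) : θ.lift b v = v := by
  rw [θ.apply_eq] at h
  rw [lift_apply, eq_neg_of_add_eq_zero_right h, neg_smul, sub_neg_eq_add, hor_add_vert]

/-- The quadratic correction term. -/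
noncomputable def quad (b v : Heis n) : ℝ := fderiv ℝ θ.form b (θ.lift b v) (θ.lift b v)

theorem quad_smul (b v : Heis n) (s : ℝ) : θ.quad b (s • v) = s ^ 2 * θ.quad b v := by
  simp [quad]; ring

@[simp] theorem quad_hor (b v : Heis n) : θ.quad b (hor v) = θ.quad b v := by simp [quad]

/-- The coordinates at scale `1/t` at the point `b`. -/
noncomputable def zoom (b : Heis n) (t : ℝ) (ξ : Heis n) : Heis n :=
  b + t⁻¹ • θ.lift b ξ + (t⁻¹ ^ 2 * (ξ 0 - 1 / 2 * θ.quad b ξ)) • e0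

/-- The inverse of `zoom`. -/
noncomputable def unzoom (b : Heis n) (t : ℝ) (y : Heis n) : Heis n :=
  t • hor (y - b) + (t ^ 2 * (θ.form b (y - b) + 1 / 2 * θ.quad b (y - b))) • e0

theorem unzoom_zoom (b : Heis n) {t : ℝ} (ht : t ≠ 0) (ξ : Heis n) :
    θ.unzoom b t (θ.zoom b t ξ) = ξ := by
  have h0 : θ.zoom b t ξ - b = t⁻¹ • θ.lift b ξ + (t⁻¹ ^ 2 * (ξ 0 - 1 / 2 * θ.quad b ξ)) • e0 := by
    rw [zoom]; abel
  have h1 : hor (θ.zoom b t ξ - b) = t⁻¹ • hor ξ := by simp [h0]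
  have h2 : θ.quad b (θ.zoom b t ξ - b) = t⁻¹ ^ 2 * θ.quad b ξ := by
    rw [← quad_hor, h1, quad_smul, quad_hor]
  have h3 : θ.form b (θ.zoom b t ξ - b) = t⁻¹ ^ 2 * (ξ 0 - 1 / 2 * θ.quad b ξ) := by
    simp [h0, θ.apply_e0]
  rw [unzoom, h1, h2, h3, smul_smul, mul_inv_cancel₀ ht, one_smul]
  have h4 : t ^ 2 * (t⁻¹ ^ 2 * (ξ 0 - 1 / 2 * θ.quad b ξ) + 1 / 2 * (t⁻¹ ^ 2 * θ.quad b ξ)) = ξ 0 := by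
    field_simp; ring
  rw [h4, hor_add_vert]

theorem continuous_form_apply : Continuous fun p : Heis n × Heis n => θ.form p.1 p.2 :=
  (θ.contDiff.continuous.comp continuous_fst).clm_apply continuous_snd

theorem continuous_lift : Continuous fun p : Heis n × Heis n => θ.lift p.1 p.2 := by
  simp only [lift_apply]
  exact (hor.continuous.comp continuous_snd).sub
    ((θ.continuous_form_apply.comp (continuous_fst.prodMk (hor.continuous.comp continuous_snd))).smul
      continuous_const)

theorem continuous_fderiv : Continuous (fderiv ℝ θ.form) := θ.contDiff.continuous_fderiv (by simp)

theorem continuous_quad : Continuous fun p : Heis n × Heis n => θ.quad p.1 p.2 :=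
  ((θ.continuous_fderiv.comp continuous_fst).clm_apply θ.continuous_lift).clm_apply θ.continuous_lift

theorem continuous_zoom (b : Heis n) (t : ℝ) : Continuous (θ.zoom b t) := by
  have h1 : Continuous (θ.quad b) := θ.continuous_quad.comp (Continuous.prodMk_right b)
  have h2 : Continuous fun ξ : Heis n => ξ 0 := vert.continuous
  unfold zoom
  fun_prop

/-- `zoom` is composed of a translation, two vertical shears and the dilation by `t⁻¹`; only the
dilation changes the volume, by `t^(-(2n+2))`. -/
theorem lintegral_zoom (b : Heis n) {t : ℝ} (ht : 0 < t) (f : Heis n → ℝ≥0∞) :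
    ∫⁻ ξ, f (θ.zoom b t ξ) = ENNReal.ofReal (t ^ (2 * n + 2)) * ∫⁻ y, f y := by
  have hq : Differentiable ℝ (θ.quad b) := by
    have : θ.quad b = fun v => fderiv ℝ θ.form b (θ.lift b v) (θ.lift b v) := rfl
    rw [this]; fun_prop
  conv_rhs => rw [← lintegral_add_left_eq_self f b,
    ← lintegral_shear (c := fun v => -θ.form b (hor v)) (by fun_prop) (by simp),
    ← lintegral_dil (inv_pos.2 ht), ← mul_assoc, ← ENNReal.ofReal_mul (by positivity), inv_pow,
    mul_inv_cancel₀ (by positivity), ENNReal.ofReal_one, one_mul,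
    ← lintegral_shear (c := fun v => -(1 / 2 * θ.quad b v)) (by fun_prop)
      (fun v s => by simp only [quad, map_add, map_smul, lift_e0, smul_zero, add_zero])]
  refine lintegral_congr fun ξ => congrArg f (ext_hor ?_ ?_)
  · simp [zoom]
  · simp [zoom, lift_apply]
    ring

/-- The coordinate of the difference of two points with respect to the form at the midpoint. -/
noncomputable def diff (x y : Heis n) : Heis n :=
  hor (x - y) + θ.form ((1 / 2 : ℝ) • (x + y)) (x - y) • e0

@[simp] theorem hor_diff (x y : Heis n) : hor (θ.diff x y) = hor (x - y) := by simp [diff]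

@[simp] theorem diff_zero_coord (x y : Heis n) :
    θ.diff x y 0 = θ.form ((1 / 2 : ℝ) • (x + y)) (x - y) := by simp [diff]

/-- This is the benefit of evaluating the form at the midpoint: the adjoint of an operator with
kernel `β(x, y, δ_t(diff x y))` has a kernel of the same kind. -/
theorem diff_swap (x y : Heis n) : θ.diff y x = -θ.diff x y := by
  rw [diff, diff, add_comm y x, ← neg_sub x y]
  simp only [map_neg, neg_smul]; abel

theorem continuous_diff : Continuous fun p : Heis n × Heis n => θ.diff p.1 p.2 := by
  unfold diff
  have := θ.continuous_form_apply.comp (f := fun p : Heis n × Heis n =>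
    ((1 / 2 : ℝ) • (p.1 + p.2), p.1 - p.2)) (by fun_prop)
  exact Continuous.add (by fun_prop) (this.smul continuous_const)

/-- The group law of the osculating group at `b`. -/
noncomputable def mulAt (b z w : Heis n) : Heis n :=
  z + w + (1 / 2 * (fderiv ℝ θ.form b (θ.lift b z) (θ.lift b w) -
    fderiv ℝ θ.form b (θ.lift b w) (θ.lift b z))) • e0

theorem continuous_mulAt :
    Continuous fun p : Heis n × Heis n × Heis n => θ.mulAt p.1 p.2.1 p.2.2 := by
  have h1 : Continuous fun p : Heis n × Heis n × Heis n => θ.lift p.1 p.2.1 :=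
    θ.continuous_lift.comp (f := fun p : Heis n × Heis n × Heis n => (p.1, p.2.1)) (by fun_prop)
  have h2 : Continuous fun p : Heis n × Heis n × Heis n => θ.lift p.1 p.2.2 :=
    θ.continuous_lift.comp (f := fun p : Heis n × Heis n × Heis n => (p.1, p.2.2)) (by fun_prop)
  have h3 := θ.continuous_fderiv
  unfold mulAt
  fun_prop

theorem mulAt_neg_hor (b z w : Heis n) : hor (θ.mulAt b z (-w)) = hor (z - w) := by
  simp [mulAt, sub_eq_add_neg]

theorem mulAt_neg_zero (b z w : Heis n) : θ.mulAt b z (-w) 0 = z 0 - w 0 -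
    1 / 2 * (fderiv ℝ θ.form b (θ.lift b z) (θ.lift b w) -
    fderiv ℝ θ.form b (θ.lift b w) (θ.lift b z)) := by
  simp [mulAt]; ring

theorem mulAt_neg_swap (b z w : Heis n) : θ.mulAt b w (-z) = -θ.mulAt b z (-w) := by
  refine ext_hor ?_ ?_
  · simp only [map_neg, mulAt_neg_hor, map_sub, neg_sub]
  · rw [mulAt_neg_zero, PiLp.neg_apply, mulAt_neg_zero]; ring

/-- For fixed `z` the map `w ↦ z w⁻¹` is a reflection followed by a translation and a vertical
shear, so Lebesgue measure is a two-sided Haar measure. -/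
theorem lintegral_mulAt_neg (b z : Heis n) (f : Heis n → ℝ≥0∞) :
    ∫⁻ w, f (θ.mulAt b z (-w)) = ∫⁻ w, f w := by
  conv_rhs => rw [← lintegral_add_left_eq_self f z, ← lintegral_neg_eq_self (fun w => f (z + w)),
    ← lintegral_shear (c := fun w => 1 / 2 * (fderiv ℝ θ.form b (θ.lift b z) (θ.lift b w) -
    fderiv ℝ θ.form b (θ.lift b w) (θ.lift b z))) (by fun_prop) (by simp)]
  refine lintegral_congr fun w => congrArg f (ext_hor ?_ ?_)
  · rw [mulAt_neg_hor]; simp [sub_eq_add_neg]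
  · rw [mulAt_neg_zero]; simp; ring

end TransverseForm

attribute [irreducible] Heis.hor Heis.e0 TransverseForm.lift TransverseForm.quad
  TransverseForm.zoom TransverseForm.unzoom TransverseForm.diff TransverseForm.mulAt

/-! ## Limits in zoomed coordinates -/

section Strict

variable {E F : Type*} [NormedAddCommGroup E] [NormedSpace ℝ E] [NormedAddCommGroup F]
  [NormedSpace ℝ F] {ι : Type*} {l : Filter ι}

/-- `T r = o(T x)`, and `T x` is bounded since it converges. -/
theorem tendsto_smul_zero_of_isLittleO {T : ι → ℝ} {x : ι → E} {r : ι → F} {w : E}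
    (h : r =o[l] x) (hw : Tendsto (fun i => T i • x i) l (𝓝 w)) :
    Tendsto (fun i => T i • r i) l (𝓝 0) := by
  have h1 := (Asymptotics.isBigO_refl T l).smul_isLittleO h
  exact (Asymptotics.isLittleO_one_iff ℝ).1 (h1.trans_isBigO (hw.isBigO_one ℝ))

theorem tendsto_clm_apply {L : ι → E →L[ℝ] F} {L₀ : E →L[ℝ] F} {x : ι → E} {x₀ : E}
    (hL : Tendsto L l (𝓝 L₀)) (hx : Tendsto x l (𝓝 x₀)) :
    Tendsto (fun i => L i (x i)) l (𝓝 (L₀ x₀)) := by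
  have h := (isBoundedBilinearMap_apply (𝕜 := ℝ) (E := E) (F := F)).continuous.tendsto (L₀, x₀)
  have h2 := h.comp (hL.prodMk_nhds hx)
  exact h2

theorem HasStrictFDerivAt.tendsto_smul_sub {f : E → F} {f' : E →L[ℝ] F} {b₀ : E}
    (hf : HasStrictFDerivAt f f' b₀) {T : ι → ℝ} {x y : ι → E} {w : E}
    (hx : Tendsto x l (𝓝 b₀)) (hy : Tendsto y l (𝓝 b₀))
    (hw : Tendsto (fun i => T i • (x i - y i)) l (𝓝 w)) :
    Tendsto (fun i => T i • (f (x i) - f (y i))) l (𝓝 (f' w)) := by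
  have h1 := tendsto_smul_zero_of_isLittleO
    (hf.isLittleO.comp_tendsto (hx.prodMk_nhds hy)) hw
  have h2 := h1.add ((f'.continuous.tendsto w).comp hw)
  rw [zero_add] at h2
  refine h2.congr fun i => ?_
  simp only [Function.comp, map_smul, smul_sub, map_sub]
  abel

/-- The midpoint rule is exact to second order. With `m` the midpoint and `h` half the difference,
`σ(m + s h) - σ(m - s h) - 2 s Dσ(m) h` vanishes at `s = 0`; its derivative in `s` is estimated and
the mean value inequality is applied. No third derivative is needed, only strict differentiability
of `Dσ`. -/
theorem isLittleO_midpoint {σ : E → F} {b₀ : E} (hσ : ContDiffAt ℝ 2 σ b₀) :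
    (fun p : E × E => σ p.1 - σ p.2 - fderiv ℝ σ ((1 / 2 : ℝ) • (p.1 + p.2)) (p.1 - p.2))
      =o[𝓝 (b₀, b₀)] fun p => ‖p.1 - p.2‖ ^ 2 := by
  rw [Asymptotics.isLittleO_iff]
  intro ε hε
  have hd : HasStrictFDerivAt (fderiv ℝ σ) (fderiv ℝ (fderiv ℝ σ) b₀) b₀ :=
    (hσ.fderiv_right (m := 1) (by norm_num)).hasStrictFDerivAt (by norm_num)
  have h1 := hd.isLittleO.def hε
  have h2 : ∀ᶠ x in 𝓝 b₀, DifferentiableAt ℝ σ x :=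
    (hσ.eventually (by norm_num)).mono fun x hx => hx.differentiableAt (by norm_num)
  rw [nhds_prod_eq, eventually_prod_self_iff' ] at h1
  obtain ⟨t, ht, h1⟩ := h1
  obtain ⟨δ, hδ, hball⟩ := Metric.mem_nhds_iff.1 (inter_mem ht h2)
  have hmem : ∀ᶠ p : E × E in 𝓝 (b₀, b₀), p.1 ∈ Metric.ball b₀ δ ∧ p.2 ∈ Metric.ball b₀ δ := by
    rw [nhds_prod_eq]
    exact prod_mem_prod (Metric.ball_mem_nhds b₀ hδ) (Metric.ball_mem_nhds b₀ hδ)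
  filter_upwards [hmem] with ⟨x, y⟩ ⟨hx, hy⟩
  simp only at hx hy ⊢
  set m := (1 / 2 : ℝ) • (x + y) with hm
  set h := (1 / 2 : ℝ) • (x - y) with hh
  have exm : m + h = x := by rw [hm, hh]; module
  have eym : m - h = y := by rw [hm, hh]; module
  have hcx : ∀ s ∈ Icc (0 : ℝ) 1, m + s • h ∈ Metric.ball b₀ δ ∧ m - s • h ∈ Metric.ball b₀ δ := by
    intro s hs
    have hc := convex_ball b₀ δ
    have e1 : m + s • h = ((1 + s) / 2) • x + ((1 - s) / 2) • y := by rw [hm, hh]; module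
    have e2 : m - s • h = ((1 - s) / 2) • x + ((1 + s) / 2) • y := by rw [hm, hh]; module
    rw [e1, e2]
    constructor
    · exact hc hx hy (by linarith [hs.1]) (by linarith [hs.2]) (by ring)
    · exact hc hx hy (by linarith [hs.2]) (by linarith [hs.1]) (by ring)
  have hmb : m ∈ Metric.ball b₀ δ := by simpa using (hcx 0 ⟨le_rfl, zero_le_one⟩).1
  have hder : ∀ s ∈ Icc (0 : ℝ) 1, HasDerivWithinAt
      (fun s : ℝ => σ (m + s • h) - σ (m - s • h) - (2 * s) • fderiv ℝ σ m h)
      (fderiv ℝ σ (m + s • h) h + fderiv ℝ σ (m - s • h) h - (2 : ℝ) • fderiv ℝ σ m h)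
      (Icc 0 1) s := by
    intro s hs
    have hp : DifferentiableAt ℝ σ (m + s • h) := (hball (hcx s hs).1).2
    have hq : DifferentiableAt ℝ σ (m - s • h) := (hball (hcx s hs).2).2
    have d1 : HasDerivAt (fun s : ℝ => m + s • h) h s := by
      simpa using ((hasDerivAt_id s).smul_const h).const_add m
    have d2 : HasDerivAt (fun s : ℝ => m - s • h) (-h) s := by
      simpa using ((hasDerivAt_id s).smul_const h).const_sub m
    have d3 := hp.hasFDerivAt.comp_hasDerivAt s d1
    have d4 := hq.hasFDerivAt.comp_hasDerivAt s d2
    have d5 : HasDerivAt (fun s : ℝ => (2 * s) • fderiv ℝ σ m h) ((2 : ℝ) • fderiv ℝ σ m h) s := by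
      simpa using ((hasDerivAt_id s).const_mul (2 : ℝ)).smul_const (fderiv ℝ σ m h)
    have := (d3.sub d4).sub d5
    simp only [map_neg, sub_neg_eq_add] at this
    exact this.hasDerivWithinAt
  have hbd : ∀ s ∈ Icc (0 : ℝ) 1,
      ‖fderiv ℝ σ (m + s • h) h + fderiv ℝ σ (m - s • h) h - (2 : ℝ) • fderiv ℝ σ m h‖ ≤
        2 * ε * ‖h‖ ^ 2 := by
    intro s hs
    have i1 := h1 _ (hball (hcx s hs).1).1 _ (hball hmb).1
    have i2 := h1 _ (hball (hcx s hs).2).1 _ (hball hmb).1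
    simp only [add_sub_cancel_left] at i1
    have e3 : m - s • h - m = -(s • h) := by abel
    simp only [e3, map_neg, norm_neg] at i2
    have hsn : ‖s • h‖ ≤ ‖h‖ := by
      rw [norm_smul, Real.norm_of_nonneg hs.1]
      exact mul_le_of_le_one_left (norm_nonneg _) hs.2
    set D := fderiv ℝ (fderiv ℝ σ) b₀ (s • h) with hD
    -- The first order terms at `m + s h` and `m - s h` are `D` and `-D`, and they cancel.
    have e4 : fderiv ℝ σ (m + s • h) h + fderiv ℝ σ (m - s • h) h - (2 : ℝ) • fderiv ℝ σ m h =
        ((fderiv ℝ σ (m + s • h) - fderiv ℝ σ m - D) +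
        (fderiv ℝ σ (m - s • h) - fderiv ℝ σ m - -D)) h := by
      simp [two_smul]; abel
    rw [e4]
    refine (ContinuousLinearMap.le_opNorm _ _).trans ?_
    have i3 := norm_add_le (fderiv ℝ σ (m + s • h) - fderiv ℝ σ m - D)
        (fderiv ℝ σ (m - s • h) - fderiv ℝ σ m - -D)
    have i4 : ε * ‖s • h‖ ≤ ε * ‖h‖ := by gcongr
    calc _ ≤ (ε * ‖h‖ + ε * ‖h‖) * ‖h‖ := by gcongr; linarith
      _ = _ := by ring
  have hmv := (convex_Icc (0 : ℝ) 1).norm_image_sub_le_of_norm_hasDerivWithin_le hder hbd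
    (left_mem_Icc.2 zero_le_one) (right_mem_Icc.2 zero_le_one)
  simp only [one_smul, zero_smul, add_zero, sub_zero, exm, eym, mul_one, mul_zero, sub_self,
    norm_one] at hmv
  have e5 : (2 : ℝ) • fderiv ℝ σ m h = fderiv ℝ σ m (x - y) := by
    rw [← map_smul, hh, smul_smul]; norm_num
  rw [e5] at hmv
  refine hmv.trans ?_
  rw [hh, norm_smul, Real.norm_of_nonneg (by norm_num), norm_pow, norm_norm]
  nlinarith [sq_nonneg ‖x - y‖]

end Strict

namespace TransverseForm

open Heis

variable {n : ℕ} {ι : Type*} {l : Filter ι} (θ : TransverseForm n)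

theorem hasStrictFDerivAt (b : Heis n) : HasStrictFDerivAt θ.form (fderiv ℝ θ.form b) b :=
  θ.contDiff.contDiffAt.hasStrictFDerivAt (by simp)

section Zoom

variable {T : ι → ℝ} {b ξ η : ι → Heis n} {b₀ ξ₀ η₀ : Heis n}

theorem tendsto_smul_zoom_sub (hT : Tendsto T l atTop) (hb : Tendsto b l (𝓝 b₀))
    (hξ : Tendsto ξ l (𝓝 ξ₀)) :
    Tendsto (fun i => T i • (θ.zoom (b i) (T i) (ξ i) - b i)) l (𝓝 (θ.lift b₀ ξ₀)) := by
  have h0 : Tendsto (fun i => (T i)⁻¹) l (𝓝 0) := tendsto_inv_atTop_zero.comp hT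
  have h1 : Tendsto (fun i => θ.lift (b i) (ξ i)) l (𝓝 (θ.lift b₀ ξ₀)) :=
    (θ.continuous_lift.tendsto (b₀, ξ₀)).comp (hb.prodMk_nhds hξ)
  have h2 : Tendsto (fun i => θ.quad (b i) (ξ i)) l (𝓝 (θ.quad b₀ ξ₀)) :=
    (θ.continuous_quad.tendsto (b₀, ξ₀)).comp (hb.prodMk_nhds hξ)
  have h3 : Tendsto (fun i => ξ i 0) l (𝓝 (ξ₀ 0)) := (vert.continuous.tendsto ξ₀).comp hξ
  have h4 := h1.add ((h0.mul (h3.sub (h2.const_mul (1 / 2)))).smul_const (e0 : Heis n))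
  simp only [zero_mul, zero_smul, add_zero] at h4
  refine h4.congr' ?_
  filter_upwards [hT.eventually_gt_atTop 0] with i hi
  rw [zoom, add_assoc, add_sub_cancel_left, smul_add, smul_smul, smul_smul, mul_inv_cancel₀ hi.ne',
    one_smul]
  congr 2
  field_simp

theorem tendsto_zoom (hT : Tendsto T l atTop) (hb : Tendsto b l (𝓝 b₀))
    (hξ : Tendsto ξ l (𝓝 ξ₀)) : Tendsto (fun i => θ.zoom (b i) (T i) (ξ i)) l (𝓝 b₀) := by
  have h0 : Tendsto (fun i => (T i)⁻¹) l (𝓝 0) := tendsto_inv_atTop_zero.comp hT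
  have h1 := (h0.smul (θ.tendsto_smul_zoom_sub hT hb hξ)).add hb
  rw [zero_smul, zero_add] at h1
  refine h1.congr' ?_
  filter_upwards [hT.eventually_gt_atTop 0] with i hi
  rw [smul_smul, inv_mul_cancel₀ hi.ne', one_smul, sub_add_cancel]

theorem tendsto_smul_zoom_sub_zoom (hT : Tendsto T l atTop) (hb : Tendsto b l (𝓝 b₀))
    (hξ : Tendsto ξ l (𝓝 ξ₀)) (hη : Tendsto η l (𝓝 η₀)) :
    Tendsto (fun i => T i • (θ.zoom (b i) (T i) (ξ i) - θ.zoom (b i) (T i) (η i))) l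
      (𝓝 (θ.lift b₀ (ξ₀ - η₀))) := by
  have h := (θ.tendsto_smul_zoom_sub hT hb hξ).sub (θ.tendsto_smul_zoom_sub hT hb hη)
  rw [← map_sub] at h
  refine h.congr fun i => ?_
  rw [← smul_sub]; congr 1; abel

/-- Replace the form at the midpoint by its first order expansion at `b`. With `u`, `v` the lifts of
`ξ₀`, `η₀` this adds `½ Dθ(u + v)(u - v)` to `ξ₀ 0 - η₀ 0`. Its symmetric part `½ (Dθ(u)(u) -
Dθ(v)(v))` is cancelled by the terms `quad` in `zoom`, and the antisymmetric part that remains is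
the cocycle of the osculating group. -/
theorem tendsto_form_zoom (hT : Tendsto T l atTop) (hb : Tendsto b l (𝓝 b₀))
    (hξ : Tendsto ξ l (𝓝 ξ₀)) (hη : Tendsto η l (𝓝 η₀)) :
    Tendsto (fun i => T i ^ 2 * θ.form ((1 / 2 : ℝ) • (θ.zoom (b i) (T i) (ξ i) +
      θ.zoom (b i) (T i) (η i))) (θ.zoom (b i) (T i) (ξ i) - θ.zoom (b i) (T i) (η i))) l
      (𝓝 (θ.mulAt b₀ ξ₀ (-η₀) 0)) := by
  set x := fun i => θ.zoom (b i) (T i) (ξ i) with hx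
  set y := fun i => θ.zoom (b i) (T i) (η i) with hy
  have hxl := θ.tendsto_zoom hT hb hξ
  have hyl := θ.tendsto_zoom hT hb hη
  have hm : Tendsto (fun i => (1 / 2 : ℝ) • (x i + y i)) l (𝓝 b₀) := by
    have := (hxl.add hyl).const_smul (1 / 2 : ℝ)
    rwa [← two_smul ℝ b₀, smul_smul, show (1 / 2 : ℝ) * 2 = 1 by norm_num, one_smul] at this
  have hmT : Tendsto (fun i => T i • ((1 / 2 : ℝ) • (x i + y i) - b i)) l
      (𝓝 ((1 / 2 : ℝ) • θ.lift b₀ (ξ₀ + η₀))) := by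
    have := ((θ.tendsto_smul_zoom_sub hT hb hξ).add
      (θ.tendsto_smul_zoom_sub hT hb hη)).const_smul (1 / 2 : ℝ)
    rw [← map_add] at this
    refine this.congr fun i => ?_
    simp only [hx, hy]; module
  have hθ := (θ.hasStrictFDerivAt b₀).tendsto_smul_sub hm hb hmT
  have hlift : Tendsto (fun i => θ.lift (b i) (ξ i - η i)) l (𝓝 (θ.lift b₀ (ξ₀ - η₀))) :=
    (θ.continuous_lift.tendsto (b₀, ξ₀ - η₀)).comp (hb.prodMk_nhds (hξ.sub hη))
  have h1 := tendsto_clm_apply hθ hlift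
  have h2 : Tendsto (fun i => ξ i 0 - η i 0 - 1 / 2 * (θ.quad (b i) (ξ i) - θ.quad (b i) (η i))) l
      (𝓝 (ξ₀ 0 - η₀ 0 - 1 / 2 * (θ.quad b₀ ξ₀ - θ.quad b₀ η₀))) := by
    refine Tendsto.sub (((vert.continuous.tendsto ξ₀).comp hξ).sub
      ((vert.continuous.tendsto η₀).comp hη)) (Tendsto.const_mul _ (Tendsto.sub ?_ ?_))
    · exact (θ.continuous_quad.tendsto (b₀, ξ₀)).comp (hb.prodMk_nhds hξ)
    · exact (θ.continuous_quad.tendsto (b₀, η₀)).comp (hb.prodMk_nhds hη)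
  have h3 := h2.add h1
  have e : ξ₀ 0 - η₀ 0 - 1 / 2 * (θ.quad b₀ ξ₀ - θ.quad b₀ η₀) +
      fderiv ℝ θ.form b₀ ((1 / 2 : ℝ) • θ.lift b₀ (ξ₀ + η₀)) (θ.lift b₀ (ξ₀ - η₀)) =
      θ.mulAt b₀ ξ₀ (-η₀) 0 := by
    rw [mulAt_neg_zero, quad, quad]
    simp only [map_smul, map_add, map_sub, FunLike.coe_smul, FunLike.coe_add, Pi.add_apply,
      Pi.smul_apply, smul_eq_mul]
    ring
  rw [e] at h3
  refine h3.congr' ?_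
  filter_upwards [hT.eventually_gt_atTop 0] with i hi
  have e1 : x i - y i = (T i)⁻¹ • θ.lift (b i) (ξ i - η i) + ((T i)⁻¹ ^ 2 * (ξ i 0 - η i 0 -
      1 / 2 * (θ.quad (b i) (ξ i) - θ.quad (b i) (η i)))) • e0 := by
    simp only [hx, hy, zoom, map_sub]; module
  rw [e1, map_add, map_smul, map_smul, θ.apply_e0]
  simp only [FunLike.coe_smul, FunLike.coe_sub, Pi.sub_apply, Pi.smul_apply, smul_eq_mul, form_lift]
  field_simp
  ring

end Zoom

end TransverseForm

/-! ### Coordinate changes that respect the kernels of two transverse forms. -/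

namespace TransverseForm

open Heis

variable {n : ℕ} {ι : Type*} {l : Filter ι}

/-- The germ of a diffeomorphism of the model space which maps the kernel of `θ'` to that of `θ`. -/
structure IsTransition (θ' θ : TransverseForm n) (σ : Heis n → Heis n) (b₀ : Heis n) : Prop where
  contDiffAt : ContDiffAt ℝ ∞ σ b₀
  ker : ∀ᶠ x in 𝓝 b₀, ∀ v, θ'.form x v = 0 → θ.form (σ x) (fderiv ℝ σ x v) = 0
  inverse : ∃ τ : Heis n → Heis n, ContDiffAt ℝ ∞ τ (σ b₀) ∧ (∀ᶠ x in 𝓝 b₀, τ (σ x) = x) ∧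
    ∀ᶠ y in 𝓝 (σ b₀), σ (τ y) = y

/-- The map of the osculating groups which is induced by `σ`. -/
noncomputable def fibreTrans (θ' θ : TransverseForm n) (σ : Heis n → Heis n) (b z : Heis n) :
    Heis n :=
  hor (fderiv ℝ σ b (θ'.lift b z)) + (z 0 * θ.form (σ b) (fderiv ℝ σ b e0)) • e0

namespace IsTransition

variable {θ' θ : TransverseForm n} {σ : Heis n → Heis n} {b₀ : Heis n}

/-- `v - θ'(v) e0` lies in the kernel of `θ'`. Thus `σ` pulls `θ` back to a multiple of `θ'`, and
the conformal factor is read off on `e0`. -/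
theorem form_fderiv {x : Heis n} (hx : ∀ v, θ'.form x v = 0 → θ.form (σ x) (fderiv ℝ σ x v) = 0)
    (v : Heis n) :
    θ.form (σ x) (fderiv ℝ σ x v) = θ'.form x v * θ.form (σ x) (fderiv ℝ σ x e0) := by
  have h := hx (v - θ'.form x v • e0) (by simp [θ'.apply_e0])
  rw [map_sub, map_smul, map_sub, map_smul, smul_eq_mul, sub_eq_zero] at h
  exact h

theorem tendsto_mid (b₀ : Heis n) :
    Tendsto (fun p : Heis n × Heis n => (1 / 2 : ℝ) • (p.1 + p.2)) (𝓝 (b₀, b₀)) (𝓝 b₀) := by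
  have : Continuous fun p : Heis n × Heis n => (1 / 2 : ℝ) • (p.1 + p.2) := by fun_prop
  have h := this.tendsto (b₀, b₀)
  rwa [← two_smul ℝ b₀, smul_smul, show (1 / 2 : ℝ) * 2 = 1 by norm_num, one_smul] at h

theorem tendsto_mid_of_tendsto {x y : ι → Heis n} (hx : Tendsto x l (𝓝 b₀))
    (hy : Tendsto y l (𝓝 b₀)) : Tendsto (fun i => (1 / 2 : ℝ) • (x i + y i)) l (𝓝 b₀) := by
  have := (hx.add hy).const_smul (1 / 2 : ℝ)
  rwa [← two_smul ℝ b₀, smul_smul, show (1 / 2 : ℝ) * 2 = 1 by norm_num, one_smul] at this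

variable (h : IsTransition θ' θ σ b₀)
include h

theorem hasStrictFDerivAt : HasStrictFDerivAt σ (fderiv ℝ σ b₀) b₀ :=
  h.contDiffAt.hasStrictFDerivAt (by simp)

theorem continuousAt_fderiv : ContinuousAt (fderiv ℝ σ) b₀ :=
  (h.contDiffAt.fderiv_right (m := 1) (by norm_cast)).continuousAt

/-- There are two errors. The midpoint of the images differs from the image of the midpoint by `o(‖x
- y‖)`, and it acts on `σ x - σ y = O(‖x - y‖)`; the difference `σ x - σ y` itself is replaced by
the derivative at the midpoint using `isLittleO_midpoint`. -/
theorem isLittleO_form :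
    (fun p : Heis n × Heis n => θ.form ((1 / 2 : ℝ) • (σ p.1 + σ p.2)) (σ p.1 - σ p.2) -
      θ.form (σ ((1 / 2 : ℝ) • (p.1 + p.2)))
        (fderiv ℝ σ ((1 / 2 : ℝ) • (p.1 + p.2)) (p.1 - p.2)))
      =o[𝓝 (b₀, b₀)] fun p => ‖p.1 - p.2‖ ^ 2 := by
  set m := fun p : Heis n × Heis n => (1 / 2 : ℝ) • (p.1 + p.2) with hm
  have hmt : Tendsto m (𝓝 (b₀, b₀)) (𝓝 b₀) := (tendsto_mid b₀)
  have h1t : Tendsto (fun p : Heis n × Heis n => p.1) (𝓝 (b₀, b₀)) (𝓝 b₀) :=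
    continuous_fst.tendsto (b₀, b₀)
  have h2t : Tendsto (fun p : Heis n × Heis n => p.2) (𝓝 (b₀, b₀)) (𝓝 b₀) :=
    continuous_snd.tendsto (b₀, b₀)
  have hσ := h.hasStrictFDerivAt
  have hσc : Tendsto σ (𝓝 b₀) (𝓝 (σ b₀)) := h.contDiffAt.continuousAt
  have o1 := hσ.isLittleO.comp_tendsto (h1t.prodMk_nhds hmt)
  have o2 := hσ.isLittleO.comp_tendsto (h2t.prodMk_nhds hmt)
  have b1 : (fun p : Heis n × Heis n => p.1 - m p) =O[𝓝 (b₀, b₀)] fun p => p.1 - p.2 := by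
    have : (fun p : Heis n × Heis n => p.1 - m p) = fun p => (1 / 2 : ℝ) • (p.1 - p.2) := by
      ext1 p; simp only [hm]; module
    rw [this]
    refine Asymptotics.IsBigO.of_bound 1 (Eventually.of_forall fun p => ?_)
    rw [norm_smul]
    gcongr
    norm_num
  have b2 : (fun p : Heis n × Heis n => p.2 - m p) =O[𝓝 (b₀, b₀)] fun p => p.1 - p.2 := by
    have : (fun p : Heis n × Heis n => p.2 - m p) = fun p => (-(1 / 2) : ℝ) • (p.1 - p.2) := by
      ext1 p; simp only [hm]; module
    rw [this]
    refine Asymptotics.IsBigO.of_bound 1 (Eventually.of_forall fun p => ?_)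
    rw [norm_smul]
    gcongr
    norm_num
  have o3 := (((o1.trans_isBigO b1).add (o2.trans_isBigO b2)).const_smul_left (1 / 2 : ℝ))
  have o4 : (fun p : Heis n × Heis n => (1 / 2 : ℝ) • (σ p.1 + σ p.2) - σ (m p))
      =o[𝓝 (b₀, b₀)] fun p => p.1 - p.2 := by
    refine o3.congr_left fun p => ?_
    have e : fderiv ℝ σ b₀ (p.1 - m p) + fderiv ℝ σ b₀ (p.2 - m p) = 0 := by
      rw [← map_add]
      have : p.1 - m p + (p.2 - m p) = 0 := by simp only [hm]; module
      rw [this, map_zero]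
    simp only [Pi.smul_apply, Function.comp]
    have e2 := eq_neg_of_add_eq_zero_right e
    rw [e2]; module
  have hMt : Tendsto (fun p : Heis n × Heis n => (1 / 2 : ℝ) • (σ p.1 + σ p.2)) (𝓝 (b₀, b₀))
      (𝓝 (σ b₀)) := by
    have := ((hσc.comp h1t).add (hσc.comp h2t)).const_smul (1 / 2 : ℝ)
    rwa [← two_smul ℝ (σ b₀), smul_smul, show (1 / 2 : ℝ) * 2 = 1 by norm_num, one_smul] at this
  have o5 : (fun p : Heis n × Heis n => θ.form ((1 / 2 : ℝ) • (σ p.1 + σ p.2)) - θ.form (σ (m p)))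
      =o[𝓝 (b₀, b₀)] fun p => p.1 - p.2 :=
    ((θ.hasStrictFDerivAt (σ b₀)).isBigO_sub.comp_tendsto
      (hMt.prodMk_nhds (hσc.comp hmt))).trans_isLittleO o4
  have b3 : (fun p : Heis n × Heis n => σ p.1 - σ p.2) =O[𝓝 (b₀, b₀)] fun p => p.1 - p.2 :=
    hσ.isBigO_sub
  have o6 : (fun p : Heis n × Heis n => (θ.form ((1 / 2 : ℝ) • (σ p.1 + σ p.2)) -
      θ.form (σ (m p))) (σ p.1 - σ p.2)) =o[𝓝 (b₀, b₀)] fun p => ‖p.1 - p.2‖ ^ 2 := by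
    refine Asymptotics.IsBigO.trans_isLittleO (g := fun p : Heis n × Heis n =>
      ‖θ.form ((1 / 2 : ℝ) • (σ p.1 + σ p.2)) - θ.form (σ (m p))‖ * ‖σ p.1 - σ p.2‖) ?_ ?_
    · refine Asymptotics.IsBigO.of_bound 1 (Eventually.of_forall fun p => ?_)
      rw [one_mul, norm_mul, norm_norm, norm_norm]
      exact ContinuousLinearMap.le_opNorm _ _
    · simp only [pow_two]
      exact o5.norm_norm.mul_isBigO b3.norm_norm
  have b4 : (fun p => θ.form (σ (m p))) =O[𝓝 (b₀, b₀)] fun _ => (1 : ℝ) :=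
    ((θ.contDiff.continuous.tendsto _).comp (hσc.comp hmt)).isBigO_one ℝ
  have o7 : (fun p : Heis n × Heis n => θ.form (σ (m p)) (σ p.1 - σ p.2 -
      fderiv ℝ σ (m p) (p.1 - p.2))) =o[𝓝 (b₀, b₀)] fun p => ‖p.1 - p.2‖ ^ 2 := by
    refine Asymptotics.IsBigO.trans_isLittleO (g := fun p : Heis n × Heis n =>
      ‖θ.form (σ (m p))‖ * ‖σ p.1 - σ p.2 - fderiv ℝ σ (m p) (p.1 - p.2)‖) ?_ ?_
    · refine Asymptotics.IsBigO.of_bound 1 (Eventually.of_forall fun p => ?_)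
      rw [one_mul, norm_mul, norm_norm, norm_norm]
      exact ContinuousLinearMap.le_opNorm _ _
    · have := b4.norm_left.mul_isLittleO
        (isLittleO_midpoint (h.contDiffAt.of_le (m := 2) (by norm_cast))).norm_left
      simpa only [one_mul] using this
  refine (o6.add o7).congr_left fun p => ?_
  simp only [map_sub, FunLike.coe_sub, Pi.sub_apply]
  ring

theorem tendsto_scale : Tendsto (fun x => θ.form (σ x) (fderiv ℝ σ x e0)) (𝓝 b₀)
    (𝓝 (θ.form (σ b₀) (fderiv ℝ σ b₀ e0))) := by
  have h1 : Tendsto (fun x => θ.form (σ x)) (𝓝 b₀) (𝓝 (θ.form (σ b₀))) :=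
    (θ.contDiff.continuous.tendsto _).comp h.contDiffAt.continuousAt
  exact tendsto_clm_apply h1 (tendsto_clm_apply h.continuousAt_fderiv tendsto_const_nhds)

/-- Apply `form_fderiv` to the preimage of `e0` under the invertible differential: the left side is
`1`, so the conformal factor cannot vanish. -/
theorem scale_ne_zero : θ.form (σ b₀) (fderiv ℝ σ b₀ e0) ≠ 0 := by
  obtain ⟨τ, hτ, hl, hr⟩ := h.inverse
  have hb : τ (σ b₀) = b₀ := hl.self_of_nhds
  have h1 : HasFDerivAt (fun y => σ (τ y)) ((fderiv ℝ σ b₀).comp (fderiv ℝ τ (σ b₀))) (σ b₀) := by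
    have h2 : HasFDerivAt σ (fderiv ℝ σ b₀) (τ (σ b₀)) := by
      rw [hb]; exact h.hasStrictFDerivAt.hasFDerivAt
    exact h2.comp _ (hτ.differentiableAt (by simp)).hasFDerivAt
  have h3 : HasFDerivAt (fun y => σ (τ y)) (ContinuousLinearMap.id ℝ (Heis n)) (σ b₀) :=
    (hasFDerivAt_id _).congr_of_eventuallyEq hr
  have h4 := congrArg (fun L => L (e0 : Heis n)) (h1.unique h3)
  simp only [ContinuousLinearMap.comp_apply, ContinuousLinearMap.id_apply] at h4
  have h5 := form_fderiv h.ker.self_of_nhds (fderiv ℝ τ (σ b₀) e0)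
  rw [h4, θ.apply_e0] at h5
  intro h0
  rw [h0, mul_zero] at h5
  exact one_ne_zero h5

theorem tendsto_fibreTrans {b z : ι → Heis n} {z₀ : Heis n} (hb : Tendsto b l (𝓝 b₀))
    (hz : Tendsto z l (𝓝 z₀)) :
    Tendsto (fun i => fibreTrans θ' θ σ (b i) (z i)) l (𝓝 (fibreTrans θ' θ σ b₀ z₀)) := by
  have h1 : Tendsto (fun i => θ'.lift (b i) (z i)) l (𝓝 (θ'.lift b₀ z₀)) := by
    have := (θ'.continuous_lift.tendsto (b₀, z₀)).comp (hb.prodMk_nhds hz)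
    exact this
  have h2 : Tendsto (fun i => fderiv ℝ σ (b i)) l (𝓝 (fderiv ℝ σ b₀)) :=
    h.continuousAt_fderiv.tendsto.comp hb
  have h3 := (hor.continuous.tendsto _).comp (tendsto_clm_apply h2 h1)
  have h4 : Tendsto (fun i => z i 0) l (𝓝 (z₀ 0)) := (vert.continuous.tendsto z₀).comp hz
  have h5 := h3.add ((h4.mul (h.tendsto_scale.comp hb)).smul_const e0)
  rw [fibreTrans]
  refine h5.congr fun i => ?_
  rw [fibreTrans]; rfl

/-- Horizontally, strict differentiability suffices. Vertically one multiplies by `T²`, so the form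
must be known up to `o(‖x - y‖²)`; this is `isLittleO_form`, after which `form_fderiv` extracts the
conformal factor. -/
theorem tendsto_dil_diff_of_tendsto {T : ι → ℝ} {x y : ι → Heis n} {u : Heis n} {c : ℝ}
    (hxl : Tendsto x l (𝓝 b₀)) (hyl : Tendsto y l (𝓝 b₀))
    (hxy : Tendsto (fun i => T i • (x i - y i)) l (𝓝 u))
    (hc : Tendsto (fun i => T i ^ 2 * θ'.form ((1 / 2 : ℝ) • (x i + y i)) (x i - y i)) l (𝓝 c)) :
    Tendsto (fun i => dil (T i) (θ.diff (σ (x i)) (σ (y i)))) l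
      (𝓝 (hor (fderiv ℝ σ b₀ u) + (c * θ.form (σ b₀) (fderiv ℝ σ b₀ e0)) • e0)) := by
  have h1 := h.hasStrictFDerivAt.tendsto_smul_sub hxl hyl hxy
  have hr : Tendsto (fun i => T i ^ 2 * (θ.form ((1 / 2 : ℝ) • (σ (x i) + σ (y i)))
      (σ (x i) - σ (y i)) - θ.form (σ ((1 / 2 : ℝ) • (x i + y i)))
        (fderiv ℝ σ ((1 / 2 : ℝ) • (x i + y i)) (x i - y i)))) l (𝓝 0) := by
    have ho := h.isLittleO_form.comp_tendsto (hxl.prodMk_nhds hyl)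
    have hn : Tendsto (fun i => T i ^ 2 • (((fun p : Heis n × Heis n => ‖p.1 - p.2‖ ^ 2) ∘
        fun i => (x i, y i)) i)) l (𝓝 (‖u‖ ^ 2)) := by
      refine (hxy.norm.pow 2).congr fun i => ?_
      rw [norm_smul, mul_pow, Real.norm_eq_abs, sq_abs]; rfl
    have := tendsto_smul_zero_of_isLittleO ho hn
    exact this
  have hmid : Tendsto (fun i => (1 / 2 : ℝ) • (x i + y i)) l (𝓝 b₀) :=
    tendsto_mid_of_tendsto hxl hyl
  have h3 := hr.add (hc.mul (h.tendsto_scale.comp hmid))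
  rw [zero_add] at h3
  have h4 := ((hor.continuous.tendsto _).comp h1).add (h3.smul_const (e0 : Heis n))
  refine h4.congr' ?_
  filter_upwards [hmid.eventually h.ker] with i hi
  have e := form_fderiv hi (x i - y i)
  rw [dil_eq, hor_diff, diff_zero_coord, Function.comp_apply, map_smul, Function.comp_apply, e]
  congr 2
  ring

/-- The computation on which all kernel limits rest: the rescaled difference in one chart, in terms
of zoom coordinates of another, tends to the image of the quotient `ξ₀ η₀⁻¹` in the osculating group
at `b₀`. -/
theorem tendsto_dil_diff {T : ι → ℝ} {b ξ η : ι → Heis n} {ξ₀ η₀ : Heis n}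
    (hT : Tendsto T l atTop) (hb : Tendsto b l (𝓝 b₀))
    (hξ : Tendsto ξ l (𝓝 ξ₀)) (hη : Tendsto η l (𝓝 η₀)) :
    Tendsto (fun i => dil (T i) (θ.diff (σ (θ'.zoom (b i) (T i) (ξ i)))
      (σ (θ'.zoom (b i) (T i) (η i))))) l
      (𝓝 (fibreTrans θ' θ σ b₀ (θ'.mulAt b₀ ξ₀ (-η₀)))) := by
  have h1 := h.tendsto_dil_diff_of_tendsto (θ'.tendsto_zoom hT hb hξ) (θ'.tendsto_zoom hT hb hη)
    (θ'.tendsto_smul_zoom_sub_zoom hT hb hξ hη) (θ'.tendsto_form_zoom hT hb hξ hη)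
  have e : θ'.lift b₀ (θ'.mulAt b₀ ξ₀ (-η₀)) = θ'.lift b₀ (ξ₀ - η₀) := by
    rw [← θ'.lift_hor b₀ (θ'.mulAt b₀ ξ₀ (-η₀)), mulAt_neg_hor, lift_hor]
  rw [fibreTrans, e]
  exact h1

/-- Near `b₀` the distances and the vertical distances are comparable. -/
theorem exists_comparison : ∃ C > 0, ∀ᶠ p : Heis n × Heis n in 𝓝 (b₀, b₀),
    ‖p.1 - p.2‖ ≤ C * ‖σ p.1 - σ p.2‖ ∧
    |θ'.form p.2 (p.1 - p.2)| ≤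
      C * (|θ.form ((1 / 2 : ℝ) • (σ p.1 + σ p.2)) (σ p.1 - σ p.2)| + ‖p.1 - p.2‖ ^ 2) ∧
    ‖θ'.form p.1 - θ'.form p.2‖ ≤ C * ‖p.1 - p.2‖ := by
  obtain ⟨τ, hτ, hl, -⟩ := h.inverse
  have hσc : Tendsto σ (𝓝 b₀) (𝓝 (σ b₀)) := h.contDiffAt.continuousAt
  have h1t : Tendsto (fun p : Heis n × Heis n => p.1) (𝓝 (b₀, b₀)) (𝓝 b₀) :=
    continuous_fst.tendsto (b₀, b₀)
  have h2t : Tendsto (fun p : Heis n × Heis n => p.2) (𝓝 (b₀, b₀)) (𝓝 b₀) :=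
    continuous_snd.tendsto (b₀, b₀)
  obtain ⟨C₁, hC₁, h1⟩ := (hτ.hasStrictFDerivAt (by simp)).isBigO_sub.exists_pos
  have hσ1 : Tendsto (fun p : Heis n × Heis n => σ p.1) (𝓝 (b₀, b₀)) (𝓝 (σ b₀)) := hσc.comp h1t
  have hσ2 : Tendsto (fun p : Heis n × Heis n => σ p.2) (𝓝 (b₀, b₀)) (𝓝 (σ b₀)) := hσc.comp h2t
  have h1' := (hσ1.prodMk_nhds hσ2).eventually h1.bound
  obtain ⟨C₂, hC₂, h2⟩ := (θ'.hasStrictFDerivAt b₀).isBigO_sub.exists_pos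
  have h2' := h2.bound
  have h2'' := h2'.filter_mono ((tendsto_mid b₀).prodMk_nhds h2t)
  set lam := θ.form (σ b₀) (fderiv ℝ σ b₀ e0) with hlam
  have hlam0 : 0 < |lam| := abs_pos.2 h.scale_ne_zero
  -- The conformal factor at the midpoint stays away from zero, so that it can be divided out in
  -- `i6`.
  have h3 : ∀ᶠ p : Heis n × Heis n in 𝓝 (b₀, b₀), |lam| / 2 <
      |θ.form (σ ((1 / 2 : ℝ) • (p.1 + p.2))) (fderiv ℝ σ ((1 / 2 : ℝ) • (p.1 + p.2)) e0)| :=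
    ((h.tendsto_scale.abs.comp (tendsto_mid b₀)).eventually (lt_mem_nhds (half_lt_self hlam0)))
  have h4 := h.isLittleO_form.def one_pos
  set C := C₁ + C₂ + 2 / |lam| with hC
  have hp : 0 < 2 / |lam| := by positivity
  refine ⟨C, by positivity, ?_⟩
  filter_upwards [h1', h2', h2'', h3, h4, (tendsto_mid b₀).eventually h.ker, h1t.eventually hl,
    h2t.eventually hl] with p i1 i2 i2' i3 i4 hker hl1 hl2
  refine ⟨?_, ?_, ?_⟩
  · rw [hl1, hl2] at i1
    exact i1.trans (by gcongr; linarith)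
  · rw [form_fderiv hker, norm_pow, norm_norm, one_mul, Real.norm_eq_abs] at i4
    set m := (1 / 2 : ℝ) • (p.1 + p.2) with hm
    set lm := θ.form (σ m) (fderiv ℝ σ m e0)
    set A := θ.form ((1 / 2 : ℝ) • (σ p.1 + σ p.2)) (σ p.1 - σ p.2)
    have i5 : |θ'.form m (p.1 - p.2)| * |lm| ≤ |A| + ‖p.1 - p.2‖ ^ 2 := by
      rw [← abs_mul]
      have := abs_sub_abs_le_abs_sub (θ'.form m (p.1 - p.2) * lm) A
      rw [abs_sub_comm] at this
      linarith
    have i6 : |θ'.form m (p.1 - p.2)| ≤ 2 / |lam| * (|A| + ‖p.1 - p.2‖ ^ 2) := by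
      rw [div_mul_eq_mul_div, le_div_iff₀ hlam0]
      nlinarith [abs_nonneg (θ'.form m (p.1 - p.2))]
    have i7 : |(θ'.form m - θ'.form p.2) (p.1 - p.2)| ≤ C₂ * ‖p.1 - p.2‖ ^ 2 := by
      have e : ‖m - p.2‖ ≤ ‖p.1 - p.2‖ := by
        have : m - p.2 = (1 / 2 : ℝ) • (p.1 - p.2) := by rw [hm]; module
        rw [this, norm_smul, Real.norm_of_nonneg (by norm_num)]
        linarith [norm_nonneg (p.1 - p.2)]
      rw [← Real.norm_eq_abs]
      refine (ContinuousLinearMap.le_opNorm _ _).trans ?_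
      rw [pow_two, ← mul_assoc]
      gcongr
      exact i2'.trans (by gcongr)
    have i8 : |θ'.form p.2 (p.1 - p.2)| ≤ |θ'.form m (p.1 - p.2)| +
        |(θ'.form m - θ'.form p.2) (p.1 - p.2)| := by
      have : θ'.form p.2 (p.1 - p.2) = θ'.form m (p.1 - p.2) -
        (θ'.form m - θ'.form p.2) (p.1 - p.2) := by simp
      rw [this]; exact abs_sub _ _
    have : 0 ≤ |A| := abs_nonneg _
    have : 0 ≤ ‖p.1 - p.2‖ ^ 2 := by positivity
    rw [hC]
    nlinarith [mul_nonneg hC₁.le this, mul_nonneg hC₁.le (abs_nonneg A),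
      mul_nonneg hC₂.le (abs_nonneg A)]
  · exact i2.trans (by gcongr; linarith)

end IsTransition

end TransverseForm

/-! ## Cells and averaging -/

namespace TransverseForm

open Heis

variable {n : ℕ} (θ : TransverseForm n)

/-- The coordinates of `y - b` with respect to the form at `y`. -/
noncomputable def offset (y b : Heis n) : Heis n := hor (y - b) + θ.form y (y - b) • e0

/-- The parabolic neighbourhood of `b` of size `R` at scale `1/t`. -/
def cell (b : Heis n) (t R : ℝ) : Set (Heis n) := {y | dil t (θ.offset y b) ∈ box n R}

theorem mem_cell {b y : Heis n} {t R : ℝ} : y ∈ θ.cell b t R ↔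
    ‖t • hor (y - b)‖ < R ∧ |t ^ 2 * θ.form y (y - b)| < R ^ 2 := by
  change ‖hor (dil t (θ.offset y b))‖ < R ∧ |dil t (θ.offset y b) 0| < R ^ 2 ↔ _
  simp [offset]

theorem continuous_offset : Continuous fun p : Heis n × Heis n => θ.offset p.1 p.2 := by
  unfold offset
  have := θ.continuous_form_apply.comp (f := fun p : Heis n × Heis n => (p.1, p.1 - p.2))
    (by fun_prop)
  exact Continuous.add (by fun_prop) (this.smul continuous_const)

theorem isOpen_cell (t R : ℝ) : IsOpen {p : Heis n × Heis n | p.2 ∈ θ.cell p.1 t R} := by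
  have h1 : Continuous fun p : Heis n × Heis n => θ.offset p.2 p.1 :=
    θ.continuous_offset.comp continuous_swap
  have h2 : Continuous fun p : Heis n × Heis n => dil t (θ.offset p.2 p.1) :=
    continuous_dil.comp (continuous_const.prodMk h1)
  exact (isOpen_box R).preimage h2

theorem measurableSet_cell (b : Heis n) (t R : ℝ) : MeasurableSet (θ.cell b t R) :=
  ((θ.isOpen_cell t R).preimage (Continuous.prodMk_right b)).measurableSet

/-- The form is taken at `y`, not at `b`. For fixed `y` the offset is then an affine function of `b`
whose linear part is, up to sign, a vertical shear. Hence the set of centres whose cell contains `y`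
has exactly the same volume for every `y`, without error terms. -/
theorem lintegral_offset (y : Heis n) (f : Heis n → ℝ≥0∞) :
    ∫⁻ b, f (θ.offset y b) = ∫⁻ v, f v := by
  conv_rhs => rw [← lintegral_shear (c := fun v => θ.form y (hor v)) (by fun_prop) (by simp),
    ← lintegral_add_left_eq_self _ y, ← lintegral_neg_eq_self (fun w => f (y + w + _))]
  refine lintegral_congr fun b => congrArg f (ext_hor ?_ ?_)
  · simp [offset, sub_eq_add_neg]
  · have := θ.apply_eq y (y - b)
    simp only [offset, PiLp.add_apply, hor_zero_coord, PiLp.smul_apply, e0_zero, smul_eq_mul,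
      mul_one, zero_add, this]
    simp [sub_eq_add_neg]

theorem volume_setOf_mem_cell (y : Heis n) {t R : ℝ} (ht : 0 < t) :
    ENNReal.ofReal (t ^ (2 * n + 2)) * volume {b | y ∈ θ.cell b t R} = volume (box n R) := by
  have hm : MeasurableSet {b | y ∈ θ.cell b t R} :=
    ((θ.isOpen_cell t R).preimage (Continuous.prodMk_left y)).measurableSet
  rw [← lintegral_indicator_one hm, ← lintegral_indicator_one (isOpen_box R).measurableSet,
    ← lintegral_dil ht (indicator (box n R) 1),
    ← θ.lintegral_offset y fun v => indicator (box n R) 1 (dil t v)]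
  rfl

/-- Integrate the inequality of `h2` over the centres `b`. By Fubini each point `y` is counted with
the volume of the set of centres `b` with `y` in the cell of `b`, which is `t^(-(2n+2))` times the
volume of the box. Centres outside `B` contribute nothing, as their cells do not meet `A`. -/
theorem lintegral_le_of_cell_le {A B : Set (Heis n)} {G H : Heis n → ℝ≥0∞} (hA : MeasurableSet A)
    (hG : Measurable G) (hH : Measurable H) {t R R' : ℝ} (ht : 0 < t) {c : ℝ≥0∞}
    (hc : c ≠ ⊤)
    (h1 : ∀ y ∈ A, ∀ b, y ∈ θ.cell b t R → b ∈ B)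
    (h2 : ∀ b ∈ B, ∫⁻ y in θ.cell b t R, G y ≤ c * ∫⁻ y in θ.cell b t R', H y) :
    volume (box n R) * ∫⁻ y in A, G y ≤ c * (volume (box n R') * ∫⁻ y, H y) := by
  have key : ∀ (R : ℝ) (G : Heis n → ℝ≥0∞), Measurable G →
      ENNReal.ofReal (t ^ (2 * n + 2)) * ∫⁻ b, ∫⁻ y in θ.cell b t R, G y =
        volume (box n R) * ∫⁻ y, G y := by
    intro R G hG
    have e1 : ∀ b, ∫⁻ y in θ.cell b t R, G y =
        ∫⁻ y, {p : Heis n × Heis n | p.2 ∈ θ.cell p.1 t R}.indicator (fun p => G p.2) (b, y) := by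
      intro b
      rw [← lintegral_indicator (θ.measurableSet_cell b t R)]
      rfl
    have hm : Measurable ({p : Heis n × Heis n | p.2 ∈ θ.cell p.1 t R}.indicator
        fun p => G p.2) :=
      (hG.comp measurable_snd).indicator (θ.isOpen_cell t R).measurableSet
    simp only [e1]
    rw [lintegral_lintegral_swap (f := fun b y => {p : Heis n × Heis n | p.2 ∈ θ.cell p.1 t
      R}.indicator (fun p => G p.2) (b, y)) hm.aemeasurable, ← lintegral_const_mul'
      _ _ ENNReal.ofReal_ne_top, ← lintegral_const_mul' _ _ (volume_box_lt_top R).ne]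
    refine lintegral_congr fun y => ?_
    have e2 : ∀ b, {p : Heis n × Heis n | p.2 ∈ θ.cell p.1 t R}.indicator (fun p => G p.2) (b, y)
        = {b | y ∈ θ.cell b t R}.indicator (fun _ => G y) b := fun b => rfl
    have hm : MeasurableSet {b | y ∈ θ.cell b t R} :=
      ((θ.isOpen_cell t R).preimage (Continuous.prodMk_left y)).measurableSet
    simp only [e2]
    rw [lintegral_indicator_const hm, mul_left_comm, θ.volume_setOf_mem_cell y ht, mul_comm]
  have hGA : Measurable (A.indicator G) := hG.indicator hA
  rw [← lintegral_indicator hA, ← key R _ hGA, ← key R' _ hH, mul_left_comm]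
  gcongr
  rw [← lintegral_const_mul' _ _ hc]
  refine lintegral_mono fun b => ?_
  by_cases hb : b ∈ B
  · refine le_trans (lintegral_mono fun y => ?_) (h2 b hb)
    exact indicator_le_self _ _ _
  · refine le_of_eq_of_le ?_ bot_le
    refine (setLIntegral_congr_fun (θ.measurableSet_cell b t R) (g := fun _ => 0) fun y hy => ?_).trans
      (by simp)
    exact indicator_of_notMem (fun hyA => hb (h1 y hyA b hy)) _

theorem norm_sub_le_of_mem_cell {b y : Heis n} {t R B : ℝ} (ht : 0 < t) (hR : R ≤ t)
    (hB : ‖θ.form y‖ ≤ B) (hy : y ∈ θ.cell b t R) : ‖y - b‖ ≤ (2 + B) * R / t := by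
  obtain ⟨h1, h2⟩ := θ.mem_cell.1 hy
  rw [norm_smul, Real.norm_of_nonneg ht.le] at h1
  rw [abs_mul, abs_of_pos (pow_pos ht 2)] at h2
  have hR0 : 0 < R := (by positivity : 0 ≤ t * ‖hor (y - b)‖).trans_lt h1
  have e := θ.apply_eq y (y - b)
  have h3 : |θ.form y (hor (y - b))| ≤ B * ‖hor (y - b)‖ :=
    ((θ.form y).le_opNorm _).trans (by gcongr)
  have h4 : |(y - b) 0| ≤ |θ.form y (y - b)| + B * ‖hor (y - b)‖ := by
    rw [eq_sub_of_add_eq e.symm]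
    exact (abs_sub _ _).trans (by gcongr)
  have h5 := norm_le_hor_add (y - b)
  have hB0 : 0 ≤ B := (norm_nonneg _).trans hB
  rw [le_div_iff₀ ht]
  -- From `t² |θ_y(y - b)| < R² ≤ t R`.
  have h6 : t * |θ.form y (y - b)| ≤ R := by
    have : t * (t * |θ.form y (y - b)|) ≤ t * R := by nlinarith
    exact le_of_mul_le_mul_left this ht
  nlinarith

/-- The form at `y` must be bounded before `y` is known to be near `b`. This is possible because its
growth is controlled by the horizontal part of `y` alone, which the cell condition bounds directly.
-/
theorem exists_cell_bound (r R : ℝ) : ∃ D, ∀ t, 1 ≤ t → R ≤ t → ∀ b : Heis n, ‖b‖ ≤ r →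
    ∀ y ∈ θ.cell b t R, ‖y - b‖ ≤ D / t := by
  obtain ⟨C, hC⟩ := θ.growth
  have hC0 : 0 ≤ C := by
    have := (norm_nonneg _).trans (hC 0)
    simpa using this
  refine ⟨(2 + C * (1 + (R + 2 * r))) * R, fun t h1 hR b hb y hy => ?_⟩
  have ht : 0 < t := one_pos.trans_le h1
  refine θ.norm_sub_le_of_mem_cell ht hR ((hC y).trans ?_) hy
  have h2 := (θ.mem_cell.1 hy).1
  rw [norm_smul, Real.norm_of_nonneg ht.le] at h2
  have h3 : ‖hor y‖ ≤ ‖hor (y - b)‖ + ‖hor b‖ := by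
    have : hor y = hor (y - b) + hor b := by rw [← map_add, sub_add_cancel]
    rw [this]; exact norm_add_le _ _
  have h4 := norm_hor_le b
  have h5 : ‖hor (y - b)‖ ≤ R := by nlinarith [norm_nonneg (hor (y - b))]
  gcongr
  linarith

theorem eventually_cell_subset (R : ℝ) (b₀ : Heis n) {U : Set (Heis n)} (hU : U ∈ 𝓝 b₀) :
    ∀ᶠ p : ℝ × Heis n in atTop ×ˢ 𝓝 b₀, θ.cell p.2 p.1 R ⊆ U := by
  obtain ⟨D, hD⟩ := θ.exists_cell_bound (‖b₀‖ + 1) R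
  obtain ⟨ε, hε, hball⟩ := Metric.mem_nhds_iff.1 hU
  have h1 : ∀ᶠ t : ℝ in atTop, 1 ≤ t ∧ R ≤ t ∧ D / t < ε / 2 :=
    (eventually_ge_atTop 1).and ((eventually_ge_atTop R).and
      ((tendsto_const_nhds.div_atTop tendsto_id).eventually (gt_mem_nhds (half_pos hε))))
  have h2 : ∀ᶠ b in 𝓝 b₀, b ∈ Metric.ball b₀ (min 1 (ε / 2)) :=
    Metric.ball_mem_nhds _ (by positivity)
  filter_upwards [h1.prod_mk h2] with ⟨t, b⟩ ⟨⟨h1, h1', h1''⟩, h2⟩ y hy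
  rw [Metric.mem_ball, dist_eq_norm] at h2
  have hb : ‖b‖ ≤ ‖b₀‖ + 1 := by
    have := norm_sub_norm_le b b₀
    linarith [h2.trans_le (min_le_left _ _)]
  refine hball ?_
  rw [Metric.mem_ball, dist_eq_norm]
  have := hD t h1 h1' b hb y hy
  calc ‖y - b₀‖ ≤ ‖y - b‖ + ‖b - b₀‖ := norm_sub_le_norm_sub_add_norm_sub _ _ _
    _ < ε / 2 + ε / 2 := add_lt_add (this.trans_lt h1'') (h2.trans_le (min_le_right _ _))
    _ = ε := by ring

theorem eventually_of_mem_cell (R : ℝ) (y₀ : Heis n) {U : Set (Heis n)} (hU : U ∈ 𝓝 y₀) :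
    ∀ᶠ p : ℝ × Heis n in atTop ×ˢ 𝓝 y₀, ∀ b, p.2 ∈ θ.cell b p.1 R → b ∈ U := by
  obtain ⟨ε, hε, hball⟩ := Metric.mem_nhds_iff.1 hU
  set B := ‖θ.form y₀‖ + 1 with hB
  have h1 : ∀ᶠ t : ℝ in atTop, 0 < t ∧ R ≤ t ∧ (2 + B) * R / t < ε / 2 :=
    (eventually_gt_atTop 0).and ((eventually_ge_atTop R).and
      ((tendsto_const_nhds.div_atTop tendsto_id).eventually (gt_mem_nhds (half_pos hε))))
  have h2 : ∀ᶠ y in 𝓝 y₀, y ∈ Metric.ball y₀ (ε / 2) :=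
    Metric.ball_mem_nhds _ (by positivity)
  have h3 : ∀ᶠ y in 𝓝 y₀, ‖θ.form y‖ < B :=
    (θ.contDiff.continuous.norm.tendsto y₀).eventually (gt_mem_nhds (lt_add_one _))
  filter_upwards [h1.prod_mk (h2.and h3)] with ⟨t, y⟩ ⟨⟨h1, h1', h1''⟩, h2, h3⟩ b hb
  have := θ.norm_sub_le_of_mem_cell h1 h1' h3.le hb
  rw [Metric.mem_ball, dist_eq_norm] at h2
  refine hball ?_
  rw [Metric.mem_ball, dist_eq_norm]
  calc ‖b - y₀‖ ≤ ‖b - y‖ + ‖y - y₀‖ := norm_sub_le_norm_sub_add_norm_sub _ _ _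
    _ < ε / 2 + ε / 2 := by
      rw [norm_sub_rev b y]; exact add_lt_add (this.trans_lt h1'') h2
    _ = ε := by ring

theorem eventually_lipschitz (b₀ : Heis n) : ∃ L > 0, ∀ᶠ p : Heis n × Heis n in 𝓝 (b₀, b₀),
    ‖θ.form p.1 - θ.form p.2‖ ≤ L * ‖p.1 - p.2‖ := by
  obtain ⟨C, hC, h⟩ := (θ.hasStrictFDerivAt b₀).isBigO_sub.exists_pos
  exact ⟨C, hC, h.bound⟩

/-- Cells are defined with the form at `y`, zoom coordinates with the form at `b`. The two forms
differ by `O(‖y - b‖)` and act on a vector of size `O(1/t)`, which leaves a bounded error after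
multiplication by `t²`; the quadratic term is bounded by compactness. -/
theorem exists_unzoom_bound (R : ℝ) (b₀ : Heis n) : ∃ R', ∀ᶠ p : ℝ × Heis n in atTop ×ˢ 𝓝 b₀,
    ∀ y ∈ θ.cell p.2 p.1 R, ‖θ.unzoom p.2 p.1 y‖ ≤ R' := by
  obtain ⟨D, hD⟩ := θ.exists_cell_bound (‖b₀‖ + 1) R
  obtain ⟨L, hL, hlip⟩ := θ.eventually_lipschitz b₀
  rw [nhds_prod_eq, eventually_prod_self_iff'] at hlip
  obtain ⟨U, hU, hlip⟩ := hlip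
  obtain ⟨Q, hQ⟩ := ((isCompact_closedBall b₀ 1).prod
    (isCompact_closedBall (0 : Heis n) D)).exists_bound_of_continuousOn
    (θ.continuous_quad.continuousOn)
  refine ⟨2 * D + (R ^ 2 + L * D ^ 2 + Q), ?_⟩
  have h1 : ∀ᶠ t : ℝ in atTop, 1 ≤ t ∧ R ≤ t :=
    (eventually_ge_atTop 1).and (eventually_ge_atTop R)
  have h2 : ∀ᶠ b in 𝓝 b₀, b ∈ Metric.ball b₀ 1 ∧ b ∈ U :=
    inter_mem (Metric.ball_mem_nhds _ one_pos) hU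
  filter_upwards [h1.prod_mk h2, θ.eventually_cell_subset R b₀ hU]
    with ⟨t, b⟩ ⟨⟨h1, h1'⟩, h2, h2'⟩ hcell y hy
  rw [Metric.mem_ball, dist_eq_norm] at h2
  have ht : 0 < t := one_pos.trans_le h1
  have hb : ‖b‖ ≤ ‖b₀‖ + 1 := by
    have := norm_sub_norm_le b b₀
    linarith
  have hy1 := hD t h1 h1' b hb y hy
  have hy2 := hlip y (hcell hy) b h2'
  have hw : ‖t • (y - b)‖ ≤ D := by
    rw [norm_smul, Real.norm_of_nonneg ht.le]
    rwa [le_div_iff₀ ht, mul_comm] at hy1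
  have hq : |θ.quad b (t • (y - b))| ≤ Q := hQ (b, t • (y - b))
    ⟨by rw [Metric.mem_closedBall, dist_eq_norm]; exact h2.le, by simpa using hw⟩
  have hD0 : 0 ≤ D := (norm_nonneg _).trans hw
  obtain ⟨c1, c2⟩ := θ.mem_cell.1 hy
  have e1 : hor (θ.unzoom b t y) = hor (t • (y - b)) := by rw [unzoom]; simp
  have e2 : θ.unzoom b t y 0 = t ^ 2 * θ.form y (y - b) -
      t ^ 2 * (θ.form y - θ.form b) (y - b) + 1 / 2 * θ.quad b (t • (y - b)) := by
    rw [unzoom, quad_smul]; simp; ring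
  refine (norm_le_hor_add _).trans (add_le_add ?_ ?_)
  · rw [e1]; exact (norm_hor_le _).trans (by gcongr)
  · rw [e2]
    have h3 : |t ^ 2 * (θ.form y - θ.form b) (y - b)| ≤ L * D ^ 2 := by
      rw [abs_mul, abs_of_pos (pow_pos ht 2), ← Real.norm_eq_abs]
      have h4 := (θ.form y - θ.form b).le_opNorm (y - b)
      have h5 : ‖t • (y - b)‖ ^ 2 ≤ D ^ 2 := by gcongr
      rw [norm_smul, Real.norm_of_nonneg ht.le, mul_pow] at h5
      calc t ^ 2 * ‖(θ.form y - θ.form b) (y - b)‖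
          ≤ t ^ 2 * ((L * ‖y - b‖) * ‖y - b‖) := by gcongr; exact h4.trans (by gcongr)
        _ = L * (t ^ 2 * ‖y - b‖ ^ 2) := by ring
        _ ≤ _ := by gcongr
    change |t ^ 2 * θ.form y (y - b)| < R ^ 2 at c2
    rw [abs_lt] at c2
    rw [abs_le] at *
    constructor <;> linarith [c2.1, c2.2, h3.1, h3.2, hq.1, hq.2]

/-- Points which are close at scale `1/t` lie in cells of comparable size. -/
theorem mem_cell_of_close {b x y : Heis n} {t R ρ L B P : ℝ} (ht : 0 < t) (hR : R ≤ t)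
    (hx : x ∈ θ.cell b t R) (hρ : 0 ≤ ρ) (hL : 0 ≤ L) (h1 : ‖y - x‖ ≤ ρ / t)
    (h2 : |θ.form y (y - x)| ≤ ρ ^ 2 / t ^ 2) (h3 : ‖θ.form y - θ.form x‖ ≤ L * ‖y - x‖)
    (hB : ‖θ.form x‖ ≤ B) (hP : 2 * ρ + L * ρ * (2 + B) ≤ P) (hP0 : 0 < P) :
    y ∈ θ.cell b t (R + P) := by
  have hxb := θ.norm_sub_le_of_mem_cell ht hR hB hx
  obtain ⟨c1, c2⟩ := θ.mem_cell.1 hx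
  have hB0 : 0 ≤ B := (norm_nonneg _).trans hB
  have hR0 : 0 < R := (norm_nonneg _).trans_lt c1
  have hLρ : 0 ≤ L * ρ * (2 + B) := by positivity
  have h4 : t * ‖y - x‖ ≤ ρ := by rwa [le_div_iff₀ ht, mul_comm] at h1
  have h5 : t * ‖x - b‖ ≤ (2 + B) * R := by rwa [le_div_iff₀ ht, mul_comm] at hxb
  refine θ.mem_cell.2 ⟨?_, ?_⟩
  · have e : t • hor (y - b) = t • hor (x - b) + t • hor (y - x) := by
      rw [← smul_add, ← map_add]; congr 2; abel
    rw [e]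
    refine (norm_add_le _ _).trans_lt (add_lt_add_of_lt_of_le c1 ?_)
    rw [norm_smul, Real.norm_of_nonneg ht.le]
    have := norm_hor_le (y - x)
    nlinarith
  · have e : t ^ 2 * θ.form y (y - b) = t ^ 2 * θ.form x (x - b) + (t ^ 2 * θ.form y (y - x) +
        t ^ 2 * (θ.form y - θ.form x) (x - b)) := by
      have : y - b = (y - x) + (x - b) := by abel
      rw [this, map_add]; simp; ring
    have h6 : |t ^ 2 * θ.form y (y - x)| ≤ ρ ^ 2 := by
      rw [abs_mul, abs_of_pos (pow_pos ht 2)]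
      rwa [le_div_iff₀ (pow_pos ht 2), mul_comm] at h2
    have h7 : |t ^ 2 * (θ.form y - θ.form x) (x - b)| ≤ L * ρ * ((2 + B) * R) := by
      rw [abs_mul, abs_of_pos (pow_pos ht 2), ← Real.norm_eq_abs]
      have h8 := (θ.form y - θ.form x).le_opNorm (x - b)
      calc t ^ 2 * ‖(θ.form y - θ.form x) (x - b)‖
          ≤ t ^ 2 * ((L * ‖y - x‖) * ‖x - b‖) := by gcongr; exact h8.trans (by gcongr)
        _ = L * (t * ‖y - x‖) * (t * ‖x - b‖) := by ring
        _ ≤ L * ρ * ((2 + B) * R) := by gcongr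
    rw [e]
    calc _ ≤ |t ^ 2 * θ.form x (x - b)| + (|t ^ 2 * θ.form y (y - x)| +
          |t ^ 2 * (θ.form y - θ.form x) (x - b)|) :=
        (abs_add_le _ _).trans (by gcongr; exact abs_add_le _ _)
      _ < R ^ 2 + (ρ ^ 2 + L * ρ * ((2 + B) * R)) := add_lt_add_of_lt_of_le c2 (add_le_add h6 h7)
      -- `ρ ≤ P` gives `ρ² ≤ P²`, and the mixed term `L ρ (2 + B) R` is at most `P R`.
      _ ≤ (R + P) ^ 2 := by
        have : ρ ^ 2 ≤ P ^ 2 := by gcongr; linarith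
        nlinarith

end TransverseForm

/-- The tube lemma for filters. By means of it, joint limits at single points become limits uniform
over compact sets. -/
theorem IsCompact.eventually_forall_mem {ι X : Type*} [TopologicalSpace X] {l : Filter ι}
    {K : Set X} (hK : IsCompact K) {P : ι × X → Prop}
    (h : ∀ y ∈ K, ∀ᶠ z in l ×ˢ 𝓝 y, P z) : ∀ᶠ i in l, ∀ y ∈ K, P (i, y) := by
  have := hK.mem_prod_nhdsSet_of_forall h
  obtain ⟨s, hs, u, hu, hsu⟩ := mem_prod_iff.1 this
  filter_upwards [hs] with i hi y hy
  exact hsu ⟨hi, subset_of_mem_nhdsSet hu hy⟩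

/-! ## Charts of a manifold -/

section Charts

set_option linter.unusedSectionVars false

variable {n : ℕ} {M : Type*} [TopologicalSpace M] [ChartedSpace (Heis n) M]
  [IsManifold (𝓡 (2 * n + 1)) ∞ M] {e e' : OpenPartialHomeomorph M (Heis n)}

theorem mdifferentiable_of_mem_maximalAtlas
    (he : e ∈ IsManifold.maximalAtlas (𝓡 (2 * n + 1)) ∞ M) :
    e.MDifferentiable (𝓡 (2 * n + 1)) (𝓡 (2 * n + 1)) :=
  ⟨(contMDiffOn_of_mem_maximalAtlas he).mdifferentiableOn (by simp),
    (contMDiffOn_symm_of_mem_maximalAtlas he).mdifferentiableOn (by simp)⟩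

theorem contDiffAt_transition (he : e ∈ IsManifold.maximalAtlas (𝓡 (2 * n + 1)) ∞ M)
    (he' : e' ∈ IsManifold.maximalAtlas (𝓡 (2 * n + 1)) ∞ M) {x : M} (hx : x ∈ e.source)
    (hx' : x ∈ e'.source) : ContDiffAt ℝ ∞ (fun y => e' (e.symm y)) (e x) := by
  have h1 : ContMDiffAt (𝓡 (2 * n + 1)) (𝓡 (2 * n + 1)) ∞ e.symm (e x) :=
    (contMDiffOn_symm_of_mem_maximalAtlas he).contMDiffAt
      (e.open_target.mem_nhds (e.map_source hx))
  have h2 : ContMDiffAt (𝓡 (2 * n + 1)) (𝓡 (2 * n + 1)) ∞ e' (e.symm (e x)) := by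
    rw [e.left_inv hx]
    exact (contMDiffOn_of_mem_maximalAtlas he').contMDiffAt (e'.open_source.mem_nhds hx')
  exact (h2.comp (e x) h1).contDiffAt

theorem fderiv_transition (he : e ∈ IsManifold.maximalAtlas (𝓡 (2 * n + 1)) ∞ M)
    (he' : e' ∈ IsManifold.maximalAtlas (𝓡 (2 * n + 1)) ∞ M) {x : M} (hx : x ∈ e.source)
    (hx' : x ∈ e'.source) (v : TSp n x) :
    fderiv ℝ (fun y => e' (e.symm y)) (e x) (mfderiv (𝓡 (2 * n + 1)) (𝓡 (2 * n + 1)) e x v) =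
      mfderiv (𝓡 (2 * n + 1)) (𝓡 (2 * n + 1)) e' x v := by
  have h1 := (mdifferentiable_of_mem_maximalAtlas he).mdifferentiableAt hx
  have h2 : MDifferentiableAt (𝓡 (2 * n + 1)) (𝓡 (2 * n + 1)) (fun y => e' (e.symm y)) (e x) :=
    (contDiffAt_transition he he' hx hx').contMDiffAt.mdifferentiableAt (by simp)
  have h3 := mfderiv_comp x h2 h1
  have h4 : (fun y => e' (e.symm y)) ∘ e =ᶠ[𝓝 x] e' := by
    filter_upwards [e.open_source.mem_nhds hx] with z hz
    simp [e.left_inv hz]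
  rw [h4.mfderiv_eq] at h3
  rw [h3, mfderiv_eq_fderiv]
  rfl

/-- The tangent space at `x` is the model space by way of the preferred chart at `x`; so derivatives
of transitions out of this chart are derivatives of charts. -/
theorem mfderiv_chartAt_self (x : M) :
    mfderiv (𝓡 (2 * n + 1)) (𝓡 (2 * n + 1)) (chartAt (Heis n) x) x =
      ContinuousLinearMap.id ℝ (TSp n x) := by
  have := mfderiv_extChartAt_self (I := 𝓡 (2 * n + 1)) (x := x)
  exact this

/-- The differential of a chart, as a continuous linear equivalence. -/
noncomputable def chartDeriv (he : e ∈ IsManifold.maximalAtlas (𝓡 (2 * n + 1)) ∞ M) {x : M}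
    (hx : x ∈ e.source) : TSp n x ≃L[ℝ] Heis n :=
  (mdifferentiable_of_mem_maximalAtlas he).mfderiv hx

variable [MeasurableSpace M] [BorelSpace M]

theorem IsChartDensity.aemeasurable {μ : Measure M} {w : Heis n → ℝ} (h : IsChartDensity μ e w) :
    AEMeasurable (fun y => ENNReal.ofReal (w y)) (volume.restrict e.target) :=
  (h.smooth.continuousOn.aemeasurable e.open_target.measurableSet).ennreal_ofReal

theorem IsChartDensity.lintegral_eq {μ : Measure M} {w : Heis n → ℝ} (h : IsChartDensity μ e w)
    {f : M → ℝ≥0∞} (hf : Measurable f) :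
    ∫⁻ y in e.target, ENNReal.ofReal (w y) * f (e.symm y) = ∫⁻ x in e.source, f x ∂μ := by
  have hs : AEMeasurable (fun y => f (e.symm y)) (volume.restrict e.target) :=
    hf.comp_aemeasurable (e.continuousOn_symm.aemeasurable e.open_target.measurableSet)
  have he : AEMeasurable e (μ.restrict e.source) :=
    e.continuousOn.aemeasurable e.open_source.measurableSet
  have h1 := lintegral_withDensity_eq_lintegral_mul₀ h.aemeasurable hs
  simp only [Pi.mul_apply] at h1
  rw [← h1, ← h.map_eq, lintegral_map' _ he]
  · refine setLIntegral_congr_fun e.open_source.measurableSet fun x hx => ?_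
    simp only [e.left_inv hx]
  · rw [h.map_eq]
    exact hs.mono_ac (withDensity_absolutelyContinuous _ _)

/-- The transformation law of densities. -/
theorem IsChartDensity.transform {μ : Measure M} {w w' : Heis n → ℝ} (h : IsChartDensity μ e w)
    (h' : IsChartDensity μ e' w') (he : e ∈ IsManifold.maximalAtlas (𝓡 (2 * n + 1)) ∞ M)
    (he' : e' ∈ IsManifold.maximalAtlas (𝓡 (2 * n + 1)) ∞ M) {x : M} (hx : x ∈ e.source)
    (hx' : x ∈ e'.source) :
    w (e x) = w' (e' x) * |(fderiv ℝ (fun y => e' (e.symm y)) (e x)).det| := by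
  set σ := fun y => e' (e.symm y) with hσ
  set U := e.target ∩ e.symm ⁻¹' e'.source with hU
  have hUo : IsOpen U := e.symm.isOpen_inter_preimage e'.open_source
  have hUs : ∀ y ∈ U, ContDiffAt ℝ ∞ σ y := by
    intro y hy
    have := contDiffAt_transition he he' (e.map_target hy.1) hy.2
    rwa [e.right_inv hy.1] at this
  have hinj : InjOn σ U := by
    intro y hy z hz hyz
    have h1 := e'.injOn hy.2 hz.2 hyz
    exact e.symm.injOn hy.1 hz.1 h1
  have hmapsU : ∀ y ∈ U, σ y ∈ e'.target := fun y hy => e'.map_source hy.2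
  -- Both densities compute the same `μ`-mass of the set `S ⊆ M` corresponding to `A ∩ U`, in the
  -- two charts. The densities therefore agree almost everywhere on `U`, and everywhere by
  -- continuity.
  have key : (volume.restrict U).withDensity (fun y => ENNReal.ofReal (w y)) =
      (volume.restrict U).withDensity
        (fun y => ENNReal.ofReal (w' (σ y) * |(fderiv ℝ σ y).det|)) := by
    ext A hA
    rw [withDensity_apply _ hA, withDensity_apply _ hA, Measure.restrict_restrict hA]
    set B := A ∩ U with hB
    have hBm : MeasurableSet B := hA.inter hUo.measurableSet
    set S : Set M := e.source ∩ e ⁻¹' B with hS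
    have hSm : MeasurableSet S := by
      have h2 : MeasurableSet (e.source.domRestrict e ⁻¹' B) :=
        e.continuousOn.domRestrict.measurable hBm
      convert MeasurableSet.subtype_image e.open_source.measurableSet h2 using 1
      ext z; simp [hS, and_comm]
    have h1 := h.lintegral_eq (f := S.indicator 1) (measurable_one.indicator hSm)
    have h2 := h'.lintegral_eq (f := S.indicator 1) (measurable_one.indicator hSm)
    have hSs : S ⊆ e.source := inter_subset_left
    have hSs' : S ⊆ e'.source := by
      rintro z ⟨hz1, hz2⟩
      have := hz2.2.2
      simp only [mem_preimage, e.left_inv hz1] at this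
      exact this
    have h3 : ∫⁻ x in e.source, S.indicator 1 x ∂μ = ∫⁻ x in e'.source, S.indicator 1 x ∂μ := by
      rw [lintegral_indicator_one hSm, lintegral_indicator_one hSm,
        Measure.restrict_apply hSm, Measure.restrict_apply hSm, inter_eq_left.2 hSs,
        inter_eq_left.2 hSs']
    have hBt : B ⊆ e.target := fun y hy => hy.2.1
    have h4 : ∫⁻ y in e.target, ENNReal.ofReal (w y) * S.indicator 1 (e.symm y) =
        ∫⁻ y in B, ENNReal.ofReal (w y) := by
      rw [← inter_eq_right.2 hBt, inter_comm, ← Measure.restrict_restrict hBm,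
        ← lintegral_indicator hBm]
      refine setLIntegral_congr_fun e.open_target.measurableSet fun y hy => ?_
      by_cases hyB : y ∈ B
      · have : e.symm y ∈ S := ⟨e.map_target hy, by simpa [e.right_inv hy] using hyB⟩
        simp [hyB, this]
      · have : e.symm y ∉ S := fun hS => hyB (by simpa [e.right_inv hy] using hS.2)
        simp [hyB, this]
    have hσBm : MeasurableSet (σ '' B) :=
      measurable_image_of_fderivWithin hBm
        (fun y hy => ((hUs y hy.2).differentiableAt (by simp)).hasFDerivAt.hasFDerivWithinAt)
        (hinj.mono inter_subset_right)
    have h5 : ∫⁻ y in e'.target, ENNReal.ofReal (w' y) * S.indicator 1 (e'.symm y) =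
        ∫⁻ y in σ '' B, ENNReal.ofReal (w' y) := by
      have hsub : σ '' B ⊆ e'.target := by
        rintro _ ⟨y, hy, rfl⟩; exact hmapsU y hy.2
      rw [← inter_eq_right.2 hsub, inter_comm, ← Measure.restrict_restrict hσBm,
        ← lintegral_indicator hσBm]
      refine setLIntegral_congr_fun e'.open_target.measurableSet fun y hy => ?_
      by_cases hyB : y ∈ σ '' B
      · have : e'.symm y ∈ S := by
          obtain ⟨z, hz, rfl⟩ := hyB
          simp only [hσ, e'.left_inv hz.2.2]
          exact ⟨e.map_target hz.2.1, by simpa [e.right_inv hz.2.1] using hz⟩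
        simp [hyB, this]
      · have : e'.symm y ∉ S := fun hS => hyB ⟨e (e'.symm y), hS.2, by
          simp only [hσ, e.left_inv hS.1, e'.right_inv hy]⟩
        simp [hyB, this]
    rw [← h4, h1, h3, ← h2, h5, lintegral_image_eq_lintegral_abs_det_fderiv_mul volume hBm
      (fun y hy => ((hUs y hy.2).differentiableAt (by simp)).hasFDerivAt.hasFDerivWithinAt)
        (hinj.mono inter_subset_right)]
    refine setLIntegral_congr_fun hBm fun y hy => ?_
    rw [mul_comm, ENNReal.ofReal_mul (h'.pos _ (hmapsU y hy.2)).le]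
  have hc1 : ContinuousOn w U := h.smooth.continuousOn.mono inter_subset_left
  have hσc : ContinuousOn σ U := fun y hy => (hUs y hy).continuousAt.continuousWithinAt
  have hc2 : ContinuousOn (fun y => w' (σ y) * |(fderiv ℝ σ y).det|) U := by
    refine (h'.smooth.continuousOn.comp hσc hmapsU).mul (ContinuousOn.abs fun y hy => ?_)
    have : ContinuousAt (fderiv ℝ σ) y :=
      ((hUs y hy).fderiv_right (m := 1) (by norm_cast)).continuousAt
    exact (ContinuousLinearMap.continuous_det.continuousAt.comp this).continuousWithinAt
  rw [withDensity_eq_iff_of_sigmaFinite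
    (hc1.aemeasurable hUo.measurableSet).ennreal_ofReal
    (hc2.aemeasurable hUo.measurableSet).ennreal_ofReal] at key
  have key2 : w =ᵐ[volume.restrict U] fun y => w' (σ y) * |(fderiv ℝ σ y).det| := by
    filter_upwards [key, self_mem_ae_restrict hUo.measurableSet] with y hy hyU
    rwa [ENNReal.ofReal_eq_ofReal_iff (h.pos y hyU.1).le
      (mul_nonneg (h'.pos _ (hmapsU y hyU)).le (abs_nonneg _))] at hy
  have hxU : e x ∈ U := ⟨e.map_source hx, by simpa [e.left_inv hx] using hx'⟩
  have := Measure.eqOn_open_of_ae_eq key2 hUo hc1 hc2 hxU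
  simpa only [hσ, e.left_inv hx] using this

end Charts

/-! ## The canonical contact form of the Heisenberg group -/

namespace Heis

variable {n : ℕ}

theorem p_hor (x : Heis n) (j : Fin n) : (hor x).p j = x.p j :=
  hor_coord x (by simp [Fin.ext_iff])

theorem q_hor (x : Heis n) (j : Fin n) : (hor x).q j = x.q j :=
  hor_coord x (by simp [Fin.ext_iff])

/-- The coordinate `p` as a continuous linear map. -/
noncomputable def pL (j : Fin n) : Heis n →L[ℝ] ℝ := EuclideanSpace.proj ⟨j + 1, by omega⟩

/-- The coordinate `q` as a continuous linear map. -/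
noncomputable def qL (j : Fin n) : Heis n →L[ℝ] ℝ := EuclideanSpace.proj ⟨n + j + 1, by omega⟩

theorem pL_apply (x : Heis n) (j : Fin n) : pL j x = x.p j := rfl

theorem qL_apply (x : Heis n) (j : Fin n) : qL j x = x.q j := rfl

/-- The linear part of the contact form. -/
noncomputable def formLin : Heis n →L[ℝ] Heis n →L[ℝ] ℝ :=
  (1 / 2 : ℝ) • ∑ j, ((pL j).smulRight (qL j) - (qL j).smulRight (pL j))

theorem formLin_apply (x v : Heis n) :
    formLin x v = (1 / 2) * ∑ j, (x.p j * v.q j - x.q j * v.p j) := by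
  simp [formLin, pL_apply, qL_apply]

theorem form_eq (x v : Heis n) : form x v = vert v + formLin x v := by
  rw [formLin_apply]; rfl

/-- The canonical contact form as a transverse form. -/
noncomputable def transverseForm (n : ℕ) : TransverseForm n where
  form x := vert + formLin x
  contDiff := by fun_prop
  apply_e0 x := by
    have h : hor (e0 : Heis n) = 0 := hor_e0
    have hp : ∀ j, (e0 : Heis n).p j = 0 := fun j => by
      rw [← p_hor, h]; rfl
    have hq : ∀ j, (e0 : Heis n).q j = 0 := fun j => by
      rw [← q_hor, h]; rfl
    simp [formLin_apply, hp, hq]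
  growth := by
    refine ⟨‖(vert : Heis n →L[ℝ] ℝ)‖ + ‖(formLin : Heis n →L[ℝ] Heis n →L[ℝ] ℝ)‖, fun x => ?_⟩
    have h : formLin x = formLin (hor x) := by
      ext v; simp [formLin_apply, p_hor, q_hor]
    rw [h]
    have h1 := (formLin : Heis n →L[ℝ] Heis n →L[ℝ] ℝ).le_opNorm (hor x)
    have h2 := norm_add_le (vert : Heis n →L[ℝ] ℝ) (formLin (hor x))
    nlinarith [norm_nonneg (vert : Heis n →L[ℝ] ℝ), norm_nonneg (hor x),
      norm_nonneg (formLin : Heis n →L[ℝ] Heis n →L[ℝ] ℝ)]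

theorem transverseForm_apply (x v : Heis n) : (transverseForm n).form x v = form x v :=
  (form_eq x v).symm

/-- The linear part of the contact form is an alternating bilinear form `½ ω`, and `¼ ω(x + y, x -
y) = -½ ω(x, y)`. So the kernels of the theorem are the kernels of the canonical transverse form. -/
theorem mul_inv_eq_diff (x y : Heis n) : x.mul y.inv = (transverseForm n).diff x y := by
  refine ext_hor ?_ ?_
  · rw [TransverseForm.hor_diff]
    ext i
    by_cases hi : i = 0
    · subst hi; simp
    · rw [hor_coord _ hi, hor_coord _ hi]
      simp [mul, inv, hi, sub_eq_add_neg]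
  · rw [TransverseForm.diff_zero_coord, transverseForm_apply]
    simp only [mul, inv, form, p, q, if_true, PiLp.neg_apply, PiLp.sub_apply, PiLp.smul_apply,
      PiLp.add_apply, smul_eq_mul]
    rw [add_assoc, sub_eq_add_neg, add_assoc]
    congr 2
    rw [Finset.mul_sum, Finset.mul_sum]
    refine Finset.sum_congr rfl fun j _ => ?_
    ring

end Heis

/-! ## Adapted charts -/

section Adapted

set_option linter.unusedSectionVars false

open Heis

variable {n : ℕ} {M : Type*} [TopologicalSpace M] [ChartedSpace (Heis n) M]
  [IsManifold (𝓡 (2 * n + 1)) ∞ M] {C : ContactStructure n M}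

/-- A chart together with a transverse form whose kernel is the image of the contact structure. -/
structure AdaptedChart (C : ContactStructure n M) where
  chart : OpenPartialHomeomorph M (Heis n)
  mem_atlas : chart ∈ IsManifold.maximalAtlas (𝓡 (2 * n + 1)) ∞ M
  form : TransverseForm n
  map_contact : ∀ x ∈ chart.source, ∀ v : TSp n x, v ∈ C.H x ↔
    form.form (chart x) (mfderiv (𝓡 (2 * n + 1)) (𝓡 (2 * n + 1)) chart x v) = 0

/-- A contact chart is adapted to the canonical contact form. -/
noncomputable def ContactChart.toAdapted (Φ : ContactChart C) : AdaptedChart C where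
  chart := Φ.chart
  mem_atlas := Φ.mem_atlas
  form := transverseForm n
  map_contact x hx v := (Φ.map_contact x hx v).trans
    (iff_of_eq (congrArg (· = 0) (transverseForm_apply _ _).symm))

namespace AdaptedChart

variable (φ : AdaptedChart C)

/-- The differential of the chart. -/
noncomputable def deriv (x : M) : TSp n x →L[ℝ] Heis n :=
  mfderiv (𝓡 (2 * n + 1)) (𝓡 (2 * n + 1)) φ.chart x

/-- The identification of an osculating group with the model space. -/
noncomputable def fib (x : M) (g : C.Osc x) : Heis n :=
  hor (φ.deriv x (g.1 : TSp n x)) +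
    φ.form.form (φ.chart x) (φ.deriv x (Quotient.out g.2)) • e0

@[simp] theorem hor_fib (x : M) (g : C.Osc x) :
    hor (φ.fib x g) = hor (φ.deriv x (g.1 : TSp n x)) := by simp [fib]

theorem fib_zero_coord (x : M) (g : C.Osc x) :
    φ.fib x g 0 = φ.form.form (φ.chart x) (φ.deriv x (Quotient.out g.2)) := by simp [fib]

theorem mem_H_iff {x : M} (hx : x ∈ φ.chart.source) (v : TSp n x) :
    v ∈ C.H x ↔ φ.form.form (φ.chart x) (φ.deriv x v) = 0 := φ.map_contact x hx v

/-- Two representatives differ by an element of `H`, which the form annihilates. -/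
theorem form_deriv_out {x : M} (hx : x ∈ φ.chart.source) (v : TSp n x) :
    φ.form.form (φ.chart x) (φ.deriv x (Quotient.out (Submodule.Quotient.mk v : C.Normal x))) =
      φ.form.form (φ.chart x) (φ.deriv x v) := by
  rw [← sub_eq_zero, ← map_sub, ← map_sub, ← φ.mem_H_iff hx, ← Submodule.Quotient.eq]
  exact Quotient.out_eq _

theorem fibreMap_eq (Φ : ContactChart C) (x : M) (g : C.Osc x) :
    Φ.fibreMap x g = Φ.toAdapted.fib x g := by
  refine ext_hor ?_ ?_
  · rw [hor_fib]
    ext i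
    by_cases hi : i = 0
    · subst hi; simp
    · rw [hor_coord _ hi, hor_coord _ hi]
      simp only [ContactChart.fibreMap, hi, if_false]
      rfl
  · rw [fib_zero_coord]
    simp only [ContactChart.fibreMap, if_true]
    exact (transverseForm_apply _ _).symm

section Fibre

variable {φ} {x : M}

theorem section_mk (ν : C.Normal x) : (Submodule.Quotient.mk (C.section_ x ν) : C.Normal x) = ν :=
  LinearMap.congr_fun ((C.H x).mkQ.exists_rightInverse_of_surjective
    (C.H x).range_mkQ).choose_spec ν

theorem continuous_section (C : ContactStructure n M) (x : M) : Continuous (C.section_ x) := by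
  refine (Submodule.isOpenQuotientMap_mkQ (C.H x)).isQuotientMap.continuous_iff.2 ?_
  let L : Heis n →ₗ[ℝ] Heis n := (C.section_ x).comp (C.H x).mkQ
  exact L.continuous_of_finiteDimensional

/-- The underlying vector of the osculating group. -/
noncomputable def oscHomeomorphTSp (C : ContactStructure n M) (x : M) : C.Osc x ≃ₜ TSp n x where
  toFun := C.oscToTangent x
  invFun v := (⟨v - C.section_ x (Submodule.Quotient.mk v), by
    rw [← Submodule.Quotient.eq, section_mk]⟩, Submodule.Quotient.mk v)
  left_inv := by
    rintro ⟨h, ν⟩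
    have e : (Submodule.Quotient.mk ((h : TSp n x) + C.section_ x ν) : C.Normal x) = ν := by
      rw [Submodule.Quotient.mk_add, section_mk, (Submodule.Quotient.mk_eq_zero _).2 h.2, zero_add]
    refine Prod.ext (Subtype.ext ?_) e
    change (h : TSp n x) + C.section_ x ν - C.section_ x (Submodule.Quotient.mk
      ((h : TSp n x) + C.section_ x ν)) = h
    rw [e, add_sub_cancel_right]
  right_inv v := sub_add_cancel v _
  continuous_toFun := by
    have h := continuous_section C x
    exact (continuous_subtype_val.comp continuous_fst).add (h.comp continuous_snd)
  continuous_invFun := by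
    have h := continuous_section C x
    have h2 : Continuous (Submodule.Quotient.mk : TSp n x → C.Normal x) := continuous_quot_mk
    exact Continuous.prodMk (Continuous.subtype_mk (continuous_id.sub (h.comp h2)) _) h2

/-- The underlying vector of the osculating group, as an element of the model space. -/
noncomputable def oscHomeomorph (C : ContactStructure n M) (x : M) : C.Osc x ≃ₜ Heis n :=
  oscHomeomorphTSp C x

/-- The differential of the chart as an equivalence. -/
noncomputable def derivEquiv (hx : x ∈ φ.chart.source) : Heis n ≃L[ℝ] Heis n :=
  chartDeriv φ.mem_atlas hx

/-- The normal space is a line: modulo `H` every vector is a multiple of the preimage of `e0`, with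
the value of the form as coefficient. -/
theorem exists_section_eq (hx : x ∈ φ.chart.source) : ∃ s : TSp n x, ∀ ν : C.Normal x,
    C.section_ x ν = φ.form.form (φ.chart x) (φ.deriv x (C.section_ x ν)) • s := by
  set v₁ : TSp n x := (derivEquiv hx).symm e0 with hv₁
  have h1 : φ.deriv x v₁ = e0 := (derivEquiv hx).apply_symm_apply e0
  refine ⟨C.section_ x (Submodule.Quotient.mk v₁), fun ν => ?_⟩
  set c := φ.form.form (φ.chart x) (φ.deriv x (C.section_ x ν)) with hc
  have h2 : ν = c • Submodule.Quotient.mk v₁ := by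
    rw [← section_mk ν, ← Submodule.Quotient.mk_smul, Submodule.Quotient.eq, φ.mem_H_iff hx,
      map_sub, map_sub, map_smul, map_smul, h1, φ.form.apply_e0, hc, smul_eq_mul, mul_one, sub_self]
  conv_lhs => rw [h2, map_smul]

theorem exists_fib_eq (hx : x ∈ φ.chart.source) : ∃ r : Heis n, ∀ g : C.Osc x,
    φ.fib x g = hor (φ.deriv x (C.oscToTangent x g)) +
      φ.form.form (φ.chart x) (φ.deriv x (C.oscToTangent x g)) • (e0 - hor r) := by
  obtain ⟨s, hs⟩ := exists_section_eq hx
  refine ⟨φ.deriv x s, fun g => ?_⟩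
  set c := φ.form.form (φ.chart x) (φ.deriv x (C.section_ x g.2)) with hc
  have e0' : φ.deriv x (C.oscToTangent x g) = φ.deriv x (g.1 : TSp n x) +
      φ.deriv x (C.section_ x g.2) := map_add _ _ _
  have h1 : φ.form.form (φ.chart x) (φ.deriv x (C.oscToTangent x g)) = c := by
    rw [e0', map_add, (φ.mem_H_iff hx _).1 g.1.2, zero_add]
  have h2 : φ.form.form (φ.chart x) (φ.deriv x (Quotient.out g.2)) = c := by
    have := φ.form_deriv_out hx (C.section_ x g.2)
    rw [section_mk] at this
    exact this
  have h3 : φ.deriv x (C.section_ x g.2) = c • φ.deriv x s := by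
    conv_lhs => rw [hs g.2, map_smul]
  rw [fib, h1, h2, e0', h3, map_add, map_smul]
  module

/-- The osculating group is homeomorphic to the model space. -/
theorem exists_fib_linear (hx : x ∈ φ.chart.source) : ∃ B : Heis n ≃L[ℝ] Heis n,
    (∀ g : C.Osc x, φ.fib x g = B (C.oscToTangent x g)) ∧
    LinearMap.det (B : Heis n →ₗ[ℝ] Heis n) =
      LinearMap.det ((derivEquiv hx : Heis n ≃L[ℝ] Heis n) : Heis n →ₗ[ℝ] Heis n) := by
  obtain ⟨r, hr⟩ := exists_fib_eq hx
  set b := φ.chart x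
  let f₁ : Heis n →ₗ[ℝ] ℝ := (φ.form.form b).comp hor
  let f₂ : Heis n →ₗ[ℝ] ℝ := (vert : Heis n →L[ℝ] ℝ)
  have h₁ : f₁ e0 = 0 := by simp [f₁]
  have h₂ : f₂ (-hor r) = 0 := by simp [f₂]
  -- The first transvection replaces the vertical coordinate by the value of the form; the second
  -- subtracts this value times `hor r` and so removes the dependence on the section. Both have
  -- determinant `1`.
  let A : Heis n ≃ₗ[ℝ] Heis n := (LinearEquiv.transvection h₁).trans (LinearEquiv.transvection h₂)
  have hA : ∀ v, A v = hor v + φ.form.form b v • (e0 - hor r) := by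
    intro v
    have e : φ.form.form b v = v 0 + φ.form.form b (hor v) := φ.form.apply_eq b v
    have e1 : A v = (v + f₁ v • e0) + f₂ (v + f₁ v • e0) • (-hor r) := rfl
    have e2 : f₂ (v + f₁ v • e0) = φ.form.form b v := by
      rw [e]; simp [f₁, f₂]
    rw [e1, e2]
    have e3 : v + f₁ v • e0 = hor v + φ.form.form b v • e0 := by
      nth_rewrite 1 [← hor_add_vert v]
      rw [e, add_smul, add_assoc]; rfl
    rw [e3]
    module
  refine ⟨(derivEquiv hx).trans A.toContinuousLinearEquiv, fun g => ?_, ?_⟩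
  · rw [hr g]; exact (hA _).symm
  · have e : (((derivEquiv hx).trans A.toContinuousLinearEquiv : Heis n ≃L[ℝ] Heis n) :
        Heis n →ₗ[ℝ] Heis n) = (A : Heis n →ₗ[ℝ] Heis n) ∘ₗ
          ((derivEquiv hx : Heis n ≃L[ℝ] Heis n) : Heis n →ₗ[ℝ] Heis n) := rfl
    have e2 : (A : Heis n →ₗ[ℝ] Heis n) = (LinearMap.transvection f₂ (-hor r)) ∘ₗ
        (LinearMap.transvection f₁ e0) := rfl
    rw [e, LinearMap.det_comp, e2, LinearMap.det_comp, LinearMap.transvection.det,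
      LinearMap.transvection.det, h₁, h₂]
    simp

/-- The identification of an osculating group with the model space, as a homeomorphism. -/
noncomputable def fibHomeomorph (hx : x ∈ φ.chart.source) : C.Osc x ≃ₜ Heis n :=
  (oscHomeomorph C x).trans (exists_fib_linear hx).choose.toHomeomorph

theorem fibHomeomorph_apply (hx : x ∈ φ.chart.source) (g : C.Osc x) : fibHomeomorph hx g = φ.fib x g :=
  ((exists_fib_linear hx).choose_spec.1 g).symm

theorem map_oscToTangent_haar [MeasurableSpace M] (μ : SmoothMeasure n M) :
    (C.haar μ x).map (C.oscToTangent x) = ENNReal.ofReal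
      (μ.density (IsManifold.chart_mem_maximalAtlas (I := 𝓡 (2 * n + 1)) (n := ∞) x)
        (chartAt (Heis n) x x)) • (volume : Measure (Heis n)) := by
  have : BorelSpace (C.Osc x) := ⟨rfl⟩
  have h : MeasurableEmbedding (C.oscToTangent x) := (oscHomeomorph C x).measurableEmbedding
  have hr : range (C.oscToTangent x) = univ := (oscHomeomorph C x).range_coe
  rw [ContactStructure.haar, h.map_comap, hr, Measure.restrict_univ]

theorem isChartDensity_density [MeasurableSpace M] (μ : SmoothMeasure n M)
    {e : OpenPartialHomeomorph M (Heis n)}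
    (he : e ∈ IsManifold.maximalAtlas (𝓡 (2 * n + 1)) ∞ M) :
    IsChartDensity μ.measure e (μ.density he) := (μ.exists_density e he).choose_spec

/-- `fib` is the underlying tangent vector followed by a linear map with the determinant of the
differential of the chart. The Jacobian of the linear map is thus the one in the transformation law
of densities, from the preferred chart to this chart. -/
theorem map_fib_haar (hx : x ∈ φ.chart.source) [MeasurableSpace M] [BorelSpace M] (μ : SmoothMeasure n M) :
    (C.haar μ x).map (φ.fib x) = ENNReal.ofReal (μ.density φ.mem_atlas (φ.chart x)) •
      (volume : Measure (Heis n)) := by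
  have : BorelSpace (C.Osc x) := ⟨rfl⟩
  obtain ⟨B, hB, hdet⟩ := exists_fib_linear hx
  have e : φ.fib x = B ∘ C.oscToTangent x := funext hB
  have h1 : Measurable (C.oscToTangent x) := (oscHomeomorph C x).continuous.measurable
  have hB0 : LinearMap.det (B : Heis n →ₗ[ℝ] Heis n) ≠ 0 :=
    (LinearEquiv.isUnit_det' B.toLinearEquiv).ne_zero
  have hB1 : Measure.map B (volume : Measure (Heis n)) =
      ENNReal.ofReal |(LinearMap.det (B : Heis n →ₗ[ℝ] Heis n))⁻¹| • volume :=
    Measure.map_linearMap_addHaar_eq_smul_addHaar volume hB0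
  rw [e, ← Measure.map_map B.continuous.measurable h1, map_oscToTangent_haar, Measure.map_smul,
    hB1, smul_smul]
  congr 1
  have hc := mem_chart_source (Heis n) x
  have hca := IsManifold.chart_mem_maximalAtlas (I := 𝓡 (2 * n + 1)) (n := ∞) x
  have h2 := (isChartDensity_density μ hca).transform
    (isChartDensity_density μ φ.mem_atlas) hca φ.mem_atlas hc hx
  have hpos := (isChartDensity_density μ hca).pos _ ((chartAt (Heis n) x).map_source hc)
  rw [← ENNReal.ofReal_mul hpos.le, h2]
  congr 1
  have h3 : fderiv ℝ (fun y => φ.chart ((chartAt (Heis n) x).symm y)) (chartAt (Heis n) x x) =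
      ((derivEquiv hx : Heis n ≃L[ℝ] Heis n) : Heis n →L[ℝ] Heis n) := by
    ext1 v
    have h4 := fderiv_transition hca φ.mem_atlas hc hx v
    rw [mfderiv_chartAt_self] at h4
    exact h4
  rw [h3]
  have h5 : (((derivEquiv hx : Heis n ≃L[ℝ] Heis n) : Heis n →L[ℝ] Heis n)).det =
      LinearMap.det ((derivEquiv hx : Heis n ≃L[ℝ] Heis n) : Heis n →ₗ[ℝ] Heis n) := rfl
  rw [h5, hdet, abs_inv, mul_assoc, mul_inv_cancel₀, mul_one]
  rw [← hdet]
  exact abs_ne_zero.2 hB0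

theorem lintegral_fib (hx : x ∈ φ.chart.source) [MeasurableSpace M] [BorelSpace M] (μ : SmoothMeasure n M)
    (f : Heis n → ℝ≥0∞) : ∫⁻ g, f (φ.fib x g) ∂C.haar μ x =
      ENNReal.ofReal (μ.density φ.mem_atlas (φ.chart x)) * ∫⁻ z, f z := by
  have : BorelSpace (C.Osc x) := ⟨rfl⟩
  have h : MeasurableEmbedding (φ.fib x) := by
    have := (fibHomeomorph hx).measurableEmbedding
    rwa [show ⇑(fibHomeomorph hx) = φ.fib x from funext (fibHomeomorph_apply hx)] at this
  rw [← h.lintegral_map, map_fib_haar hx, lintegral_smul_measure, smul_eq_mul]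

end Fibre

end AdaptedChart

end Adapted

/-! ## The Levi form in adapted charts -/

section Levi

variable {E : Type*} [NormedAddCommGroup E] [NormedSpace ℝ E]

/-- If two functionals have the same kernel then they are proportional. -/
theorem mul_apply_eq_of_ker_eq {η ζ : E →L[ℝ] ℝ} (h : ∀ v, η v = 0 → ζ v = 0)
    (v r : E) : η v * ζ r = η r * ζ v := by
  have h1 := h (η v • r - η r • v) (by simp; ring)
  simp only [map_sub, map_smul, smul_eq_mul, sub_eq_zero] at h1
  exact h1

/-- Differentiate `η(v) ζ(r) = η(r) ζ(v)`, valid near `y₀` by proportionality. The terms containing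
`η(v)` and `ζ(v)` undifferentiated drop out, as both vanish at `y₀`. -/
theorem fderiv_apply_mul_of_ker_eq {η ζ : E → E →L[ℝ] ℝ} {y₀ : E} (hη : DifferentiableAt ℝ η y₀)
    (hζ : DifferentiableAt ℝ ζ y₀) (h : ∀ᶠ y in 𝓝 y₀, ∀ v, η y v = 0 → ζ y v = 0)
    (u v r : E) (hv : η y₀ v = 0) :
    fderiv ℝ η y₀ u v * ζ y₀ r = η y₀ r * fderiv ℝ ζ y₀ u v := by
  have happ : ∀ {f : E → E →L[ℝ] ℝ}, DifferentiableAt ℝ f y₀ → ∀ w : E,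
      HasFDerivAt (fun y => f y w) ((fderiv ℝ f y₀).flip w) y₀ := fun hf w => by
    have := hf.hasFDerivAt.clm_apply (hasFDerivAt_const w y₀)
    simpa using this
  have h1 := ((happ hη v).mul (happ hζ r)).sub ((happ hη r).mul (happ hζ v))
  have h2 : HasFDerivAt (fun _ : E => (0 : ℝ)) (0 : E →L[ℝ] ℝ) y₀ := hasFDerivAt_const _ _
  have h3 := h1.unique (h2.congr_of_eventuallyEq (by
    filter_upwards [h] with y hy
    exact sub_eq_zero.2 (mul_apply_eq_of_ker_eq hy v r)))
  have h4 := congrArg (fun L => L u) h3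
  have hv' := h.self_of_nhds v hv
  simp [hv, hv'] at h4
  linarith

/-- The exterior derivative commutes with pullback: the terms with second derivatives of `τ` cancel
by symmetry. -/
theorem fderiv_pullback_antisymm {θ : E → E →L[ℝ] ℝ} {τ : E → E} {y₀ : E}
    (hθ : DifferentiableAt ℝ θ (τ y₀)) (hτ : ContDiffAt ℝ ∞ τ y₀) :
    DifferentiableAt ℝ (fun y => (θ (τ y)).comp (fderiv ℝ τ y)) y₀ ∧ ∀ u v,
    fderiv ℝ (fun y => (θ (τ y)).comp (fderiv ℝ τ y)) y₀ u v -
      fderiv ℝ (fun y => (θ (τ y)).comp (fderiv ℝ τ y)) y₀ v u =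
      fderiv ℝ θ (τ y₀) (fderiv ℝ τ y₀ u) (fderiv ℝ τ y₀ v) -
        fderiv ℝ θ (τ y₀) (fderiv ℝ τ y₀ v) (fderiv ℝ τ y₀ u) := by
  have h1 : HasFDerivAt (fun y => θ (τ y)) ((fderiv ℝ θ (τ y₀)).comp (fderiv ℝ τ y₀)) y₀ :=
    hθ.hasFDerivAt.comp y₀ (hτ.differentiableAt (by simp)).hasFDerivAt
  have h2 : HasFDerivAt (fderiv ℝ τ) (fderiv ℝ (fderiv ℝ τ) y₀) y₀ :=
    ((hτ.fderiv_right (m := 1) (by norm_cast)).differentiableAt (by simp)).hasFDerivAt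
  have h3 := h1.clm_comp h2
  refine ⟨h3.differentiableAt, fun u v => ?_⟩
  have hs : IsSymmSndFDerivAt ℝ τ y₀ := by
    refine hτ.isSymmSndFDerivAt ?_
    rw [minSmoothness_of_isRCLikeNormedField]
    norm_cast
  rw [h3.fderiv]
  simp [hs.eq u v]

end Levi

/-! ### Local defining forms in the preferred charts. -/

section LocalForm

variable {n : ℕ} {M : Type*} [TopologicalSpace M] [ChartedSpace (Heis n) M]
  [IsManifold (𝓡 (2 * n + 1)) ∞ M]

theorem IsLocalDefiningForm.contDiffAt {H : ∀ x : M, Submodule ℝ (TSp n x)} {U : Set M}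
    {θ : ∀ x : M, TSp n x →L[ℝ] ℝ} (h : IsLocalDefiningForm H U θ) {x : M} (hx : x ∈ U) :
    ContDiffAt ℝ ∞ (formInChart θ x) (chartAt (Heis n) x x) := by
  have h1 := (contMDiffAt_hom_bundle _).1 ((h.smooth).contMDiffAt (h.isOpen.mem_nhds hx))
  have h2 := h1.2
  have hs : ContMDiffAt (𝓡 (2 * n + 1)) (𝓡 (2 * n + 1)) ∞ (chartAt (Heis n) x).symm
      (chartAt (Heis n) x x) :=
    (contMDiffOn_symm_of_mem_maximalAtlas (IsManifold.chart_mem_maximalAtlas x)).contMDiffAt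
      ((chartAt (Heis n) x).open_target.mem_nhds (mem_chart_target _ x))
  have hl : (chartAt (Heis n) x).symm (chartAt (Heis n) x x) = x :=
    (chartAt (Heis n) x).left_inv (mem_chart_source _ x)
  rw [← hl] at h2
  have h3 := (h2.comp _ hs).contDiffAt
  rw [hl] at h3
  refine h3.congr_of_eventuallyEq ?_
  filter_upwards [(chartAt (Heis n) x).open_target.mem_nhds (mem_chart_target _ x)] with y hy
  have hy' : (chartAt (Heis n) x).symm y ∈ (chartAt (Heis n) x).source :=
    (chartAt (Heis n) x).map_target hy
  have e1 := TangentBundle.symmL_trivializationAt (I := 𝓡 (2 * n + 1)) hy'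
  have e2 : extChartAt (𝓡 (2 * n + 1)) x ((chartAt (Heis n) x).symm y) = y :=
    (chartAt (Heis n) x).right_inv hy
  have e3 : (trivializationAt ℝ (Bundle.Trivial M ℝ) x).continuousLinearMapAt ℝ
      ((chartAt (Heis n) x).symm y) = ContinuousLinearMap.id ℝ ℝ :=
    Bundle.Trivial.continuousLinearMapAt_trivialization ℝ M ℝ _
  simp only [Function.comp, ContinuousLinearMap.inCoordinates]
  rw [e1, e2, e3, ModelWithCorners.range_eq_univ, mfderivWithin_univ]
  rfl

theorem formInChart_apply (θ : ∀ x : M, TSp n x →L[ℝ] ℝ) (x : M) {z : M}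
    (hz : z ∈ (chartAt (Heis n) x).source) (v : TSp n z) :
    formInChart θ x (chartAt (Heis n) x z)
      (mfderiv (𝓡 (2 * n + 1)) (𝓡 (2 * n + 1)) (chartAt (Heis n) x) z v) = θ z v := by
  have h1 := (mdifferentiable_of_mem_maximalAtlas
    (IsManifold.chart_mem_maximalAtlas (I := 𝓡 (2 * n + 1)) (n := ∞) x)).symm_comp_deriv hz
  have h2 : mfderiv (𝓡 (2 * n + 1)) (𝓡 (2 * n + 1)) (chartAt (Heis n) x).symm
    (chartAt (Heis n) x z) (mfderiv (𝓡 (2 * n + 1)) (𝓡 (2 * n + 1)) (chartAt (Heis n) x) z v) = v :=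
    congrArg (fun L : TSp n z →L[ℝ] TSp n z => L v) h1
  have hl : (extChartAt (𝓡 (2 * n + 1)) x).symm (chartAt (Heis n) x z) = z :=
    (chartAt (Heis n) x).left_inv hz
  have h3 : (formInChart θ x (chartAt (Heis n) x z)
      (mfderiv (𝓡 (2 * n + 1)) (𝓡 (2 * n + 1)) (chartAt (Heis n) x) z v)) =
      (θ ((extChartAt (𝓡 (2 * n + 1)) x).symm (chartAt (Heis n) x z)) : Heis n →L[ℝ] ℝ)
      (mfderiv (𝓡 (2 * n + 1)) (𝓡 (2 * n + 1)) (chartAt (Heis n) x).symm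
        (chartAt (Heis n) x z)
        (mfderiv (𝓡 (2 * n + 1)) (𝓡 (2 * n + 1)) (chartAt (Heis n) x) z v)) := rfl
  rw [h3, h2, hl]

theorem formInChart_self (θ : ∀ x : M, TSp n x →L[ℝ] ℝ) (x : M) (v : Heis n) :
    formInChart θ x (chartAt (Heis n) x x) v = θ x v := by
  have h := formInChart_apply θ x (mem_chart_source _ x) v
  rw [mfderiv_chartAt_self] at h
  exact h

end LocalForm

/-! ### Adapted charts and the osculating group law. -/

section AdaptedLevi

open Heis

variable {n : ℕ} {M : Type*} [TopologicalSpace M] [ChartedSpace (Heis n) M]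
  [IsManifold (𝓡 (2 * n + 1)) ∞ M] {C : ContactStructure n M}

theorem ContactStructure.isLocalDefiningForm_formAt (x : M) :
    ∃ U, x ∈ U ∧ IsLocalDefiningForm C.H U (C.formAt x) := (C.exists_form x).choose_spec

namespace AdaptedChart

variable (φ : AdaptedChart C) {x : M}

/-- On `H` the exterior derivatives of two forms with kernel `H` are proportional, with the same
factor as the forms themselves. Both forms are compared in the preferred chart at `x`, where
`extDerivAt` is defined; the factor is fixed by `r`. -/
theorem form_mul_extDerivAt (hx : x ∈ φ.chart.source) {h h' : TSp n x} (hh : h ∈ C.H x)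
    (hh' : h' ∈ C.H x) (r : TSp n x) (hr : C.formAt x x r = 1) :
    extDerivAt (C.formAt x) x h h' * φ.form.form (φ.chart x) (φ.deriv x r) =
      fderiv ℝ φ.form.form (φ.chart x) (φ.deriv x h) (φ.deriv x h') -
        fderiv ℝ φ.form.form (φ.chart x) (φ.deriv x h') (φ.deriv x h) := by
  obtain ⟨U, hxU, hU⟩ := C.isLocalDefiningForm_formAt x
  have hca := IsManifold.chart_mem_maximalAtlas (I := 𝓡 (2 * n + 1)) (n := ∞) x
  have hc := mem_chart_source (Heis n) x
  set c := chartAt (Heis n) x with hcdef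
  set τ : Heis n → Heis n := fun y => φ.chart (c.symm y) with hτ
  have hτs : ContDiffAt ℝ ∞ τ (c x) := contDiffAt_transition hca φ.mem_atlas hc hx
  have hτx : τ (c x) = φ.chart x := congrArg φ.chart (c.left_inv hc)
  have hτd : ∀ v : TSp n x, fderiv ℝ τ (c x) v = φ.deriv x v := by
    intro v
    have h4 := fderiv_transition hca φ.mem_atlas hc hx v
    rw [mfderiv_chartAt_self] at h4
    exact h4
  have hη : DifferentiableAt ℝ (formInChart (C.formAt x) x) (c x) :=
    (hU.contDiffAt hxU).differentiableAt (by simp)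
  obtain ⟨hζ, hanti⟩ := fderiv_pullback_antisymm (φ.form.differentiable (τ (c x))) hτs
  have hker : ∀ᶠ y in 𝓝 (c x), ∀ v, formInChart (C.formAt x) x y v = 0 →
      ((φ.form.form (τ y)).comp (fderiv ℝ τ y)) v = 0 := by
    have h1 : c.symm ⁻¹' (U ∩ φ.chart.source) ∈ 𝓝 (c x) := by
      refine (c.continuousAt_symm (c.map_source hc)).preimage_mem_nhds ?_
      rw [c.left_inv hc]
      exact (hU.isOpen.inter φ.chart.open_source).mem_nhds ⟨hxU, hx⟩
    filter_upwards [h1, c.open_target.mem_nhds (c.map_source hc)] with y hy hyt v hv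
    have hz := c.map_target hyt
    obtain ⟨w, rfl⟩ : ∃ w : TSp n (c.symm y), mfderiv (𝓡 (2 * n + 1)) (𝓡 (2 * n + 1)) c
        (c.symm y) w = v := by
      refine ⟨(chartDeriv hca hz).symm v, ?_⟩
      exact (chartDeriv hca hz).apply_symm_apply v
    have e1 := formInChart_apply (C.formAt x) x hz w
    have e2 := fderiv_transition hca φ.mem_atlas hz hy.2 w
    rw [c.right_inv hyt] at e2
    have e3 : c (c.symm y) = y := c.right_inv hyt
    rw [← hcdef, e3] at e1
    have e4 := e1.symm.trans hv
    rw [hU.ker_eq _ hy.1, φ.mem_H_iff hy.2] at e4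
    exact (congrArg (φ.form.form (τ y)) e2).trans e4
  have hη0 : ∀ v : Heis n, formInChart (C.formAt x) x (c x) v = C.formAt x x v :=
    formInChart_self _ x
  have hz1 := fderiv_apply_mul_of_ker_eq hη hζ hker h h' r
    ((hη0 h').trans ((hU.ker_eq x hxU h').2 hh'))
  have hz2 := fderiv_apply_mul_of_ker_eq hη hζ hker h' h r
    ((hη0 h).trans ((hU.ker_eq x hxU h).2 hh))
  have hr0 : formInChart (C.formAt x) x (c x) r = 1 := (hη0 r).trans hr
  rw [hr0, one_mul] at hz1 hz2
  have hr' : ((φ.form.form (τ (c x))).comp (fderiv ℝ τ (c x))) r =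
      φ.form.form (φ.chart x) (φ.deriv x r) :=
    (congrArg (φ.form.form (τ (c x))) (hτd r)).trans (by rw [hτx])
  rw [hr'] at hz1 hz2
  have e5 := hanti h h'
  rw [hτd, hτd, hτx, ← hz1, ← hz2, ← sub_mul] at e5
  exact e5

/-- Horizontal vectors are their own horizontal lifts, and by `form_mul_extDerivAt` the Levi form
becomes the antisymmetrized derivative of the form in the chart. Hence `fib` carries the group law
of `T_H M_x` to `mulAt`. -/
theorem fib_oscMul (hx : x ∈ φ.chart.source) (g g' : C.Osc x) :
    φ.fib x (C.oscMul x g g') = φ.form.mulAt (φ.chart x) (φ.fib x g) (φ.fib x g') := by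
  have hlift : ∀ g : C.Osc x, φ.form.lift (φ.chart x) (φ.fib x g) = φ.deriv x (g.1 : TSp n x) := by
    intro g
    rw [← TransverseForm.lift_hor, hor_fib, TransverseForm.lift_hor]
    exact φ.form.lift_of_form_eq_zero ((φ.mem_H_iff hx _).1 g.1.2)
  refine ext_hor ?_ ?_
  · rw [hor_fib, TransverseForm.mulAt]
    simp only [map_add, map_smul, hor_e0, smul_zero, add_zero, hor_fib]
    rw [← map_add hor, ← map_add]
    rfl
  · set r := (C.exists_normal x).choose with hr
    have hr1 : C.formAt x x r = 1 := (C.exists_normal x).choose_spec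
    set c := extDerivAt (C.formAt x) x (g.1 : TSp n x) (g'.1 : TSp n x) with hc
    have e1 : (C.oscMul x g g').2 = Submodule.Quotient.mk (Quotient.out g.2 + Quotient.out g'.2 +
        (1 / 2 * c) • r) := by
      have h1 : (Submodule.Quotient.mk (Quotient.out g.2) : C.Normal x) = g.2 := Quotient.out_eq _
      have h2 : (Submodule.Quotient.mk (Quotient.out g'.2) : C.Normal x) = g'.2 := Quotient.out_eq _
      rw [Submodule.Quotient.mk_add, Submodule.Quotient.mk_add, Submodule.Quotient.mk_smul, h1, h2,
        mul_smul]
      rfl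
    rw [fib_zero_coord, e1, φ.form_deriv_out hx, TransverseForm.mulAt, hlift, hlift,
      ← φ.form_mul_extDerivAt hx g.1.2 g'.1.2 r hr1]
    simp only [map_add, map_smul, PiLp.add_apply, PiLp.smul_apply, e0_zero, fib_zero_coord,
      smul_eq_mul, mul_one]
    ring

theorem fib_oscInv (hx : x ∈ φ.chart.source) (g : C.Osc x) :
    φ.fib x (C.oscInv x g) = -φ.fib x g := by
  refine ext_hor ?_ ?_
  · rw [hor_fib, map_neg, hor_fib, ← map_neg, ← map_neg]
    rfl
  · have e1 : (C.oscInv x g).2 = Submodule.Quotient.mk (-Quotient.out g.2) := by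
      have h1 : (Submodule.Quotient.mk (Quotient.out g.2) : C.Normal x) = g.2 := Quotient.out_eq _
      rw [Submodule.Quotient.mk_neg, h1]
      rfl
    rw [fib_zero_coord, e1, φ.form_deriv_out hx, PiLp.neg_apply, fib_zero_coord, map_neg, map_neg]

/-- The transition between two adapted charts. -/
theorem isTransition (ψ : AdaptedChart C) (hx : x ∈ φ.chart.source) (hx' : x ∈ ψ.chart.source) :
    TransverseForm.IsTransition ψ.form φ.form (fun y => φ.chart (ψ.chart.symm y))
      (ψ.chart x) where
  contDiffAt := contDiffAt_transition ψ.mem_atlas φ.mem_atlas hx' hx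
  ker := by
    have h1 : ψ.chart.symm ⁻¹' φ.chart.source ∈ 𝓝 (ψ.chart x) := by
      refine (ψ.chart.continuousAt_symm (ψ.chart.map_source hx')).preimage_mem_nhds ?_
      rw [ψ.chart.left_inv hx']
      exact φ.chart.open_source.mem_nhds hx
    filter_upwards [h1, ψ.chart.open_target.mem_nhds (ψ.chart.map_source hx')] with y hy hyt v hv
    have hz := ψ.chart.map_target hyt
    obtain ⟨w, rfl⟩ : ∃ w : TSp n (ψ.chart.symm y), ψ.deriv (ψ.chart.symm y) w = v :=
      ⟨(chartDeriv ψ.mem_atlas hz).symm v, (chartDeriv ψ.mem_atlas hz).apply_symm_apply v⟩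
    have e2 := fderiv_transition ψ.mem_atlas φ.mem_atlas hz hy w
    rw [ψ.chart.right_inv hyt] at e2
    have e3 := (ψ.mem_H_iff hz w).2 (by rw [ψ.chart.right_inv hyt]; exact hv)
    rw [φ.mem_H_iff hy] at e3
    have e4 : fderiv ℝ (fun y => φ.chart (ψ.chart.symm y)) y (ψ.deriv (ψ.chart.symm y) w) =
      φ.deriv (ψ.chart.symm y) w := e2
    rw [e4]
    exact e3
  inverse := by
    refine ⟨fun y => ψ.chart (φ.chart.symm y), ?_, ?_, ?_⟩
    · simp only [ψ.chart.left_inv hx']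
      exact contDiffAt_transition φ.mem_atlas ψ.mem_atlas hx hx'
    · have h1 : ψ.chart.symm ⁻¹' φ.chart.source ∈ 𝓝 (ψ.chart x) := by
        refine (ψ.chart.continuousAt_symm (ψ.chart.map_source hx')).preimage_mem_nhds ?_
        rw [ψ.chart.left_inv hx']
        exact φ.chart.open_source.mem_nhds hx
      filter_upwards [h1, ψ.chart.open_target.mem_nhds (ψ.chart.map_source hx')] with y hy hyt
      rw [φ.chart.left_inv hy, ψ.chart.right_inv hyt]
    · simp only [ψ.chart.left_inv hx']
      have h1 : φ.chart.symm ⁻¹' ψ.chart.source ∈ 𝓝 (φ.chart x) := by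
        refine (φ.chart.continuousAt_symm (φ.chart.map_source hx)).preimage_mem_nhds ?_
        rw [φ.chart.left_inv hx]
        exact ψ.chart.open_source.mem_nhds hx'
      filter_upwards [h1, φ.chart.open_target.mem_nhds (φ.chart.map_source hx)] with y hy hyt
      rw [ψ.chart.left_inv hy, φ.chart.right_inv hyt]

/-- The identifications by two charts differ by the induced map of the transition: the chain rule
gives the horizontal part, and the conformal factor gives the vertical coordinate. -/
theorem fib_eq_fibreTrans (ψ : AdaptedChart C) (hx : x ∈ φ.chart.source)
    (hx' : x ∈ ψ.chart.source) (g : C.Osc x) :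
    φ.fib x g = TransverseForm.fibreTrans ψ.form φ.form (fun y => φ.chart (ψ.chart.symm y))
      (ψ.chart x) (ψ.fib x g) := by
  have hlift : ψ.form.lift (ψ.chart x) (ψ.fib x g) = ψ.deriv x (g.1 : TSp n x) := by
    rw [← TransverseForm.lift_hor, hor_fib, TransverseForm.lift_hor]
    exact ψ.form.lift_of_form_eq_zero ((ψ.mem_H_iff hx' _).1 g.1.2)
  have hd : ∀ v : TSp n x, fderiv ℝ (fun y => φ.chart (ψ.chart.symm y)) (ψ.chart x)
      (ψ.deriv x v) = φ.deriv x v := fderiv_transition ψ.mem_atlas φ.mem_atlas hx' hx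
  have hker := (φ.isTransition ψ hx hx').ker.self_of_nhds
  have h1 := TransverseForm.IsTransition.form_fderiv (θ' := ψ.form) (θ := φ.form)
    (σ := fun y => φ.chart (ψ.chart.symm y)) hker (ψ.deriv x (Quotient.out g.2))
  rw [hd] at h1
  simp only [ψ.chart.left_inv hx'] at h1
  rw [TransverseForm.fibreTrans, hlift, hd, fib_zero_coord]
  simp only [ψ.chart.left_inv hx']
  rw [← h1, fib]

end AdaptedChart

end AdaptedLevi

/-! ## Existence of adapted charts -/

section Existence

open Heis

/-- A form which is transverse at a point agrees near this point with a multiple of a globally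
defined transverse form. -/
theorem exists_transverseForm {n : ℕ} {κ : Heis n → Heis n →L[ℝ] ℝ} {y₀ : Heis n}
    (hκ : ContDiffAt ℝ 1 κ y₀) (h0 : κ y₀ e0 ≠ 0) :
    ∃ θ : TransverseForm n, ∀ᶠ y in 𝓝 y₀, κ y e0 ≠ 0 ∧ θ.form y = (κ y e0)⁻¹ • κ y := by
  have happ : ∀ y, ContDiffAt ℝ 1 κ y → ContDiffAt ℝ 1 (fun y => κ y e0) y := fun y h =>
    h.clm_apply contDiffAt_const
  have hev : ∀ᶠ y in 𝓝 y₀, ContDiffAt ℝ 1 κ y ∧ κ y e0 ≠ 0 :=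
    (hκ.eventually (by simp)).and ((happ y₀ hκ).continuousAt.eventually_ne h0)
  obtain ⟨ε, hε, hball⟩ := Metric.mem_nhds_iff.1 hev
  let χ : ContDiffBump y₀ := ⟨ε / 4, ε / 2, by positivity, by linarith⟩
  have hsub : tsupport χ ⊆ Metric.ball y₀ ε := by
    rw [χ.tsupport_eq]
    exact Metric.closedBall_subset_ball (by change ε / 2 < ε; linarith)
  -- The normalized form is cut off to the constant form `vert`. The difference has compact support,
  -- so the new form is globally bounded, and its value on `e0` remains `1`.
  set f : Heis n → Heis n →L[ℝ] ℝ := fun y => χ y • ((κ y e0)⁻¹ • κ y - vert) with hf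
  have hfs : ContDiff ℝ 1 f := by
    rw [contDiff_iff_contDiffAt]
    intro y
    by_cases hy : y ∈ tsupport χ
    · obtain ⟨h1, h2⟩ := hball (hsub hy)
      exact χ.contDiffAt.smul ((((happ y h1).inv h2).smul h1).sub contDiffAt_const)
    · have : f =ᶠ[𝓝 y] fun _ => 0 := by
        filter_upwards [notMem_tsupport_iff_eventuallyEq.1 hy] with z hz
        simp [hf, hz]
      exact contDiffAt_const.congr_of_eventuallyEq this
  have hfc : HasCompactSupport f := χ.hasCompactSupport.smul_right
  obtain ⟨B, hB⟩ := hfs.continuous.bounded_above_of_compact_support hfc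
  have hB0 : 0 ≤ B := (norm_nonneg _).trans (hB 0)
  refine ⟨⟨fun y => vert + f y, contDiff_const.add hfs, fun y => ?_, ?_⟩, ?_⟩
  · by_cases hy : y ∈ tsupport χ
    · have h2 := (hball (hsub hy)).2
      simp [hf, h2]
    · have : χ y = 0 := image_eq_zero_of_notMem_tsupport hy
      simp [hf, this]
  · refine ⟨‖(vert : Heis n →L[ℝ] ℝ)‖ + B, fun y => ?_⟩
    have h1 := norm_add_le (vert : Heis n →L[ℝ] ℝ) (f y)
    have h2 := hB y
    nlinarith [norm_nonneg (vert : Heis n →L[ℝ] ℝ), norm_nonneg (hor y)]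
  · filter_upwards [hev, χ.eventuallyEq_one] with y hy hχ
    refine ⟨hy.2, ?_⟩
    simp only [hf, hχ, Pi.one_apply, one_smul, add_sub_cancel]

variable {n : ℕ} {M : Type*} [TopologicalSpace M] [ChartedSpace (Heis n) M]
  [IsManifold (𝓡 (2 * n + 1)) ∞ M]

/-- The preferred chart is followed by a linear isomorphism taking a vector transverse to `H` at `x`
to `e0`. Near `x` the contact structure is then the kernel of a form that can be normalized on `e0`;
its normal form plays no role. -/
theorem AdaptedChart.exists_mem_source (C : ContactStructure n M) (x : M) :
    ∃ φ : AdaptedChart C, x ∈ φ.chart.source := by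
  obtain ⟨U, hxU, hU⟩ := C.isLocalDefiningForm_formAt x
  have hca := IsManifold.chart_mem_maximalAtlas (I := 𝓡 (2 * n + 1)) (n := ∞) x
  have hc := mem_chart_source (Heis n) x
  set c := chartAt (Heis n) x with hcdef
  set η := formInChart (C.formAt x) x with hη
  obtain ⟨r, hr⟩ : ∃ r : Heis n, η (c x) r ≠ 0 := by
    obtain ⟨r, hr⟩ := C.exists_normal x
    refine ⟨r, ?_⟩
    have h : η (c x) r = C.formAt x x r := formInChart_self _ x r
    rw [h, hr]
    exact one_ne_zero
  have hr0 : r ≠ 0 := by rintro rfl; simp at hr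
  have he0 : (e0 : Heis n) ≠ 0 := fun h => by
    have := congrArg (fun v : Heis n => v 0) h
    simp at this
  obtain ⟨A, hA⟩ := SeparatingDual.exists_continuousLinearEquiv_apply_eq (R := ℝ) hr0 he0
  set κ : Heis n → Heis n →L[ℝ] ℝ := fun y => (η (A.symm y)).comp (A.symm : Heis n →L[ℝ] Heis n)
    with hκ
  have hκs : ContDiffAt ℝ 1 κ (A (c x)) := by
    have h1 : ContDiffAt ℝ 1 η (A.symm (A (c x))) := by
      rw [A.symm_apply_apply]
      exact (hU.contDiffAt hxU).of_le (by norm_cast)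
    have h2 := h1.comp (A (c x)) A.symm.contDiff.contDiffAt
    exact h2.clm_comp contDiffAt_const
  obtain ⟨θ, hθ⟩ := exists_transverseForm hκs (by
    simp only [hκ, ContinuousLinearMap.comp_apply, ContinuousLinearEquiv.coe_coe,
      A.symm_apply_apply]
    rwa [← hA, A.symm_apply_apply])
  obtain ⟨W, hW, hWo, hxW⟩ := mem_nhds_iff.1 hθ
  set S : Set M := c.source ∩ c ⁻¹' (A ⁻¹' W) with hS
  have hSo : IsOpen S := c.isOpen_inter_preimage (hWo.preimage A.continuous)
  let φ : OpenPartialHomeomorph M (Heis n) :=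
    (c.trans A.toHomeomorph.toOpenPartialHomeomorph).restrOpen (S ∩ U) (hSo.inter hU.isOpen)
  have hφs : ∀ z ∈ φ.source, z ∈ c.source ∧ z ∈ S ∧ z ∈ U := by
    intro z hz
    simp only [φ, OpenPartialHomeomorph.restrOpen_source] at hz
    exact ⟨hz.2.1.1, hz.2.1, hz.2.2⟩
  have hφc : ∀ z, φ z = A (c z) := fun z => rfl
  have hφm : φ ∈ IsManifold.maximalAtlas (𝓡 (2 * n + 1)) ∞ M := by
    refine φ.mem_maximalAtlas_of_contMDiffOn ?_ ?_
    · have h1 : ContMDiffOn (𝓡 (2 * n + 1)) (𝓡 (2 * n + 1)) ∞ c φ.source :=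
        (contMDiffOn_of_mem_maximalAtlas hca).mono fun z hz => (hφs z hz).1
      exact A.contDiff.contMDiff.comp_contMDiffOn h1
    · have h1 := contMDiffOn_symm_of_mem_maximalAtlas hca
      have h2 : ContMDiffOn (𝓡 (2 * n + 1)) (𝓡 (2 * n + 1)) ∞ A.symm φ.target :=
        A.symm.contDiff.contMDiff.contMDiffOn
      refine h1.comp h2 fun y hy => ?_
      have h3 : c (φ.symm y) = A.symm y := by
        have h4 := φ.right_inv hy
        rw [hφc] at h4
        rw [← h4, A.symm_apply_apply]
        congr 1
        rw [h4]
      change A.symm y ∈ c.target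
      rw [← h3]
      exact c.map_source (hφs _ (φ.map_target hy)).1
  refine ⟨⟨φ, hφm, θ, fun z hz v => ?_⟩, ?_⟩
  · obtain ⟨hz1, hz2, hz3⟩ := hφs z hz
    have hd : mfderiv (𝓡 (2 * n + 1)) (𝓡 (2 * n + 1)) φ z v =
        A (mfderiv (𝓡 (2 * n + 1)) (𝓡 (2 * n + 1)) c z v) := by
      have h1 := (mdifferentiable_of_mem_maximalAtlas hca).mdifferentiableAt hz1
      have h2 : MDifferentiableAt (𝓡 (2 * n + 1)) (𝓡 (2 * n + 1)) A (c z) :=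
        A.differentiableAt.mdifferentiableAt
      have h3 := mfderiv_comp z h2 h1
      have h4 : mfderiv (𝓡 (2 * n + 1)) (𝓡 (2 * n + 1)) φ z =
        mfderiv (𝓡 (2 * n + 1)) (𝓡 (2 * n + 1)) (A ∘ c) z := rfl
      rw [h4, h3, mfderiv_eq_fderiv, A.fderiv]
      rfl
    obtain ⟨h5, h6⟩ := hW hz2.2
    have h7 : θ.form (φ z) (A (mfderiv (𝓡 (2 * n + 1)) (𝓡 (2 * n + 1)) c z v)) =
        (κ (A (c z)) e0)⁻¹ * C.formAt x z v := by
      rw [hφc, h6]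
      change _ * η (A.symm (A (c z))) (A.symm (A _)) = _
      rw [A.symm_apply_apply]
      congr 1
      exact (congrArg (η (c z)) (A.symm_apply_apply _)).trans (formInChart_apply _ x hz1 v)
    have h8 : θ.form (φ z) (mfderiv (𝓡 (2 * n + 1)) (𝓡 (2 * n + 1)) φ z v) =
        (κ (A (c z)) e0)⁻¹ * C.formAt x z v := (congrArg (θ.form (φ z)) hd).trans h7
    refine Iff.trans ?_ (iff_of_eq (congrArg (· = 0) h8.symm))
    rw [← hU.ker_eq z hz3, mul_eq_zero, or_iff_right (inv_ne_zero h5)]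
  · simp only [φ, OpenPartialHomeomorph.restrOpen_source]
    exact ⟨by simpa using hc, ⟨hc, hxW⟩, hxU⟩

end Existence

/-! ## The topology of the Heisenberg tangent bundle -/

section HeisTangent

set_option linter.unusedSectionVars false

open Heis

variable {n : ℕ} {M : Type*} [TopologicalSpace M] [ChartedSpace (Heis n) M]
  [IsManifold (𝓡 (2 * n + 1)) ∞ M] {e : OpenPartialHomeomorph M (Heis n)}

theorem continuousOn_mfderiv_chart (he : e ∈ IsManifold.maximalAtlas (𝓡 (2 * n + 1)) ∞ M) :
    ContinuousOn (fun p : TangentBundle (𝓡 (2 * n + 1)) M =>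
      (mfderiv (𝓡 (2 * n + 1)) (𝓡 (2 * n + 1)) e p.1 p.2 : Heis n))
      (Bundle.TotalSpace.proj ⁻¹' e.source) := by
  have h1 := (contMDiffOn_of_mem_maximalAtlas he).continuousOn_tangentMapWithin (by simp)
    e.open_source.uniqueMDiffOn
  have h2 := (tangentBundleModelSpaceHomeomorph (𝓡 (2 * n + 1))).continuous.comp_continuousOn h1
  have h3 := continuous_snd.comp_continuousOn h2
  refine h3.congr fun p hp => ?_
  have h4 := tangentMapWithin_eq_tangentMap (p := p) (e.open_source.uniqueMDiffOn p.1 hp)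
    ((mdifferentiable_of_mem_maximalAtlas he).mdifferentiableAt hp)
  have h5 : ((tangentBundleModelSpaceHomeomorph (𝓡 (2 * n + 1))) (tangentMap (𝓡 (2 * n + 1))
      (𝓡 (2 * n + 1)) e p)).2 = mfderiv (𝓡 (2 * n + 1)) (𝓡 (2 * n + 1)) e p.1 p.2 := by
    rw [tangentBundleModelSpaceHomeomorph_coe]; rfl
  simp only [Function.comp]
  rw [h4]
  exact h5.symm

theorem continuousOn_mfderiv_chart_symm
    (he : e ∈ IsManifold.maximalAtlas (𝓡 (2 * n + 1)) ∞ M) :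
    ContinuousOn (fun p : Heis n × Heis n => (⟨e.symm p.1,
      mfderiv (𝓡 (2 * n + 1)) (𝓡 (2 * n + 1)) e.symm p.1 p.2⟩ : TangentBundle (𝓡 (2 * n + 1)) M))
      (e.target ×ˢ univ) := by
  have h1 := (contMDiffOn_symm_of_mem_maximalAtlas he).continuousOn_tangentMapWithin (by simp)
    e.open_target.uniqueMDiffOn
  have h2 : Continuous fun p : Heis n × Heis n =>
      (tangentBundleModelSpaceHomeomorph (𝓡 (2 * n + 1))).symm p :=
    (tangentBundleModelSpaceHomeomorph (𝓡 (2 * n + 1))).symm.continuous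
  have h3 := h1.comp h2.continuousOn (s := e.target ×ˢ univ) (fun p hp => by
    rw [tangentBundleModelSpaceHomeomorph_coe_symm]; exact hp.1)
  refine h3.congr fun p hp => ?_
  simp only [Function.comp]
  rw [tangentBundleModelSpaceHomeomorph_coe_symm]
  have h4 := tangentMapWithin_eq_tangentMap (p := (Bundle.TotalSpace.mk p.1 p.2 :
      TangentBundle (𝓡 (2 * n + 1)) (Heis n))) (e.open_target.uniqueMDiffOn p.1 hp.1)
    ((mdifferentiable_of_mem_maximalAtlas he).mdifferentiableAt_symm hp.1)
  exact h4.symm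

variable {C : ContactStructure n M}

namespace ContactStructure

/-- The projection from `H ⊕ TM` to `H ⊕ N`. -/
noncomputable def toHeisTangent (p : C.PreTangent) : C.HeisTangent :=
  ⟨p.1, (p.2.1, Submodule.Quotient.mk p.2.2)⟩

theorem continuous_toHeisTangent : Continuous (toHeisTangent : C.PreTangent → C.HeisTangent) :=
  continuous_coinduced_rng

theorem isOpen_heisTangent_iff {s : Set C.HeisTangent} :
    IsOpen s ↔ IsOpen (toHeisTangent ⁻¹' s) := isOpen_coinduced

theorem continuous_preTangent : Continuous fun p : C.PreTangent =>
    ((⟨p.1, (p.2.1 : TSp n p.1)⟩, ⟨p.1, p.2.2⟩) :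
      TangentBundle (𝓡 (2 * n + 1)) M × TangentBundle (𝓡 (2 * n + 1)) M) :=
  continuous_induced_dom

theorem continuous_preTangent_fst : Continuous fun p : C.PreTangent =>
    (⟨p.1, (p.2.1 : TSp n p.1)⟩ : TangentBundle (𝓡 (2 * n + 1)) M) :=
  continuous_fst.comp continuous_preTangent

theorem continuous_preTangent_snd : Continuous fun p : C.PreTangent =>
    (⟨p.1, p.2.2⟩ : TangentBundle (𝓡 (2 * n + 1)) M) :=
  continuous_snd.comp continuous_preTangent

theorem continuous_heisTangent_proj : Continuous fun p : C.HeisTangent => p.1 := by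
  refine continuous_coinduced_dom.2 ?_
  exact (FiberBundle.continuous_proj (Heis n) (TangentSpace (𝓡 (2 * n + 1)))).comp
    continuous_preTangent_fst

end ContactStructure

namespace AdaptedChart

open ContactStructure

variable (φ : AdaptedChart C)

theorem fib_mk {x : M} (hx : x ∈ φ.chart.source) (h : C.H x) (v : TSp n x) :
    φ.fib x ((h, Submodule.Quotient.mk v) : C.H x × C.Normal x) =
      hor (φ.deriv x (h : TSp n x)) + φ.form.form (φ.chart x) (φ.deriv x v) • e0 :=
  congrArg (fun s : ℝ => hor (φ.deriv x (h : TSp n x)) + s • e0) (φ.form_deriv_out hx v)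

/-- The map of the Heisenberg tangent bundles induced by the chart. -/
noncomputable def tangentChart (p : C.HeisTangent) : Heis n × Heis n :=
  (φ.chart p.1, φ.fib p.1 p.2)

/-- `T_H M` carries the quotient topology, so continuity is tested on `H ⊕ TM`, where the vertical
coordinate may be computed with the given representative by `fib_mk`. -/
theorem continuousOn_tangentChart :
    ContinuousOn φ.tangentChart ((fun p : C.HeisTangent => p.1) ⁻¹' φ.chart.source) := by
  have ho : IsOpen ((fun p : C.HeisTangent => p.1) ⁻¹' φ.chart.source) :=
    φ.chart.open_source.preimage continuous_heisTangent_proj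
  have key : ContinuousOn (fun p : C.PreTangent => φ.tangentChart (toHeisTangent p))
      (toHeisTangent ⁻¹' ((fun p : C.HeisTangent => p.1) ⁻¹' φ.chart.source)) := by
    have hc : ContinuousOn (fun p : C.PreTangent => φ.chart p.1)
        (toHeisTangent ⁻¹' ((fun p : C.HeisTangent => p.1) ⁻¹' φ.chart.source)) :=
      φ.chart.continuousOn.comp
        (continuous_heisTangent_proj.comp continuous_toHeisTangent).continuousOn fun p hp => hp
    have h1 : ContinuousOn (fun p : C.PreTangent => φ.deriv p.1 (p.2.1 : TSp n p.1))
        (toHeisTangent ⁻¹' ((fun p : C.HeisTangent => p.1) ⁻¹' φ.chart.source)) :=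
      (continuousOn_mfderiv_chart φ.mem_atlas).comp continuous_preTangent_fst.continuousOn
        fun p hp => hp
    have h2 : ContinuousOn (fun p : C.PreTangent => φ.deriv p.1 p.2.2)
        (toHeisTangent ⁻¹' ((fun p : C.HeisTangent => p.1) ⁻¹' φ.chart.source)) :=
      (continuousOn_mfderiv_chart φ.mem_atlas).comp continuous_preTangent_snd.continuousOn
        fun p hp => hp
    have h3 := φ.form.continuous_form_apply.comp_continuousOn (hc.prodMk h2)
    have h4 := hc.prodMk ((hor.continuous.comp_continuousOn h1).add
      (h3.smul (continuousOn_const (c := (e0 : Heis n)))))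
    refine h4.congr fun p hp => Prod.ext rfl ?_
    exact φ.fib_mk (x := p.1) hp p.2.1 p.2.2
  rw [continuousOn_open_iff ho]
  intro t ht
  rw [isOpen_heisTangent_iff]
  exact key.isOpen_inter_preimage (ho.preimage continuous_toHeisTangent) ht

/-- The inverse of the map of the Heisenberg tangent bundles induced by the chart. -/
noncomputable def tangentChartSymm (p : {p : Heis n × Heis n // p.1 ∈ φ.chart.target}) :
    C.HeisTangent :=
  ⟨φ.chart.symm p.1.1, (fibHomeomorph (φ.chart.map_target p.2)).symm p.1.2⟩

theorem tangentChart_tangentChartSymm (p : {p : Heis n × Heis n // p.1 ∈ φ.chart.target}) :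
    φ.tangentChart (φ.tangentChartSymm p) = p.1 := by
  refine Prod.ext (φ.chart.right_inv p.2) ?_
  exact (fibHomeomorph_apply (φ.chart.map_target p.2) _).symm.trans
    ((fibHomeomorph (φ.chart.map_target p.2)).apply_symm_apply _)

theorem tangentChart_injOn :
    InjOn φ.tangentChart ((fun p : C.HeisTangent => p.1) ⁻¹' φ.chart.source) := by
  rintro ⟨x, g⟩ hx ⟨y, g'⟩ hy h
  have hxy : x = y := φ.chart.injOn hx hy (congrArg Prod.fst h)
  subst hxy
  have h2 : φ.fib x g = φ.fib x g' := congrArg Prod.snd h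
  rw [← fibHomeomorph_apply hx, ← fibHomeomorph_apply hx] at h2
  rw [(fibHomeomorph hx).injective h2]

/-- The inverse is factored through an explicit continuous map into `H ⊕ TM`: the horizontal lift
gives the component in `H`, and a multiple of `e0` represents the normal component. -/
theorem continuous_tangentChartSymm : Continuous φ.tangentChartSymm := by
  have hJ : ∀ y ∈ φ.chart.target, ∀ v : Heis n, φ.deriv (φ.chart.symm y)
      (mfderiv (𝓡 (2 * n + 1)) (𝓡 (2 * n + 1)) φ.chart.symm y v) = v := fun y hy v =>
    congrArg (fun L : Heis n →L[ℝ] Heis n => L v)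
      ((mdifferentiable_of_mem_maximalAtlas φ.mem_atlas).comp_symm_deriv hy)
  have hmem : ∀ p : {p : Heis n × Heis n // p.1 ∈ φ.chart.target},
      (mfderiv (𝓡 (2 * n + 1)) (𝓡 (2 * n + 1)) φ.chart.symm p.1.1
        (φ.form.lift p.1.1 p.1.2) : TSp n (φ.chart.symm p.1.1)) ∈ C.H (φ.chart.symm p.1.1) := by
    intro p
    rw [φ.mem_H_iff (φ.chart.map_target p.2), φ.chart.right_inv p.2, hJ _ p.2]
    exact φ.form.form_lift _ _
  let s : {p : Heis n × Heis n // p.1 ∈ φ.chart.target} → C.PreTangent := fun p =>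
    ⟨φ.chart.symm p.1.1, ⟨_, hmem p⟩, mfderiv (𝓡 (2 * n + 1)) (𝓡 (2 * n + 1)) φ.chart.symm p.1.1
      (p.1.2 0 • e0 : Heis n)⟩
  have hs : Continuous s := by
    refine continuous_induced_rng.2 (Continuous.prodMk ?_ ?_)
    · refine (continuousOn_mfderiv_chart_symm φ.mem_atlas).comp_continuous
        (f := fun p : {p : Heis n × Heis n // p.1 ∈ φ.chart.target} =>
          (p.1.1, φ.form.lift p.1.1 p.1.2)) ?_ fun p => ⟨p.2, mem_univ _⟩
      exact (continuous_fst.comp continuous_subtype_val).prodMk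
        (φ.form.continuous_lift.comp continuous_subtype_val)
    · refine (continuousOn_mfderiv_chart_symm φ.mem_atlas).comp_continuous
        (f := fun p : {p : Heis n × Heis n // p.1 ∈ φ.chart.target} =>
          (p.1.1, p.1.2 0 • (e0 : Heis n))) ?_ fun p => ⟨p.2, mem_univ _⟩
      exact (continuous_fst.comp continuous_subtype_val).prodMk
        ((vert.continuous.comp (continuous_snd.comp continuous_subtype_val)).smul
          continuous_const)
  have h : φ.tangentChartSymm = fun p => toHeisTangent (s p) := by
    funext p
    refine φ.tangentChart_injOn (φ.chart.map_target p.2) (φ.chart.map_target p.2) ?_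
    rw [tangentChart_tangentChartSymm]
    refine Prod.ext (φ.chart.right_inv p.2).symm ?_
    refine Eq.symm ((φ.fib_mk (φ.chart.map_target p.2) ⟨_, hmem p⟩ _).trans ?_)
    have h1 := hJ _ p.2 (φ.form.lift p.1.1 p.1.2)
    have h2 := hJ _ p.2 (p.1.2 0 • e0)
    have h3 : φ.form.form (φ.chart (φ.chart.symm p.1.1)) (p.1.2 0 • e0) = p.1.2 0 := by
      rw [map_smul, φ.form.apply_e0, smul_eq_mul, mul_one]
    have h4 := congrArg (φ.form.form (φ.chart (φ.chart.symm p.1.1))) h2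
    rw [h3] at h4
    have h5 := congrArg hor h1
    rw [φ.form.hor_lift] at h5
    exact (congrArg₂ (fun (u : Heis n) (s : ℝ) => u + s • (e0 : Heis n)) h5 h4).trans
      (hor_add_vert _)
  rw [h]
  exact continuous_toHeisTangent.comp hs

end AdaptedChart

end HeisTangent

/-! ## Functions with compact support on the Heisenberg tangent bundle -/

section Pullback

set_option linter.unusedSectionVars false

open Heis ContactStructure

variable {n : ℕ} {M : Type*} [TopologicalSpace M] [ChartedSpace (Heis n) M]
  [IsManifold (𝓡 (2 * n + 1)) ∞ M] {C : ContactStructure n M}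

instance [T2Space M] : T2Space C.HeisTangent where
  t2 p q hpq := by
    by_cases h : p.1 = q.1
    · obtain ⟨φ, hφ⟩ := AdaptedChart.exists_mem_source C p.1
      have hne : φ.tangentChart p ≠ φ.tangentChart q := fun h2 =>
        hpq (φ.tangentChart_injOn hφ (h ▸ hφ : q.1 ∈ φ.chart.source) h2)
      obtain ⟨u, v, hu, hv, hpu, hqv, huv⟩ := t2_separation hne
      have ho : IsOpen ((fun p : C.HeisTangent => p.1) ⁻¹' φ.chart.source) :=
        φ.chart.open_source.preimage continuous_heisTangent_proj
      refine ⟨_, _, φ.continuousOn_tangentChart.isOpen_inter_preimage ho hu,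
        φ.continuousOn_tangentChart.isOpen_inter_preimage ho hv, ⟨hφ, hpu⟩,
        ⟨(h ▸ hφ : q.1 ∈ φ.chart.source), hqv⟩, ?_⟩
      exact (huv.preimage φ.tangentChart).mono inter_subset_right inter_subset_right
    · obtain ⟨u, v, hu, hv, hpu, hqv, huv⟩ := t2_separation h
      exact ⟨_, _, hu.preimage continuous_heisTangent_proj, hv.preimage continuous_heisTangent_proj,
        hpu, hqv, huv.preimage _⟩

namespace AdaptedChart

variable (φ : AdaptedChart C)

/-- Continuous functions with compact support over the target of the chart. -/
structure IsSymbol (α : Heis n × Heis n → ℂ) : Prop where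
  continuous : Continuous α
  compactSupport : HasCompactSupport α
  support_subset : tsupport α ⊆ φ.chart.target ×ˢ univ

variable [MeasurableSpace M] (μ : SmoothMeasure n M)

open Classical in
/-- The function on the Heisenberg tangent bundle given by a symbol. -/
noncomputable def pullback (α : Heis n × Heis n → ℂ) (p : C.HeisTangent) : ℂ :=
  if p.1 ∈ φ.chart.source then
    (((μ.density φ.mem_atlas (φ.chart p.1))⁻¹ : ℝ) : ℂ) * α (φ.tangentChart p)
  else 0

theorem pullback_eq (Φ : ContactChart C) (α : Heis n × Heis n → ℂ) :
    Φ.pullback μ α = Φ.toAdapted.pullback μ α := by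
  funext p
  rw [ContactChart.pullback, pullback, tangentChart, ← fibreMap_eq]
  rfl

variable {φ} {α : Heis n × Heis n → ℂ}

theorem pullback_of_mem {p : C.HeisTangent} (hp : p.1 ∈ φ.chart.source) :
    φ.pullback μ α p =
      (((μ.density φ.mem_atlas (φ.chart p.1))⁻¹ : ℝ) : ℂ) * α (φ.tangentChart p) := if_pos hp

theorem pullback_of_notMem {p : C.HeisTangent} (hp : p.1 ∉ φ.chart.source) :
    φ.pullback μ α p = 0 := if_neg hp

theorem density_pos {y : Heis n} (hy : y ∈ φ.chart.target) : 0 < μ.density φ.mem_atlas y :=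
  (isChartDensity_density μ φ.mem_atlas).pos y hy

theorem continuousOn_density : ContinuousOn (μ.density φ.mem_atlas) φ.chart.target :=
  (isChartDensity_density μ φ.mem_atlas).smooth.continuousOn

namespace IsSymbol

variable (h : φ.IsSymbol α)
include h

theorem continuous_pullback [T2Space M] : Continuous (φ.pullback μ α) := by
  rw [continuous_iff_continuousAt]
  intro p
  by_cases hp : p.1 ∈ φ.chart.source
  · have ho : IsOpen ((fun p : C.HeisTangent => p.1) ⁻¹' φ.chart.source) :=
      φ.chart.open_source.preimage continuous_heisTangent_proj
    have h1 : ContinuousOn (fun p : C.HeisTangent => φ.chart p.1)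
        ((fun p : C.HeisTangent => p.1) ⁻¹' φ.chart.source) :=
      φ.chart.continuousOn.comp continuous_heisTangent_proj.continuousOn fun p hp => hp
    have h2 := (continuousOn_density μ (φ := φ)).comp h1 fun p hp => φ.chart.map_source hp
    have h3 := h2.inv₀ fun p hp => (density_pos μ (φ.chart.map_source hp)).ne'
    have h4 := (Complex.continuous_ofReal.comp_continuousOn h3).mul
      (h.continuous.comp_continuousOn φ.continuousOn_tangentChart)
    exact (h4.congr fun p hp => pullback_of_mem μ hp).continuousAt (ho.mem_nhds hp)
  · have hK : IsCompact (φ.chart.symm '' (Prod.fst '' tsupport α)) := by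
      refine (h.compactSupport.isCompact.image continuous_fst).image_of_continuousOn
        (φ.chart.continuousOn_symm.mono ?_)
      rintro _ ⟨q, hq, rfl⟩
      exact (h.support_subset hq).1
    have hpK : p.1 ∉ φ.chart.symm '' (Prod.fst '' tsupport α) := by
      rintro ⟨_, ⟨q, hq, rfl⟩, h2⟩
      exact hp (h2 ▸ φ.chart.map_target (h.support_subset hq).1)
    have : φ.pullback μ α =ᶠ[𝓝 p] fun _ => 0 := by
      filter_upwards [(hK.isClosed.isOpen_compl.preimage
        continuous_heisTangent_proj).mem_nhds hpK] with q hq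
      by_cases hqs : q.1 ∈ φ.chart.source
      · rw [pullback_of_mem μ hqs]
        have : α (φ.tangentChart q) = 0 := by
          by_contra h0
          exact hq ⟨_, ⟨_, subset_tsupport _ h0, rfl⟩, φ.chart.left_inv hqs⟩
        rw [this, mul_zero]
      · exact pullback_of_notMem μ hqs
    exact continuousAt_const.congr this.symm

theorem hasCompactSupport_pullback [T2Space M] : HasCompactSupport (φ.pullback μ α) := by
  have hK : IsCompact ((Subtype.val : {p : Heis n × Heis n // p.1 ∈ φ.chart.target} → _) ⁻¹'
      tsupport α) := by
    rw [Subtype.isCompact_iff, image_preimage_eq_of_subset fun q hq =>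
      ⟨⟨q, (h.support_subset hq).1⟩, rfl⟩]
    exact h.compactSupport
  refine HasCompactSupport.intro (hK.image φ.continuous_tangentChartSymm) fun p hp => ?_
  by_cases hps : p.1 ∈ φ.chart.source
  · rw [pullback_of_mem μ hps]
    have : α (φ.tangentChart p) = 0 := by
      by_contra h0
      refine hp ⟨⟨φ.tangentChart p, φ.chart.map_source hps⟩, subset_tsupport _ h0, ?_⟩
      refine φ.tangentChart_injOn (φ.chart.map_target (φ.chart.map_source hps)) hps ?_
      exact φ.tangentChart_tangentChartSymm ⟨φ.tangentChart p, φ.chart.map_source hps⟩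
    rw [this, mul_zero]
  · exact pullback_of_notMem μ hps

theorem exists_lintegral_le : ∃ c : ℝ, 0 ≤ c ∧
    ∀ y, ∫⁻ z, ‖α (y, z)‖ₑ ≤ ENNReal.ofReal c := by
  obtain ⟨B, hB⟩ := h.continuous.bounded_above_of_compact_support h.compactSupport
  have hB0 : 0 ≤ B := (norm_nonneg _).trans (hB 0)
  set K := Prod.snd '' tsupport α with hK
  have hKc : IsCompact K := h.compactSupport.isCompact.image continuous_snd
  refine ⟨B * (volume : Measure (Heis n)).real K, by positivity, fun y => ?_⟩
  rw [ENNReal.ofReal_mul hB0, Measure.real, ENNReal.ofReal_toReal hKc.measure_lt_top.ne,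
    ← lintegral_indicator_const hKc.measurableSet]
  refine lintegral_mono fun z => ?_
  by_cases hz : z ∈ K
  · rw [indicator_of_mem hz, ← ofReal_norm]
    exact ENNReal.ofReal_le_ofReal (hB _)
  · have : α (y, z) = 0 := by
      by_contra h0
      exact hz ⟨(y, z), subset_tsupport _ h0, rfl⟩
    simp [this]

end IsSymbol

variable (C) in
theorem sFinite_haar (x : M) : SFinite (C.haar μ x) := by
  have : BorelSpace (C.Osc x) := ⟨rfl⟩
  have h : Measurable (oscHomeomorph C x).symm := (oscHomeomorph C x).symm.continuous.measurable
  have h2 : Measurable (oscHomeomorph C x) := (oscHomeomorph C x).continuous.measurable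
  have e : C.haar μ x = ((C.haar μ x).map (oscHomeomorph C x)).map (oscHomeomorph C x).symm := by
    rw [Measure.map_map h h2]
    simp
  rw [e, show ⇑(oscHomeomorph C x) = C.oscToTangent x from rfl, map_oscToTangent_haar]
  infer_instance

theorem measurable_fib {x : M} (hx : x ∈ φ.chart.source) : Measurable (φ.fib x) := by
  have : BorelSpace (C.Osc x) := ⟨rfl⟩
  have := (fibHomeomorph hx).continuous.measurable
  rwa [show ⇑(fibHomeomorph hx) = φ.fib x from funext (fibHomeomorph_apply hx)] at this

theorem pullback_oscMul {x : M} (hx : x ∈ φ.chart.source) (g g' : C.Osc x) :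
    φ.pullback μ α ⟨x, C.oscMul x g (C.oscInv x g')⟩ =
      (((μ.density φ.mem_atlas (φ.chart x))⁻¹ : ℝ) : ℂ) *
        α (φ.chart x, φ.form.mulAt (φ.chart x) (φ.fib x g) (-φ.fib x g')) := by
  rw [← φ.fib_oscInv hx, ← φ.fib_oscMul hx]
  exact pullback_of_mem μ hx

/-- The factor `1/w` cancels the density of the Haar measure, and by invariance both integrals
reduce to `∫ |α(y, z)| dz`, which is bounded uniformly in `y`. Uniformity in `x` makes the fibre
operators an element of the product algebra. -/
theorem IsSymbol.exists_schur_bound [T2Space M] [BorelSpace M] (h : φ.IsSymbol α) : ∃ c : ℝ, 0 ≤ c ∧ ∀ x : M,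
    Measurable (Function.uncurry fun g g' : C.Osc x =>
      φ.pullback μ α ⟨x, C.oscMul x g (C.oscInv x g')⟩) ∧
    (∀ g, ∫⁻ g', ‖φ.pullback μ α ⟨x, C.oscMul x g (C.oscInv x g')⟩‖ₑ ∂(C.haar μ x) ≤
      ENNReal.ofReal c) ∧
    ∀ g', ∫⁻ g, ‖φ.pullback μ α ⟨x, C.oscMul x g (C.oscInv x g')⟩‖ₑ ∂(C.haar μ x) ≤
      ENNReal.ofReal c := by
  obtain ⟨c, hc, hle⟩ := h.exists_lintegral_le
  refine ⟨c, hc, fun x => ?_⟩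
  by_cases hx : x ∈ φ.chart.source
  · simp only [pullback_oscMul μ hx]
    have hw := density_pos μ (φ.chart.map_source hx)
    have hw1 : ENNReal.ofReal (μ.density φ.mem_atlas (φ.chart x)) *
        ‖(((μ.density φ.mem_atlas (φ.chart x))⁻¹ : ℝ) : ℂ)‖ₑ = 1 := by
      rw [← ofReal_norm, Complex.norm_real, Real.norm_of_nonneg (by positivity),
        ← ENNReal.ofReal_mul hw.le, mul_inv_cancel₀ hw.ne', ENNReal.ofReal_one]
    have hm : Continuous fun p : Heis n × Heis n =>
        φ.form.mulAt (φ.chart x) p.1 (-p.2) := by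
      have := φ.form.continuous_mulAt.comp (f := fun p : Heis n × Heis n =>
        (φ.chart x, p.1, -p.2)) (by fun_prop)
      exact this
    refine ⟨?_, fun g => ?_, fun g' => ?_⟩
    · have h1 : Measurable fun p : Heis n × Heis n => α (φ.chart x,
          φ.form.mulAt (φ.chart x) p.1 (-p.2)) :=
        (h.continuous.comp (continuous_const.prodMk hm)).measurable
      have h2 := h1.comp (((measurable_fib hx).comp measurable_fst).prodMk
        ((measurable_fib hx).comp measurable_snd))
      exact h2.const_mul _
    · simp only [enorm_mul]
      rw [lintegral_fib hx μ fun z' => ‖(((μ.density φ.mem_atlas (φ.chart x))⁻¹ : ℝ) : ℂ)‖ₑ *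
        ‖α (φ.chart x, φ.form.mulAt (φ.chart x) (φ.fib x g) (-z'))‖ₑ,
        lintegral_const_mul' _ _ enorm_ne_top, ← mul_assoc, hw1, one_mul,
        φ.form.lintegral_mulAt_neg (φ.chart x) (φ.fib x g) fun z => ‖α (φ.chart x, z)‖ₑ]
      exact hle _
    · simp only [enorm_mul]
      rw [lintegral_fib hx μ fun z => ‖(((μ.density φ.mem_atlas (φ.chart x))⁻¹ : ℝ) : ℂ)‖ₑ *
        ‖α (φ.chart x, φ.form.mulAt (φ.chart x) z (-φ.fib x g'))‖ₑ,
        lintegral_const_mul' _ _ enorm_ne_top, ← mul_assoc, hw1, one_mul]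
      simp only [φ.form.mulAt_neg_swap (φ.chart x) (φ.fib x g')]
      rw [φ.form.lintegral_mulAt_neg (φ.chart x) (φ.fib x g') fun z => ‖α (φ.chart x, -z)‖ₑ,
        lintegral_neg_eq_self (fun z => ‖α (φ.chart x, z)‖ₑ)]
      exact hle _
  · have h0 : ∀ g g', φ.pullback μ α ⟨x, C.oscMul x g (C.oscInv x g')⟩ = 0 :=
      fun g g' => pullback_of_notMem μ hx
    simp only [h0]
    exact ⟨measurable_const, by simp, by simp⟩

theorem IsSymbol.exists_isRegularRep [T2Space M] [BorelSpace M] (h : φ.IsSymbol α) :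
    ∃ a : C.FibreOps μ, C.IsRegularRep μ (φ.pullback μ α) a := by
  obtain ⟨c, hc, hle⟩ := h.exists_schur_bound μ
  have hop : ∀ x : M, ∃ T : C.FibreOp μ x, IsKernelOp (C.haar μ x)
      (fun g g' => φ.pullback μ α ⟨x, C.oscMul x g (C.oscInv x g')⟩) T ∧ ‖T‖ ≤ c := by
    intro x
    have := sFinite_haar C μ x
    exact exists_isKernelOp (hle x).1 hc (hle x).2.1 (hle x).2.2
  choose T hT hTn using hop
  have hmem : Memℓp T ⊤ := memℓp_infty ⟨c, by rintro _ ⟨x, rfl⟩; exact hTn x⟩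
  exact ⟨(⟨T, hmem⟩ : lp (fun x : M => C.FibreOp μ x) ⊤), fun x ξ => hT x ξ⟩

/-- Continuous functions with compact support over the domain of an adapted chart are given by
symbols. -/
theorem exists_isSymbol_pullback_eq [T2Space M] {f : C.HeisTangent → ℂ} (hf : Continuous f)
    (hfc : HasCompactSupport f) {ρ : M → ℝ} (hρ : Continuous ρ)
    (hρs : tsupport ρ ⊆ φ.chart.source) :
    ∃ α, φ.IsSymbol α ∧ ∀ p, φ.pullback μ α p = ρ p.1 * f p := by
  classical
  -- The density compensates the factor `1/w` in `pullback`.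
  let α : Heis n × Heis n → ℂ := fun q => if h : q.1 ∈ φ.chart.target then
    (μ.density φ.mem_atlas q.1 : ℂ) * (ρ (φ.chart.symm q.1) * f (φ.tangentChartSymm ⟨q, h⟩)) else 0
  set S : Set (Heis n × Heis n) :=
    φ.tangentChart '' (tsupport f ∩ (fun p : C.HeisTangent => p.1) ⁻¹' tsupport ρ) with hS
  have hSc : IsCompact S := by
    refine (hfc.isCompact.inter_right ((isClosed_tsupport ρ).preimage
      continuous_heisTangent_proj)).image_of_continuousOn (φ.continuousOn_tangentChart.mono ?_)
    exact fun p hp => hρs hp.2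
  have hSt : S ⊆ φ.chart.target ×ˢ univ := by
    rintro _ ⟨p, hp, rfl⟩
    exact ⟨φ.chart.map_source (hρs hp.2), mem_univ _⟩
  have hαS : ∀ q ∉ S, α q = 0 := by
    intro q hq
    by_cases h : q.1 ∈ φ.chart.target
    · simp only [α, h, dif_pos]
      by_contra h0
      refine hq ⟨φ.tangentChartSymm ⟨q, h⟩, ⟨?_, ?_⟩, φ.tangentChart_tangentChartSymm ⟨q, h⟩⟩
      · exact subset_tsupport _ fun h1 => h0 (by rw [h1, mul_zero, mul_zero])
      · refine subset_tsupport _ fun h1 => h0 ?_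
        have h2 : ρ (φ.chart.symm q.1) = 0 := h1
        rw [h2]; simp
    · simp only [α, h, dif_neg, not_false_eq_true]
  have hαt : tsupport α ⊆ S := closure_minimal (fun q hq => by
    by_contra h
    exact hq (hαS q h)) hSc.isClosed
  have hto : IsOpen (φ.chart.target ×ˢ (univ : Set (Heis n))) :=
    φ.chart.open_target.prod isOpen_univ
  refine ⟨α, ⟨?_, hSc.of_isClosed_subset (isClosed_tsupport _) hαt, hαt.trans hSt⟩, fun p => ?_⟩
  · rw [continuous_iff_continuousAt]
    intro q
    by_cases hq : q.1 ∈ φ.chart.target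
    · have h1 : ContinuousOn α {q | q.1 ∈ φ.chart.target} := by
        rw [continuousOn_iff_continuous_domRestrict]
        have h2 : Continuous fun q : {q : Heis n × Heis n // q.1 ∈ φ.chart.target} =>
            (μ.density φ.mem_atlas q.1.1 : ℂ) *
              (ρ (φ.chart.symm q.1.1) * f (φ.tangentChartSymm q)) := by
          have h3 : Continuous fun q : {q : Heis n × Heis n // q.1 ∈ φ.chart.target} => q.1.1 :=
            continuous_fst.comp continuous_subtype_val
          refine (Complex.continuous_ofReal.comp ((continuousOn_density μ).comp_continuous h3
            fun q => q.2)).mul ((Complex.continuous_ofReal.comp (hρ.comp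
            (φ.chart.continuousOn_symm.comp_continuous h3 fun q => q.2))).mul
            (hf.comp φ.continuous_tangentChartSymm))
        refine h2.congr fun q => ?_
        have hq : q.1.1 ∈ φ.chart.target := q.2
        simp only [α, domRestrict_apply, hq, dif_pos]
      exact h1.continuousAt (by
        have := hto.mem_nhds (x := q) ⟨hq, mem_univ _⟩
        filter_upwards [this] with z hz using hz.1)
    · have : α =ᶠ[𝓝 q] fun _ => 0 := by
        filter_upwards [hSc.isClosed.isOpen_compl.mem_nhds fun h => hq (hSt h).1] with z hz
        exact hαS z hz
      exact continuousAt_const.congr this.symm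
  · by_cases hp : p.1 ∈ φ.chart.source
    · have ht := φ.chart.map_source hp
      have h1 : φ.tangentChartSymm ⟨φ.tangentChart p, ht⟩ = p :=
        φ.tangentChart_injOn (φ.chart.map_target ht) hp
          (φ.tangentChart_tangentChartSymm ⟨φ.tangentChart p, ht⟩)
      have h2 : α (φ.tangentChart p) = (μ.density φ.mem_atlas (φ.chart p.1) : ℂ) *
          (ρ p.1 * f p) := by
        have h3 : (φ.tangentChart p).1 ∈ φ.chart.target := ht
        simp only [α, h3, dif_pos]
        rw [h1]
        congr 3
        exact congrArg ρ (φ.chart.left_inv hp)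
      have hw := (density_pos μ ht).ne'
      rw [pullback_of_mem μ hp, h2, ← mul_assoc, ← Complex.ofReal_mul, inv_mul_cancel₀ hw,
        Complex.ofReal_one, one_mul]
    · have : ρ p.1 = 0 := by
        by_contra h0
        exact hp (hρs (subset_tsupport _ h0))
      rw [pullback_of_notMem μ hp, this]
      simp

end AdaptedChart

/-- A partition of unity on the compact image of the support of `f` in `M`, subordinate to finitely
many adapted charts, splits `f` into pullbacks of symbols. -/
theorem exists_sum_pullback_eq [T2Space M] [MeasurableSpace M] (μ : SmoothMeasure n M)
    {f : C.HeisTangent → ℂ} (hf : Continuous f) (hfc : HasCompactSupport f) :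
    ∃ (k : ℕ) (φ : Fin k → AdaptedChart C) (α : Fin k → Heis n × Heis n → ℂ),
      (∀ i, (φ i).IsSymbol (α i)) ∧ ∀ p, f p = ∑ i, (φ i).pullback μ (α i) p := by
  have : LocallyCompactSpace M := ChartedSpace.locallyCompactSpace (Heis n) M
  choose φ hφ using AdaptedChart.exists_mem_source C
  have hK : IsCompact ((fun p : C.HeisTangent => p.1) '' tsupport f) :=
    hfc.isCompact.image continuous_heisTangent_proj
  obtain ⟨t, ht⟩ := hK.elim_finite_subcover (fun x => (φ x).chart.source)
    (fun x => (φ x).chart.open_source) fun x _ => mem_iUnion.2 ⟨x, hφ x⟩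
  let e := t.equivFin.symm
  obtain ⟨ρ, h1, h2, -, -⟩ := exists_continuous_sum_one_of_isOpen_isCompact
    (s := fun i => (φ (e i)).chart.source) (fun i => (φ (e i)).chart.open_source) hK (by
      intro x hx
      obtain ⟨y, hy, hxy⟩ := mem_iUnion₂.1 (ht hx)
      exact mem_iUnion.2 ⟨e.symm ⟨y, hy⟩, by simpa using hxy⟩)
  choose α hα hαe using fun i => AdaptedChart.exists_isSymbol_pullback_eq (φ := φ (e i)) μ hf hfc
    (ρ i).continuous (h1 i)
  refine ⟨_, fun i => φ (e i), α, hα, fun p => ?_⟩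
  simp only [hαe]
  rw [← Finset.sum_mul]
  by_cases hp : f p = 0
  · simp [hp]
  · have h3 := h2 ⟨p, subset_tsupport _ hp, rfl⟩
    simp only [Finset.sum_apply, Pi.one_apply] at h3
    rw [← Complex.ofReal_sum, h3, Complex.ofReal_one, one_mul]

/-- This justifies speaking of the element defined by a function: the relation between functions and
families of operators is single valued. -/
theorem ContactStructure.IsRegularRep.unique [MeasurableSpace M] {μ : SmoothMeasure n M}
    {f : C.HeisTangent → ℂ} {a a' : C.FibreOps μ} (h : C.IsRegularRep μ f a)
    (h' : C.IsRegularRep μ f a') : a = a' := by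
  refine lp.ext (funext fun x => ?_)
  ext1 ξ
  exact Lp.ext ((h x ξ).trans (h' x ξ).symm)

end Pullback

/-! ## Supports of square integrable functions -/

section Support

variable {X : Type*} [MeasurableSpace X] {ν : Measure X} {D D' : Set X} {u v : Lp ℂ 2 ν}

/-- `u` vanishes almost everywhere outside `D`. -/
def SuppIn (D : Set X) (u : Lp ℂ 2 ν) : Prop := ∀ᵐ x ∂ν, x ∉ D → u x = 0

namespace SuppIn

theorem mono (h : SuppIn D u) (hD : D ⊆ D') : SuppIn D' u := by
  filter_upwards [h] with x hx hxD using hx fun h' => hxD (hD h')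

theorem add (hu : SuppIn D u) (hv : SuppIn D v) : SuppIn D (u + v) := by
  filter_upwards [hu, hv, Lp.coeFn_add u v] with x h1 h2 h3 hx
  rw [h3, Pi.add_apply, h1 hx, h2 hx, add_zero]

theorem smul (c : ℂ) (hu : SuppIn D u) : SuppIn D (c • u) := by
  filter_upwards [hu, Lp.coeFn_smul c u] with x h1 h3 hx
  rw [h3, Pi.smul_apply, h1 hx, smul_zero]

end SuppIn

/-- Operators of multiplication by indicator functions. -/
theorem exists_cutOp (ν : Measure X) (hD : MeasurableSet D) :
    ∃ L : Lp ℂ 2 ν →L[ℂ] Lp ℂ 2 ν, ∀ u : Lp ℂ 2 ν, L u =ᵐ[ν] D.indicator u := by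
  obtain ⟨L, hL⟩ := exists_weightedComp (ν := ν) (ρ := ν) (g := id) (m := D.indicator 1) (A := D)
    (fun f hf => by
      rw [← lintegral_indicator hD]
      refine lintegral_congr fun x => ?_
      by_cases hx : x ∈ D <;> simp [hx])
    (measurable_one.indicator hD) measurable_id.aemeasurable
  refine ⟨L, fun u => (hL u).trans (Eventually.of_forall fun x => ?_)⟩
  by_cases hx : x ∈ D <;> simp [hx]

open Classical in
/-- The operator of multiplication by the indicator function of a measurable set. -/
noncomputable def cutOp (ν : Measure X) (D : Set X) : Lp ℂ 2 ν →L[ℂ] Lp ℂ 2 ν :=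
  if hD : MeasurableSet D then (exists_cutOp ν hD).choose else 0

theorem cutOp_ae (hD : MeasurableSet D) (u : Lp ℂ 2 ν) : cutOp ν D u =ᵐ[ν] D.indicator u := by
  rw [cutOp, dif_pos hD]
  exact (exists_cutOp ν hD).choose_spec u

theorem suppIn_cutOp (hD : MeasurableSet D) (u : Lp ℂ 2 ν) : SuppIn D (cutOp ν D u) := by
  filter_upwards [cutOp_ae hD u] with x hx hxD
  rw [hx, indicator_of_notMem hxD]

theorem SuppIn.cutOp_eq (hD : MeasurableSet D) (h : SuppIn D u) : cutOp ν D u = u := by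
  refine Lp.ext ?_
  filter_upwards [cutOp_ae hD u, h] with x hx hxD
  rw [hx]
  by_cases h : x ∈ D
  · rw [indicator_of_mem h]
  · rw [indicator_of_notMem h, hxD h]

theorem enorm_cutOp_sq (hD : MeasurableSet D) (u : Lp ℂ 2 ν) :
    ‖cutOp ν D u‖ₑ ^ 2 = ∫⁻ x in D, ‖u x‖ₑ ^ 2 ∂ν := by
  rw [enorm_sq_eq_lintegral, ← lintegral_indicator hD]
  refine lintegral_congr_ae ?_
  filter_upwards [cutOp_ae hD u] with x hx
  rw [hx]
  by_cases h : x ∈ D <;> simp [h]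

theorem inner_cutOp (hD : MeasurableSet D) (u v : Lp ℂ 2 ν) :
    inner ℂ (cutOp ν D u) v = inner ℂ u (cutOp ν D v) := by
  rw [L2.inner_def, L2.inner_def]
  refine integral_congr_ae ?_
  filter_upwards [cutOp_ae hD u, cutOp_ae hD v] with x hx hx'
  rw [hx, hx']
  by_cases h : x ∈ D <;> simp [h]

/-- If the adjoint of `F` enlarges supports at most from `D` to `D'`, then `F u` is determined on
`D` by `u` on `D'`. -/
theorem norm_cutOp_apply_le {F : Lp ℂ 2 ν →L[ℂ] Lp ℂ 2 ν} (hD : MeasurableSet D)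
    (hD' : MeasurableSet D')
    (h : ∀ u, SuppIn D u → SuppIn D' (ContinuousLinearMap.adjoint F u)) (u : Lp ℂ 2 ν) :
    ‖cutOp ν D (F u)‖ ≤ ‖F (cutOp ν D' u)‖ := by
  set w := cutOp ν D (F u) with hw
  have hwD : SuppIn D w := suppIn_cutOp hD _
  -- `F` is moved onto `w`, which lives on `D`. The adjoint image of `w` lives on `D'`, so that `u`
  -- may be restricted to `D'` before `F` is moved back.
  have e : inner ℂ w w = inner ℂ w (F (cutOp ν D' u)) :=
    calc inner ℂ w w = inner ℂ (cutOp ν D w) (F u) := (inner_cutOp hD _ _).symm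
      _ = inner ℂ (ContinuousLinearMap.adjoint F w) u := by
        rw [hwD.cutOp_eq hD, ContinuousLinearMap.adjoint_inner_left]
      _ = inner ℂ (cutOp ν D' (ContinuousLinearMap.adjoint F w)) u := by
        rw [(h w hwD).cutOp_eq hD']
      _ = _ := by rw [inner_cutOp hD', ContinuousLinearMap.adjoint_inner_left]
  have h2 : ‖w‖ * ‖w‖ ≤ ‖w‖ * ‖F (cutOp ν D' u)‖ := by
    rw [← inner_self_eq_norm_mul_norm (𝕜 := ℂ), e]
    exact (RCLike.re_le_norm _).trans (norm_inner_le_norm _ _)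
  rcases eq_or_lt_of_le (norm_nonneg w) with h0 | h0
  · rw [← h0]; exact norm_nonneg _
  · exact le_of_mul_le_mul_left h2 h0

/-- A kernel operator composed with a weighted composition operator. -/
theorem IsWeightedComp.comp_kernel {Y : Type*} [MeasurableSpace Y] {ρ : Measure Y} {g : Y → X}
    {m : Y → ℝ} {A : Set X} {L : Lp ℂ 2 ν →L[ℂ] Lp ℂ 2 ρ} (hL : IsWeightedComp g m L)
    (hA : MeasurableSet A)
    (h : ∀ f : X → ℝ≥0∞, Measurable f →
      ∫⁻ y, ENNReal.ofReal (m y ^ 2) * f (g y) ∂ρ = ∫⁻ x in A, f x ∂ν)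
    (hm : Measurable m) (hg : AEMeasurable g (ρ.restrict {y | m y ≠ 0})) {κ : X → X → ℂ}
    (hκ : ∀ x, Measurable (κ x)) {F : Lp ℂ 2 ν →L[ℂ] Lp ℂ 2 ν} (hF : IsKernelOp ν κ F)
    (hu : SuppIn A u) :
    L (F u) =ᵐ[ρ] fun y => ∫ y', (m y * κ (g y) (g y') * m y') * L u y' ∂ρ := by
  have h1 := ae_comp_of_lintegral h hm hg (hF u)
  filter_upwards [hL (F u), h1] with y hy hy1
  rw [hy]
  have h2 : ∫ y', (m y * κ (g y) (g y') * m y') * L u y' ∂ρ =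
      ∫ y', (m y : ℂ) * m y' ^ 2 • (κ (g y) (g y') * u (g y')) ∂ρ := by
    refine integral_congr_ae ?_
    filter_upwards [hL u] with y' hy'
    rw [hy', Complex.real_smul]
    push_cast; ring
  rw [h2, integral_const_mul, integral_weightedComp h hm hg
    (f := fun x' => κ (g y) x' * u x') ((hκ _).aestronglyMeasurable.mul
      (Lp.aestronglyMeasurable u).restrict)]
  rcases hy1 with h0 | h0
  · simp [h0]
  · rw [h0, ← integral_indicator hA]
    congr 1
    refine integral_congr_ae ?_
    filter_upwards [hu] with x hx
    by_cases hxA : x ∈ A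
    · rw [indicator_of_mem hxA]
    · rw [indicator_of_notMem hxA, hx hxA, mul_zero]

end Support

/-! ## The local operators of an adapted chart -/

section LocalOperators

set_option linter.unusedSectionVars false

open Heis ContactStructure

variable {n : ℕ} {M : Type*} [TopologicalSpace M] [ChartedSpace (Heis n) M]
  [IsManifold (𝓡 (2 * n + 1)) ∞ M] {C : ContactStructure n M}

namespace AdaptedChart

variable (φ : AdaptedChart C)

section Unitary

variable [MeasurableSpace M] (μ : SmoothMeasure n M)

/-- The weight `w^(1/2)` on the image of the chart. -/
noncomputable def weight : Heis n → ℝ :=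
  φ.chart.target.indicator fun y => Real.sqrt (μ.density φ.mem_atlas y)

/-- The weight `w^(-1/2)` on the domain of the chart. -/
noncomputable def coweight : M → ℝ :=
  φ.chart.source.indicator fun x => (Real.sqrt (μ.density φ.mem_atlas (φ.chart x)))⁻¹

variable {φ}

theorem weight_pos {y : Heis n} (hy : y ∈ φ.chart.target) : 0 < φ.weight μ y := by
  rw [weight, indicator_of_mem hy]
  exact Real.sqrt_pos.2 (density_pos μ hy)

theorem weight_sq {y : Heis n} (hy : y ∈ φ.chart.target) :
    φ.weight μ y ^ 2 = μ.density φ.mem_atlas y := by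
  rw [weight, indicator_of_mem hy, Real.sq_sqrt (density_pos μ hy).le]

theorem coweight_eq {x : M} (hx : x ∈ φ.chart.source) :
    φ.coweight μ x = (φ.weight μ (φ.chart x))⁻¹ := by
  rw [weight, coweight, indicator_of_mem hx, indicator_of_mem (φ.chart.map_source hx)]

theorem coweight_of_notMem {x : M} (hx : x ∉ φ.chart.source) : φ.coweight μ x = 0 :=
  indicator_of_notMem hx _

theorem mem_target_of_weight_ne_zero {y : Heis n} (hy : φ.weight μ y ≠ 0) :
    y ∈ φ.chart.target := mem_of_indicator_ne_zero hy

theorem mem_source_of_coweight_ne_zero {x : M} (hx : φ.coweight μ x ≠ 0) :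
    x ∈ φ.chart.source := mem_of_indicator_ne_zero hx

theorem continuousOn_weight : ContinuousOn (φ.weight μ) φ.chart.target :=
  (Real.continuous_sqrt.comp_continuousOn (continuousOn_density μ)).congr fun _ hy =>
    indicator_of_mem hy _

theorem measurable_weight : Measurable (φ.weight μ) := by
  classical
  rw [weight, ← piecewise_eq_indicator]
  exact ContinuousOn.measurable_piecewise
    (Real.continuous_sqrt.comp_continuousOn (continuousOn_density μ)) continuousOn_const
    φ.chart.open_target.measurableSet

variable [BorelSpace M]

theorem measurable_coweight : Measurable (φ.coweight μ) := by
  classical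
  rw [coweight, ← piecewise_eq_indicator]
  refine ContinuousOn.measurable_piecewise (ContinuousOn.inv₀
    (Real.continuous_sqrt.comp_continuousOn ((continuousOn_density μ).comp φ.chart.continuousOn
      φ.chart.mapsTo)) fun x hx => ?_) continuousOn_const φ.chart.open_source.measurableSet
  exact (Real.sqrt_pos.2 (density_pos μ (φ.chart.map_source hx))).ne'

theorem lintegral_weight (f : M → ℝ≥0∞) (hf : Measurable f) :
    ∫⁻ y, ENNReal.ofReal (φ.weight μ y ^ 2) * f (φ.chart.symm y) =
      ∫⁻ x in φ.chart.source, f x ∂μ.measure := by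
  rw [← (isChartDensity_density μ φ.mem_atlas).lintegral_eq hf,
    ← lintegral_indicator φ.chart.open_target.measurableSet]
  refine lintegral_congr fun y => ?_
  by_cases hy : y ∈ φ.chart.target
  · rw [indicator_of_mem hy, weight_sq μ hy]
  · rw [indicator_of_notMem hy, weight, indicator_of_notMem hy]; simp

theorem aemeasurable_symm : AEMeasurable φ.chart.symm
    ((volume : Measure (Heis n)).restrict {y | φ.weight μ y ≠ 0}) :=
  (φ.chart.continuousOn_symm.aemeasurable φ.chart.open_target.measurableSet).mono_measure
    (Measure.restrict_mono (fun _ => mem_target_of_weight_ne_zero μ) le_rfl)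

theorem aemeasurable_chart : AEMeasurable φ.chart
    (μ.measure.restrict {x | φ.coweight μ x ≠ 0}) :=
  (φ.chart.continuousOn.aemeasurable φ.chart.open_source.measurableSet).mono_measure
    (Measure.restrict_mono (fun _ => mem_source_of_coweight_ne_zero μ) le_rfl)

theorem lintegral_coweight (f : Heis n → ℝ≥0∞) (hf : Measurable f) :
    ∫⁻ x, ENNReal.ofReal (φ.coweight μ x ^ 2) * f (φ.chart x) ∂μ.measure =
      ∫⁻ y in φ.chart.target, f y := by
  classical
  have hm : Measurable (φ.chart.source.piecewise φ.chart fun _ => 0) :=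
    φ.chart.continuousOn.measurable_piecewise continuousOn_const φ.chart.open_source.measurableSet
  have h := (isChartDensity_density μ φ.mem_atlas).lintegral_eq
    (f := fun x => ENNReal.ofReal (φ.coweight μ x ^ 2) *
      f ((φ.chart.source.piecewise φ.chart fun _ => 0) x))
    (((measurable_coweight μ).pow_const 2).ennreal_ofReal.mul (hf.comp hm))
  have e1 : ∫⁻ x, ENNReal.ofReal (φ.coweight μ x ^ 2) * f (φ.chart x) ∂μ.measure =
      ∫⁻ x in φ.chart.source, ENNReal.ofReal (φ.coweight μ x ^ 2) *
        f ((φ.chart.source.piecewise φ.chart fun _ => 0) x) ∂μ.measure := by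
    rw [← lintegral_indicator φ.chart.open_source.measurableSet]
    refine lintegral_congr fun x => ?_
    by_cases hx : x ∈ φ.chart.source
    · rw [indicator_of_mem hx, piecewise_eq_of_mem _ _ _ hx]
    · rw [indicator_of_notMem hx, coweight_of_notMem μ hx]; simp
  rw [e1, ← h]
  refine setLIntegral_congr_fun φ.chart.open_target.measurableSet fun y hy => ?_
  have hs := φ.chart.map_target hy
  simp only [piecewise_eq_of_mem _ _ _ hs, coweight_eq μ hs, φ.chart.right_inv hy]
  rw [inv_pow, weight_sq μ hy, ← mul_assoc, ← ENNReal.ofReal_mul (density_pos μ hy).le,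
    mul_inv_cancel₀ (density_pos μ hy).ne', ENNReal.ofReal_one, one_mul]

variable (φ) in
/-- The partial isometry `L²(M) → L²(H_n)` given by the chart. -/
noncomputable def unitary : μ.L2 →L[ℂ] Lp ℂ 2 (volume : Measure (Heis n)) :=
  (exists_weightedComp (lintegral_weight (φ := φ) μ) (measurable_weight μ)
    (aemeasurable_symm μ)).choose

theorem isWeightedComp_unitary : IsWeightedComp φ.chart.symm (φ.weight μ) (φ.unitary μ) :=
  (exists_weightedComp (lintegral_weight (φ := φ) μ) (measurable_weight μ)
    (aemeasurable_symm μ)).choose_spec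

theorem isWeightedComp_adjoint_unitary : IsWeightedComp φ.chart (φ.coweight μ)
    (ContinuousLinearMap.adjoint (φ.unitary μ)) := by
  obtain ⟨L, hL⟩ := exists_weightedComp (lintegral_coweight (φ := φ) μ) (measurable_coweight μ)
    (aemeasurable_chart μ)
  rwa [← (isWeightedComp_unitary μ).eq_adjoint hL φ.chart.open_source.measurableSet
    (lintegral_weight μ) (measurable_weight μ) (aemeasurable_symm μ)
    (fun x hx => coweight_of_notMem μ hx)
    (fun y hy => φ.chart.right_inv (mem_target_of_weight_ne_zero μ hy)) fun y hy => ?_]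
  have hyt := mem_target_of_weight_ne_zero μ hy
  rw [coweight_eq μ (φ.chart.map_target hyt), φ.chart.right_inv hyt, mul_inv_cancel₀ hy]

variable (φ) in
/-- The kernel on `M` with the given expression in the chart. -/
noncomputable def pullKernel (k : Heis n → Heis n → ℂ) (x x' : M) : ℂ :=
  φ.coweight μ x * k (φ.chart x) (φ.chart x') * φ.coweight μ x'

theorem measurable_uncurry_pullKernel {k : Heis n → Heis n → ℂ}
    (hk : Measurable (Function.uncurry k)) : Measurable (Function.uncurry (φ.pullKernel μ k)) := by
  classical
  have hm : Measurable (φ.chart.source.piecewise φ.chart fun _ => 0) :=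
    φ.chart.continuousOn.measurable_piecewise continuousOn_const φ.chart.open_source.measurableSet
  have : Function.uncurry (φ.pullKernel μ k) = fun p => φ.coweight μ p.1 *
      k (φ.chart.source.piecewise φ.chart (fun _ => 0) p.1)
        (φ.chart.source.piecewise φ.chart (fun _ => 0) p.2) * φ.coweight μ p.2 := by
    funext p
    change φ.pullKernel μ k p.1 p.2 = _
    by_cases h1 : p.1 ∈ φ.chart.source
    · by_cases h2 : p.2 ∈ φ.chart.source
      · rw [pullKernel, piecewise_eq_of_mem _ _ _ h1, piecewise_eq_of_mem _ _ _ h2]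
      · rw [pullKernel, coweight_of_notMem μ h2]; simp
    · rw [pullKernel, coweight_of_notMem μ h1]; simp
  rw [this]
  have hc := Complex.measurable_ofReal.comp (measurable_coweight (φ := φ) μ)
  exact ((hc.comp measurable_fst).mul (hk.comp ((hm.comp measurable_fst).prodMk
    (hm.comp measurable_snd)))).mul (hc.comp measurable_snd)

theorem measurable_pullKernel {k : Heis n → Heis n → ℂ} (hk : Measurable (Function.uncurry k))
    (x : M) : Measurable (φ.pullKernel μ k x) :=
  (measurable_uncurry_pullKernel μ hk).of_uncurry_left

/-- Change variables from the chart to `M`: of the three weights present at `y`, namely `w^(1/2)`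
twice and `w^(-1/2)`, one factor `w^(1/2)` is left, which is the one contained in the unitary. -/
theorem isKernelOp_conj_unitary {k : Heis n → Heis n → ℂ} (hk : Measurable (Function.uncurry k))
    {S : Lp ℂ 2 (volume : Measure (Heis n)) →L[ℂ] Lp ℂ 2 (volume : Measure (Heis n))}
    (hS : IsKernelOp volume k S) : IsKernelOp μ.measure (φ.pullKernel μ k)
      (ContinuousLinearMap.adjoint (φ.unitary μ) ∘L S ∘L φ.unitary μ) := by
  intro u
  have h1 := ae_comp_of_lintegral (lintegral_coweight (φ := φ) μ) (measurable_coweight μ)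
    (aemeasurable_chart μ) (hS (φ.unitary μ u))
  filter_upwards [isWeightedComp_adjoint_unitary μ (S (φ.unitary μ u)), h1] with x hx h1
  change ContinuousLinearMap.adjoint (φ.unitary μ) (S (φ.unitary μ u)) x = _
  rw [hx]
  rcases h1 with h1 | h1
  · simp [pullKernel, h1]
  rw [h1, ← integral_const_mul]
  have e1 : ∫ x', φ.pullKernel μ k x x' * u x' ∂μ.measure =
      ∫ x' in φ.chart.source, φ.pullKernel μ k x x' * u x' ∂μ.measure := by
    rw [← integral_indicator φ.chart.open_source.measurableSet]
    refine integral_congr_ae (Eventually.of_forall fun x' => ?_)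
    by_cases hx : x' ∈ φ.chart.source
    · simp only [indicator_of_mem hx]
    · simp only [indicator_of_notMem hx, pullKernel, coweight_of_notMem μ hx]; simp
  rw [e1, ← integral_weightedComp (lintegral_weight μ) (measurable_weight μ) (aemeasurable_symm μ)
    (f := fun x' => φ.pullKernel μ k x x' * u x') ((measurable_pullKernel μ hk x).aestronglyMeasurable.mul (Lp.aestronglyMeasurable u).restrict)]
  refine integral_congr_ae ?_
  filter_upwards [isWeightedComp_unitary μ u] with y hy
  rw [hy]
  by_cases h0 : φ.weight μ y = 0
  · simp [h0]
  have hyt := mem_target_of_weight_ne_zero μ h0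
  rw [pullKernel, φ.chart.right_inv hyt, coweight_eq μ (φ.chart.map_target hyt),
    φ.chart.right_inv hyt, Complex.real_smul]
  have h2 : (φ.weight μ y : ℂ) * ((φ.weight μ y)⁻¹ : ℝ) = 1 := by
    exact_mod_cast mul_inv_cancel₀ h0
  push_cast at h2 ⊢
  linear_combination -(φ.coweight μ x * k (φ.chart x) y * φ.weight μ y *
    u (φ.chart.symm y)) * h2

end Unitary

end AdaptedChart

end LocalOperators

/-! ### Kernels from symbols in three variables, and their local operators. -/

section KernelSymbols

set_option linter.unusedSectionVars false

open Heis ContactStructure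

/-- The integral operator with the kernel `k`, if it exists. -/
noncomputable def kernelOp {X : Type*} [MeasurableSpace X] (ν : Measure X) (k : X → X → ℂ) :
    Lp ℂ 2 ν →L[ℂ] Lp ℂ 2 ν :=
  open Classical in if h : ∃ T, IsKernelOp ν k T then h.choose else 0

theorem IsBddKernel.isKernelOp {X : Type*} [MeasurableSpace X] {ν : Measure X} [SFinite ν]
    {k : X → X → ℂ} {c : ℝ} {K : Set X} (h : IsBddKernel ν k c K) :
    IsKernelOp ν k (kernelOp ν k) := by
  have h' : ∃ T, IsKernelOp ν k T := h.exists_op.imp fun T hT => hT.1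
  rw [kernelOp, dif_pos h']
  exact h'.choose_spec

theorem IsBddKernel.adjoint_kernelOp {X : Type*} [MeasurableSpace X] {ν : Measure X} [SFinite ν]
    {k k' : X → X → ℂ} {c : ℝ} {K : Set X} (h : IsBddKernel ν k c K) (h' : IsBddKernel ν k' c K)
    (hk : ∀ x y, k' x y = (starRingEnd ℂ) (k y x)) :
    ContinuousLinearMap.adjoint (kernelOp ν k) = kernelOp ν k' := by
  have h1 := IsKernelOp.adjoint h.measurable (mul_nonneg h.nonneg measureReal_nonneg)
    h.lintegral_le h.lintegral_le' h.isKernelOp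
  have e : k' = fun x y => (starRingEnd ℂ) (k y x) := funext₂ hk
  have h2 := h'.isKernelOp
  rw [e] at h2 ⊢
  exact h1.unique h2

theorem ContinuousLinearMap.adjoint_conj {H H' : Type*} [NormedAddCommGroup H]
    [InnerProductSpace ℂ H] [CompleteSpace H] [NormedAddCommGroup H'] [InnerProductSpace ℂ H']
    [CompleteSpace H'] (W : H →L[ℂ] H') (S : H' →L[ℂ] H') :
    adjoint (adjoint W ∘L S ∘L W) = adjoint W ∘L adjoint S ∘L W := by
  rw [adjoint_comp, adjoint_comp, adjoint_adjoint, comp_assoc]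

variable {n : ℕ} {M : Type*} [TopologicalSpace M] [ChartedSpace (Heis n) M]
  [IsManifold (𝓡 (2 * n + 1)) ∞ M] {C : ContactStructure n M}

namespace AdaptedChart

variable (φ : AdaptedChart C)

/-- Continuous functions `β(x, y, z)` with compact support over the image of the chart. They define
the kernels `t^(2n+2) β(x, y, δ_t(x - y))`. -/
structure IsKernelSymbol (β : Heis n × Heis n × Heis n → ℂ) : Prop where
  continuous : Continuous β
  compactSupport : HasCompactSupport β
  support_subset : tsupport β ⊆ φ.chart.target ×ˢ φ.chart.target ×ˢ univ

/-- The kernel defined by a symbol. -/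
noncomputable def modelKernel (β : Heis n × Heis n × Heis n → ℂ) (t : ℝ) (x y : Heis n) : ℂ :=
  (t : ℂ) ^ (2 * n + 2) * β (x, y, dil t (φ.form.diff x y))

/-- The symbol of the adjoint operator. -/
def adjSymbol (β : Heis n × Heis n × Heis n → ℂ) (p : Heis n × Heis n × Heis n) : ℂ :=
  (starRingEnd ℂ) (β (p.2.1, p.1, -p.2.2))

theorem modelKernel_adjSymbol (β : Heis n × Heis n × Heis n → ℂ) (t : ℝ) (x y : Heis n) :
    φ.modelKernel (adjSymbol β) t x y = (starRingEnd ℂ) (φ.modelKernel β t y x) := by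
  rw [modelKernel, modelKernel, adjSymbol, φ.form.diff_swap x y, dil_neg]
  simp

variable {φ} {β : Heis n × Heis n × Heis n → ℂ}

namespace IsKernelSymbol

variable (h : φ.IsKernelSymbol β)
include h

theorem adjSymbol : φ.IsKernelSymbol (adjSymbol β) := by
  let e : Heis n × Heis n × Heis n ≃ₜ Heis n × Heis n × Heis n :=
    { toFun := fun p => (p.2.1, p.1, -p.2.2)
      invFun := fun p => (p.2.1, p.1, -p.2.2)
      left_inv := fun p => by simp
      right_inv := fun p => by simp
      continuous_toFun := by fun_prop
      continuous_invFun := by fun_prop }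
  have hs : tsupport (AdaptedChart.adjSymbol β) ⊆ e ⁻¹' tsupport β := by
    refine closure_minimal (fun p hp => subset_tsupport _ ?_)
      ((isClosed_tsupport β).preimage e.continuous)
    intro h0
    exact hp (by rw [AdaptedChart.adjSymbol]; exact (map_eq_zero _).2 h0)
  refine ⟨Complex.continuous_conj.comp (h.continuous.comp e.continuous), ?_, fun p hp => ?_⟩
  · exact (e.isCompact_preimage.2 h.compactSupport.isCompact).of_isClosed_subset
      (isClosed_tsupport _) hs
  · have := h.support_subset (hs hp)
    exact ⟨this.2.1, this.1, mem_univ _⟩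

theorem exists_support : ∃ K, IsCompact K ∧ K ⊆ φ.chart.target ∧
    ∀ x y z, β (x, y, z) ≠ 0 → x ∈ K ∧ y ∈ K := by
  have hc := h.compactSupport.isCompact
  refine ⟨Prod.fst '' tsupport β ∪ (fun p => p.2.1) '' tsupport β,
    (hc.image continuous_fst).union (hc.image (continuous_fst.comp continuous_snd)), ?_, ?_⟩
  · rintro _ (⟨p, hp, rfl⟩ | ⟨p, hp, rfl⟩)
    · exact (h.support_subset hp).1
    · exact (h.support_subset hp).2.1
  · intro x y z h0
    have := subset_tsupport _ (show (x, y, z) ∈ Function.support β from h0)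
    exact ⟨Or.inl ⟨_, this, rfl⟩, Or.inr ⟨_, this, rfl⟩⟩

theorem exists_bound : ∃ c, 0 ≤ c ∧ ∀ p, ‖β p‖ ≤ c := by
  obtain ⟨c, hc⟩ := h.compactSupport.exists_bound_of_continuous h.continuous
  exact ⟨c, (norm_nonneg _).trans (hc 0), hc⟩

theorem continuous_modelKernel :
    Continuous fun p : ℝ × Heis n × Heis n => φ.modelKernel β p.1 p.2.1 p.2.2 := by
  have h1 : Continuous fun p : ℝ × Heis n × Heis n => dil p.1 (φ.form.diff p.2.1 p.2.2) :=
    continuous_dil.comp (continuous_fst.prodMk (φ.form.continuous_diff.comp continuous_snd))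
  have h2 := h.continuous.comp (f := fun p : ℝ × Heis n × Heis n =>
    (p.2.1, p.2.2, dil p.1 (φ.form.diff p.2.1 p.2.2))) (by fun_prop)
  have h3 : Continuous fun p : ℝ × Heis n × Heis n => (p.1 : ℂ) ^ (2 * n + 2) := by fun_prop
  exact h3.mul h2

theorem measurable_modelKernel (t : ℝ) : Measurable (Function.uncurry (φ.modelKernel β t)) := by
  have := h.continuous_modelKernel.comp (f := fun p : Heis n × Heis n => (t, p)) (by fun_prop)
  exact this.measurable

theorem exists_isBddKernel : ∃ K, IsCompact K ∧ K ⊆ φ.chart.target ∧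
    ∀ t, ∃ c, IsBddKernel volume (φ.modelKernel β t) c K := by
  obtain ⟨K, hK, hKt, hs⟩ := h.exists_support
  obtain ⟨c, hc, hb⟩ := h.exists_bound
  refine ⟨K, hK, hKt, fun t => ⟨|t| ^ (2 * n + 2) * c, h.measurable_modelKernel t,
    hK.measurableSet, hK.measure_lt_top, by positivity, fun x y => ?_, fun x y hxy => ?_⟩⟩
  · rw [modelKernel, norm_mul, norm_pow, Complex.norm_real, Real.norm_eq_abs]
    exact mul_le_mul_of_nonneg_left (hb _) (by positivity)
  · exact hs x y _ (right_ne_zero_of_mul hxy)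

theorem isKernelOp (t : ℝ) : IsKernelOp volume (φ.modelKernel β t)
    (kernelOp volume (φ.modelKernel β t)) := by
  obtain ⟨K, -, -, hb⟩ := h.exists_isBddKernel
  obtain ⟨c, hb⟩ := hb t
  exact hb.isKernelOp

theorem adjoint_kernelOp (t : ℝ) :
    ContinuousLinearMap.adjoint (kernelOp volume (φ.modelKernel β t)) =
      kernelOp volume (φ.modelKernel (AdaptedChart.adjSymbol β) t) :=
  h.exists_isBddKernel.elim fun _ hK => (hK.2.2 t).elim fun _ hb => by
    refine hb.adjoint_kernelOp ⟨h.adjSymbol.measurable_modelKernel t, hb.measurableSet, hb.finite,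
      hb.nonneg, fun x y => ?_, fun x y hxy => ?_⟩ fun x y => φ.modelKernel_adjSymbol β t x y
    · rw [modelKernel_adjSymbol, RCLike.norm_conj]
      exact hb.bound y x
    · rw [modelKernel_adjSymbol] at hxy
      exact (hb.support y x fun h0 => hxy (by rw [h0, map_zero])).symm

theorem isCompactOperator_kernelOp (t : ℝ) :
    IsCompactOperator (kernelOp volume (φ.modelKernel β t)) := by
  obtain ⟨K, hK, -, hb⟩ := h.exists_isBddKernel
  obtain ⟨c, hb⟩ := hb t
  refine hb.isCompactOperator hK (fun ε hε => ?_) hb.isKernelOp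
  have hc : Continuous (Function.uncurry (φ.modelKernel β t)) :=
    h.continuous_modelKernel.comp (f := fun p : Heis n × Heis n => (t, p)) (by fun_prop)
  have hcs : HasCompactSupport (Function.uncurry (φ.modelKernel β t)) :=
    HasCompactSupport.intro (hK.prod hK) fun p hp => by
      by_contra h0
      exact hp (hb.support p.1 p.2 h0)
  obtain ⟨δ, hδ, hu⟩ := Metric.uniformContinuous_iff.1 (hcs.uniformContinuous_of_continuous hc) ε hε
  refine ⟨δ, hδ, fun x x' y hx => ?_⟩
  have := hu (a := (x, y)) (b := (x', y)) (by rw [Prod.dist_eq, dist_self]; exact max_lt hx hδ)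
  rw [dist_eq_norm] at this
  exact this.le

/-- All kernels vanish outside one compact set `K × K`. They depend continuously on `t` uniformly
there, and the norm of the difference is at most its supremum times the volume of `K`. -/
theorem continuous_kernelOp : Continuous fun t => kernelOp volume (φ.modelKernel β t) := by
  obtain ⟨K, hK, -, hb⟩ := h.exists_isBddKernel
  refine continuous_iff_continuousAt.2 fun t => ?_
  rw [ContinuousAt, tendsto_iff_norm_sub_tendsto_zero, Metric.tendsto_nhds]
  intro ε hε
  set V := (volume : Measure (Heis n)).real K with hV
  have hV0 : 0 ≤ V := measureReal_nonneg
  have hη : 0 < ε / (2 * (V + 1)) := by positivity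
  have hev : ∀ᶠ s in 𝓝 t, ∀ p ∈ K ×ˢ K,
      ‖φ.modelKernel β s p.1 p.2 - φ.modelKernel β t p.1 p.2‖ < ε / (2 * (V + 1)) := by
    refine (hK.prod hK).eventually_forall_mem (P := fun q : ℝ × Heis n × Heis n =>
      ‖φ.modelKernel β q.1 q.2.1 q.2.2 - φ.modelKernel β t q.2.1 q.2.2‖ < ε / (2 * (V + 1)))
      fun p _ => ?_
    have h2 := h.continuous_modelKernel
    have h3 := h.continuous_modelKernel.comp (f := fun q : ℝ × Heis n × Heis n => (t, q.2))
      (by fun_prop)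
    have h4 := (h2.sub h3).norm.tendsto (t, p)
    rw [nhds_prod_eq] at h4
    refine h4.eventually (gt_mem_nhds ?_)
    simpa using hη
  filter_upwards [hev] with s hs
  obtain ⟨c, hbs⟩ := hb s
  obtain ⟨c', hbt⟩ := hb t
  have hd : IsBddKernel volume
      (fun x y => φ.modelKernel β s x y - φ.modelKernel β t x y) (ε / (2 * (V + 1))) K := by
    have hsupp : ∀ x y, φ.modelKernel β s x y - φ.modelKernel β t x y ≠ 0 → x ∈ K ∧ y ∈ K := by
      intro x y h0
      by_contra hcon
      have e1 : φ.modelKernel β s x y = 0 := by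
        by_contra h1; exact hcon (hbs.support x y h1)
      have e2 : φ.modelKernel β t x y = 0 := by
        by_contra h1; exact hcon (hbt.support x y h1)
      exact h0 (by rw [e1, e2, sub_zero])
    refine ⟨hbs.measurable.sub hbt.measurable, hbs.measurableSet, hbs.finite, hη.le,
      fun x y => ?_, hsupp⟩
    by_cases h0 : φ.modelKernel β s x y - φ.modelKernel β t x y = 0
    · rw [h0, norm_zero]; exact hη.le
    · exact (hs (x, y) (hsupp x y h0)).le
  have hk := (hbs.mono (le_max_left c c') subset_rfl hbs.measurableSet hbs.finite).sub
    (hbt.mono (le_max_right c c') subset_rfl hbs.measurableSet hbs.finite)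
    hbs.isKernelOp hbt.isKernelOp
  have := hd.norm_le hk
  rw [Real.dist_eq, sub_zero, abs_of_nonneg (norm_nonneg _)]
  refine this.trans_lt ?_
  rw [div_mul_eq_mul_div, div_lt_iff₀ (by positivity)]
  nlinarith

end IsKernelSymbol

variable (φ) [MeasurableSpace M] [BorelSpace M] (μ : SmoothMeasure n M)

/-- The local operators on `L²(M)` defined by a symbol. -/
noncomputable def localOp (β : Heis n × Heis n × Heis n → ℂ) (t : ℝ) : μ.L2 →L[ℂ] μ.L2 :=
  ContinuousLinearMap.adjoint (φ.unitary μ) ∘L kernelOp volume (φ.modelKernel β t) ∘L φ.unitary μ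

variable {φ}

namespace IsKernelSymbol

variable (h : φ.IsKernelSymbol β)
include h

theorem isKernelOp_localOp (t : ℝ) :
    IsKernelOp μ.measure (φ.pullKernel μ (φ.modelKernel β t)) (φ.localOp μ β t) :=
  isKernelOp_conj_unitary μ (h.measurable_modelKernel t) (h.isKernelOp t)

theorem adjoint_localOp (t : ℝ) : ContinuousLinearMap.adjoint (φ.localOp μ β t) =
    φ.localOp μ (AdaptedChart.adjSymbol β) t :=
  (ContinuousLinearMap.adjoint_conj _ _).trans (congrArg (fun S =>
    ContinuousLinearMap.adjoint (φ.unitary μ) ∘L S ∘L φ.unitary μ) (h.adjoint_kernelOp t))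

theorem isCompactOperator_localOp (t : ℝ) : IsCompactOperator (φ.localOp μ β t) := by
  have h1 := (h.isCompactOperator_kernelOp t).comp_clm (φ.unitary μ)
  exact h1.clm_comp (ContinuousLinearMap.adjoint (φ.unitary μ))

theorem continuous_localOp : Continuous (φ.localOp μ β) := by
  have h1 : Continuous fun t => kernelOp volume (φ.modelKernel β t) ∘L φ.unitary μ :=
    h.continuous_kernelOp.clm_comp continuous_const
  exact continuous_const.clm_comp h1

theorem exists_suppIn_localOp [T2Space M] : ∃ K ⊆ φ.chart.source, IsCompact K ∧
    ∀ t u, SuppIn K (φ.localOp μ β t u) := by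
  obtain ⟨K, hK, hKt, hs⟩ := h.exists_support
  refine ⟨φ.chart.symm '' K, ?_, hK.image_of_continuousOn (φ.chart.continuousOn_symm.mono hKt),
    fun t u => ?_⟩
  · rintro _ ⟨y, hy, rfl⟩
    exact φ.chart.map_target (hKt hy)
  filter_upwards [h.isKernelOp_localOp μ t u] with x hx hxK
  rw [hx]
  have : ∀ x', φ.pullKernel μ (φ.modelKernel β t) x x' = 0 := fun x' => by
    by_contra h0
    have h1 : φ.coweight μ x ≠ 0 := fun h => h0 (by simp [pullKernel, h])
    have h2 : φ.modelKernel β t (φ.chart x) (φ.chart x') ≠ 0 := fun h =>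
      h0 (by simp [pullKernel, h])
    exact hxK ⟨φ.chart x, (hs _ _ _ (right_ne_zero_of_mul h2)).1,
      φ.chart.left_inv (mem_source_of_coweight_ne_zero μ h1)⟩
  simp [this]

end IsKernelSymbol

end AdaptedChart

end KernelSymbols

/-! ## The operators of contact charts -/

section ContactCharts

set_option linter.unusedSectionVars false

open Heis ContactStructure

theorem Heis.norm_dil_le {n : ℕ} {s : ℝ} (hs : 0 ≤ s) (h1 : s ≤ 1) (v : Heis n) :
    ‖dil s v‖ ≤ 3 * s * ‖v‖ := by
  refine (norm_le_hor_add _).trans ?_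
  rw [hor_dil, norm_smul, Real.norm_of_nonneg hs, dil_zero_coord, abs_mul, abs_pow, abs_of_nonneg hs]
  have h2 := norm_hor_le v
  have h3 := abs_coord_le v
  have h4 : s ^ 2 ≤ s := by nlinarith
  nlinarith [mul_le_mul h4 h3 (abs_nonneg _) hs, mul_le_mul_of_nonneg_left h2 hs]

/-- The horizontal part of `x - y` is that of `diff x y`. The vertical coordinate is recovered from
the form at the midpoint, whose norm is at most linear in the horizontal part of the midpoint, that
is, in `r` and `‖diff x y‖`. -/
theorem TransverseForm.exists_norm_sub_le {n : ℕ} (θ : TransverseForm n) {r : ℝ} (hr : 0 ≤ r) :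
    ∃ c > 0, ∀ x y : Heis n, ‖x‖ ≤ r → ‖x - y‖ ≤ c * (1 + ‖θ.diff x y‖) * ‖θ.diff x y‖ := by
  obtain ⟨C, hC⟩ := θ.growth
  have hC0 : 0 ≤ C := by
    have := (norm_nonneg _).trans (hC 0)
    simpa using this
  refine ⟨3 + 2 * C * (2 + 2 * r), by positivity, fun x y hx => ?_⟩
  set d := ‖θ.diff x y‖ with hd
  have hd0 : 0 ≤ d := norm_nonneg _
  have h1 : ‖hor (x - y)‖ ≤ 2 * d := by
    rw [← θ.hor_diff]; exact norm_hor_le _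
  have h2 : |θ.form ((1 / 2 : ℝ) • (x + y)) (x - y)| ≤ d := by
    rw [← θ.diff_zero_coord]; exact abs_coord_le _
  have e : hor ((1 / 2 : ℝ) • (x + y)) = hor x - (1 / 2 : ℝ) • hor (x - y) := by
    rw [map_smul, map_add, map_sub]; module
  have h3 : ‖hor ((1 / 2 : ℝ) • (x + y))‖ ≤ 2 * r + d := by
    rw [e]
    refine (norm_sub_le _ _).trans ?_
    rw [norm_smul, Real.norm_of_nonneg (by norm_num)]
    have := norm_hor_le x
    linarith
  have h4 : |(x - y) 0| ≤ d + C * (1 + (2 * r + d)) * (2 * d) := by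
    have e2 := θ.apply_eq ((1 / 2 : ℝ) • (x + y)) (x - y)
    have h5 : |θ.form ((1 / 2 : ℝ) • (x + y)) (hor (x - y))| ≤ C * (1 + (2 * r + d)) * (2 * d) := by
      rw [← Real.norm_eq_abs]
      refine (ContinuousLinearMap.le_opNorm _ _).trans (mul_le_mul ((hC _).trans ?_) h1
        (norm_nonneg _) (by positivity))
      gcongr
    rw [← sub_eq_iff_eq_add] at e2
    rw [← e2]
    exact (abs_sub _ _).trans (add_le_add h2 h5)
  refine (norm_le_hor_add _).trans ((add_le_add h1 h4).trans ?_)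
  nlinarith [mul_nonneg hC0 hd0, mul_nonneg (mul_nonneg hC0 hd0) hd0, mul_nonneg hC0 hr,
    mul_nonneg (mul_nonneg hC0 hr) hd0, mul_nonneg (mul_nonneg (mul_nonneg hC0 hr) hd0) hd0,
    mul_nonneg hd0 hd0]

/-- `diff x y` is the dilation by `t⁻¹` of a vector of norm at most `r`; for `t ≥ 1` this shortens
every vector to `O(1/t)`. -/
theorem TransverseForm.exists_norm_sub_le_div {n : ℕ} (θ : TransverseForm n) {r : ℝ} (hr : 0 ≤ r) :
    ∃ c ≥ 0, ∀ t ≥ 1, ∀ x y : Heis n, ‖x‖ ≤ r → ‖dil t (θ.diff x y)‖ ≤ r → ‖x - y‖ ≤ c / t := by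
  obtain ⟨c, hc, hle⟩ := θ.exists_norm_sub_le hr
  refine ⟨c * (1 + 3 * r) * (3 * r), by positivity, fun t ht x y hx hz => ?_⟩
  have ht0 : 0 < t := one_pos.trans_le ht
  have ht1 : t⁻¹ ≤ 1 := inv_le_one_of_one_le₀ ht
  have h1 : ‖θ.diff x y‖ ≤ 3 * r / t := by
    have e : θ.diff x y = dil t⁻¹ (dil t (θ.diff x y)) := by
      rw [dil_dil, inv_mul_cancel₀ ht0.ne', dil_one]
    rw [e]
    refine (norm_dil_le (by positivity) ht1 _).trans ?_
    rw [div_eq_mul_inv]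
    nlinarith [mul_le_mul_of_nonneg_left hz (inv_nonneg.2 ht0.le)]
  have h2 : 3 * r / t ≤ 3 * r := div_le_self (by positivity) ht
  refine (hle x y hx).trans ?_
  rw [mul_div_assoc]
  gcongr
  exact h1.trans h2

variable {n : ℕ} {M : Type*} [TopologicalSpace M] [ChartedSpace (Heis n) M]
  [IsManifold (𝓡 (2 * n + 1)) ∞ M] {C : ContactStructure n M}

namespace AdaptedChart

variable {φ : AdaptedChart C} {α : Heis n × Heis n → ℂ}

theorem IsSymbol.exists_radius (h : φ.IsSymbol α) : ∃ r, 0 ≤ r ∧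
    ∀ x z, α (x, z) ≠ 0 → ‖x‖ ≤ r ∧ ‖z‖ ≤ r := by
  obtain ⟨r, hr⟩ := h.compactSupport.isCompact.isBounded.exists_norm_le
  refine ⟨max r 0, le_max_right _ _, fun x z h0 => ?_⟩
  have := hr _ (subset_tsupport _ (show (x, z) ∈ Function.support α from h0))
  exact ⟨(norm_fst_le (x, z)).trans (this.trans (le_max_left _ _)),
    (norm_snd_le (x, z)).trans (this.trans (le_max_left _ _))⟩

/-- The points `x`, `y` are close if the kernel of a local operator does not vanish at `(x, y)`. -/
theorem IsSymbol.exists_close (h : φ.IsSymbol α) : ∃ c, ∀ t ≥ 1, ∀ x y,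
    α (x, dil t (φ.form.diff x y)) ≠ 0 → ‖x - y‖ ≤ c / t := by
  obtain ⟨r, hr, hs⟩ := h.exists_radius
  obtain ⟨c, hc, hle⟩ := φ.form.exists_norm_sub_le_div hr
  exact ⟨c, fun t ht x y h0 => hle t ht x y (hs x _ h0).1 (hs x _ h0).2⟩

/-- A function of two variables may be replaced by a function of three variables. -/
theorem IsSymbol.exists_isKernelSymbol (h : φ.IsSymbol α) : ∃ β, φ.IsKernelSymbol β ∧
    (∀ x z, β (x, x, z) = α (x, z)) ∧ ∀ᶠ t : ℝ in atTop, ∀ x y,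
      β (x, y, dil t (φ.form.diff x y)) = α (x, dil t (φ.form.diff x y)) := by
  set K := Prod.fst '' tsupport α with hK
  have hKc : IsCompact K := h.compactSupport.isCompact.image continuous_fst
  have hKt : K ⊆ φ.chart.target := by
    rintro _ ⟨p, hp, rfl⟩
    exact (h.support_subset hp).1
  have hαK : ∀ x z, α (x, z) ≠ 0 → x ∈ K := fun x z h0 =>
    ⟨(x, z), subset_tsupport _ h0, rfl⟩
  obtain ⟨δ, hδ, hδt⟩ := hKc.exists_cthickening_subset_open φ.chart.open_target hKt
  -- The cutoff `χ(y)` keeps `y` in the chart as well as `x`. It is `1` on the `δ/2`-neighbourhood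
  -- of the projected support; for large `t` the kernel vanishes unless `y` is within `c/t < δ/2` of
  -- `x`, so the cutoff does not change it.
  obtain ⟨χ, hχ1, hχ0, hχc, -⟩ := exists_continuous_one_zero_of_isCompact
    (hKc.cthickening (r := δ / 2)) (Metric.isOpen_thickening (δ := δ) (E := K)).isClosed_compl
    (disjoint_compl_right_iff_subset.2 (Metric.cthickening_subset_thickening' hδ (by linarith) K))
  have hχs : tsupport χ ⊆ φ.chart.target := by
    refine (closure_minimal (fun y hy => ?_) Metric.isClosed_cthickening).trans hδt
    by_contra hcon
    exact hy (hχ0 fun h => hcon (Metric.thickening_subset_cthickening _ _ h))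
  refine ⟨fun p => α (p.1, p.2.2) * χ p.2.1, ⟨?_, ?_, ?_⟩, fun x z => ?_, ?_⟩
  · have h1 := h.continuous.comp (f := fun p : Heis n × Heis n × Heis n => (p.1, p.2.2))
      (by fun_prop)
    exact h1.mul (Complex.continuous_ofReal.comp (χ.continuous.comp (by fun_prop)))
  · have hc := (h.compactSupport.isCompact.prod hχc.isCompact).image
      (f := fun q : (Heis n × Heis n) × Heis n => (q.1.1, q.2, q.1.2)) (by fun_prop)
    refine HasCompactSupport.intro hc fun p hp => ?_
    by_contra h0
    refine hp ⟨((p.1, p.2.2), p.2.1), ⟨subset_tsupport _ (left_ne_zero_of_mul h0),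
      subset_tsupport _ fun h1 => h0 (by rw [h1]; simp)⟩, rfl⟩
  · have hcl : IsClosed {p : Heis n × Heis n × Heis n | (p.1, p.2.2) ∈ tsupport α ∧
        p.2.1 ∈ tsupport χ} :=
      ((isClosed_tsupport α).preimage (by fun_prop)).inter
        ((isClosed_tsupport χ).preimage (by fun_prop))
    refine (closure_minimal (fun p hp => ?_) hcl).trans fun p hp => ?_
    · exact ⟨subset_tsupport _ (left_ne_zero_of_mul hp),
        subset_tsupport _ fun h1 => hp (by simp only [h1]; simp)⟩
    · exact ⟨(h.support_subset hp.1).1, hχs hp.2, mem_univ _⟩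
  · by_cases h0 : α (x, z) = 0
    · simp only [h0, zero_mul]
    · have : χ x = 1 := hχ1 (Metric.self_subset_cthickening _ (hαK x z h0))
      simp only [this]; simp
  · obtain ⟨c, hc⟩ := h.exists_close
    have h1 : ∀ᶠ t : ℝ in atTop, c / t < δ / 2 :=
      (tendsto_const_nhds.div_atTop tendsto_id).eventually (gt_mem_nhds (half_pos hδ))
    filter_upwards [h1, eventually_ge_atTop 1] with t ht ht1 x y
    by_cases h0 : α (x, dil t (φ.form.diff x y)) = 0
    · simp only [h0, zero_mul]
    · have : χ y = 1 := hχ1 (Metric.mem_cthickening_of_dist_le y x _ _ (hαK x _ h0) (by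
        rw [dist_comm, dist_eq_norm]
        exact (hc t ht1 x y h0).trans ht.le))
      simp only [this]; simp

/-- `IsTransported` requires the operator of the uncut kernel for every `t > 0`. For small `t` the
support may leave the chart, but it remains in a bounded set, so the kernel still gives a bounded
operator on `L²(H_n)`. -/
theorem IsSymbol.exists_isBddKernel (h : φ.IsSymbol α) {t : ℝ} (ht : 0 < t) :
    ∃ c K, IsBddKernel volume (fun x y : Heis n =>
      (t : ℂ) ^ (2 * n + 2) * α (x, dil t (φ.form.diff x y))) c K := by
  obtain ⟨r, hr, hs⟩ := h.exists_radius
  obtain ⟨c, hc, hle⟩ := φ.form.exists_norm_sub_le hr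
  obtain ⟨d, hd⟩ := h.compactSupport.exists_bound_of_continuous h.continuous
  have hd0 : 0 ≤ d := (norm_nonneg _).trans (hd 0)
  obtain ⟨s, hs2⟩ := ((isCompact_closedBall (0 : Heis n) r).image
    (continuous_dil.comp (Continuous.prodMk_right t⁻¹))).isBounded.exists_norm_le
  refine ⟨t ^ (2 * n + 2) * d, Metric.closedBall 0 (r + c * (1 + max s 0) * max s 0), ?_,
    measurableSet_closedBall, measure_closedBall_lt_top, by positivity, fun x y => ?_,
    fun x y hxy => ?_⟩
  · have h1 : Continuous fun p : Heis n × Heis n => dil t (φ.form.diff p.1 p.2) :=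
      continuous_dil.comp (continuous_const.prodMk φ.form.continuous_diff)
    have h2 := h.continuous.comp (continuous_fst.prodMk h1)
    exact (continuous_const.mul h2).measurable
  · rw [norm_mul, norm_pow, Complex.norm_real, Real.norm_of_nonneg ht.le]
    exact mul_le_mul_of_nonneg_left (hd _) (by positivity)
  · obtain ⟨hx, hz⟩ := hs x _ (right_ne_zero_of_mul hxy)
    have h1 : ‖φ.form.diff x y‖ ≤ max s 0 := by
      refine (hs2 _ ⟨dil t (φ.form.diff x y), by simpa using hz, ?_⟩).trans (le_max_left _ _)
      change dil t⁻¹ (dil t (φ.form.diff x y)) = _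
      rw [dil_dil, inv_mul_cancel₀ ht.ne', dil_one]
    have h2 : ‖x - y‖ ≤ c * (1 + max s 0) * max s 0 := (hle x y hx).trans (by gcongr)
    have h3 : ‖y‖ ≤ ‖x‖ + ‖x - y‖ := by
      rw [norm_sub_rev]
      simpa using norm_add_le x (y - x)
    rw [mem_closedBall_zero_iff, mem_closedBall_zero_iff]
    exact ⟨hx.trans (le_add_of_nonneg_right (by positivity)), h3.trans (add_le_add hx h2)⟩

end AdaptedChart

variable [MeasurableSpace M] [BorelSpace M] (μ : SmoothMeasure n M)

theorem ContactChart.isUnitary_unitary (Φ : ContactChart C) :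
    Φ.IsUnitary μ (Φ.toAdapted.unitary μ) := by
  intro f
  filter_upwards [AdaptedChart.isWeightedComp_unitary (φ := Φ.toAdapted) μ f] with y hy
  rw [hy]
  by_cases h : y ∈ Φ.chart.target
  · rw [indicator_of_mem h, AdaptedChart.weight, indicator_of_mem (show y ∈ Φ.toAdapted.chart.target
      from h)]
    rfl
  · rw [indicator_of_notMem h, AdaptedChart.weight, indicator_of_notMem (show y ∉
      Φ.toAdapted.chart.target from h)]
    simp

/-- The transported operators are eventually the local operators. -/
theorem ContactChart.exists_isTransported (Φ : ContactChart C) {α : Heis n × Heis n → ℂ}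
    (h : Φ.toAdapted.IsSymbol α) {β : Heis n × Heis n × Heis n → ℂ}
    (hβ : ∀ᶠ t : ℝ in atTop, ∀ x y, β (x, y, dil t (Φ.toAdapted.form.diff x y)) =
      α (x, dil t (Φ.toAdapted.form.diff x y))) :
    ∃ B, Φ.IsTransported μ α B ∧ ∀ᶠ t in atTop, B t = Φ.toAdapted.localOp μ β t := by
  let S : ℝ → (Lp ℂ 2 (volume : Measure (Heis n)) →L[ℂ] Lp ℂ 2 (volume : Measure (Heis n))) :=
    fun t => kernelOp volume fun x y =>
      (t : ℂ) ^ (2 * n + 2) * α (x, dil t (Φ.toAdapted.form.diff x y))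
  refine ⟨fun t => ContinuousLinearMap.adjoint (Φ.toAdapted.unitary μ) ∘L S t ∘L
    Φ.toAdapted.unitary μ, ⟨_, S, Φ.isUnitary_unitary μ, fun t ht => ⟨fun f => ?_, rfl⟩⟩, ?_⟩
  · obtain ⟨c, K, hb⟩ := h.exists_isBddKernel ht
    filter_upwards [hb.isKernelOp f] with x hx
    rw [hx, ← integral_const_mul]
    refine integral_congr_ae (Eventually.of_forall fun y => ?_)
    simp only [mul_inv_eq_diff]
    exact mul_assoc _ _ _
  · filter_upwards [hβ] with t ht
    have e : (fun x y => (t : ℂ) ^ (2 * n + 2) * α (x, dil t (Φ.toAdapted.form.diff x y))) =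
        Φ.toAdapted.modelKernel β t := by
      funext x y
      rw [AdaptedChart.modelKernel, ht]
    exact congrArg (fun k => ContinuousLinearMap.adjoint (Φ.toAdapted.unitary μ) ∘L
      kernelOp volume k ∘L Φ.toAdapted.unitary μ) e

end ContactCharts

/-! ## Zooming in at a point -/

section Zoom

set_option linter.unusedSectionVars false

open Heis ContactStructure

theorem TransverseForm.cell_mono {n : ℕ} (θ : TransverseForm n) (b : Heis n) (t : ℝ) {R R' : ℝ}
    (hR : R ≤ R') : θ.cell b t R ⊆ θ.cell b t R' := fun y hy => by
  obtain ⟨h1, h2⟩ := θ.mem_cell.1 hy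
  have h0 : 0 < R := (norm_nonneg _).trans_lt h1
  exact θ.mem_cell.2 ⟨h1.trans_le hR, h2.trans_le (by gcongr)⟩

variable {n : ℕ} {M : Type*} [TopologicalSpace M] [ChartedSpace (Heis n) M]
  [IsManifold (𝓡 (2 * n + 1)) ∞ M] {C : ContactStructure n M}

section FibreOps

variable [MeasurableSpace M] {μ : SmoothMeasure n M}

theorem ContactStructure.FibreOps.at_add (a b : C.FibreOps μ) (x : M) :
    (a + b).at x = a.at x + b.at x := rfl

theorem ContactStructure.FibreOps.at_smul (c : ℂ) (a : C.FibreOps μ) (x : M) :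
    (c • a).at x = c • a.at x := rfl

theorem ContactStructure.FibreOps.at_mul (a b : C.FibreOps μ) (x : M) :
    (a * b).at x = a.at x * b.at x := rfl

theorem ContactStructure.FibreOps.at_star (a : C.FibreOps μ) (x : M) :
    (star a).at x = ContinuousLinearMap.adjoint (a.at x) := rfl

theorem ContactStructure.FibreOps.norm_at_le (a : C.FibreOps μ) (x : M) : ‖a.at x‖ ≤ ‖a‖ :=
  lp.norm_apply_le_norm (by simp) (show lp (fun x : M => C.FibreOp μ x) ⊤ from a) x

theorem ContactStructure.FibreOps.at_apply_le (a : C.FibreOps μ) (x : M)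
    (u : Lp ℂ 2 (C.haar μ x)) : ‖a.at x u‖ ≤ ‖a‖ * ‖u‖ :=
  (ContinuousLinearMap.le_opNorm _ _).trans
    (mul_le_mul_of_nonneg_right (a.norm_at_le x) (norm_nonneg _))

end FibreOps

namespace AdaptedChart

variable (ψ : AdaptedChart C)

/-- The points of the domain of the chart which are close to `b` at the scale `1/t`. -/
def nearby (b : M) (t R : ℝ) : Set M :=
  ψ.chart.source ∩ ψ.chart ⁻¹' ψ.form.cell (ψ.chart b) t R

theorem nearby_mono (b : M) (t : ℝ) {R R' : ℝ} (hR : R ≤ R') :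
    ψ.nearby b t R ⊆ ψ.nearby b t R' :=
  inter_subset_inter_right _ (preimage_mono (ψ.form.cell_mono _ t hR))

theorem measurableSet_nearby [MeasurableSpace M] [BorelSpace M] (b : M) (t R : ℝ) :
    MeasurableSet (ψ.nearby b t R) :=
  (ψ.chart.continuousOn.isOpen_inter_preimage ψ.chart.open_source
    ((ψ.form.isOpen_cell t R).preimage (Continuous.prodMk_right _))).measurableSet

/-- The point of `M` with the given coordinates at the scale `1/t`. -/
noncomputable def zoomPoint (b : M) (t : ℝ) (g : C.Osc b) : M :=
  ψ.chart.symm (ψ.form.zoom (ψ.chart b) t (ψ.fib b g))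

variable [MeasurableSpace M] (μ : SmoothMeasure n M)

/-- The square root of the Jacobian of `zoomPoint`. -/
noncomputable def zoomWeight (b : M) (t : ℝ) (g : C.Osc b) : ℝ :=
  ψ.weight μ (ψ.form.zoom (ψ.chart b) t (ψ.fib b g)) * (ψ.weight μ (ψ.chart b))⁻¹ *
    (t ^ (n + 1))⁻¹

/-- The rescaling operator from `L²(M)` to `L²(T_H M_b)`. -/
def IsZoomOp (b : M) (t : ℝ) (L : μ.L2 →L[ℂ] Lp ℂ 2 (C.haar μ b)) : Prop :=
  IsWeightedComp (ψ.zoomPoint b t) (ψ.zoomWeight μ b t) L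

variable {ψ}

theorem zoom_mem_target_of_zoomWeight_ne_zero {b : M} {t : ℝ} {g : C.Osc b}
    (h : ψ.zoomWeight μ b t g ≠ 0) :
    ψ.form.zoom (ψ.chart b) t (ψ.fib b g) ∈ ψ.chart.target :=
  mem_target_of_weight_ne_zero μ (left_ne_zero_of_mul (left_ne_zero_of_mul h))

variable [BorelSpace M] {b : M} (hb : b ∈ ψ.chart.source)
include hb

theorem measurable_zoomWeight (t : ℝ) : Measurable (ψ.zoomWeight μ b t) :=
  (((measurable_weight μ).comp ((ψ.form.continuous_zoom _ t).measurable.comp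
    (measurable_fib hb))).mul_const _).mul_const _

theorem aemeasurable_zoomPoint (t : ℝ) : AEMeasurable (ψ.zoomPoint b t)
    ((C.haar μ b).restrict {g | ψ.zoomWeight μ b t g ≠ 0}) := by
  classical
  have hm : Measurable (ψ.chart.target.piecewise ψ.chart.symm fun _ => b) :=
    ψ.chart.continuousOn_symm.measurable_piecewise continuousOn_const
      ψ.chart.open_target.measurableSet
  have hm2 := hm.comp ((ψ.form.continuous_zoom (ψ.chart b) t).measurable.comp (measurable_fib hb))
  have hS : MeasurableSet {g | ψ.zoomWeight μ b t g ≠ 0} :=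
    measurable_zoomWeight μ hb t (measurableSet_singleton 0).compl
  refine hm2.aemeasurable.congr ?_
  filter_upwards [ae_restrict_mem hS] with g hg
  exact piecewise_eq_of_mem _ _ _ (zoom_mem_target_of_zoomWeight_ne_zero μ hg)

/-- The densities of `μ` and of the Haar measure are accounted for by the two weights, and the
Jacobian `t^(2n+2)` of `zoom` by the square of `t^(n+1)`. So rescaling is isometric on functions
supported in the chart. -/
theorem lintegral_zoomWeight {t : ℝ} (ht : 0 < t) (f : M → ℝ≥0∞) (hf : Measurable f) :
    ∫⁻ g, ENNReal.ofReal (ψ.zoomWeight μ b t g ^ 2) * f (ψ.zoomPoint b t g) ∂(C.haar μ b) =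
      ∫⁻ x in ψ.chart.source, f x ∂μ.measure := by
  have hbt := ψ.chart.map_source hb
  have hw := weight_pos μ hbt
  set c := ψ.weight μ (ψ.chart b) with hc
  have e1 := lintegral_fib hb μ fun z =>
    ENNReal.ofReal ((ψ.weight μ (ψ.form.zoom (ψ.chart b) t z) * c⁻¹ * (t ^ (n + 1))⁻¹) ^ 2) *
      f (ψ.chart.symm (ψ.form.zoom (ψ.chart b) t z))
  have e2 := ψ.form.lintegral_zoom (ψ.chart b) ht fun y =>
    ENNReal.ofReal ((ψ.weight μ y * c⁻¹ * (t ^ (n + 1))⁻¹) ^ 2) * f (ψ.chart.symm y)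
  refine e1.trans ?_
  rw [e2, ← lintegral_weight μ f hf, ← weight_sq μ hbt, ← mul_assoc,
    ← ENNReal.ofReal_mul (by positivity), ← lintegral_const_mul' _ _ ENNReal.ofReal_ne_top]
  refine lintegral_congr fun y => ?_
  rw [← mul_assoc, ← ENNReal.ofReal_mul (by positivity)]
  congr 2
  have h1 : t ^ (2 * n + 2) = (t ^ (n + 1)) ^ 2 := by ring
  rw [h1, ← hc]
  field_simp

theorem exists_isZoomOp {t : ℝ} (ht : 0 < t) :
    ∃ L : μ.L2 →L[ℂ] Lp ℂ 2 (C.haar μ b), ψ.IsZoomOp μ b t L :=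
  exists_weightedComp (lintegral_zoomWeight μ hb ht) (measurable_zoomWeight μ hb t)
    (aemeasurable_zoomPoint μ hb t)

variable {μ}

theorem IsZoomOp.norm_le {t : ℝ} (ht : 0 < t) {L : μ.L2 →L[ℂ] Lp ℂ 2 (C.haar μ b)}
    (hL : ψ.IsZoomOp μ b t L) (u : μ.L2) : ‖L u‖ ≤ ‖u‖ :=
  IsWeightedComp.norm_le hL (lintegral_zoomWeight μ hb ht) u

theorem IsZoomOp.norm_eq {t : ℝ} (ht : 0 < t) {L : μ.L2 →L[ℂ] Lp ℂ 2 (C.haar μ b)}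
    (hL : ψ.IsZoomOp μ b t L) {u : μ.L2} (hu : SuppIn ψ.chart.source u) : ‖L u‖ = ‖u‖ := by
  have h := IsWeightedComp.lintegral_sq hL (lintegral_zoomWeight μ hb ht) u
  have hm := ψ.chart.open_source.measurableSet
  rw [← enorm_cutOp_sq hm, hu.cutOp_eq hm] at h
  have h2 : ‖L u‖ ^ 2 = ‖u‖ ^ 2 := by
    have := congrArg ENNReal.toReal h
    simpa using this
  exact (pow_left_inj₀ (norm_nonneg _) (norm_nonneg _) two_ne_zero).1 h2

theorem SuppIn.of_nearby {b : M} {t R : ℝ} {u : μ.L2} (h : SuppIn (ψ.nearby b t R) u) :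
    SuppIn ψ.chart.source u := h.mono inter_subset_left

end AdaptedChart

variable [MeasurableSpace M] {μ : SmoothMeasure n M}

/-- The operators `F t` enlarge supports by at most a multiple of `1/t`, and in the limit `t → ∞`
they are given by `a`, in the coordinates at the scale `1/t`. -/
def IsZoomLimit (F : ℝ → μ.L2 →L[ℂ] μ.L2) (a : C.FibreOps μ) : Prop :=
  ∀ (ψ : AdaptedChart C) (K : Set M), IsCompact K → K ⊆ ψ.chart.source → ∃ P > 0, ∀ R > 0,
    (∀ᶠ t in atTop, ∀ b ∈ K, ∀ u : μ.L2, SuppIn (ψ.nearby b t R) u →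
      SuppIn (ψ.nearby b t (R + P)) (F t u)) ∧
    ∀ ε > 0, ∀ᶠ t in atTop, ∀ b ∈ K, ∀ L, ψ.IsZoomOp μ b t L → ∀ u : μ.L2,
      SuppIn (ψ.nearby b t R) u → ‖L (F t u) - a.at b (L u)‖ ≤ ε * ‖u‖

namespace IsZoomLimit

variable {F G : ℝ → μ.L2 →L[ℂ] μ.L2} {a a' : C.FibreOps μ}

theorem add (h : IsZoomLimit F a) (h' : IsZoomLimit G a') :
    IsZoomLimit (fun t => F t + G t) (a + a') := by
  intro ψ K hK hKs
  obtain ⟨P, hP, h⟩ := h ψ K hK hKs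
  obtain ⟨P', hP', h'⟩ := h' ψ K hK hKs
  refine ⟨max P P', lt_max_of_lt_left hP, fun R hR => ⟨?_, fun ε hε => ?_⟩⟩
  · filter_upwards [(h R hR).1, (h' R hR).1] with t h1 h2 b hb u hu
    exact ((h1 b hb u hu).mono (ψ.nearby_mono b t (by gcongr; exact le_max_left _ _))).add
      ((h2 b hb u hu).mono (ψ.nearby_mono b t (by gcongr; exact le_max_right _ _)))
  · filter_upwards [(h R hR).2 (ε / 2) (half_pos hε), (h' R hR).2 (ε / 2) (half_pos hε)]
      with t h1 h2 b hb L hL u hu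
    have e : L ((F t + G t) u) - (a + a').at b (L u) =
        (L (F t u) - a.at b (L u)) + (L (G t u) - a'.at b (L u)) := by
      rw [FibreOps.at_add, add_apply, add_apply, map_add]
      abel
    rw [e]
    refine (norm_add_le _ _).trans ?_
    linarith [h1 b hb L hL u hu, h2 b hb L hL u hu]

theorem smul (c : ℂ) (h : IsZoomLimit F a) : IsZoomLimit (fun t => c • F t) (c • a) := by
  intro ψ K hK hKs
  obtain ⟨P, hP, h⟩ := h ψ K hK hKs
  refine ⟨P, hP, fun R hR => ⟨?_, fun ε hε => ?_⟩⟩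
  · filter_upwards [(h R hR).1] with t h1 b hb u hu
    exact (h1 b hb u hu).smul c
  · filter_upwards [(h R hR).2 (ε / (‖c‖ + 1)) (by positivity)] with t h1 b hb L hL u hu
    have e : L ((c • F t) u) - (c • a).at b (L u) = c • (L (F t u) - a.at b (L u)) := by
      rw [FibreOps.at_smul, smul_apply, smul_apply, map_smul, smul_sub]
    rw [e, norm_smul]
    calc ‖c‖ * ‖L (F t u) - a.at b (L u)‖ ≤ (‖c‖ + 1) * (ε / (‖c‖ + 1) * ‖u‖) :=
          mul_le_mul (by linarith) (h1 b hb L hL u hu) (norm_nonneg _) (by positivity)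
      _ = ε * ‖u‖ := by field_simp

variable [BorelSpace M]

/-- Since `F t u` is still supported in the chart, its norm can be measured after rescaling, where
it is nearly `a_b` applied to the rescaled `u`. -/
theorem eventually_norm_le (h : IsZoomLimit F a) {ψ : AdaptedChart C} {K : Set M}
    (hK : IsCompact K) (hKs : K ⊆ ψ.chart.source) {R : ℝ} (hR : 0 < R) {ε : ℝ} (hε : 0 < ε) :
    ∀ᶠ t in atTop, ∀ b ∈ K, ∀ u : μ.L2, SuppIn (ψ.nearby b t R) u →
      ‖F t u‖ ≤ (‖a‖ + ε) * ‖u‖ := by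
  obtain ⟨P, hP, h⟩ := h ψ K hK hKs
  filter_upwards [(h R hR).1, (h R hR).2 ε hε, eventually_gt_atTop 0] with t h1 h2 ht b hb u hu
  obtain ⟨L, hL⟩ := AdaptedChart.exists_isZoomOp μ (hKs hb) ht
  rw [← hL.norm_eq (hKs hb) ht (AdaptedChart.SuppIn.of_nearby (hKs hb) (h1 b hb u hu))]
  have h3 := h2 b hb L hL u hu
  have h4 : ‖L (F t u)‖ ≤ ‖L (F t u) - a.at b (L u)‖ + ‖a.at b (L u)‖ := by
    simpa using norm_add_le (L (F t u) - a.at b (L u)) (a.at b (L u))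
  have h5 := (a.at_apply_le b (L u)).trans
    (mul_le_mul_of_nonneg_left (hL.norm_le (hKs hb) ht u) (norm_nonneg _))
  linarith

/-- Finite propagation is essential here: `G t u` lies in a cell of size `R + P'`, and the limit of
`F` is applied on that cell. The propagation constants add. -/
theorem comp (h : IsZoomLimit F a) (h' : IsZoomLimit G a') :
    IsZoomLimit (fun t => F t ∘L G t) (a * a') := by
  intro ψ K hK hKs
  have hG := h'
  obtain ⟨P, hP, h⟩ := h ψ K hK hKs
  obtain ⟨P', hP', h'⟩ := h' ψ K hK hKs
  refine ⟨P' + P, add_pos hP' hP, fun R hR => ⟨?_, fun ε hε => ?_⟩⟩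
  · filter_upwards [(h' R hR).1, (h (R + P') (by positivity)).1] with t h1 h2 b hb u hu
    rw [← add_assoc]
    exact h2 b hb _ (h1 b hb u hu)
  · have e1 : 0 < ε / (2 * (‖a'‖ + 1)) := by positivity
    have e2 : 0 < ε / (2 * (‖a‖ + 1)) := by positivity
    filter_upwards [(h' R hR).1, (h' R hR).2 _ e2, (h (R + P') (by positivity)).2 _ e1,
      hG.eventually_norm_le hK hKs hR one_pos] with t h1 h2 h3 h4 b hb L hL u hu
    have e : L ((F t ∘L G t) u) - (a * a').at b (L u) =
        (L (F t (G t u)) - a.at b (L (G t u))) +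
          a.at b (L (G t u) - a'.at b (L u)) := by
      rw [FibreOps.at_mul, map_sub]
      change L (F t (G t u)) - a.at b (a'.at b (L u)) = _
      abel
    rw [e]
    refine (norm_add_le _ _).trans ?_
    have h5 := (h3 b hb L hL _ (h1 b hb u hu)).trans
      (mul_le_mul_of_nonneg_left (h4 b hb u hu) e1.le)
    have h6 := (a.at_apply_le b (L (G t u) - a'.at b (L u))).trans
      (mul_le_mul_of_nonneg_left (h2 b hb L hL u hu) (norm_nonneg a))
    have h7 : ε / (2 * (‖a'‖ + 1)) * ((‖a'‖ + 1) * ‖u‖) = ε / 2 * ‖u‖ := by field_simp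
    have h8 : ‖a‖ * (ε / (2 * (‖a‖ + 1)) * ‖u‖) ≤ ε / 2 * ‖u‖ := by
      have : ‖a‖ * (ε / (2 * (‖a‖ + 1))) ≤ ε / 2 := by
        rw [mul_div_assoc', div_le_div_iff₀ (by positivity) (by positivity)]
        nlinarith [norm_nonneg a]
      rw [← mul_assoc]
      exact mul_le_mul_of_nonneg_right this (norm_nonneg _)
    linarith

end IsZoomLimit

end Zoom

/-! ## The norm estimate -/

section NormEstimate

set_option linter.unusedSectionVars false

open Heis ContactStructure

variable {n : ℕ} {M : Type*} [TopologicalSpace M] [ChartedSpace (Heis n) M]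
  [IsManifold (𝓡 (2 * n + 1)) ∞ M] {C : ContactStructure n M}
  [MeasurableSpace M] [BorelSpace M] {μ : SmoothMeasure n M}

theorem AdaptedChart.setLIntegral_unitary (ψ : AdaptedChart C) (u : μ.L2) {S : Set (Heis n)}
    (hS : MeasurableSet S) : ∫⁻ y in S, ‖ψ.unitary μ u y‖ₑ ^ 2 =
      ∫⁻ x in ψ.chart.source ∩ ψ.chart ⁻¹' S, ‖u x‖ₑ ^ 2 ∂μ.measure := by
  have hm : MeasurableSet (ψ.chart.source ∩ ψ.chart ⁻¹' S) := by
    have := ψ.chart.open_source.measurableSet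
    have h2 := measurable_subtype_coe.comp (measurable_id (α := ψ.chart.source))
    have h3 : Measurable (ψ.chart.source.domRestrict ψ.chart) :=
      (continuousOn_iff_continuous_domRestrict.1 ψ.chart.continuousOn).measurable
    rw [← Subtype.image_preimage_coe]
    exact (MeasurableEmbedding.subtype_coe this).measurableSet_image.2 (h3 hS)
  have hu : Measurable fun x => ‖u x‖ₑ ^ 2 :=
    ((Lp.stronglyMeasurable u).measurable.enorm.pow_const 2)
  have h := AdaptedChart.lintegral_weight (φ := ψ) μ
    ((ψ.chart.source ∩ ψ.chart ⁻¹' S).indicator fun x => ‖u x‖ₑ ^ 2) (hu.indicator hm)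
  rw [setLIntegral_indicator hm, inter_eq_left.2 inter_subset_left] at h
  rw [← h, ← lintegral_indicator hS]
  refine lintegral_congr_ae ?_
  filter_upwards [AdaptedChart.isWeightedComp_unitary (φ := ψ) μ u] with y hy
  by_cases h0 : ψ.weight μ y = 0
  · rw [h0]
    by_cases hyS : y ∈ S
    · rw [indicator_of_mem hyS, hy, h0]; simp
    · rw [indicator_of_notMem hyS]; simp
  · have hyt := AdaptedChart.mem_target_of_weight_ne_zero μ h0
    have e : ψ.chart.symm y ∈ ψ.chart.source ∩ ψ.chart ⁻¹' S ↔ y ∈ S := by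
      rw [mem_inter_iff, mem_preimage, ψ.chart.right_inv hyt]
      exact and_iff_right (ψ.chart.map_target hyt)
    by_cases hyS : y ∈ S
    · rw [indicator_of_mem hyS, indicator_of_mem (e.2 hyS), hy, enorm_mul, mul_pow, ← ofReal_norm,
        Complex.norm_real, Real.norm_eq_abs, ← ENNReal.ofReal_pow (abs_nonneg _), sq_abs]
    · rw [indicator_of_notMem hyS, indicator_of_notMem (mt e.1 hyS), mul_zero]

variable {F : ℝ → μ.L2 →L[ℂ] μ.L2} {a a' : C.FibreOps μ}

/-- The adjoint moves supports by at most `P`. Hence the values of `F t u` on the cell of size `P`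
depend only on `u` on the cell of size `2P`, and the bound for a single cell applies there. -/
theorem IsZoomLimit.eventually_cutOp_nearby_le (h : IsZoomLimit F a)
    (h' : IsZoomLimit (fun t => ContinuousLinearMap.adjoint (F t)) a') {ψ : AdaptedChart C}
    {K : Set M} (hK : IsCompact K) (hKs : K ⊆ ψ.chart.source) {ε : ℝ} (hε : 0 < ε) :
    ∃ P > 0, ∀ᶠ t in atTop, ∀ b ∈ K, ∀ u : μ.L2,
      ‖cutOp μ.measure (ψ.nearby b t P) (F t u)‖ ≤
        (‖a‖ + ε) * ‖cutOp μ.measure (ψ.nearby b t (2 * P)) u‖ := by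
  obtain ⟨P, hP, h'⟩ := h' ψ K hK hKs
  refine ⟨P, hP, ?_⟩
  filter_upwards [(h' P hP).1, h.eventually_norm_le hK hKs (R := 2 * P) (by positivity) hε]
    with t h1 h2 b hb u
  have hm := ψ.measurableSet_nearby b t
  refine (norm_cutOp_apply_le (hm P) (hm (2 * P)) (fun v hv => ?_) u).trans
    (h2 b hb _ (suppIn_cutOp (hm _) u))
  rw [two_mul]
  exact h1 b hb v hv

/-- Average the preceding estimate over all cells. The cells are as large as the propagation `P`, so
the loss is the ratio of the volumes of boxes of sizes `2P` and `P`, namely `2^(2n+2)`. It does not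
depend on `P`, hence not on `F`; this is what makes the passage to powers work. -/
theorem IsZoomLimit.eventually_cutOp_le [T2Space M] (h : IsZoomLimit F a)
    (h' : IsZoomLimit (fun t => ContinuousLinearMap.adjoint (F t)) a') {ψ : AdaptedChart C}
    {K : Set M} (hK : IsCompact K) (hKs : K ⊆ ψ.chart.source) {ε : ℝ} (hε : 0 < ε) :
    ∀ᶠ t in atTop, ∀ u : μ.L2,
      ‖cutOp μ.measure K (F t u)‖ ≤ 2 ^ (n + 1) * (‖a‖ + ε) * ‖u‖ := by
  have : LocallyCompactSpace M := ChartedSpace.locallyCompactSpace (Heis n) M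
  obtain ⟨K', hK', hKK', hKs'⟩ := exists_compact_between hK ψ.chart.open_source hKs
  obtain ⟨P, hP, hev⟩ := h.eventually_cutOp_nearby_le h' hK' hKs' hε
  have hA : IsCompact (ψ.chart '' K) := hK.image_of_continuousOn (ψ.chart.continuousOn.mono hKs)
  have hB : IsOpen (ψ.chart '' interior K') :=
    ψ.chart.isOpen_image_of_subset_source isOpen_interior (interior_subset.trans hKs')
  have hcell : ∀ᶠ t : ℝ in atTop, ∀ y ∈ ψ.chart '' K, ∀ b, y ∈ ψ.form.cell b t P →
      b ∈ ψ.chart '' interior K' :=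
    hA.eventually_forall_mem (P := fun p : ℝ × Heis n => ∀ b, p.2 ∈ ψ.form.cell b p.1 P →
      b ∈ ψ.chart '' interior K') fun y hy =>
      ψ.form.eventually_of_mem_cell P y (hB.mem_nhds (image_mono hKK' hy))
  filter_upwards [hev, hcell, eventually_gt_atTop 0] with t ht1 ht2 ht u
  have hmeas : ∀ v : μ.L2, Measurable fun y => ‖ψ.unitary μ v y‖ₑ ^ 2 := fun v =>
    (Lp.stronglyMeasurable _).measurable.enorm.pow_const 2
  have key := ψ.form.lintegral_le_of_cell_le hA.measurableSet (hmeas (F t u)) (hmeas u) ht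
    (c := ENNReal.ofReal ((‖a‖ + ε) ^ 2)) (R := P) (R' := 2 * P) ENNReal.ofReal_ne_top ht2 (by
      rintro _ ⟨b, hb, rfl⟩
      rw [ψ.setLIntegral_unitary _ (ψ.form.measurableSet_cell _ t _),
        ψ.setLIntegral_unitary _ (ψ.form.measurableSet_cell _ t _)]
      have h1 := ht1 b (interior_subset hb) u
      have hm := ψ.measurableSet_nearby b t
      change ∫⁻ x in ψ.nearby b t P, _ ∂_ ≤ _ * ∫⁻ x in ψ.nearby b t (2 * P), _ ∂_
      rw [← enorm_cutOp_sq (hm _), ← enorm_cutOp_sq (hm _), ENNReal.ofReal_pow (by positivity),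
        ← mul_pow]
      gcongr
      rw [← ofReal_norm, ← ofReal_norm, ← ENNReal.ofReal_mul (by positivity)]
      exact ENNReal.ofReal_le_ofReal h1)
  rw [volume_box hP, volume_box (R := 2 * P) (by positivity), mul_pow,
    ENNReal.ofReal_mul (by positivity)] at key
  have hv0 : ENNReal.ofReal (P ^ (2 * n + 2)) * volume (box n 1) ≠ 0 := by
    rw [← volume_box hP]; exact (volume_box_pos hP).ne'
  have hvt : ENNReal.ofReal (P ^ (2 * n + 2)) * volume (box n 1) ≠ ⊤ := by
    rw [← volume_box hP]; exact (volume_box_lt_top P).ne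
  have key2 : ∫⁻ y in ψ.chart '' K, ‖ψ.unitary μ (F t u) y‖ₑ ^ 2 ≤
      ENNReal.ofReal ((2 ^ (n + 1) * (‖a‖ + ε)) ^ 2) * ∫⁻ y, ‖ψ.unitary μ u y‖ₑ ^ 2 := by
    rw [← ENNReal.mul_le_mul_iff_right hv0 hvt]
    refine key.trans_eq ?_
    have e : ((2 : ℝ) ^ (n + 1) * (‖a‖ + ε)) ^ 2 = (‖a‖ + ε) ^ 2 * 2 ^ (2 * n + 2) := by ring
    rw [e, ENNReal.ofReal_mul (by positivity)]
    ring
  rw [ψ.setLIntegral_unitary _ hA.measurableSet, ← enorm_sq_eq_lintegral] at key2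
  have hsub : K ⊆ ψ.chart.source ∩ ψ.chart ⁻¹' (ψ.chart '' K) := fun x hx =>
    ⟨hKs hx, mem_image_of_mem _ hx⟩
  refine norm_le_of_lintegral_le _ u (by positivity) ?_
  rw [← enorm_sq_eq_lintegral, enorm_cutOp_sq hK.measurableSet, ← enorm_sq_eq_lintegral]
  refine (lintegral_mono_set hsub).trans (key2.trans ?_)
  gcongr
  rw [← ofReal_norm, ← ofReal_norm]
  exact ENNReal.ofReal_le_ofReal (IsWeightedComp.norm_le
    (AdaptedChart.isWeightedComp_unitary (φ := ψ) μ) (AdaptedChart.lintegral_weight μ) u)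

/-- The family `F` of operators, which has its support over `K`, represents `a`. -/
structure IsZoomRep (K : Set M) (F : ℝ → μ.L2 →L[ℂ] μ.L2) (a : C.FibreOps μ) : Prop where
  zoom : IsZoomLimit F a
  zoom_adjoint : IsZoomLimit (fun t => ContinuousLinearMap.adjoint (F t)) (star a)
  suppIn : ∀ t u, SuppIn K (F t u)
  suppIn_adjoint : ∀ t u, SuppIn K (ContinuousLinearMap.adjoint (F t) u)

namespace IsZoomRep

variable {K K' : Set M} {G : ℝ → μ.L2 →L[ℂ] μ.L2} {b : C.FibreOps μ}

theorem mono (h : IsZoomRep K F a) (hK : K ⊆ K') : IsZoomRep K' F a :=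
  ⟨h.zoom, h.zoom_adjoint, fun t u => (h.suppIn t u).mono hK,
    fun t u => (h.suppIn_adjoint t u).mono hK⟩

theorem add (h : IsZoomRep K F a) (h' : IsZoomRep K G b) :
    IsZoomRep K (fun t => F t + G t) (a + b) := by
  refine ⟨h.zoom.add h'.zoom, ?_, fun t u => (h.suppIn t u).add (h'.suppIn t u), fun t u => ?_⟩
  · simp only [map_add, star_add]
    exact h.zoom_adjoint.add h'.zoom_adjoint
  · rw [map_add]
    exact (h.suppIn_adjoint t u).add (h'.suppIn_adjoint t u)

theorem smul (c : ℂ) (h : IsZoomRep K F a) : IsZoomRep K (fun t => c • F t) (c • a) := by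
  refine ⟨h.zoom.smul c, ?_, fun t u => (h.suppIn t u).smul c, fun t u => ?_⟩
  · simp only [map_smulₛₗ, star_smul]
    exact h.zoom_adjoint.smul _
  · rw [map_smulₛₗ]
    exact (h.suppIn_adjoint t u).smul _

theorem adjoint (h : IsZoomRep K F a) :
    IsZoomRep K (fun t => ContinuousLinearMap.adjoint (F t)) (star a) := by
  refine ⟨h.zoom_adjoint, ?_, h.suppIn_adjoint, fun t u => ?_⟩
  · simp only [ContinuousLinearMap.adjoint_adjoint, star_star]
    exact h.zoom
  · rw [ContinuousLinearMap.adjoint_adjoint]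
    exact h.suppIn t u

theorem comp (h : IsZoomRep K F a) (h' : IsZoomRep K G b) :
    IsZoomRep K (fun t => F t ∘L G t) (a * b) := by
  refine ⟨h.zoom.comp h'.zoom, ?_, fun t u => h.suppIn t _, fun t u => ?_⟩
  · simp only [ContinuousLinearMap.adjoint_comp, star_mul]
    exact h'.zoom_adjoint.comp h.zoom_adjoint
  · rw [ContinuousLinearMap.adjoint_comp]
    exact h'.suppIn_adjoint t _

end IsZoomRep

variable [T2Space M]

/-- The estimate of the norm up to a constant which depends only on the support. -/
theorem exists_norm_le_of_isZoomRep (C : ContactStructure n M) (μ : SmoothMeasure n M) {K : Set M}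
    (hK : IsCompact K) : ∃ c > 0, ∀ (F : ℝ → μ.L2 →L[ℂ] μ.L2) (a : C.FibreOps μ),
      IsZoomRep K F a → ∀ ε > 0, ∀ᶠ t in atTop, ‖F t‖ ≤ c * (‖a‖ + ε) := by
  have : LocallyCompactSpace M := ChartedSpace.locallyCompactSpace (Heis n) M
  choose ψ hψ using AdaptedChart.exists_mem_source C
  choose N hN hNs hNc using fun x : M =>
    local_compact_nhds ((ψ x).chart.open_source.mem_nhds (hψ x))
  obtain ⟨s, -, hs⟩ := hK.elim_nhds_subcover N fun x _ => hN x
  -- The constant counts the compact pieces covering `K`; adding `1` keeps it positive for an empty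
  -- cover.
  refine ⟨Real.sqrt (s.card + 1) * 2 ^ (n + 1), by positivity, fun F a h ε hε => ?_⟩
  have hev : ∀ᶠ t in atTop, ∀ i ∈ s, ∀ u : μ.L2,
      ‖cutOp μ.measure (N i) (F t u)‖ ≤ 2 ^ (n + 1) * (‖a‖ + ε) * ‖u‖ :=
    (eventually_all_finset s).2 fun i _ =>
      h.zoom.eventually_cutOp_le h.zoom_adjoint (hNc i) (hNs i) hε
  filter_upwards [hev] with t ht
  refine ContinuousLinearMap.opNorm_le_bound _ (by positivity) fun u => ?_
  refine norm_le_of_lintegral_le _ u (by positivity) ?_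
  rw [← enorm_sq_eq_lintegral, ← enorm_sq_eq_lintegral]
  calc ‖F t u‖ₑ ^ 2 = ∫⁻ x in K, ‖F t u x‖ₑ ^ 2 ∂μ.measure := by
        rw [← enorm_cutOp_sq hK.measurableSet, (h.suppIn t u).cutOp_eq hK.measurableSet]
    _ ≤ ∫⁻ x in ⋃ i ∈ s, N i, ‖F t u x‖ₑ ^ 2 ∂μ.measure := lintegral_mono_set hs
    _ ≤ ∑ i ∈ s, ∫⁻ x in N i, ‖F t u x‖ₑ ^ 2 ∂μ.measure := by
        rw [← Finset.set_biUnion_coe, biUnion_eq_iUnion]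
        refine (lintegral_iUnion_le _ _).trans_eq ?_
        rw [tsum_fintype]
        exact Finset.sum_coe_sort s fun i => ∫⁻ x in N i, ‖F t u x‖ₑ ^ 2 ∂μ.measure
    _ ≤ ∑ i ∈ s, ENNReal.ofReal ((2 ^ (n + 1) * (‖a‖ + ε)) ^ 2) * ‖u‖ₑ ^ 2 := by
        refine Finset.sum_le_sum fun i hi => ?_
        rw [← enorm_cutOp_sq (hNc i).measurableSet, ENNReal.ofReal_pow (by positivity), ← mul_pow]
        gcongr
        rw [← ofReal_norm, ← ofReal_norm, ← ENNReal.ofReal_mul (by positivity)]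
        exact ENNReal.ofReal_le_ofReal (ht i hi u)
    _ = ENNReal.ofReal (s.card * (2 ^ (n + 1) * (‖a‖ + ε)) ^ 2) * ‖u‖ₑ ^ 2 := by
        rw [Finset.sum_const, nsmul_eq_mul, ← mul_assoc, ENNReal.ofReal_mul (by positivity),
          ENNReal.ofReal_natCast]
    _ ≤ _ := by
        gcongr
        rw [mul_assoc, mul_pow (Real.sqrt _), Real.sq_sqrt (by positivity)]
        gcongr
        linarith

/-- After one step `F*F` is self-adjoint, and squaring a self-adjoint element squares its norm, for
operators and fibre operators alike. The compact set `K` does not grow, although the propagation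
does. -/
theorem IsZoomRep.exists_power {K : Set M} (h : IsZoomRep K F a) (m : ℕ) :
    ∃ (G : ℝ → μ.L2 →L[ℂ] μ.L2) (b : C.FibreOps μ), IsZoomRep K G b ∧ IsSelfAdjoint b ∧
      (∀ t, IsSelfAdjoint (G t)) ∧ ‖b‖ = ‖a‖ ^ 2 ^ (m + 1) ∧
      ∀ t, ‖G t‖ = ‖F t‖ ^ 2 ^ (m + 1) := by
  induction m with
  | zero =>
    refine ⟨fun t => ContinuousLinearMap.adjoint (F t) ∘L F t, star a * a, h.adjoint.comp h,
      IsSelfAdjoint.star_mul_self a, fun t => IsSelfAdjoint.star_mul_self (F t), ?_, fun t => ?_⟩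
    · rw [CStarRing.norm_star_mul_self]; ring
    · rw [ContinuousLinearMap.norm_adjoint_comp_self]; ring
  | succ m ih =>
    obtain ⟨G, b, hG, hb, hGs, hbn, hGn⟩ := ih
    refine ⟨fun t => G t ∘L G t, b * b, hG.comp hG, ?_, fun t => ?_, ?_, fun t => ?_⟩
    · rw [IsSelfAdjoint, star_mul, hb.star_eq]
    · change IsSelfAdjoint (G t * G t)
      rw [IsSelfAdjoint, star_mul, (hGs t).star_eq]
    · rw [hb.norm_mul_self, hbn, ← pow_mul]; ring
    · change ‖G t * G t‖ = _
      rw [(hGs t).norm_mul_self, hGn, ← pow_mul]; ring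

/-- The norm estimate. -/
theorem IsZoomRep.eventually_norm_le {K : Set M} (hK : IsCompact K) (h : IsZoomRep K F a) {ε : ℝ}
    (hε : 0 < ε) : ∀ᶠ t in atTop, ‖F t‖ ≤ ‖a‖ + ε := by
  obtain ⟨c, hc, hle⟩ := exists_norm_le_of_isZoomRep C μ hK
  have ha := norm_nonneg a
  have hq1 : ‖a‖ / (‖a‖ + ε) < 1 := (div_lt_one (by positivity)).2 (by linarith)
  have hlim : Tendsto (fun m : ℕ => c * (‖a‖ / (‖a‖ + ε)) ^ 2 ^ (m + 1)) atTop (𝓝 (c * 0)) :=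
    ((tendsto_pow_atTop_nhds_zero_of_lt_one (by positivity) hq1).comp
      ((tendsto_pow_atTop_atTop_of_one_lt one_lt_two).comp (tendsto_add_atTop_nat 1))).const_mul c
  rw [mul_zero] at hlim
  -- With `N = 2^(m+1)`, half of `(‖a‖ + ε)^N` absorbs `c ‖a‖^N`, and the other half absorbs `c`
  -- times the slack `(‖a‖ + ε)^N / (2c)`.
  obtain ⟨m, hm⟩ := (hlim.eventually (gt_mem_nhds (half_pos one_pos))).exists
  obtain ⟨G, b, hG, -, -, hb, hGn⟩ := h.exists_power m
  set N := 2 ^ (m + 1) with hN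
  have hpos : 0 < (‖a‖ + ε) ^ N := by positivity
  filter_upwards [hle G b hG ((‖a‖ + ε) ^ N / (2 * c)) (by positivity)] with t ht
  rw [hGn, hb] at ht
  rw [div_pow, ← mul_div_assoc, div_lt_iff₀ hpos] at hm
  have h2 : ‖F t‖ ^ N ≤ (‖a‖ + ε) ^ N := by
    refine ht.trans ?_
    rw [mul_add]
    have : c * ((‖a‖ + ε) ^ N / (2 * c)) = (‖a‖ + ε) ^ N / 2 := by field_simp
    linarith
  exact le_of_pow_le_pow_left₀ (by positivity) (by positivity) h2

end NormEstimate

/-! ## Propagation of the local operators -/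

section Propagation

set_option linter.unusedSectionVars false

open Heis ContactStructure

variable {n : ℕ} {M : Type*} [TopologicalSpace M] [ChartedSpace (Heis n) M]
  [IsManifold (𝓡 (2 * n + 1)) ∞ M] {C : ContactStructure n M}

namespace AdaptedChart

variable {φ : AdaptedChart C} {β : Heis n × Heis n × Heis n → ℂ}

namespace IsKernelSymbol

theorem exists_radius (h : φ.IsKernelSymbol β) : ∃ r, 0 ≤ r ∧
    ∀ x y z, β (x, y, z) ≠ 0 → ‖x‖ ≤ r ∧ ‖z‖ ≤ r := by
  obtain ⟨r, hr⟩ := h.compactSupport.isCompact.isBounded.exists_norm_le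
  refine ⟨max r 0, le_max_right _ _, fun x y z h0 => ?_⟩
  have := hr _ (subset_tsupport _ (show (x, y, z) ∈ Function.support β from h0))
  exact ⟨(norm_fst_le (x, y, z)).trans (this.trans (le_max_left _ _)),
    (norm_snd_le (y, z)).trans ((norm_snd_le (x, y, z)).trans (this.trans (le_max_left _ _)))⟩

/-- The support of a local operator, as a subset of `M`. -/
theorem exists_support_source (h : φ.IsKernelSymbol β) : ∃ S ⊆ φ.chart.source, IsCompact S ∧
    ∀ x ∈ φ.chart.source, ∀ y ∈ φ.chart.source, ∀ z, β (φ.chart x, φ.chart y, z) ≠ 0 →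
      x ∈ S ∧ y ∈ S := by
  obtain ⟨K, hK, hKt, hs⟩ := h.exists_support
  refine ⟨φ.chart.symm '' K, ?_, hK.image_of_continuousOn (φ.chart.continuousOn_symm.mono hKt),
    fun x hx y hy z h0 => ?_⟩
  · rintro _ ⟨y, hy, rfl⟩
    exact φ.chart.map_target (hKt hy)
  · exact ⟨⟨_, (hs _ _ z h0).1, φ.chart.left_inv hx⟩, ⟨_, (hs _ _ z h0).2, φ.chart.left_inv hy⟩⟩

/-- Points at which the kernel does not vanish are close at the scale `1/t`. -/
theorem exists_propagation_nhds [T2Space M] (h : φ.IsKernelSymbol β) {ψ : AdaptedChart C} {b₀ : M}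
    (hb₀ : b₀ ∈ ψ.chart.source) : ∃ P > 0, ∃ V ∈ 𝓝 (ψ.chart b₀), ∀ R > 0, ∀ᶠ t in atTop,
      ∀ b, ∀ x ∈ ψ.nearby b t R, ψ.chart x ∈ V → ∀ x', x ∈ φ.chart.source → x' ∈ φ.chart.source →
        φ.modelKernel β t (φ.chart x') (φ.chart x) ≠ 0 → x' ∈ ψ.nearby b t (R + P) := by
  obtain ⟨S, hSs, hS, hsupp⟩ := h.exists_support_source
  have hb₀t := ψ.chart.map_source hb₀
  -- Away from the compact support of the kernel there is nothing to propagate. On the support `b₀`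
  -- lies in both charts, and the transition can be used.
  by_cases hb₀S : b₀ ∈ S
  swap
  · have hV : ψ.chart.target ∩ ψ.chart.symm ⁻¹' Sᶜ ∈ 𝓝 (ψ.chart b₀) :=
      (ψ.chart.continuousOn_symm.isOpen_inter_preimage ψ.chart.open_target
        hS.isClosed.isOpen_compl).mem_nhds ⟨hb₀t, by
          rw [mem_preimage, ψ.chart.left_inv hb₀]; exact hb₀S⟩
    refine ⟨1, one_pos, _, hV, fun R hR => Eventually.of_forall fun t b x hx hxV x' hxs hxs' h0 => ?_⟩
    have h1 := hxV.2
    rw [mem_preimage, ψ.chart.left_inv hx.1] at h1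
    exact absurd (hsupp x' hxs' x hxs _ (right_ne_zero_of_mul h0)).2 h1
  have hb₀φ := hSs hb₀S
  set σ := fun y => φ.chart (ψ.chart.symm y) with hσ
  have hT := φ.isTransition ψ hb₀φ hb₀
  obtain ⟨K, hK, hcomp⟩ := hT.exists_comparison
  rw [nhds_prod_eq, eventually_prod_self_iff'] at hcomp
  obtain ⟨V₁, hV₁, hcomp⟩ := hcomp
  set B := ‖ψ.form.form (ψ.chart b₀)‖ + 1 with hB
  have hBev : ∀ᶠ y in 𝓝 (ψ.chart b₀), ‖ψ.form.form y‖ < B :=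
    (ψ.form.contDiff.continuous.norm.tendsto _).eventually (gt_mem_nhds (lt_add_one _))
  obtain ⟨V, hVs, hVo, hbV⟩ := mem_nhds_iff.1 (inter_mem hV₁ hBev)
  -- a neighbourhood of the image of the point under the other chart
  have hW : φ.chart.target ∩ φ.chart.symm ⁻¹' (ψ.chart.source ∩ ψ.chart ⁻¹' V) ∈
      𝓝 (φ.chart b₀) :=
    (φ.chart.continuousOn_symm.isOpen_inter_preimage φ.chart.open_target
      (ψ.chart.continuousOn.isOpen_inter_preimage ψ.chart.open_source hVo)).mem_nhds
      ⟨φ.chart.map_source hb₀φ, by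
        rw [mem_preimage, φ.chart.left_inv hb₀φ]; exact ⟨hb₀, hbV⟩⟩
  obtain ⟨δ, hδ, hδW⟩ := Metric.mem_nhds_iff.1 hW
  have hV₂ : V ∩ σ ⁻¹' Metric.ball (φ.chart b₀) (δ / 2) ∈ 𝓝 (ψ.chart b₀) := by
    have hσc : ContinuousAt σ (ψ.chart b₀) := hT.contDiffAt.continuousAt
    have hσb : σ (ψ.chart b₀) = φ.chart b₀ := congrArg φ.chart (ψ.chart.left_inv hb₀)
    exact inter_mem (hVo.mem_nhds hbV) (hσc.preimage_mem_nhds (by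
      rw [hσb]; exact Metric.ball_mem_nhds _ (half_pos hδ)))
  obtain ⟨r, hr, hrad⟩ := h.exists_radius
  obtain ⟨c, hc, hclose⟩ := φ.form.exists_norm_sub_le_div hr
  -- The first term bounds `t ‖ψ x' - ψ x‖`; the next two bound `t²` times the vertical distance.
  -- The summand `1` gives `ρ ≤ ρ²`, as `mem_cell_of_close` requires the vertical bound in the form
  -- `ρ²`.
  set ρ := K * c + K * r + K * (K * c) ^ 2 + 1 with hρ
  have hρ1 : 1 ≤ ρ := le_add_of_nonneg_left (by positivity)
  have hρ0 : 0 ≤ ρ := zero_le_one.trans hρ1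
  have hB0 : 0 ≤ B := by positivity
  refine ⟨2 * ρ + K * ρ * (2 + B), by positivity, _, hV₂, fun R hR => ?_⟩
  have hev : ∀ᶠ t : ℝ in atTop, c / t < δ / 2 :=
    (tendsto_const_nhds.div_atTop tendsto_id).eventually (gt_mem_nhds (half_pos hδ))
  filter_upwards [hev, eventually_ge_atTop 1, eventually_ge_atTop R]
    with t htc ht1 htR b x hx hxV x' hxs hxs' h0
  have ht : 0 < t := one_pos.trans_le ht1
  have hβ := right_ne_zero_of_mul h0
  obtain ⟨hr1, hr2⟩ := hrad _ _ _ hβ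
  have hd := hclose t ht1 _ _ hr1 hr2
  have e1 : σ (ψ.chart x) = φ.chart x := congrArg φ.chart (ψ.chart.left_inv hx.1)
  have hx'W : φ.chart x' ∈ Metric.ball (φ.chart b₀) δ := by
    have h1 : dist (φ.chart x) (φ.chart b₀) < δ / 2 := by
      have : σ (ψ.chart x) ∈ Metric.ball (φ.chart b₀) (δ / 2) := hxV.2
      rwa [e1] at this
    have h2 : dist (φ.chart x') (φ.chart x) < δ / 2 := by
      rw [dist_eq_norm]; exact hd.trans_lt htc
    rw [Metric.mem_ball]
    linarith [dist_triangle (φ.chart x') (φ.chart x) (φ.chart b₀)]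
  have hx'V := (hδW hx'W).2
  rw [mem_preimage, φ.chart.left_inv hxs'] at hx'V
  have e2 : σ (ψ.chart x') = φ.chart x' := congrArg φ.chart (ψ.chart.left_inv hx'V.1)
  obtain ⟨c1, -, c3⟩ := hcomp _ (hVs hx'V.2).1 _ (hVs hxV.1).1
  obtain ⟨-, c2, -⟩ := hcomp _ (hVs hxV.1).1 _ (hVs hx'V.2).1
  simp only at c1 c2
  have hnorm : ‖ψ.chart x' - ψ.chart x‖ ≤ K * c / t := by
    refine c1.trans ?_
    change K * ‖σ (ψ.chart x') - σ (ψ.chart x)‖ ≤ _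
    rw [e1, e2, mul_div_assoc]
    gcongr
  refine ⟨hx'V.1, ψ.form.mem_cell_of_close ht htR hx.2 hρ0 hK.le (hnorm.trans ?_) ?_ c3
    (hVs hxV.1).2.le le_rfl (by positivity)⟩
  · gcongr
    rw [hρ]
    nlinarith [mul_nonneg hK.le hr, mul_nonneg hK.le (sq_nonneg (K * c))]
  · have h3 : |φ.form.form ((1 / 2 : ℝ) • (φ.chart x + φ.chart x')) (φ.chart x - φ.chart x')| ≤
        r / t ^ 2 := by
      have h4 := (abs_coord_le _).trans hr2
      rw [dil_zero_coord, TransverseForm.diff_zero_coord, abs_mul, abs_of_pos (pow_pos ht 2)] at h4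
      have e3 : |φ.form.form ((1 / 2 : ℝ) • (φ.chart x + φ.chart x')) (φ.chart x - φ.chart x')| =
          |φ.form.form ((1 / 2 : ℝ) • (φ.chart x' + φ.chart x)) (φ.chart x' - φ.chart x)| := by
        rw [add_comm (φ.chart x) (φ.chart x'), ← neg_sub (φ.chart x') (φ.chart x), map_neg, abs_neg]
      rw [e3, le_div_iff₀ (pow_pos ht 2), mul_comm]
      exact h4
    have h5 : ‖ψ.chart x - ψ.chart x'‖ ^ 2 ≤ (K * c) ^ 2 / t ^ 2 := by
      rw [norm_sub_rev, ← div_pow]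
      gcongr
    rw [← neg_sub, map_neg, abs_neg]
    refine c2.trans ?_
    change K * (|φ.form.form ((1 / 2 : ℝ) • (σ (ψ.chart x) + σ (ψ.chart x')))
      (σ (ψ.chart x) - σ (ψ.chart x'))| + _) ≤ _
    rw [e1, e2]
    calc K * (|φ.form.form ((1 / 2 : ℝ) • (φ.chart x + φ.chart x')) (φ.chart x - φ.chart x')| +
          ‖ψ.chart x - ψ.chart x'‖ ^ 2) ≤ K * (r / t ^ 2 + (K * c) ^ 2 / t ^ 2) := by gcongr
      _ = (K * r + K * (K * c) ^ 2) / t ^ 2 := by ring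
      _ ≤ ρ ^ 2 / t ^ 2 := by
        gcongr
        have : K * r + K * (K * c) ^ 2 ≤ ρ := by
          rw [hρ]; nlinarith [mul_nonneg hK.le hc]
        nlinarith

variable [MeasurableSpace M] [BorelSpace M] (μ : SmoothMeasure n M)

/-- The local operators enlarge supports by at most a multiple of `1/t`. -/
theorem exists_propagation [T2Space M] (h : φ.IsKernelSymbol β) {ψ : AdaptedChart C} {K : Set M}
    (hK : IsCompact K) (hKs : K ⊆ ψ.chart.source) : ∃ P > 0, ∀ R > 0, ∀ᶠ t in atTop, ∀ b ∈ K,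
      ∀ u : μ.L2, SuppIn (ψ.nearby b t R) u →
        SuppIn (ψ.nearby b t (R + P)) (φ.localOp μ β t u) := by
  have key : ∃ P > 0, ∀ R > 0, ∀ᶠ t in atTop, ∀ b ∈ K, ∀ x ∈ ψ.nearby b t R, ∀ x',
      x ∈ φ.chart.source → x' ∈ φ.chart.source →
        φ.modelKernel β t (φ.chart x') (φ.chart x) ≠ 0 → x' ∈ ψ.nearby b t (R + P) := by
    -- Propagation constants of finitely many pieces are replaced by their maximum, so the local
    -- statement passes to compact sets, with `P` chosen before `R`.
    refine hK.induction_on (p := fun s => ∃ P > 0, ∀ R > 0, ∀ᶠ t in atTop, ∀ b ∈ s,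
      ∀ x ∈ ψ.nearby b t R, ∀ x', x ∈ φ.chart.source → x' ∈ φ.chart.source →
        φ.modelKernel β t (φ.chart x') (φ.chart x) ≠ 0 → x' ∈ ψ.nearby b t (R + P)) ?_ ?_ ?_ ?_
    · exact ⟨1, one_pos, fun R _ => Eventually.of_forall fun t b hb => absurd hb (notMem_empty b)⟩
    · rintro s s' hss ⟨P, hP, hs⟩
      exact ⟨P, hP, fun R hR => (hs R hR).mono fun t ht b hb => ht b (hss hb)⟩
    · rintro s s' ⟨P, hP, hs⟩ ⟨P', hP', hs'⟩
      refine ⟨max P P', lt_max_of_lt_left hP, fun R hR => ?_⟩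
      filter_upwards [hs R hR, hs' R hR] with t h1 h2 b hb x hx x' hxs hxs' h0
      rcases hb with hb | hb
      · exact ψ.nearby_mono b t (by gcongr; exact le_max_left _ _) (h1 b hb x hx x' hxs hxs' h0)
      · exact ψ.nearby_mono b t (by gcongr; exact le_max_right _ _) (h2 b hb x hx x' hxs hxs' h0)
    · intro b₀ hb₀
      obtain ⟨P, hP, V, hV, hev⟩ := h.exists_propagation_nhds (ψ := ψ) (hKs hb₀)
      obtain ⟨η, hη, hηV⟩ := Metric.nhds_basis_closedBall.mem_iff.1 (interior_mem_nhds.2 hV)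
      refine ⟨ψ.chart ⁻¹' Metric.closedBall (ψ.chart b₀) η, mem_nhdsWithin_of_mem_nhds
        ((ψ.chart.continuousAt (hKs hb₀)).preimage_mem_nhds (Metric.closedBall_mem_nhds _ hη)),
        P, hP, fun R hR => ?_⟩
      have hcell := (isCompact_closedBall (ψ.chart b₀) η).eventually_forall_mem
        (P := fun p : ℝ × Heis n => ψ.form.cell p.2 p.1 R ⊆ V) fun y hy =>
        ψ.form.eventually_cell_subset R y (mem_interior_iff_mem_nhds.1 (hηV hy))
      filter_upwards [hev R hR, hcell] with t h1 h2 b hb x hx x' hxs hxs' h0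
      exact h1 b x hx (h2 _ hb hx.2) x' hxs hxs' h0
  obtain ⟨P, hP, key⟩ := key
  refine ⟨P, hP, fun R hR => ?_⟩
  filter_upwards [key R hR] with t ht b hb u hu
  filter_upwards [h.isKernelOp_localOp μ t u] with x' hx' hx'n
  rw [hx']
  refine integral_eq_zero_of_ae ?_
  filter_upwards [hu] with x hx
  rw [Pi.zero_apply]
  by_cases hxn : x ∈ ψ.nearby b t R
  · by_contra h0
    have h1 := left_ne_zero_of_mul h0
    have h2 : φ.coweight μ x' ≠ 0 := fun h => h1 (by simp [pullKernel, h])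
    have h3 : φ.coweight μ x ≠ 0 := fun h => h1 (by simp [pullKernel, h])
    have h4 : φ.modelKernel β t (φ.chart x') (φ.chart x) ≠ 0 := fun h =>
      h1 (by simp [pullKernel, h])
    exact hx'n (ht b hb x hxn x' (mem_source_of_coweight_ne_zero μ h3)
      (mem_source_of_coweight_ne_zero μ h2) h4)
  · rw [hx hxn, mul_zero]

end IsKernelSymbol

end AdaptedChart

end Propagation

/-! ## The limits of the kernels -/

section KernelLimits

set_option linter.unusedSectionVars false

open Heis ContactStructure

/-- Since `u`, `v` and `w` are supported in `B`, both kernels may be cut off to `B × B`, where they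
differ by at most `ε`. Closeness of the kernels is needed only on this set of finite measure. -/
theorem norm_sub_le_of_kernels {X : Type*} [MeasurableSpace X] {ρ : Measure X} [SFinite ρ]
    {B : Set X} (hB : MeasurableSet B) (hBf : ρ B < ⊤) {k f : X → X → ℂ}
    (hk : Measurable (Function.uncurry k)) (hf : Measurable (Function.uncurry f)) {c ε : ℝ}
    (hc : 0 ≤ c) (hε : 0 ≤ ε) (hfc : ∀ x y, ‖f x y‖ ≤ c)
    (hkf : ∀ x ∈ B, ∀ y ∈ B, ‖k x y - f x y‖ ≤ ε) {u v w : Lp ℂ 2 ρ}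
    (hv : v =ᵐ[ρ] fun x => ∫ y, k x y * u y ∂ρ) (hw : w =ᵐ[ρ] fun x => ∫ y, f x y * u y ∂ρ)
    (hu : SuppIn B u) (hvB : SuppIn B v) (hwB : SuppIn B w) :
    ‖v - w‖ ≤ ε * ρ.real B * ‖u‖ := by
  classical
  have hBB : MeasurableSet (B ×ˢ B) := hB.prod hB
  set cut : (X → X → ℂ) → X → X → ℂ := fun h x y =>
    (B ×ˢ B).indicator (Function.uncurry h) (x, y) with hcut
  have hin : ∀ h x y, x ∈ B → y ∈ B → cut h x y = h x y := fun h x y hx hy =>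
    indicator_of_mem (show (x, y) ∈ B ×ˢ B from ⟨hx, hy⟩) _
  have hout : ∀ h x y, ¬ (x ∈ B ∧ y ∈ B) → cut h x y = 0 := fun h x y hxy =>
    indicator_of_notMem (show (x, y) ∉ B ×ˢ B from hxy) _
  have hbdd : ∀ h d, Measurable (Function.uncurry h) → 0 ≤ d →
      (∀ x ∈ B, ∀ y ∈ B, ‖h x y‖ ≤ d) → IsBddKernel ρ (cut h) d B := by
    intro h d hm hd hle
    refine ⟨hm.indicator hBB, hB, hBf, hd, fun x y => ?_, fun x y hxy => ?_⟩
    · by_cases hxy : x ∈ B ∧ y ∈ B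
      · rw [hin h x y hxy.1 hxy.2]; exact hle x hxy.1 y hxy.2
      · rw [hout h x y hxy, norm_zero]; exact hd
    · by_contra hn
      exact hxy (hout h x y hn)
  have hbf := hbdd f c hf hc fun x _ y _ => hfc x y
  have hbk := hbdd k (c + ε) hk (by positivity) fun x hx y hy => by
    have h1 : ‖k x y‖ ≤ ‖k x y - f x y‖ + ‖f x y‖ := by
      simpa using norm_add_le (k x y - f x y) (f x y)
    linarith [hkf x hx y hy, hfc x y]
  have hbd := hbdd (fun x y => k x y - f x y) ε (hk.sub hf) hε hkf
  have hop := hbk.sub (hbf.mono (by linarith : c ≤ c + ε) subset_rfl hB hBf) hbk.isKernelOp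
    hbf.isKernelOp
  have hval : ∀ (h : X → X → ℂ) (v : Lp ℂ 2 ρ), SuppIn B v →
      (v =ᵐ[ρ] fun x => ∫ y, h x y * u y ∂ρ) → IsKernelOp ρ (cut h) (kernelOp ρ (cut h)) →
      v = kernelOp ρ (cut h) u := by
    intro h v hvB hv hop
    refine Lp.ext ?_
    filter_upwards [hv, hvB, hop u] with x h1 h2 h3
    rw [h3]
    by_cases hx : x ∈ B
    · rw [h1]
      refine integral_congr_ae ?_
      filter_upwards [hu] with y hy
      by_cases hyB : y ∈ B
      · rw [hin h x y hx hyB]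
      · rw [hy hyB, mul_zero, mul_zero]
    · rw [h2 hx]
      have : ∀ y, cut h x y = 0 := fun y => hout h x y fun hh => hx hh.1
      simp [this]
  rw [hval k v hvB hv hbk.isKernelOp, hval f w hwB hw hbf.isKernelOp]
  have hop' : IsKernelOp ρ (cut fun x y => k x y - f x y)
      (kernelOp ρ (cut k) - kernelOp ρ (cut f)) := by
    have e : (cut fun x y => k x y - f x y) = fun x y => cut k x y - cut f x y := by
      funext x y
      by_cases hxy : x ∈ B ∧ y ∈ B
      · rw [hin _ x y hxy.1 hxy.2, hin _ x y hxy.1 hxy.2, hin _ x y hxy.1 hxy.2]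
      · rw [hout _ x y hxy, hout _ x y hxy, hout _ x y hxy, sub_zero]
    rw [e]
    exact hop
  rw [← sub_apply]
  exact (ContinuousLinearMap.le_opNorm _ _).trans
    (mul_le_mul_of_nonneg_right (hbd.norm_le hop') (norm_nonneg _))

theorem TransverseForm.mulAt_mulAt_neg {n : ℕ} (θ : TransverseForm n) (b z w : Heis n) :
    θ.mulAt b (θ.mulAt b z (-w)) w = z := by
  have hl : θ.lift b (θ.mulAt b z (-w)) = θ.lift b (z - w) := by
    rw [← θ.lift_hor, θ.mulAt_neg_hor, θ.lift_hor]
  refine ext_hor ?_ ?_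
  · rw [mulAt]
    simp only [map_add, map_smul, hor_e0, smul_zero, add_zero, mulAt_neg_hor]
    rw [map_sub]; abel
  · rw [mulAt, hl]
    simp only [PiLp.add_apply, PiLp.smul_apply, e0_zero, mulAt_neg_zero, map_sub, sub_apply,
      smul_eq_mul]
    ring

variable {n : ℕ} {M : Type*} [TopologicalSpace M] [ChartedSpace (Heis n) M]
  [IsManifold (𝓡 (2 * n + 1)) ∞ M] {C : ContactStructure n M}

namespace AdaptedChart

variable {φ ψ : AdaptedChart C} {β : Heis n × Heis n × Heis n → ℂ} {b₀ : M}

/-- Right translates of sets which are bounded in one chart are bounded in the other chart. -/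
theorem exists_fib_bound (hφ : b₀ ∈ φ.chart.source) (hψ : b₀ ∈ ψ.chart.source) (r R : ℝ) :
    ∃ R', ∀ᶠ b in 𝓝 b₀, ∀ g g' : C.Osc b, ‖ψ.fib b g'‖ ≤ R →
      ‖φ.fib b (C.oscMul b g (C.oscInv b g'))‖ ≤ r → ‖ψ.fib b g‖ ≤ R' := by
  have hT := ψ.isTransition φ hψ hφ
  set τ := fun y => ψ.chart (φ.chart.symm y) with hτ
  obtain ⟨c, hc⟩ := (isCompact_closedBall (0 : Heis n) r).exists_bound_of_continuousOn
    (f := TransverseForm.fibreTrans φ.form ψ.form τ (φ.chart b₀)) (continuous_iff_continuousAt.2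
      fun z => hT.tendsto_fibreTrans tendsto_const_nhds tendsto_id).continuousOn
  have h1 : ∀ᶠ b in 𝓝 b₀, ∀ z ∈ Metric.closedBall (0 : Heis n) r,
      ‖TransverseForm.fibreTrans φ.form ψ.form τ (φ.chart b) z‖ < c + 1 := by
    refine (isCompact_closedBall (0 : Heis n) r).eventually_forall_mem (P := fun p : M × Heis n =>
      ‖TransverseForm.fibreTrans φ.form ψ.form τ (φ.chart p.1) p.2‖ < c + 1) fun z hz => ?_
    have h2 := hT.tendsto_fibreTrans (l := 𝓝 b₀ ×ˢ 𝓝 z)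
      ((φ.chart.continuousAt hφ).tendsto.comp tendsto_fst) tendsto_snd
    exact h2.norm.eventually (gt_mem_nhds ((hc z hz).trans_lt (lt_add_one c)))
  obtain ⟨R', hR'⟩ := (((isCompact_closedBall (ψ.chart b₀) 1).prod
    ((isCompact_closedBall (0 : Heis n) (c + 1)).prod
      (isCompact_closedBall (0 : Heis n) R))).exists_bound_of_continuousOn
    ψ.form.continuous_mulAt.continuousOn)
  refine ⟨R', ?_⟩
  filter_upwards [h1, φ.chart.open_source.mem_nhds hφ, ψ.chart.open_source.mem_nhds hψ,
    (ψ.chart.continuousAt hψ).preimage_mem_nhds (Metric.closedBall_mem_nhds _ one_pos)]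
    with b hb1 hbφ hbψ hb2 g g' hg' hg
  have e1 : ψ.fib b (C.oscMul b g (C.oscInv b g')) =
      ψ.form.mulAt (ψ.chart b) (ψ.fib b g) (-ψ.fib b g') := by
    rw [ψ.fib_oscMul hbψ, ψ.fib_oscInv hbψ]
  have e2 := ψ.fib_eq_fibreTrans φ hbψ hbφ (C.oscMul b g (C.oscInv b g'))
  have h3 := (hb1 _ (mem_closedBall_zero_iff.2 hg)).le
  rw [← e2, e1] at h3
  -- `g = (g g'⁻¹) g'`, a product of two bounded elements.
  rw [← ψ.form.mulAt_mulAt_neg (ψ.chart b) (ψ.fib b g) (ψ.fib b g')]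
  exact hR' (ψ.chart b, _, _) ⟨hb2, mem_closedBall_zero_iff.2 h3, mem_closedBall_zero_iff.2 hg'⟩

variable [MeasurableSpace M] (μ : SmoothMeasure n M)

theorem continuousOn_coweight : ContinuousOn (φ.coweight μ) φ.chart.source := by
  refine (ContinuousOn.inv₀ ((continuousOn_weight μ).comp φ.chart.continuousOn φ.chart.mapsTo)
    fun x hx => (weight_pos μ (φ.chart.map_source hx)).ne').congr fun x hx => coweight_eq μ hx

variable (φ ψ) in
/-- The quotient of the weights of two charts. -/
noncomputable def weightRatio (b : M) (y : Heis n) : ℝ :=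
  ψ.weight μ y * (ψ.weight μ (ψ.chart b))⁻¹ * φ.coweight μ (ψ.chart.symm y)

theorem tendsto_weightRatio {ι : Type*} {l : Filter ι} (hφ : b₀ ∈ φ.chart.source)
    (hψ : b₀ ∈ ψ.chart.source) {b : ι → M} {y : ι → Heis n} (hb : Tendsto b l (𝓝 b₀))
    (hy : Tendsto y l (𝓝 (ψ.chart b₀))) :
    Tendsto (fun i => φ.weightRatio ψ μ (b i) (y i)) l (𝓝 (φ.coweight μ b₀)) := by
  have ht := ψ.chart.map_source hψ
  have hw := (continuousOn_weight (φ := ψ) μ).continuousAt (ψ.chart.open_target.mem_nhds ht)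
  have h1 := hw.tendsto.comp hy
  have h2 := (hw.tendsto.comp ((ψ.chart.continuousAt hψ).tendsto.comp hb)).inv₀
    (weight_pos μ ht).ne'
  have hs := (ψ.chart.continuousAt_symm ht).tendsto.comp hy
  rw [ψ.chart.left_inv hψ] at hs
  have h3 := ((continuousOn_coweight (φ := φ) μ).continuousAt
    (φ.chart.open_source.mem_nhds hφ)).tendsto.comp hs
  have := (h1.mul h2).mul h3
  rw [mul_inv_cancel₀ (weight_pos μ ht).ne', one_mul] at this
  exact this

variable (φ ψ) in
/-- The kernel of the local operator in the coordinates at scale `1/t`. -/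
noncomputable def zoomKernel (β : Heis n × Heis n × Heis n → ℂ) (t : ℝ) (b : M)
    (z z' : Heis n) : ℂ :=
  φ.weightRatio ψ μ b (ψ.form.zoom (ψ.chart b) t z) *
    φ.weightRatio ψ μ b (ψ.form.zoom (ψ.chart b) t z') *
    β (φ.chart (ψ.chart.symm (ψ.form.zoom (ψ.chart b) t z)),
      φ.chart (ψ.chart.symm (ψ.form.zoom (ψ.chart b) t z')),
      dil t (φ.form.diff (φ.chart (ψ.chart.symm (ψ.form.zoom (ψ.chart b) t z)))
        (φ.chart (ψ.chart.symm (ψ.form.zoom (ψ.chart b) t z')))))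

variable (φ ψ) in
/-- The kernel of the limit. -/
noncomputable def limitKernel (β : Heis n × Heis n × Heis n → ℂ) (b : M) (z z' : Heis n) : ℂ :=
  φ.coweight μ b * φ.coweight μ b * β (φ.chart b, φ.chart b,
    TransverseForm.fibreTrans ψ.form φ.form (fun y => φ.chart (ψ.chart.symm y)) (ψ.chart b)
      (ψ.form.mulAt (ψ.chart b) z (-z')))

/-- The factor `t^(2n+2)` of the kernel is absorbed by the two factors `t^(-(n+1))` of the rescaling
weights. What is left has a limit. -/
theorem weight_mul_pullKernel {t : ℝ} (ht : 0 < t) (b : M) (g g' : C.Osc b) :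
    (ψ.zoomWeight μ b t g : ℂ) * φ.pullKernel μ (φ.modelKernel β t) (ψ.zoomPoint b t g)
      (ψ.zoomPoint b t g') * ψ.zoomWeight μ b t g' =
        φ.zoomKernel ψ μ β t b (ψ.fib b g) (ψ.fib b g') := by
  have h : (t : ℂ) ^ (2 * n + 2) * ((t : ℂ) ^ (n + 1))⁻¹ * ((t : ℂ) ^ (n + 1))⁻¹ = 1 := by
    have : (t : ℂ) ≠ 0 := by exact_mod_cast ht.ne'
    have e : (t : ℂ) ^ (2 * n + 2) = t ^ (n + 1) * t ^ (n + 1) := by ring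
    rw [e]
    field_simp
  rw [zoomKernel, pullKernel, modelKernel, zoomWeight, zoomWeight, weightRatio, weightRatio,
    zoomPoint, zoomPoint]
  push_cast
  linear_combination (ψ.weight μ (ψ.form.zoom (ψ.chart b) t (ψ.fib b g)) *
    (ψ.weight μ (ψ.chart b) : ℂ)⁻¹ *
    φ.coweight μ (ψ.chart.symm (ψ.form.zoom (ψ.chart b) t (ψ.fib b g))) *
    ψ.weight μ (ψ.form.zoom (ψ.chart b) t (ψ.fib b g')) *
    (ψ.weight μ (ψ.chart b) : ℂ)⁻¹ *
    φ.coweight μ (ψ.chart.symm (ψ.form.zoom (ψ.chart b) t (ψ.fib b g'))) *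
    β (φ.chart (ψ.chart.symm (ψ.form.zoom (ψ.chart b) t (ψ.fib b g))),
      φ.chart (ψ.chart.symm (ψ.form.zoom (ψ.chart b) t (ψ.fib b g'))),
      dil t (φ.form.diff (φ.chart (ψ.chart.symm (ψ.form.zoom (ψ.chart b) t (ψ.fib b g))))
        (φ.chart (ψ.chart.symm (ψ.form.zoom (ψ.chart b) t (ψ.fib b g'))))))) * h

/-- The weights of the chart at `b` multiply to `1/w`, the factor in `pullback`, and the argument is
`g g'⁻¹` seen in the other chart. The limit kernel is therefore that of the regular representation.
-/
theorem pullback_eq_limitKernel {α : Heis n × Heis n → ℂ} (hα : ∀ x z, α (x, z) = β (x, x, z))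
    {b : M} (hφ : b ∈ φ.chart.source) (hψ : b ∈ ψ.chart.source) (g g' : C.Osc b) :
    φ.pullback μ α ⟨b, C.oscMul b g (C.oscInv b g')⟩ =
      φ.limitKernel ψ μ β b (ψ.fib b g) (ψ.fib b g') := by
  have e1 : ψ.fib b (C.oscMul b g (C.oscInv b g')) =
      ψ.form.mulAt (ψ.chart b) (ψ.fib b g) (-ψ.fib b g') := by
    rw [ψ.fib_oscMul hψ, ψ.fib_oscInv hψ]
  have e2 := φ.fib_eq_fibreTrans ψ hφ hψ (C.oscMul b g (C.oscInv b g'))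
  rw [e1] at e2
  refine (pullback_of_mem (φ := φ) μ
    (p := (show C.HeisTangent from ⟨b, C.oscMul b g (C.oscInv b g')⟩)) hφ).trans ?_
  rw [limitKernel, ← e2, coweight_eq μ hφ]
  change _ * α (φ.chart b, φ.fib b _) = _
  change (((μ.density φ.mem_atlas (φ.chart b))⁻¹ : ℝ) : ℂ) * _ = _
  rw [hα, ← weight_sq μ (φ.chart.map_source hφ)]
  push_cast
  ring

/-- Both base points tend to `b₀`, the rescaled difference converges by `tendsto_dil_diff`, and the
weights by continuity. The points `b`, `z`, `z'` vary along with `T`, so that uniformity follows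
from the tube lemma. -/
theorem IsKernelSymbol.tendsto_zoomKernel (h : φ.IsKernelSymbol β) {ι : Type*} {l : Filter ι}
    (hφ : b₀ ∈ φ.chart.source) (hψ : b₀ ∈ ψ.chart.source) {T : ι → ℝ} {b : ι → M}
    {z z' : ι → Heis n} {z₀ z₀' : Heis n} (hT : Tendsto T l atTop) (hb : Tendsto b l (𝓝 b₀))
    (hz : Tendsto z l (𝓝 z₀)) (hz' : Tendsto z' l (𝓝 z₀')) :
    Tendsto (fun i => φ.zoomKernel ψ μ β (T i) (b i) (z i) (z' i)) l
      (𝓝 (φ.limitKernel ψ μ β b₀ z₀ z₀')) := by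
  have hψb := (ψ.chart.continuousAt hψ).tendsto.comp hb
  have h1 := ψ.form.tendsto_zoom hT hψb hz
  have h2 := ψ.form.tendsto_zoom hT hψb hz'
  have hr1 := tendsto_weightRatio μ hφ hψ hb h1
  have hr2 := tendsto_weightRatio μ hφ hψ hb h2
  have htr := φ.isTransition ψ hφ hψ
  have hd := htr.tendsto_dil_diff hT hψb hz hz'
  have hc := htr.contDiffAt.continuousAt
  have e : φ.chart (ψ.chart.symm (ψ.chart b₀)) = φ.chart b₀ :=
    congrArg φ.chart (ψ.chart.left_inv hψ)
  have hs1 := hc.tendsto.comp h1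
  have hs2 := hc.tendsto.comp h2
  simp only [e] at hs1 hs2
  have hβ := (h.continuous.tendsto (φ.chart b₀, φ.chart b₀, _)).comp
    (hs1.prodMk_nhds (hs2.prodMk_nhds hd))
  exact (((Complex.continuous_ofReal.tendsto _).comp hr1).mul
    ((Complex.continuous_ofReal.tendsto _).comp hr2)).mul hβ

theorem IsKernelSymbol.tendsto_limitKernel (h : φ.IsKernelSymbol β) {ι : Type*} {l : Filter ι}
    (hφ : b₀ ∈ φ.chart.source) (hψ : b₀ ∈ ψ.chart.source) {b : ι → M}
    {z z' : ι → Heis n} {z₀ z₀' : Heis n} (hb : Tendsto b l (𝓝 b₀))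
    (hz : Tendsto z l (𝓝 z₀)) (hz' : Tendsto z' l (𝓝 z₀')) :
    Tendsto (fun i => φ.limitKernel ψ μ β (b i) (z i) (z' i)) l
      (𝓝 (φ.limitKernel ψ μ β b₀ z₀ z₀')) := by
  have hψb := (ψ.chart.continuousAt hψ).tendsto.comp hb
  have hφb := (φ.chart.continuousAt hφ).tendsto.comp hb
  have hw := (Complex.continuous_ofReal.tendsto _).comp (((continuousOn_coweight (φ := φ)
    μ).continuousAt (φ.chart.open_source.mem_nhds hφ)).tendsto.comp hb)
  have hm := (ψ.form.continuous_mulAt.tendsto (ψ.chart b₀, z₀, -z₀')).comp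
    (hψb.prodMk_nhds (hz.prodMk_nhds hz'.neg))
  have ht := (φ.isTransition ψ hφ hψ).tendsto_fibreTrans hψb hm
  have hβ := (h.continuous.tendsto (φ.chart b₀, φ.chart b₀, _)).comp
    (hφb.prodMk_nhds (hφb.prodMk_nhds ht))
  exact (hw.mul hw).mul hβ

theorem IsKernelSymbol.eventually_zoomKernel_sub_le (h : φ.IsKernelSymbol β)
    (hφ : b₀ ∈ φ.chart.source) (hψ : b₀ ∈ ψ.chart.source) (R : ℝ) {ε : ℝ} (hε : 0 < ε) :
    ∀ᶠ p : ℝ × M in atTop ×ˢ 𝓝 b₀, ∀ z, ‖z‖ ≤ R → ∀ z', ‖z'‖ ≤ R →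
      ‖φ.zoomKernel ψ μ β p.1 p.2 z z' - φ.limitKernel ψ μ β p.2 z z'‖ ≤ ε := by
  have hball := (isCompact_closedBall (0 : Heis n) R).prod (isCompact_closedBall (0 : Heis n) R)
  have := hball.eventually_forall_mem (l := (atTop : Filter ℝ) ×ˢ 𝓝 b₀)
    (P := fun q : (ℝ × M) × Heis n × Heis n => ‖φ.zoomKernel ψ μ β q.1.1 q.1.2 q.2.1 q.2.2 -
      φ.limitKernel ψ μ β q.1.2 q.2.1 q.2.2‖ ≤ ε) fun z _ => by
    have hT : Tendsto (fun q : (ℝ × M) × Heis n × Heis n => q.1.1)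
      ((atTop ×ˢ 𝓝 b₀) ×ˢ 𝓝 z) atTop := tendsto_fst.comp tendsto_fst
    have hb : Tendsto (fun q : (ℝ × M) × Heis n × Heis n => q.1.2)
      ((atTop ×ˢ 𝓝 b₀) ×ˢ 𝓝 z) (𝓝 b₀) := tendsto_snd.comp tendsto_fst
    have hz : Tendsto (fun q : (ℝ × M) × Heis n × Heis n => q.2.1)
      ((atTop ×ˢ 𝓝 b₀) ×ˢ 𝓝 z) (𝓝 z.1) := (continuous_fst.tendsto z).comp tendsto_snd
    have hz' : Tendsto (fun q : (ℝ × M) × Heis n × Heis n => q.2.2)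
      ((atTop ×ˢ 𝓝 b₀) ×ˢ 𝓝 z) (𝓝 z.2) := (continuous_snd.tendsto z).comp tendsto_snd
    have hlim := (h.tendsto_zoomKernel μ hφ hψ hT hb hz hz').sub
      (h.tendsto_limitKernel μ hφ hψ hb hz hz')
    rw [sub_self] at hlim
    have h0 := hlim.norm.eventually (ge_mem_nhds (by rwa [norm_zero]))
    exact h0
  filter_upwards [this] with p hp z hz z' hz'
  exact hp (z, z') ⟨mem_closedBall_zero_iff.2 hz, mem_closedBall_zero_iff.2 hz'⟩

end AdaptedChart

end KernelLimits

/-! ## The limits of the local operators -/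

section ZoomLimits

set_option linter.unusedSectionVars false

open Heis ContactStructure

variable {n : ℕ} {M : Type*} [TopologicalSpace M] [ChartedSpace (Heis n) M]
  [IsManifold (𝓡 (2 * n + 1)) ∞ M] {C : ContactStructure n M}

namespace AdaptedChart

variable {φ ψ : AdaptedChart C} {β : Heis n × Heis n × Heis n → ℂ} {α : Heis n × Heis n → ℂ}
  [MeasurableSpace M] [BorelSpace M] {μ : SmoothMeasure n M}

theorem IsZoomOp.suppIn {b : M} (hb : b ∈ ψ.chart.source) {t R R' : ℝ} (ht : 0 < t)
    {L : μ.L2 →L[ℂ] Lp ℂ 2 (C.haar μ b)} (hL : ψ.IsZoomOp μ b t L)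
    (hR : ∀ y ∈ ψ.form.cell (ψ.chart b) t R, ‖ψ.form.unzoom (ψ.chart b) t y‖ ≤ R') {u : μ.L2}
    (hu : SuppIn (ψ.nearby b t R) u) : SuppIn {g | ‖ψ.fib b g‖ ≤ R'} (L u) := by
  have h1 := ae_comp_of_lintegral (lintegral_zoomWeight μ hb ht) (measurable_zoomWeight μ hb t)
    (aemeasurable_zoomPoint μ hb t) hu
  filter_upwards [h1, hL u] with g h1 h2 hg
  rw [h2]
  by_cases h0 : ψ.zoomWeight μ b t g = 0
  · rw [h0, Complex.ofReal_zero, zero_mul]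
  · rw [h1.resolve_left h0 fun hmem => hg ?_, mul_zero]
    have h3 := hmem.2
    rw [mem_preimage, zoomPoint, ψ.chart.right_inv (zoom_mem_target_of_zoomWeight_ne_zero μ h0)]
      at h3
    have h4 := hR _ h3
    rwa [ψ.form.unzoom_zoom _ ht.ne'] at h4

theorem measurableSet_fib_le {b : M} (hb : b ∈ ψ.chart.source) (R : ℝ) :
    MeasurableSet {g | ‖ψ.fib b g‖ ≤ R} :=
  measurableSet_le (measurable_fib hb).norm measurable_const

theorem haar_fib_le (μ : SmoothMeasure n M) {b : M} (hb : b ∈ ψ.chart.source) (R : ℝ) :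
    C.haar μ b {g | ‖ψ.fib b g‖ ≤ R} = ENNReal.ofReal (μ.density ψ.mem_atlas (ψ.chart b)) *
      volume (Metric.closedBall (0 : Heis n) R) := by
  have h := lintegral_fib hb μ ((Metric.closedBall (0 : Heis n) R).indicator 1)
  rw [lintegral_indicator_one measurableSet_closedBall] at h
  rw [← h, ← lintegral_indicator_one (measurableSet_fib_le hb R)]
  refine lintegral_congr fun g => ?_
  simp [indicator]

theorem suppIn_regularRep {a : C.FibreOps μ} (ha : C.IsRegularRep μ (φ.pullback μ α) a) {b : M}
    {A B : Set (C.Osc b)}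
    (h : ∀ g, ∀ g' ∈ A, φ.pullback μ α ⟨b, C.oscMul b g (C.oscInv b g')⟩ ≠ 0 → g ∈ B)
    {v : Lp ℂ 2 (C.haar μ b)} (hv : SuppIn A v) : SuppIn B (a.at b v) := by
  filter_upwards [ha b v] with g hg hgB
  rw [hg]
  refine integral_eq_zero_of_ae ?_
  filter_upwards [hv] with g' hg'
  by_cases hA : g' ∈ A
  · rw [not_imp_comm.1 (h g g' hA) hgB, zero_mul]; rfl
  · rw [hg' hA, mul_zero]; rfl

theorem pullback_eq_zero (hαβ : ∀ x z, α (x, z) = β (x, x, z)) {b : M}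
    (h : b ∈ φ.chart.source → ∀ z, β (φ.chart b, φ.chart b, z) = 0) (g : C.Osc b) :
    φ.pullback μ α ⟨b, g⟩ = 0 := by
  by_cases hb : b ∈ φ.chart.source
  · refine (pullback_of_mem (φ := φ) μ (p := (show C.HeisTangent from ⟨b, g⟩)) hb).trans ?_
    change _ * α (φ.chart b, φ.fib b g) = 0
    rw [hαβ, h hb, mul_zero]
  · exact pullback_of_notMem (φ := φ) μ (p := (show C.HeisTangent from ⟨b, g⟩)) hb

theorem IsKernelSymbol.localOp_eq_zero (h : φ.IsKernelSymbol β) {S : Set M}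
    (hS : ∀ x ∈ φ.chart.source, ∀ y ∈ φ.chart.source, ∀ z, β (φ.chart x, φ.chart y, z) ≠ 0 →
      x ∈ S ∧ y ∈ S) (t : ℝ) {u : μ.L2} (hu : SuppIn Sᶜ u) : φ.localOp μ β t u = 0 := by
  refine Lp.ext ?_
  filter_upwards [h.isKernelOp_localOp μ t u, Lp.coeFn_zero ℂ 2 μ.measure] with x hx h0
  rw [hx, h0]
  refine integral_eq_zero_of_ae ?_
  filter_upwards [hu] with y hy
  by_cases hyS : y ∈ S
  · rw [hy (not_not.2 hyS), mul_zero]; rfl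
  · have : φ.pullKernel μ (φ.modelKernel β t) x y = 0 := by
      by_contra hn
      rw [pullKernel] at hn
      have hxs := mem_source_of_coweight_ne_zero (φ := φ) μ (x := x) fun h0 => hn (by simp [h0])
      have hys := mem_source_of_coweight_ne_zero (φ := φ) μ (x := y) fun h0 => hn (by simp [h0])
      exact hyS (hS x hxs y hys _ fun h0 => hn (by rw [modelKernel, h0]; simp)).2
    rw [this, zero_mul]; rfl

variable (φ ψ μ β) in
/-- The local operator in the coordinates at the scale `1/t` has a measurable kernel. -/
theorem IsKernelSymbol.exists_zoom_kernel (h : φ.IsKernelSymbol β) {b : M}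
    (hb : b ∈ ψ.chart.source) {t : ℝ} (ht : 0 < t) {L : μ.L2 →L[ℂ] Lp ℂ 2 (C.haar μ b)}
    (hL : ψ.IsZoomOp μ b t L) : ∃ k : C.Osc b → C.Osc b → ℂ, Measurable (Function.uncurry k) ∧
      (∀ g g', k g g' = φ.zoomKernel ψ μ β t b (ψ.fib b g) (ψ.fib b g')) ∧
      ∀ u : μ.L2, SuppIn ψ.chart.source u →
        L (φ.localOp μ β t u) =ᵐ[C.haar μ b] fun g => ∫ g', k g g' * L u g' ∂(C.haar μ b) := by
  classical
  have hm := measurable_zoomWeight μ hb t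
  refine ⟨fun g g' => (ψ.zoomWeight μ b t g : ℂ) * φ.pullKernel μ (φ.modelKernel β t)
    (ψ.zoomPoint b t g) (ψ.zoomPoint b t g') * ψ.zoomWeight μ b t g', ?_,
    fun g g' => weight_mul_pullKernel μ ht b g g', fun u hu =>
      IsWeightedComp.comp_kernel hL ψ.chart.open_source.measurableSet
        (lintegral_zoomWeight μ hb ht) hm (aemeasurable_zoomPoint μ hb t)
        (fun x => measurable_pullKernel μ (h.measurable_modelKernel t) x)
        (h.isKernelOp_localOp μ t) hu⟩
  set σ : C.Osc b → M := fun g => ψ.chart.target.piecewise ψ.chart.symm (fun _ => b)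
    (ψ.form.zoom (ψ.chart b) t (ψ.fib b g)) with hσ
  have hσm : Measurable σ :=
    (ψ.chart.continuousOn_symm.measurable_piecewise continuousOn_const
      ψ.chart.open_target.measurableSet).comp
      ((ψ.form.continuous_zoom (ψ.chart b) t).measurable.comp (measurable_fib hb))
  have hσe : ∀ g, ψ.zoomWeight μ b t g ≠ 0 → σ g = ψ.zoomPoint b t g := fun g hg =>
    piecewise_eq_of_mem _ _ _ (zoom_mem_target_of_zoomWeight_ne_zero μ hg)
  have e : (Function.uncurry fun g g' => (ψ.zoomWeight μ b t g : ℂ) *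
      φ.pullKernel μ (φ.modelKernel β t) (ψ.zoomPoint b t g) (ψ.zoomPoint b t g') *
        ψ.zoomWeight μ b t g') = fun p => (ψ.zoomWeight μ b t p.1 : ℂ) *
      Function.uncurry (φ.pullKernel μ (φ.modelKernel β t)) (σ p.1, σ p.2) *
        ψ.zoomWeight μ b t p.2 := by
    funext ⟨g, g'⟩
    change (_ : ℂ) * φ.pullKernel μ (φ.modelKernel β t) _ _ * _ =
      _ * φ.pullKernel μ (φ.modelKernel β t) (σ g) (σ g') * _
    by_cases h1 : ψ.zoomWeight μ b t g = 0
    · rw [h1]; simp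
    by_cases h2 : ψ.zoomWeight μ b t g' = 0
    · rw [h2]; simp
    rw [hσe g h1, hσe g' h2]
  rw [e]
  exact ((Complex.measurable_ofReal.comp (hm.comp measurable_fst)).mul
    ((measurable_uncurry_pullKernel μ (h.measurable_modelKernel t)).comp
      ((hσm.comp measurable_fst).prodMk (hσm.comp measurable_snd)))).mul
    (Complex.measurable_ofReal.comp (hm.comp measurable_snd))

/-- In rescaled coordinates both `L (F u)` and `a_b (L u)` are integrals of `L u` against kernels
that are uniformly close on a fixed ball, and all three functions are supported in this ball. So the
operators are close on such `u`. -/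
theorem IsKernelSymbol.eventually_zoom_sub_le [T2Space M] (h : φ.IsKernelSymbol β)
    (hα : φ.IsSymbol α) (hαβ : ∀ x z, α (x, z) = β (x, x, z)) {a : C.FibreOps μ}
    (ha : C.IsRegularRep μ (φ.pullback μ α) a) {b₀ : M} (hb₀ : b₀ ∈ ψ.chart.source) {R R' ε : ℝ}
    (hR : R ≤ R') (hε : 0 < ε) : ∀ᶠ p : ℝ × M in atTop ×ˢ 𝓝 b₀, ∀ L, ψ.IsZoomOp μ p.2 p.1 L →
      ∀ u : μ.L2, SuppIn (ψ.nearby p.2 p.1 R) u →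
        SuppIn (ψ.nearby p.2 p.1 R') (φ.localOp μ β p.1 u) →
        ‖L (φ.localOp μ β p.1 u) - a.at p.2 (L u)‖ ≤ ε * ‖u‖ := by
  obtain ⟨S, hSs, hS, hsupp⟩ := h.exists_support_source
  have hb₀t := ψ.chart.map_source hb₀
  have hlim : Tendsto (fun p : ℝ × M => (p.1, ψ.chart p.2)) (atTop ×ˢ 𝓝 b₀)
      (atTop ×ˢ 𝓝 (ψ.chart b₀)) := tendsto_id.prodMap (ψ.chart.continuousAt hb₀)
  -- Off the support of the symbol both terms vanish near `b₀`; this also covers points outside the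
  -- chart `φ`.
  by_cases hb₀S : b₀ ∈ S
  swap
  · have hV : ψ.chart.target ∩ ψ.chart.symm ⁻¹' Sᶜ ∈ 𝓝 (ψ.chart b₀) :=
      (ψ.chart.continuousOn_symm.isOpen_inter_preimage ψ.chart.open_target
        hS.isClosed.isOpen_compl).mem_nhds ⟨hb₀t, by
          rw [mem_preimage, ψ.chart.left_inv hb₀]; exact hb₀S⟩
    filter_upwards [hlim.eventually (ψ.form.eventually_cell_subset R _ hV),
      tendsto_snd.eventually (hS.isClosed.isOpen_compl.mem_nhds hb₀S)]
      with p hp hpS L hL u hu hFu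
    have e1 : φ.localOp μ β p.1 u = 0 := by
      refine h.localOp_eq_zero hsupp p.1 (hu.mono fun x hx hxS => ?_)
      have h1 := (hp hx.2).2
      rw [mem_preimage, ψ.chart.left_inv hx.1] at h1
      exact h1 hxS
    have e2 : a.at p.2 (L u) = 0 := by
      refine Lp.ext ?_
      filter_upwards [ha p.2 (L u), Lp.coeFn_zero ℂ 2 (C.haar μ p.2)] with g h1 h2
      rw [h1, h2]
      refine integral_eq_zero_of_ae (Eventually.of_forall fun g' => ?_)
      change _ * _ = (0 : ℂ)
      rw [pullback_eq_zero hαβ fun hbs z => ?_, zero_mul]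
      by_contra h0
      exact hpS (hsupp _ hbs _ hbs z h0).1
    rw [e1, e2, map_zero, sub_zero, norm_zero]
    positivity
  have hφ := hSs hb₀S
  obtain ⟨r, -, hrad⟩ := h.exists_radius
  obtain ⟨R₁, hR₁⟩ := ψ.form.exists_unzoom_bound R' (ψ.chart b₀)
  obtain ⟨R₂, hR₂⟩ := exists_fib_bound (φ := φ) (ψ := ψ) hφ hb₀ r R₁
  obtain ⟨c, hc⟩ := (hα.hasCompactSupport_pullback μ).exists_bound_of_continuous
    (hα.continuous_pullback μ)
  obtain ⟨c', -, hmeas⟩ := hα.exists_schur_bound μ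
  -- `R₁` bounds the zoom coordinates on the cell of size `R'`, and `R₂` those on the support of
  -- `a_b (L u)`.
  set ρ := max R₁ R₂ with hρ
  set w₀ := μ.density ψ.mem_atlas (ψ.chart b₀) with hw₀
  set v₀ := (volume (Metric.closedBall (0 : Heis n) ρ)).toReal with hv₀
  have hvol : volume (Metric.closedBall (0 : Heis n) ρ) = ENNReal.ofReal v₀ :=
    (ENNReal.ofReal_toReal measure_closedBall_lt_top.ne).symm
  have hw₀0 : 0 < w₀ := density_pos μ hb₀t
  have hv₀0 : 0 ≤ v₀ := ENNReal.toReal_nonneg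
  have hw : ∀ᶠ p : ℝ × M in atTop ×ˢ 𝓝 b₀, μ.density ψ.mem_atlas (ψ.chart p.2) < w₀ + 1 :=
    (((continuousOn_density (φ := ψ) μ).continuousAt (ψ.chart.open_target.mem_nhds
      hb₀t)).tendsto.comp ((ψ.chart.continuousAt hb₀).tendsto.comp tendsto_snd)).eventually
      (gt_mem_nhds (lt_add_one _))
  -- For `b` near `b₀` the Haar measure of the ball of radius `ρ` is at most `(w₀ + 1) v₀`.
  set ε' := ε / ((w₀ + 1) * v₀ + 1) with hε'
  have hε'0 : 0 < ε' := by positivity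
  filter_upwards [hlim.eventually hR₁, tendsto_snd.eventually hR₂, hw,
    h.eventually_zoomKernel_sub_le μ hφ hb₀ ρ hε'0, tendsto_fst.eventually (eventually_gt_atTop 0),
    tendsto_snd.eventually (ψ.chart.open_source.mem_nhds hb₀),
    tendsto_snd.eventually (φ.chart.open_source.mem_nhds hφ)]
    with ⟨t, b⟩ h1 h2 h3 h4 ht hb hbφ L hL u hu hFu
  have := sFinite_haar C μ b
  have hu' := hu.mono (ψ.nearby_mono b t hR)
  have hLu := hL.suppIn hb ht h1 hu'
  have hLF := hL.suppIn hb ht h1 hFu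
  have haLu : SuppIn {g | ‖ψ.fib b g‖ ≤ R₂} (a.at b (L u)) := by
    refine suppIn_regularRep ha (fun g g' hg' h0 => h2 g g' hg' ?_) hLu
    have e := pullback_of_mem (φ := φ) μ (α := α)
      (p := (show C.HeisTangent from ⟨b, C.oscMul b g (C.oscInv b g')⟩)) hbφ
    have h5 : α (φ.chart b, φ.fib b (C.oscMul b g (C.oscInv b g'))) ≠ 0 := fun h6 =>
      h0 (e.trans (by
        change _ * α (φ.chart b, φ.fib b _) = 0
        rw [h6, mul_zero]))
    rw [hαβ] at h5
    exact (hrad _ _ _ h5).2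
  obtain ⟨k, hk, hkz, hkL⟩ := IsKernelSymbol.exists_zoom_kernel φ ψ β μ h hb ht hL
  have hm1 : {g | ‖ψ.fib b g‖ ≤ R₁} ⊆ {g | ‖ψ.fib b g‖ ≤ ρ} := fun g hg =>
    le_trans (show ‖ψ.fib b g‖ ≤ R₁ from hg) (le_max_left _ _)
  have hm2 : {g | ‖ψ.fib b g‖ ≤ R₂} ⊆ {g | ‖ψ.fib b g‖ ≤ ρ} := fun g hg =>
    le_trans (show ‖ψ.fib b g‖ ≤ R₂ from hg) (le_max_right _ _)
  have hB := haar_fib_le μ hb ρ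
  rw [hvol, ← ENNReal.ofReal_mul (density_pos μ (ψ.chart.map_source hb)).le] at hB
  have hBr : (C.haar μ b).real {g | ‖ψ.fib b g‖ ≤ ρ} ≤ (w₀ + 1) * v₀ := by
    rw [Measure.real, hB, ENNReal.toReal_ofReal
      (mul_nonneg (density_pos μ (ψ.chart.map_source hb)).le hv₀0)]
    exact mul_le_mul_of_nonneg_right (le_of_lt h3) hv₀0
  have key := norm_sub_le_of_kernels (measurableSet_fib_le hb ρ) (by rw [hB]; exact ENNReal.ofReal_lt_top)
    hk (hmeas b).1 (c := max c 0) (le_max_right _ _) hε'0.le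
    (fun g g' => (hc _).trans (le_max_left _ _))
    (fun g hg g' hg' => by
      rw [hkz]
      refine (congrArg (fun x => ‖φ.zoomKernel ψ μ β t b (ψ.fib b g) (ψ.fib b g') - x‖)
        (pullback_eq_limitKernel μ hαβ hbφ hb g g')).trans_le ?_
      exact h4 _ hg _ hg')
    (hkL u (SuppIn.of_nearby hb hu)) (ha b (L u)) (hLu.mono hm1) (hLF.mono hm1) (haLu.mono hm2)
  refine key.trans ?_
  have hle := hL.norm_le hb ht u
  calc ε' * (C.haar μ b).real {g | ‖ψ.fib b g‖ ≤ ρ} * ‖L u‖ ≤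
      ε' * ((w₀ + 1) * v₀ + 1) * ‖u‖ := by
        gcongr
        linarith
    _ = ε * ‖u‖ := by rw [hε', div_mul_cancel₀]; positivity

/-- The local operators converge to the regular representation. -/
theorem IsKernelSymbol.isZoomLimit [T2Space M] (h : φ.IsKernelSymbol β)
    (hα : φ.IsSymbol α) (hαβ : ∀ x z, α (x, z) = β (x, x, z)) {a : C.FibreOps μ}
    (ha : C.IsRegularRep μ (φ.pullback μ α) a) : IsZoomLimit (φ.localOp μ β) a := by
  intro ψ K hK hKs
  obtain ⟨P, hP, hprop⟩ := h.exists_propagation μ hK hKs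
  refine ⟨P, hP, fun R hR => ⟨hprop R hR, fun ε hε => ?_⟩⟩
  have h1 := hK.eventually_forall_mem (l := (atTop : Filter ℝ))
    (P := fun p : ℝ × M => ∀ L, ψ.IsZoomOp μ p.2 p.1 L →
      ∀ u : μ.L2, SuppIn (ψ.nearby p.2 p.1 R) u →
        SuppIn (ψ.nearby p.2 p.1 (R + P)) (φ.localOp μ β p.1 u) →
        ‖L (φ.localOp μ β p.1 u) - a.at p.2 (L u)‖ ≤ ε * ‖u‖)
    fun b hb => h.eventually_zoom_sub_le hα hαβ ha (hKs hb) (le_add_of_nonneg_right hP.le) hε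
  filter_upwards [h1, hprop R hR] with t ht ht' b hb L hL u hu
  exact ht b hb L hL u hu (ht' b hb u hu)

theorem IsSymbol.star (hα : φ.IsSymbol α) :
    φ.IsSymbol fun p => (starRingEnd ℂ) (α (p.1, -p.2)) := by
  have hc : Continuous fun p : Heis n × Heis n => (p.1, -p.2) := by fun_prop
  have hs : tsupport (fun p => (starRingEnd ℂ) (α (p.1, -p.2))) ⊆
      (fun p : Heis n × Heis n => (p.1, -p.2)) ⁻¹' tsupport α := by
    refine closure_minimal (fun p hp => subset_tsupport _ fun h0 => hp ?_)
      ((isClosed_tsupport _).preimage hc)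
    change (starRingEnd ℂ) (α (p.1, -p.2)) = 0
    rw [h0, map_zero]
  refine ⟨Complex.continuous_conj.comp (hα.continuous.comp hc), ?_, fun p hp =>
    ⟨(hα.support_subset (hs hp)).1, trivial⟩⟩
  refine ((hα.compactSupport.isCompact.image hc).of_isClosed_subset (isClosed_tsupport _)
    fun p hp => ⟨_, hs hp, ?_⟩)
  simp

/-- The adjoint of the regular representation. -/
theorem IsSymbol.isRegularRep_star [T2Space M] (hα : φ.IsSymbol α) {a : C.FibreOps μ}
    (ha : C.IsRegularRep μ (φ.pullback μ α) a) :
    C.IsRegularRep μ (φ.pullback μ fun p => (starRingEnd ℂ) (α (p.1, -p.2))) (Star.star a) := by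
  obtain ⟨c, hc, hle⟩ := hα.exists_schur_bound μ
  intro x ξ
  have := sFinite_haar C μ x
  have h1 := IsKernelOp.adjoint (hle x).1 hc (hle x).2.1 (hle x).2.2 (ha x) ξ
  rw [FibreOps.at_star]
  refine h1.trans (Eventually.of_forall fun g => ?_)
  refine integral_congr_ae (Eventually.of_forall fun g' => ?_)
  refine congrArg (· * ξ g') ?_
  by_cases hx : x ∈ φ.chart.source
  · refine (congrArg (starRingEnd ℂ) (pullback_oscMul μ hx g' g)).trans
      (Eq.trans ?_ (pullback_oscMul μ hx g g').symm)
    rw [map_mul, Complex.conj_ofReal, φ.form.mulAt_neg_swap]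
  · refine (congrArg (starRingEnd ℂ) (pullback_of_notMem (φ := φ) μ hx)).trans
      (Eq.trans (map_zero _) (pullback_of_notMem (φ := φ) μ hx).symm)

/-- The local operators are represented by the regular representation. -/
theorem IsKernelSymbol.exists_isZoomRep [T2Space M] (h : φ.IsKernelSymbol β)
    (hα : φ.IsSymbol α) (hαβ : ∀ x z, α (x, z) = β (x, x, z)) {a : C.FibreOps μ}
    (ha : C.IsRegularRep μ (φ.pullback μ α) a) :
    ∃ K, IsCompact K ∧ IsZoomRep K (φ.localOp μ β) a := by
  obtain ⟨K, -, hK, hs⟩ := h.exists_suppIn_localOp μ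
  obtain ⟨K', -, hK', hs'⟩ := h.adjSymbol.exists_suppIn_localOp μ
  refine ⟨K ∪ K', hK.union hK', h.isZoomLimit hα hαβ ha, ?_,
    fun t u => (hs t u).mono subset_union_left, fun t u => ?_⟩
  · have e : (fun t => ContinuousLinearMap.adjoint (φ.localOp μ β t)) =
        φ.localOp μ (AdaptedChart.adjSymbol β) := funext (h.adjoint_localOp μ)
    rw [e]
    exact h.adjSymbol.isZoomLimit hα.star (fun x z => by rw [hαβ]; rfl) (hα.isRegularRep_star ha)
  · rw [h.adjoint_localOp μ t]
    exact (hs' t u).mono subset_union_right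

end AdaptedChart

end ZoomLimits

/-! ## The asymptotic morphism -/

section Assembly

set_option linter.unusedSectionVars false

open Heis ContactStructure

variable {n : ℕ} {M : Type*} [TopologicalSpace M] [ChartedSpace (Heis n) M]
  [IsManifold (𝓡 (2 * n + 1)) ∞ M] {C : ContactStructure n M} [MeasurableSpace M]
  [BorelSpace M] {μ : SmoothMeasure n M}

theorem IsZoomRep.zero : IsZoomRep ∅ (fun _ => (0 : μ.L2 →L[ℂ] μ.L2)) (0 : C.FibreOps μ) := by
  have h0 : ∀ D, SuppIn D (0 : μ.L2) := fun D => by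
    filter_upwards [Lp.coeFn_zero ℂ 2 μ.measure] with x hx _
    rw [hx]; rfl
  have h : IsZoomLimit (fun _ => (0 : μ.L2 →L[ℂ] μ.L2)) (0 : C.FibreOps μ) :=
    fun ψ K _ _ => ⟨1, one_pos, fun R _ => ⟨Eventually.of_forall fun t b _ u _ => h0 _,
      fun ε hε => Eventually.of_forall fun t b _ L _ u _ => by
        have e : (0 : C.FibreOps μ).at b (L u) = 0 := rfl
        rw [e, zero_apply, map_zero, sub_zero, norm_zero]
        positivity⟩⟩
  refine ⟨h, ?_, fun t u => h0 _, fun t u => ?_⟩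
  · simpa only [map_zero, star_zero] using h
  · rw [map_zero]; exact h0 _

/-- The family `F` of compact operators represents `a`. -/
def LocalRel (a : C.cstar μ) (F : ℝ → compactOperators μ.L2) : Prop :=
  ContinuousOn F (Ioi 0) ∧ ∃ K, IsCompact K ∧
    IsZoomRep K (fun t => (F t : μ.L2 →L[ℂ] μ.L2)) (a : C.FibreOps μ)

namespace LocalRel

variable {a b : C.cstar μ} {F G : ℝ → compactOperators μ.L2}

theorem zero : LocalRel (0 : C.cstar μ) (0 : ℝ → compactOperators μ.L2) :=
  ⟨continuousOn_const, ∅, isCompact_empty, IsZoomRep.zero⟩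

theorem add (h : LocalRel a F) (h' : LocalRel b G) : LocalRel (a + b) (F + G) := by
  obtain ⟨hF, K, hK, h⟩ := h
  obtain ⟨hG, K', hK', h'⟩ := h'
  exact ⟨hF.add hG, _, hK.union hK', (h.mono subset_union_left).add (h'.mono subset_union_right)⟩

set_option synthInstance.maxHeartbeats 400000 in
theorem smul (c : ℂ) (h : LocalRel a F) :
    LocalRel (c • a) (fun t => (c • F t : compactOperators μ.L2)) := by
  obtain ⟨hF, K, hK, h⟩ := h
  exact ⟨hF.const_smul c, K, hK, h.smul c⟩

theorem star_rel (h : LocalRel a F) : LocalRel (star a) (star F) := by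
  obtain ⟨hF, K, hK, h⟩ := h
  exact ⟨hF.star, K, hK, h.adjoint⟩

theorem mul (h : LocalRel a F) (h' : LocalRel b G) : LocalRel (a * b) (F * G) := by
  obtain ⟨hF, K, hK, h⟩ := h
  obtain ⟨hG, K', hK', h'⟩ := h'
  exact ⟨hF.mul hG, _, hK.union hK', (h.mono subset_union_left).comp (h'.mono subset_union_right)⟩

theorem sum {ι : Type*} (s : Finset ι) {a : ι → C.cstar μ} {F : ι → ℝ → compactOperators μ.L2}
    (h : ∀ i, LocalRel (a i) (F i)) : LocalRel (∑ i ∈ s, a i) (∑ i ∈ s, F i) := by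
  classical
  induction s using Finset.induction_on with
  | empty => simpa using zero
  | insert i s hi ih =>
    rw [Finset.sum_insert hi, Finset.sum_insert hi]
    exact (h i).add ih

end LocalRel

variable [T2Space M]

theorem ContactStructure.IsRegularRep.sum {ι : Type*} (s : Finset ι) {φ : ι → AdaptedChart C}
    {α : ι → Heis n × Heis n → ℂ} (hα : ∀ i, (φ i).IsSymbol (α i)) {a : ι → C.FibreOps μ}
    (ha : ∀ i, C.IsRegularRep μ ((φ i).pullback μ (α i)) (a i)) :
    C.IsRegularRep μ (fun p => ∑ i ∈ s, (φ i).pullback μ (α i) p) (∑ i ∈ s, a i) := by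
  classical
  intro x ξ
  have := AdaptedChart.sFinite_haar C μ x
  have hint : ∀ᵐ g ∂(C.haar μ x), ∀ i ∈ s, Integrable
      (fun g' => (φ i).pullback μ (α i) ⟨x, C.oscMul x g (C.oscInv x g')⟩ * ξ g')
      (C.haar μ x) := by
    refine (Finset.eventually_all s).2 fun i _ => ?_
    obtain ⟨c, -, hc⟩ := (hα i).exists_schur_bound μ
    exact ae_integrable_of_schur (hc x).1 (hc x).2.1 (hc x).2.2 ξ
  have hsum : (∑ i ∈ s, a i).at x ξ =ᵐ[C.haar μ x] fun g => ∑ i ∈ s,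
      ∫ g', (φ i).pullback μ (α i) ⟨x, C.oscMul x g (C.oscInv x g')⟩ * ξ g' ∂(C.haar μ x) := by
    clear hint
    induction s using Finset.induction_on with
    | empty =>
      simp only [Finset.sum_empty]
      exact Lp.coeFn_zero ℂ 2 (C.haar μ x)
    | insert i s hi ih =>
      rw [Finset.sum_insert hi, FibreOps.at_add, add_apply]
      filter_upwards [Lp.coeFn_add ((a i).at x ξ) ((∑ i ∈ s, a i).at x ξ), ih, ha i x ξ]
        with g h1 h2 h3
      rw [h1, Pi.add_apply, h2, h3, Finset.sum_insert hi]
  filter_upwards [hsum, hint] with g h1 h2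
  rw [h1, ← integral_finsetSum _ h2]
  simp only [Finset.sum_mul]

theorem AdaptedChart.IsSymbol.exists_mem_cstar {φ : AdaptedChart C} {α : Heis n × Heis n → ℂ}
    (hα : φ.IsSymbol α) (μ : SmoothMeasure n M) :
    ∃ a : C.cstar μ, C.IsRegularRep μ (φ.pullback μ α) a := by
  obtain ⟨a, ha⟩ := hα.exists_isRegularRep μ
  exact ⟨⟨a, NonUnitalStarSubalgebra.le_topologicalClosure _
    (NonUnitalStarAlgebra.subset_adjoin ℂ _ ⟨_, hα.continuous_pullback μ,
      hα.hasCompactSupport_pullback μ, ha⟩)⟩, ha⟩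

theorem AdaptedChart.IsKernelSymbol.localRel {φ : AdaptedChart C}
    {β : Heis n × Heis n × Heis n → ℂ} {α : Heis n × Heis n → ℂ} (h : φ.IsKernelSymbol β)
    (hα : φ.IsSymbol α) (hαβ : ∀ x z, β (x, x, z) = α (x, z)) {a : C.cstar μ}
    (ha : C.IsRegularRep μ (φ.pullback μ α) a) :
    LocalRel a fun t => ⟨φ.localOp μ β t, h.isCompactOperator_localOp μ t⟩ :=
  ⟨((h.continuous_localOp μ).subtype_mk _).continuousOn,
    h.exists_isZoomRep hα (fun x z => (hαβ x z).symm) ha⟩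

/-- The generators are sums of pullbacks of symbols, represented by sums of local operators.
Products in the generated algebra are represented by products of operators, so it need not be known
that they are again given by functions in `C_c(T_H M)`. -/
theorem dense_localRel (C : ContactStructure n M) (μ : SmoothMeasure n M) :
    Dense {a : C.cstar μ | ∃ F, LocalRel a F} := by
  have key : ∀ x ∈ NonUnitalStarAlgebra.adjoin ℂ {a : C.FibreOps μ |
      ∃ f : C.HeisTangent → ℂ, Continuous f ∧ HasCompactSupport f ∧ C.IsRegularRep μ f a},
      ∃ a : C.cstar μ, (a : C.FibreOps μ) = x ∧ ∃ F, LocalRel a F := by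
    intro x hx
    induction hx using NonUnitalStarAlgebra.adjoin_induction with
    | mem x hx =>
      obtain ⟨f, hf, hfc, hr⟩ := hx
      obtain ⟨k, φ, α, hα, he⟩ := exists_sum_pullback_eq μ hf hfc
      choose a ha using fun i => (hα i).exists_mem_cstar μ
      choose β hβ hβα _ using fun i => (hα i).exists_isKernelSymbol
      have h1 := LocalRel.sum Finset.univ fun i => (hβ i).localRel (hα i) (hβα i) (ha i)
      refine ⟨_, ?_, _, h1⟩
      have h2 := ContactStructure.IsRegularRep.sum Finset.univ hα ha
      rw [← funext he] at h2
      refine Eq.trans ?_ (h2.unique hr)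
      exact map_sum (NonUnitalStarSubalgebraClass.subtype (C.cstar μ)) a Finset.univ
    | zero => exact ⟨0, rfl, 0, LocalRel.zero⟩
    | add x y _ _ hx hy =>
      obtain ⟨a, rfl, F, ha⟩ := hx
      obtain ⟨b, rfl, G, hb⟩ := hy
      exact ⟨a + b, rfl, _, ha.add hb⟩
    | mul x y _ _ hx hy =>
      obtain ⟨a, rfl, F, ha⟩ := hx
      obtain ⟨b, rfl, G, hb⟩ := hy
      exact ⟨a * b, rfl, _, ha.mul hb⟩
    | smul c x _ hx =>
      obtain ⟨a, rfl, F, ha⟩ := hx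
      exact ⟨c • a, rfl, _, ha.smul c⟩
    | star x _ hx =>
      obtain ⟨a, rfl, F, ha⟩ := hx
      exact ⟨star a, rfl, _, ha.star_rel⟩
  intro a
  rw [Metric.mem_closure_iff]
  intro ε hε
  have h1 : (a : C.FibreOps μ) ∈ closure (NonUnitalStarAlgebra.adjoin ℂ {a : C.FibreOps μ |
      ∃ f : C.HeisTangent → ℂ, Continuous f ∧ HasCompactSupport f ∧ C.IsRegularRep μ f a} :
      Set (C.FibreOps μ)) := a.2
  obtain ⟨x, hx, hd⟩ := Metric.mem_closure_iff.1 h1 ε hε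
  obtain ⟨b, rfl, hb⟩ := key x hx
  exact ⟨b, hb, hd⟩

/-- The only analytic input is `bound`, the sharp norm estimate; the algebraic clauses hold exactly
for every `t`. -/
theorem isAsymptoticRel_localRel (C : ContactStructure n M) (μ : SmoothMeasure n M) :
    IsAsymptoticRel (LocalRel (C := C) (μ := μ)) where
  continuousOn h := h.1
  add h h' := h.add h'
  smul c _ _ h := h.smul c
  star_rel h := h.star_rel
  mul h h' := h.mul h'
  bound h ε hε := by
    obtain ⟨-, K, hK, h⟩ := h
    exact h.eventually_norm_le hK hε
  dense := dense_localRel C μ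

theorem ContactChart.IsSymbol.toAdapted {Φ : ContactChart C} {α : Heis n × Heis n → ℂ}
    (h : Φ.IsSymbol α) : Φ.toAdapted.IsSymbol α :=
  ⟨h.continuous, h.compactSupport, h.support_subset⟩

/-- The operators given by a contact chart. -/
theorem ContactChart.IsSymbol.exists_localRel {Φ : ContactChart C} {α : Heis n × Heis n → ℂ}
    (h : Φ.IsSymbol α) (μ : SmoothMeasure n M) :
    ∃ (a : C.cstar μ) (F : ℝ → compactOperators μ.L2) (B : ℝ → (μ.L2 →L[ℂ] μ.L2)),
      LocalRel a F ∧ C.IsRegularRep μ (Φ.pullback μ α) a ∧ Φ.IsTransported μ α B ∧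
      ∀ᶠ t in atTop, (F t : μ.L2 →L[ℂ] μ.L2) = B t := by
  obtain ⟨β, hβ, hβα, hev⟩ := h.toAdapted.exists_isKernelSymbol
  obtain ⟨a, ha⟩ := h.toAdapted.exists_mem_cstar μ
  obtain ⟨B, hB, hBe⟩ := ContactChart.exists_isTransported μ Φ h.toAdapted hev
  refine ⟨a, _, B, hβ.localRel h.toAdapted hβα ha, ?_, hB, ?_⟩
  · rw [AdaptedChart.pullback_eq]; exact ha
  · filter_upwards [hBe] with t ht using ht.symm

end Assembly

/-- The transported operators eventually coincide with local operators, which represent the element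
defined by the pulled back function. The asymptotic morphism is asymptotic to every representative
of an element, and a sum of representatives represents the sum, whichever charts they come from;
this gives both properties. -/
theorem mainTheorem2 {n : ℕ} {M : Type*} [TopologicalSpace M] [T2Space M]
    [SecondCountableTopology M] [ChartedSpace (Heis n) M] [IsManifold (𝓡 (2 * n + 1)) ∞ M]
    [MeasurableSpace M] [BorelSpace M] (C : ContactStructure n M) (μ : SmoothMeasure n M) :
    ∃ T : ℝ → C.cstar μ → compactOperators μ.L2,
      IsAsymptoticMorphism T ∧
      (∀ (Φ : ContactChart C) (α : Heis n × Heis n → ℂ), Φ.IsSymbol α →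
        ∃ (a : C.cstar μ) (B : ℝ → (μ.L2 →L[ℂ] μ.L2)),
          C.IsRegularRep μ (Φ.pullback μ α) a ∧ Φ.IsTransported μ α B ∧
          Tendsto (fun t => ‖(T t a : μ.L2 →L[ℂ] μ.L2) - B t‖) atTop (𝓝 0)) ∧
      (∀ (k : ℕ) (Φ : Fin k → ContactChart C) (α : Fin k → Heis n × Heis n → ℂ),
        (∀ i, (Φ i).IsSymbol (α i)) →
        ∃ (a : C.cstar μ) (B : Fin k → ℝ → (μ.L2 →L[ℂ] μ.L2)),
          C.IsRegularRep μ (fun p => ∑ i, (Φ i).pullback μ (α i) p) a ∧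
          (∀ i, (Φ i).IsTransported μ (α i) (B i)) ∧
          Tendsto (fun t => ‖(T t a : μ.L2 →L[ℂ] μ.L2) - ∑ i, B i t‖) atTop (𝓝 0)) := by
  obtain ⟨T, hT, hlim⟩ := (isAsymptoticRel_localRel C μ).exists_isAsymptoticMorphism
  refine ⟨T, hT, fun Φ α h => ?_, fun k Φ α h => ?_⟩
  · obtain ⟨a, F, B, hr, ha, hB, hFB⟩ := h.exists_localRel μ
    refine ⟨a, B, ha, hB, (hlim a F hr).congr' ?_⟩
    filter_upwards [hFB] with t ht
    rw [← ht]; rfl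
  · choose a F B hr ha hB hFB using fun i => (h i).exists_localRel μ
    refine ⟨∑ i, a i, B, ?_, hB, (hlim _ _ (LocalRel.sum Finset.univ hr)).congr' ?_⟩
    · have h1 := ContactStructure.IsRegularRep.sum Finset.univ (fun i => (h i).toAdapted)
        (a := fun i => (a i : C.FibreOps μ)) fun i => by
          have := ha i
          rwa [AdaptedChart.pullback_eq] at this
      have e : ((∑ i, a i : C.cstar μ) : C.FibreOps μ) = ∑ i, (a i : C.FibreOps μ) :=
        map_sum (NonUnitalStarSubalgebraClass.subtype (C.cstar μ)) a Finset.univ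
      simp only [AdaptedChart.pullback_eq]
      rw [e]
      exact h1
    · filter_upwards [eventually_all.2 hFB] with t ht
      have e : (((∑ i, F i) t : compactOperators μ.L2) : μ.L2 →L[ℂ] μ.L2) = ∑ i, B i t := by
        rw [Finset.sum_apply, ← Finset.sum_congr rfl fun i _ => ht i]
        exact map_sum (NonUnitalStarSubalgebraClass.subtype (compactOperators μ.L2))
          (fun i => F i t) Finset.univ
      rw [← e]; rfl
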